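/- Let $M$ be a complete (connected, smooth, finite-dimensional) Riemannian manifold with Riemannian measure $\mu$ and gradient $\nabla$ (taken in the weak sense, and acting on complex-valued functions through real and imaginary parts). Write $L^p=L^p(M,\mu;\mathbb C)$ and assume the doubling property $(D)$: there is $C_0$ with $\mu(B(x,2\rho))\le C_0\,\mu(B(x,\rho))$ for all $x\in M$, $\rho>0$. Let $m>1$, let $0\le\omega<\pi/2$, and let $L$ be a linear operator on $L^2$ of type $\omega$: its spectrum lies in $S_\omega=\{z:|\arg z|\le\omega\}\cup\{0\}$ and for each $\nu>\omega$ there is $c_\nu$ with $\|(L-z)^{-1}\|_{L^2\to L^2}\le c_\nu/|z|$ for all $z\notin S_\nu$. Let $L^{1/m}$ be its fractional power on $L^2$, i.e. the closure of the operator $x\mapsto \frac{\sin(\pi/m)}{\pi}\int_0^\infty t^{1/m-1}(t+L)^{-1}Lx\,dt$ on the domain of $L$. On $L^p$, let $L^{1/m}$ be the closure in $L^p\times L^p$ of its restriction to $\{u\in L^2\cap L^p:\ L^{1/m}u\in L^p\}$. Put $$W^{1,p}_L=\{f\in L^p:\ L^{1/m}f\in L^p\},\qquad \|f\|_{W^{1,p}_L}=\|f\|_{L^p}+\|L^{1/m}f\|_{L^p}$$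 (if $L^{1/m}$ is not closable on $L^p$, so that $L^{1/m}f$ may be multivalued, $\|L^{1/m}f\|_{L^p}$ means the infimum of the norms of its values). Let $0<s_-<2<s_+\le\infty$ and $1\le q_-$, $q_+\le\infty$. Assume: * (Riesz transform) for every $p\in(s_-,s_+)$, $\nabla L^{-1/m}$ is bounded on $L^p$: there is $C$ such that every $u$ in the $L^2$-domain of $L^{1/m}$ with $L^{1/m}u\in L^p$ has a weak gradient with $\|\nabla u\|_{L^p}\le C\|L^{1/m}u\|_{L^p}$; * (reverse Riesz inequality) for every $p\in(q_-,q_+)$ there is $C$ such that every $f\in C_c^\infty(M)$ lies in $W^{1,p}_L$ and $\|L^{1/m}f\|_{L^p}\le C\|\nabla f\|_{L^p}$. Then the following hold. 1. (Leibniz rule.) Let $q_-<r<q_+$, let $p_1,q_2\in(s_-,s_+)$ with $p_1,q_2\ge r$, and let $q_1,p_2\in(r,\infty]$ with $\frac1r=\frac1{p_1}+\frac1{q_1}=\frac1{p_2}+\frac1{q_2}$. There is a constant $C$ such that for all $f\in W^{1,p_1}_L\cap L^{p_2}$ and $g\in W^{1,q_2}_L\cap L^{q_1}$ one has $fg\in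 W^{1,r}_L$ and $$\|fg\|_{W^{1,r}_L}\le C\big(\|f\|_{W^{1,p_1}_L}\|g\|_{L^{q_1}}+\|f\|_{L^{p_2}}\|g\|_{W^{1,q_2}_L}\big).$$ 2. For every $p\in(\max(q_-,s_-),\min(q_+,s_+))$ the space $W^{1,p}_L\cap L^\infty$ is an algebra under the pointwise product: there is $C$ such that for all $f,g\in W^{1,p}_L\cap L^\infty$ one has $fg\in W^{1,p}_L\cap L^\infty$ and $\|fg\|_{W^{1,p}_L}\le C(\|f\|_{W^{1,p}_L}\|g\|_{L^\infty}+\|f\|_{L^\infty}\|g\|_{W^{1,p}_L})$. 3. Assume moreover that the semigroup $e^{-tL}$ generated by $-L$ has $L^{s_-}$–$L^\infty$ off-diagonal decay: for some $\delta>1$ and $C$, for all $t>0$, all balls $B$ of radius $t^{1/m}$ and all $f\in L^2$, $$\|e^{-tL}f\|_{L^\infty(B)}\le C\sum_{k\ge0}2^{-\delta k}\Big(\frac1{\mu(2^kB)}\int_{2^kB}|f|^{s_-}d\mu\Big)^{1/s_-}.$$ Let $d\ge0$ be such that $(MV_d)$ holds: there is $c>0$ with $\mu(B(x,\rho))\ge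 c\rho^d$ for all $x\in M$, $0<\rho\le1$. Then for every $p\in(\max(q_-,s_-),\min(q_+,s_+))$ with $p>d$ the space $W^{1,p}_L$ is an algebra under the pointwise product: there is $C$ such that for all $f,g\in W^{1,p}_L$ one has $fg\in W^{1,p}_L$ and $\|fg\|_{W^{1,p}_L}\le C\|f\|_{W^{1,p}_L}\|g\|_{W^{1,p}_L}$. -/

import Mathlib

open MeasureTheory Set Filter Topology Bundle
open scoped Manifold ContDiff ENNReal NNReal

noncomputable section

namespace LSobolev

/-! ### Sectorial operators, their fractional powers and their semigroups -/

section Operators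

variable {H : Type*} [NormedAddCommGroup H] [NormedSpace ℂ H]

/-- The closed sector `S_w = {z : |arg z| ≤ w} ∪ {0}`. -/
def sector (w : ℝ) : Set ℂ := {z | z = 0 ∨ |z.arg| ≤ w}

/-- The bounded operator `R` is the resolvent `(L - z)⁻¹`. -/
def IsResolventAt (L : H →ₗ.[ℂ] H) (z : ℂ) (R : H →L[ℂ] H) : Prop :=
  (∀ x : H, ∃ hx : R x ∈ L.domain, L ⟨R x, hx⟩ - z • R x = x) ∧
    ∀ x : L.domain, R (L x - z • (x : H)) = x

open Classical in
/-- The resolvent `(L - z)⁻¹` (and `0` if `z` is in the spectrum of `L`). -/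
def resolventOp (L : H →ₗ.[ℂ] H) (z : ℂ) : H →L[ℂ] H :=
  if h : ∃ R, IsResolventAt L z R then h.choose else 0

/-- `L` is of type `w`: its spectrum lies in `S_w` and, for each `ν > w`,
`‖(L - z)⁻¹‖ ≤ c_ν / |z|` for all `z ∉ S_ν`. -/
def IsOfType (L : H →ₗ.[ℂ] H) (w : ℝ) : Prop :=
  (∀ z ∉ sector w, ∃ R, IsResolventAt L z R) ∧
    ∀ ν > w, ∃ c : ℝ, ∀ z ∉ sector ν, ‖resolventOp L z‖ ≤ c / ‖z‖

/-- Balakrishnan's formula for the fractional power of order `0 < α < 1` on the domain of `L`: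
`(sin πα / π) ∫_0^∞ t^(α-1) (t + L)⁻¹ L x dt`. -/
def balakrishnan (L : H →ₗ.[ℂ] H) (α : ℝ) (x : L.domain) : H :=
  (Real.sin (Real.pi * α) / Real.pi : ℂ) •
    ∫ t in Ioi (0 : ℝ), ((t ^ (α - 1) : ℝ) : ℂ) • resolventOp L (-(t : ℂ)) (L x)

/-- The graph of the fractional power `L^α` for `0 < α < 1`: `u` is in the domain of `L^α` and
`L^α u = v`. It is the closure of Balakrishnan's operator. -/
def IsFracPow (L : H →ₗ.[ℂ] H) (α : ℝ) (u v : H) : Prop :=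
  ∃ x : ℕ → L.domain, Tendsto (fun k => (x k : H)) atTop (𝓝 u) ∧
    Tendsto (fun k => balakrishnan L α (x k)) atTop (𝓝 v)

/-- `(T t)_{t ≥ 0}` is the strongly continuous semigroup `e^{-tL}`, that is, the one whose
infinitesimal generator is exactly `-L`. -/
structure IsSemigroupOf (L : H →ₗ.[ℂ] H) (T : ℝ → H →L[ℂ] H) : Prop where
  zero : T 0 = 1
  add : ∀ s t, 0 ≤ s → 0 ≤ t → T (s + t) = T s * T t
  continuous : ∀ x, ContinuousOn (fun t => T t x) (Ici 0)
  generator : ∀ x y, (∃ hx : x ∈ L.domain, L ⟨x, hx⟩ = y) ↔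
    Tendsto (fun t : ℝ => ((t⁻¹ : ℝ) : ℂ) • (x - T t x)) (𝓝[>] 0) (𝓝 y)

end Operators

/-! ### The Riemannian measure and weak gradients -/

section Manifold

variable {n : ℕ} {M : Type*} [MetricSpace M] [ChartedSpace (EuclideanSpace ℝ (Fin n)) M]

/-- The tangent vector of `M` at `φ⁻¹ y` with coordinates `v` in the chart `φ` around `x`. -/
def chartVector (x : M) (y v : EuclideanSpace ℝ (Fin n)) :
    TangentSpace (𝓡 n) ((chartAt (EuclideanSpace ℝ (Fin n)) x).symm y) :=
  mfderiv 𝓘(ℝ, EuclideanSpace ℝ (Fin n)) (𝓡 n) (chartAt (EuclideanSpace ℝ (Fin n)) x).symm y v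

variable [RiemannianBundle (fun x : M => TangentSpace (𝓡 n) x)]

/-- The matrix `(g_ij)` of the metric in the chart around `x`. -/
def gramMatrix (x : M) (y : EuclideanSpace ℝ (Fin n)) : Matrix (Fin n) (Fin n) ℝ :=
  Matrix.of fun i j =>
    inner ℝ (chartVector x y (EuclideanSpace.single i 1))
      (chartVector x y (EuclideanSpace.single j 1))

/-- The measure `√(det g) dy` of the chart around `x`, transported to `M`. -/
def chartVolume [MeasurableSpace M] (x : M) : Measure M :=
  ((volume.restrict (chartAt (EuclideanSpace ℝ (Fin n)) x).target).withDensity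
    (fun y => ENNReal.ofReal (Real.sqrt (gramMatrix x y).det))).map
      (chartAt (EuclideanSpace ℝ (Fin n)) x).symm

variable (n M) in
/-- The Riemannian measure. The measures `√(det g) dy` of two charts agree on the overlap
of the charts, and the Riemannian measure, which is obtained by gluing them, is their supremum. -/
def riemannianVolume [MeasurableSpace M] : Measure M :=
  ⨆ x : M, chartVolume (n := n) x

/-- The vector field `X` is the weak gradient of the locally integrable function
`u : M → ℝ`: in each chart, `⟨X, ∂_v⟩` is the weak derivative of `u` in the direction `v`. -/
def IsWeakGradient (u : M → ℝ) (X : (x : M) → TangentSpace (𝓡 n) x) : Prop :=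
  ∀ x : M,
    LocallyIntegrableOn (fun y => u ((chartAt (EuclideanSpace ℝ (Fin n)) x).symm y))
      (chartAt (EuclideanSpace ℝ (Fin n)) x).target volume ∧
    ∀ v : EuclideanSpace ℝ (Fin n),
      LocallyIntegrableOn
        (fun y => inner ℝ (X ((chartAt (EuclideanSpace ℝ (Fin n)) x).symm y)) (chartVector x y v))
        (chartAt (EuclideanSpace ℝ (Fin n)) x).target volume ∧
      ∀ ψ : EuclideanSpace ℝ (Fin n) → ℝ, ContDiff ℝ ∞ ψ → HasCompactSupport ψ →
        tsupport ψ ⊆ (chartAt (EuclideanSpace ℝ (Fin n)) x).target →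
        ∫ y, u ((chartAt (EuclideanSpace ℝ (Fin n)) x).symm y) * fderiv ℝ ψ y v =
          -∫ y, inner ℝ (X ((chartAt (EuclideanSpace ℝ (Fin n)) x).symm y)) (chartVector x y v)
            * ψ y

/-- `X + iY` is the weak gradient of the complex-valued function `f`. -/
def IsWeakGradientC (f : M → ℂ) (X Y : (x : M) → TangentSpace (𝓡 n) x) : Prop :=
  IsWeakGradient (fun z => (f z).re) X ∧ IsWeakGradient (fun z => (f z).im) Y

/-- The length `|X + iY|` of a complex vector field. -/
def gradLength (X Y : (x : M) → TangentSpace (𝓡 n) x) (z : M) : ℝ :=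
  Real.sqrt (‖X z‖ ^ 2 + ‖Y z‖ ^ 2)

end Manifold

/-! ### Sobolev spaces associated with `L` -/

section Sobolev

variable {M : Type*} [MeasurableSpace M] {μ : Measure M}

/-- `f, h ∈ L^p` and `L^{1/m} f = h`, where `L^{1/m}` on `L^p` is the closure in `L^p` of the
restriction of `L^{1/m}` on `L^2` to the `u ∈ L^2 ∩ L^p` with `L^{1/m} u ∈ L^p`. -/
def IsRootLp (L : Lp ℂ 2 μ →ₗ.[ℂ] Lp ℂ 2 μ) (m : ℝ) (p : ℝ≥0∞) (f h : M → ℂ) : Prop :=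
  MemLp f p μ ∧ MemLp h p μ ∧
    ∃ u v : ℕ → Lp ℂ 2 μ,
      (∀ k, IsFracPow L (1 / m) (u k) (v k) ∧ MemLp (u k) p μ ∧ MemLp (v k) p μ) ∧
      Tendsto (fun k => eLpNorm (fun z => u k z - f z) p μ) atTop (𝓝 0) ∧
      Tendsto (fun k => eLpNorm (fun z => v k z - h z) p μ) atTop (𝓝 0)

/-- `f ∈ W^{1,p}_L`, that is, `f ∈ L^p` and `L^{1/m} f ∈ L^p`. -/
def MemW (L : Lp ℂ 2 μ →ₗ.[ℂ] Lp ℂ 2 μ) (m : ℝ) (p : ℝ≥0∞) (f : M → ℂ) : Prop :=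
  ∃ h, IsRootLp L m p f h

/-- The norm `‖f‖_p + ‖L^{1/m} f‖_p` of `W^{1,p}_L`. (The infimum matters only
if `L^{1/m}` is not closable on `L^p`; otherwise `L^{1/m} f` is unique.) -/
def normW (L : Lp ℂ 2 μ →ₗ.[ℂ] Lp ℂ 2 μ) (m : ℝ) (p : ℝ≥0∞) (f : M → ℂ) : ℝ≥0∞ :=
  eLpNorm f p μ + ⨅ (h : M → ℂ) (_ : IsRootLp L m p f h), eLpNorm h p μ

end Sobolev

/-! ### The assumptions -/

section Assumptions

variable {n : ℕ} {M : Type*} [MetricSpace M] [MeasurableSpace M] {μ : Measure M}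

/-- The doubling property `(D)`. -/
def Doubling (μ : Measure M) : Prop :=
  ∃ C : ℝ≥0, ∀ (x : M) (ρ : ℝ), 0 < ρ →
    μ (Metric.ball x (2 * ρ)) ≤ C * μ (Metric.ball x ρ)

/-- The lower volume bound `(MV_d)`: `μ(B(x,ρ)) ≥ c ρ^d` for `0 < ρ ≤ 1`. -/
def VolumeLowerBound (μ : Measure M) (d : ℝ) : Prop :=
  ∃ c : ℝ, 0 < c ∧ ∀ (x : M) (ρ : ℝ), 0 < ρ → ρ ≤ 1 →
    ENNReal.ofReal (c * ρ ^ d) ≤ μ (Metric.ball x ρ)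

/-- `L^s - L^∞` off-diagonal decay of `e^{-tL}`: on a ball `B` of radius `t^{1/m}`,
`‖e^{-tL} f‖_{L^∞(B)} ≤ C ∑_k 2^{-δk} (⨍_{2^k B} |f|^s)^{1/s}`, for some `δ > 1`. -/
def OffDiagonalDecay (L : Lp ℂ 2 μ →ₗ.[ℂ] Lp ℂ 2 μ) (m : ℝ) (s : ℝ≥0∞) : Prop :=
  ∃ T : ℝ → Lp ℂ 2 μ →L[ℂ] Lp ℂ 2 μ, IsSemigroupOf L T ∧
    ∃ δ : ℝ, 1 < δ ∧ ∃ C : ℝ≥0, ∀ t : ℝ, 0 < t → ∀ (x : M) (f : Lp ℂ 2 μ),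
      eLpNorm (T t f) ∞ (μ.restrict (Metric.ball x (t ^ (1 / m)))) ≤
        C * ∑' k : ℕ, ENNReal.ofReal ((2 : ℝ) ^ (-(δ * k))) *
          eLpNorm f s ((μ (Metric.ball x (2 ^ k * t ^ (1 / m))))⁻¹ •
            μ.restrict (Metric.ball x (2 ^ k * t ^ (1 / m))))

variable [ChartedSpace (EuclideanSpace ℝ (Fin n)) M]
  [RiemannianBundle (fun x : M => TangentSpace (𝓡 n) x)]

variable (n) in
/-- The Riesz transform `∇ L^{-1/m}` is bounded on `L^p`: for `u` in the domain of `L^{1/m}` with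
`L^{1/m} u ∈ L^p`, one has `‖∇u‖_p ≤ C ‖L^{1/m} u‖_p`. -/
def RieszBounded (L : Lp ℂ 2 μ →ₗ.[ℂ] Lp ℂ 2 μ) (m : ℝ) (p : ℝ≥0∞) : Prop :=
  ∃ C : ℝ≥0, ∀ u v : Lp ℂ 2 μ, IsFracPow L (1 / m) u v → MemLp v p μ →
    ∃ X Y : (x : M) → TangentSpace (𝓡 n) x, IsWeakGradientC u X Y ∧
      eLpNorm (gradLength X Y) p μ ≤ C * eLpNorm v p μ

variable (n) in
/-- The reverse Riesz inequality `‖L^{1/m} f‖_p ≤ C ‖∇f‖_p` on `L^p`, for `f` in `C_c^∞(M)`. -/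
def ReverseRiesz (L : Lp ℂ 2 μ →ₗ.[ℂ] Lp ℂ 2 μ) (m : ℝ) (p : ℝ≥0∞) : Prop :=
  ∃ C : ℝ≥0, ∀ f : M → ℂ, ContMDiff (𝓡 n) 𝓘(ℝ, ℂ) ∞ f → HasCompactSupport f →
    ∀ X Y : (x : M) → TangentSpace (𝓡 n) x, IsWeakGradientC f X Y →
      ∃ h : M → ℂ, IsRootLp L m p f h ∧ eLpNorm h p μ ≤ C * eLpNorm (gradLength X Y) p μ

end Assumptions

end LSobolev

end

open LSobolev

/-! The gradient obeys the Leibniz rule and `L^{1/m}` does not, so everything passes through the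
gradient. If `L^{1/m} f ∈ L^{p₁}` and `L^{1/m} g ∈ L^{q₂}`, the Riesz transform bounds put `∇f` in
`L^{p₁}` and `∇g` in `L^{q₂}` (`exists_gradient_of_isRootLp`). Then `∇(fg) = g ∇f + f ∇g` lies in
`L^r` by Hölder (`exists_isWeakGradientC_mul`), and the reverse Riesz inequality returns from
`∇(fg)` to `L^{1/m}(fg)` (`exists_isRootLp_of_gradient`). This is `exists_leibniz`; the algebra
property of `W^{1,p}_L ∩ L^∞` is its case `r = p₁ = q₂ = p`, `q₁ = p₂ = ∞`.

Both Riesz inequalities are assumed on small classes only and have to be extended. The direct one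
holds on the `L²` graph of `L^{1/m}`; an element of the closure in `L^p` is written as a series of
increments of `L²` approximants with summable norms, and weak gradients can be summed
(`exists_isWeakGradient_of_series`). The reverse one holds for `C_c^∞`, which is dense in the first
order Sobolev space (`exists_contMDiff_approx`): a complete space with a doubling measure is proper
(`Doubling.properSpace`), so distance cutoffs with small Lipschitz constants are compactly
supported, and a partition of unity and mollification in charts do the rest. The product rule itself
is proved in charts, for mollifications of bounded truncations, and then in the limit
(`HasWeakDeriv.mul`).

The last assertion needs the embedding `W^{1,p}_L ⊆ L^∞` for `p > d`. Put `α = 1/m` and `v = L^α u`.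
Off-diagonal decay and `(MV_d)` bound `e^{-sL}` from `L^p` to `L^∞` by a multiple of
`min(1,s)^(-d/(mp))`, and decay with doubling makes the semigroup uniformly bounded on `L²`. From
`Γ(α) u = ∫ s^(α-1) e^{-sL} v ds`, valid for `L + ε` in place of `L`, one subtracts its image under
`e^{-L}` and obtains `Γ(α)(u - e^{-L}u) = ∫ (s^(α-1) - (s-1)_+^(α-1)) e^{-sL} v ds`. This kernel is
`O(s^(α-2))` at infinity, so `ε` can tend to `0` (`IsOfType.sub_eq_integral_diffKernel`), and it is
integrable against `s^(-d/(mp))` at `0` exactly because `d < p`. The integral converges in `L²`, and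
its sup norm is controlled because the balls of `L^∞` are closed convex subsets of `L²`
(`IsOfType.exists_sub_eq_smul`). -/

open scoped Convolution

set_option linter.unusedSectionVars false

namespace LSobolev


/-! ### Mollification in Euclidean space. -/

section Mollify

variable {E : Type*} [NormedAddCommGroup E] [InnerProductSpace ℝ E] [FiniteDimensional ℝ E]
  [MeasurableSpace E] [BorelSpace E]

/-- A sequence of bump functions concentrating at the origin. -/
noncomputable def bumpSeq (E : Type*) [NormedAddCommGroup E] (k : ℕ) : ContDiffBump (0 : E) where
  rIn := 1 / (2 * ((k : ℝ) + 1))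
  rOut := 1 / ((k : ℝ) + 1)
  rIn_pos := by positivity
  rIn_lt_rOut := by
    apply one_div_lt_one_div_of_lt (by positivity)
    have : (0 : ℝ) < (k : ℝ) + 1 := by positivity
    linarith

/-- The mollification of `f` at scale `1 / (k + 1)`. -/
noncomputable def mollify (k : ℕ) (f : E → ℝ) : E → ℝ :=
  (bumpSeq E k).normed volume ⋆[ContinuousLinearMap.lsmul ℝ ℝ, volume] f

theorem tendsto_bumpSeq_rOut :
    Tendsto (fun k => (bumpSeq E k).rOut) atTop (𝓝 0) :=
  tendsto_one_div_add_atTop_nhds_zero_nat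

theorem contDiff_mollify (k : ℕ) {f : E → ℝ} (hf : LocallyIntegrable f volume) :
    ContDiff ℝ ∞ (mollify k f) :=
  (bumpSeq E k).hasCompactSupport_normed.contDiff_convolution_left _
    (bumpSeq E k).contDiff_normed hf

theorem ae_tendsto_mollify {f : E → ℝ} (hf : LocallyIntegrable f volume) :
    ∀ᵐ x, Tendsto (fun k => mollify k f x) atTop (𝓝 (f x)) := by
  -- The ratio `rOut / rIn` equals 2 at every scale, the bounded eccentricity required by Lebesgue
  -- differentiation.
  refine ContDiffBump.ae_convolution_tendsto_right_of_locallyIntegrable (K := 2)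
    tendsto_bumpSeq_rOut (Eventually.of_forall fun k => ?_) hf
  simp only [bumpSeq]
  apply le_of_eq
  field_simp

theorem mollify_apply (k : ℕ) (f : E → ℝ) (x : E) :
    mollify k f x = ∫ y, (bumpSeq E k).normed volume y * f (x - y) := by
  simp [mollify, convolution_def]

/-- The probability measure with density the bump function. -/
noncomputable def bumpMeasure (E : Type*) [NormedAddCommGroup E] [InnerProductSpace ℝ E]
    [FiniteDimensional ℝ E] [MeasurableSpace E] [BorelSpace E] (k : ℕ) : Measure E :=
  volume.withDensity fun y => ENNReal.ofReal ((bumpSeq E k).normed volume y)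

theorem measurable_bump (k : ℕ) :
    Measurable fun y : E => ENNReal.ofReal ((bumpSeq E k).normed volume y) :=
  ((bumpSeq E k).continuous_normed.measurable).ennreal_ofReal

instance (k : ℕ) : IsProbabilityMeasure (bumpMeasure E k) := by
  constructor
  rw [bumpMeasure, withDensity_apply _ MeasurableSet.univ, Measure.restrict_univ,
    ← ofReal_integral_eq_lintegral_ofReal (bumpSeq E k).integrable_normed
      (Eventually.of_forall fun x => (bumpSeq E k).nonneg_normed x),
    (bumpSeq E k).integral_normed, ENNReal.ofReal_one]

theorem mollify_eq_integral (k : ℕ) (f : E → ℝ) (x : E) :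
    mollify k f x = ∫ y, f (x - y) ∂(bumpMeasure E k) := by
  rw [mollify_apply, bumpMeasure, integral_withDensity_eq_integral_toReal_smul (measurable_bump k)
    (Eventually.of_forall fun _ => ENNReal.ofReal_lt_top)]
  refine integral_congr_ae (Eventually.of_forall fun y => ?_)
  simp [ENNReal.toReal_ofReal ((bumpSeq E k).nonneg_normed y)]

/-- Mollification averages translates against a probability measure: Jensen (monotonicity of `L^p`
norms in the exponent), then Tonelli and translation invariance. -/
theorem eLpNorm_mollify_le (k : ℕ) {f : E → ℝ} {p : ℝ≥0∞} (hp : 1 ≤ p) (hp' : p ≠ ⊤)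
    (hf : AEStronglyMeasurable f volume) :
    eLpNorm (mollify k f) p volume ≤ eLpNorm f p volume := by
  have hp0 : p ≠ 0 := (zero_lt_one.trans_le hp).ne'
  have hpr : 0 < p.toReal := ENNReal.toReal_pos hp0 hp'
  have hac : bumpMeasure E k ≪ volume := withDensity_absolutelyContinuous _ _
  have hmeas : ∀ x : E, AEStronglyMeasurable (fun y => f (x - y)) (bumpMeasure E k) := fun x =>
    (hf.comp_quasiMeasurePreserving
      (quasiMeasurePreserving_sub_left volume x)).mono_ac hac
  have hpt : ∀ x : E, ‖mollify k f x‖ₑ ^ p.toReal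
      ≤ ∫⁻ y, ‖f (x - y)‖ₑ ^ p.toReal ∂(bumpMeasure E k) := by
    intro x
    have h1 : ‖mollify k f x‖ₑ ≤ eLpNorm (fun y => f (x - y)) p (bumpMeasure E k) := by
      rw [mollify_eq_integral]
      refine (enorm_integral_le_lintegral_enorm _).trans ?_
      rw [← eLpNorm_one_eq_lintegral_enorm]
      exact eLpNorm_le_eLpNorm_of_exponent_le hp (hmeas x)
    calc ‖mollify k f x‖ₑ ^ p.toReal
        ≤ (eLpNorm (fun y => f (x - y)) p (bumpMeasure E k)) ^ p.toReal := by gcongr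
      _ = _ := by
        rw [eLpNorm_eq_lintegral_rpow_enorm_toReal hp0 hp', ← ENNReal.rpow_mul,
          one_div_mul_cancel hpr.ne', ENNReal.rpow_one]
  rw [eLpNorm_eq_lintegral_rpow_enorm_toReal hp0 hp',
    eLpNorm_eq_lintegral_rpow_enorm_toReal hp0 hp']
  refine ENNReal.rpow_le_rpow ?_ (by positivity)
  calc ∫⁻ x, ‖mollify k f x‖ₑ ^ p.toReal
      ≤ ∫⁻ x, ∫⁻ y, ‖f (x - y)‖ₑ ^ p.toReal ∂(bumpMeasure E k) := lintegral_mono hpt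
    _ = ∫⁻ y, (∫⁻ x, ‖f (x - y)‖ₑ ^ p.toReal) ∂(bumpMeasure E k) := by
        refine lintegral_lintegral_swap ?_
        have : AEStronglyMeasurable (fun z : E × E => f (z.1 - z.2))
            (volume.prod (bumpMeasure E k)) :=
          (hf.comp_quasiMeasurePreserving
            (quasiMeasurePreserving_sub_of_right_invariant volume volume)).mono_ac
              (Measure.AbsolutelyContinuous.rfl.prod hac)
        exact this.enorm.pow_const _
    _ = ∫⁻ y, (∫⁻ x, ‖f x‖ₑ ^ p.toReal) ∂(bumpMeasure E k) := by
        refine lintegral_congr fun y => ?_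
        exact lintegral_sub_right_eq_self (fun x => ‖f x‖ₑ ^ p.toReal) y
    _ = ∫⁻ x, ‖f x‖ₑ ^ p.toReal := by simp

theorem integrable_bump_mul (k : ℕ) {f : E → ℝ} (hf : LocallyIntegrable f volume) (x : E) :
    Integrable (fun y => (bumpSeq E k).normed volume y * f (x - y)) := by
  have := (bumpSeq E k).hasCompactSupport_normed (μ := volume) |>.convolutionExists_left
    (ContinuousLinearMap.lsmul ℝ ℝ) (bumpSeq E k).continuous_normed hf x
  simpa [ConvolutionExistsAt] using this

theorem mollify_sub (k : ℕ) {f g : E → ℝ} (hf : LocallyIntegrable f volume)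
    (hg : LocallyIntegrable g volume) :
    mollify k (f - g) = mollify k f - mollify k g := by
  ext x
  simp only [mollify_apply, Pi.sub_apply, mul_sub]
  exact integral_sub (integrable_bump_mul k hf x) (integrable_bump_mul k hg x)

theorem tsupport_mollify_subset (k : ℕ) (f : E → ℝ) :
    tsupport (mollify k f) ⊆ Metric.cthickening (1 / ((k : ℝ) + 1)) (tsupport f) := by
  refine closure_minimal ?_ Metric.isClosed_cthickening
  refine (support_convolution_subset _).trans ?_
  rintro _ ⟨a, ha, b, hb, rfl⟩
  refine Metric.mem_cthickening_of_dist_le _ b _ _ (subset_tsupport f hb) ?_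
  rw [(bumpSeq E k).support_normed_eq] at ha
  simpa [bumpSeq] using (mem_ball_zero_iff.1 ha).le

/-- Uniform continuity gives uniform convergence, and all supports lie in one compact set because
the mollification radii are at most 1. -/
theorem tendsto_eLpNorm_mollify_of_continuous {g : E → ℝ} (hg : Continuous g)
    (hgc : HasCompactSupport g) {p : ℝ≥0∞} (hp : 1 ≤ p) :
    Tendsto (fun k => eLpNorm (mollify k g - g) p volume) atTop (𝓝 0) := by
  have hp0 : p ≠ 0 := (zero_lt_one.trans_le hp).ne'
  set K := Metric.cthickening 1 (tsupport g)
  have hK : IsCompact K := IsCompact.cthickening hgc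
  have hKtop : volume K < ⊤ := hK.measure_lt_top
  rw [ENNReal.tendsto_nhds_zero]
  intro ε hε
  obtain ⟨δ, hδ, hδε⟩ : ∃ δ : ℝ≥0, 0 < δ ∧ (δ : ℝ≥0∞) * volume K ^ (1 / p.toReal) ≤ ε := by
    have hfin : volume K ^ (1 / p.toReal) ≠ ⊤ :=
      ENNReal.rpow_ne_top_of_nonneg (one_div_nonneg.2 ENNReal.toReal_nonneg) hKtop.ne
    obtain ⟨δ, hδ, h⟩ := ENNReal.exists_nnreal_pos_mul_lt hfin hε.ne'
    exact ⟨δ, hδ, h.le⟩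
  have huc := hg.uniformContinuous_of_tendsto_cocompact (x := 0) hgc.is_zero_at_infty
  obtain ⟨η, hη, hηδ⟩ := Metric.uniformContinuous_iff.1 huc δ hδ
  have : ∀ᶠ k in atTop, (bumpSeq E k).rOut < η :=
    tendsto_bumpSeq_rOut.eventually (gt_mem_nhds hη)
  filter_upwards [this] with k hk
  have hbd : ∀ x, ‖(mollify k g - g) x‖ ≤ δ := by
    intro x
    rw [Pi.sub_apply, ← dist_eq_norm]
    refine (bumpSeq E k).dist_normed_convolution_le hg.aestronglyMeasurable fun y hy => ?_
    exact (hηδ (lt_trans hy hk)).le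
  have hsupp : (mollify k g - g) = K.indicator (mollify k g - g) := by
    symm
    rw [indicator_eq_self]
    refine (Function.support_sub _ _).trans (union_subset ?_ ?_)
    · refine (subset_tsupport _).trans ((tsupport_mollify_subset k g).trans ?_)
      refine Metric.cthickening_mono ?_ _
      rw [div_le_one (by positivity)]
      linarith [k.cast_nonneg (α := ℝ)]
    · exact (subset_tsupport _).trans (Metric.self_subset_cthickening _)
  rw [hsupp, eLpNorm_indicator_eq_eLpNorm_restrict hK.measurableSet]
  refine (eLpNorm_le_of_ae_bound (C := δ) (Eventually.of_forall hbd)).trans ?_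
  rw [Measure.restrict_apply_univ, mul_comm, ← one_div]
  simpa using hδε

/-- Density of `C_c` in `L^p` together with the contraction property `eLpNorm_mollify_le`. -/
theorem tendsto_eLpNorm_mollify {f : E → ℝ} {p : ℝ≥0∞} (hp : 1 ≤ p) (hp' : p ≠ ⊤)
    (hf : MemLp f p volume) :
    Tendsto (fun k => eLpNorm (mollify k f - f) p volume) atTop (𝓝 0) := by
  rw [ENNReal.tendsto_nhds_zero]
  intro ε hε
  have hε3 : ε / 3 ≠ 0 := (ENNReal.div_pos hε.ne' (by simp)).ne'
  obtain ⟨g, hgc, hfg, hg, hgp⟩ := hf.exists_hasCompactSupport_eLpNorm_sub_le hp' hε3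
  filter_upwards [(ENNReal.tendsto_nhds_zero.1
    (tendsto_eLpNorm_mollify_of_continuous hg hgc hp)) (ε / 3) (pos_iff_ne_zero.2 hε3)]
    with k hk
  have hfl := hf.locallyIntegrable hp
  have hgl := hgp.locallyIntegrable hp
  have heq : mollify k f - f = mollify k (f - g) + ((mollify k g - g) + (g - f)) := by
    rw [mollify_sub k hfl hgl]; abel
  have m1 : AEStronglyMeasurable (mollify k (f - g)) volume :=
    (contDiff_mollify k (hfl.sub hgl)).continuous.aestronglyMeasurable
  have m2 : AEStronglyMeasurable (mollify k g - g) volume :=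
    ((contDiff_mollify k hgl).continuous.sub hg).aestronglyMeasurable
  have m3 : AEStronglyMeasurable (g - f) volume := hgp.1.sub hf.1
  calc eLpNorm (mollify k f - f) p volume
      ≤ eLpNorm (mollify k (f - g)) p volume
        + (eLpNorm (mollify k g - g) p volume + eLpNorm (g - f) p volume) := by
        rw [heq]
        exact (eLpNorm_add_le m1 (m2.add m3) hp).trans (by gcongr; exact eLpNorm_add_le m2 m3 hp)
    _ ≤ ε / 3 + (ε / 3 + ε / 3) := by
        gcongr
        · exact (eLpNorm_mollify_le k hp hp' (hf.1.sub hgp.1)).trans hfg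
        · rw [eLpNorm_sub_comm]; exact hfg
    _ = ε := by rw [← add_assoc]; exact ENNReal.add_thirds ε

end Mollify


/-! ### Directional weak derivatives on open sets. -/

section WeakDeriv

variable {E : Type*} [NormedAddCommGroup E] [InnerProductSpace ℝ E] [FiniteDimensional ℝ E]
  [MeasurableSpace E] [BorelSpace E]

/-- `w` is the weak derivative of `u` in the direction `v` on the open set `U`. -/
structure HasWeakDeriv (U : Set E) (u w : E → ℝ) (v : E) : Prop where
  left : LocallyIntegrableOn u U volume
  right : LocallyIntegrableOn w U volume
  eq : ∀ ψ : E → ℝ, ContDiff ℝ ∞ ψ → HasCompactSupport ψ → tsupport ψ ⊆ U →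
    ∫ y, u y * fderiv ℝ ψ y v = -∫ y, w y * ψ y

variable {U : Set E} {u w f g F G : E → ℝ} {v : E}

theorem integrable_mul_of_tsupport_subset (hu : LocallyIntegrableOn u U volume) {ψ : E → ℝ}
    (hψ : Continuous ψ) (hc : HasCompactSupport ψ) (hs : tsupport ψ ⊆ U) :
    Integrable (fun y => u y * ψ y) := by
  have h1 : IntegrableOn (fun y => u y * ψ y) (tsupport ψ) volume :=
    (hu.integrableOn_compact_subset hs hc).mul_continuousOn hψ.continuousOn hc
  refine (integrableOn_iff_integrable_of_support_subset ?_).1 h1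
  intro y hy
  apply subset_tsupport ψ
  intro h0
  simp [h0] at hy

theorem continuous_fderiv_apply_of_contDiff {ψ : E → ℝ} (hψ : ContDiff ℝ ∞ ψ) (v : E) :
    Continuous fun y => fderiv ℝ ψ y v :=
  (hψ.continuous_fderiv (by simp)).clm_apply continuous_const

theorem tsupport_fderiv_apply_subset' (ψ : E → ℝ) (v : E) :
    tsupport (fun y => fderiv ℝ ψ y v) ⊆ tsupport ψ := by
  refine closure_minimal ?_ (isClosed_tsupport _)
  intro y hy
  apply support_fderiv_subset ℝ
  intro h0
  simp [h0] at hy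

theorem hasCompactSupport_fderiv_apply {ψ : E → ℝ} (hc : HasCompactSupport ψ) (v : E) :
    HasCompactSupport fun y => fderiv ℝ ψ y v :=
  hc.of_isClosed_subset (isClosed_tsupport _) (tsupport_fderiv_apply_subset' ψ v)

theorem integrable_mul_fderiv (hu : LocallyIntegrableOn u U volume) {ψ : E → ℝ}
    (hψ : ContDiff ℝ ∞ ψ) (hc : HasCompactSupport ψ) (hs : tsupport ψ ⊆ U) (v : E) :
    Integrable (fun y => u y * fderiv ℝ ψ y v) :=
  integrable_mul_of_tsupport_subset hu (continuous_fderiv_apply_of_contDiff hψ v)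
    (hasCompactSupport_fderiv_apply hc v) ((tsupport_fderiv_apply_subset' ψ v).trans hs)

/-- The integrands in the weak formulation vanish off `U`. In a chart, the values of a transported
function outside the target are junk, and this makes them irrelevant. -/
theorem integral_eq_setIntegral_of_test {ψ : E → ℝ} (hs : tsupport ψ ⊆ U) (u : E → ℝ) (v : E) :
    (∀ y ∉ U, u y * fderiv ℝ ψ y v = 0) ∧ ∀ y ∉ U, u y * ψ y = 0 := by
  refine ⟨fun y hy => ?_, fun y hy => ?_⟩
  · have h : fderiv ℝ ψ y v = 0 := by
      by_contra h0
      exact hy (hs (tsupport_fderiv_apply_subset' ψ v (subset_tsupport _ h0)))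
    simp [h]
  · have h : ψ y = 0 := by
      by_contra h0
      exact hy (hs (subset_tsupport _ h0))
    simp [h]

theorem HasWeakDeriv.congr_ae (hU : MeasurableSet U) {u' w' : E → ℝ} (h : HasWeakDeriv U u w v)
    (hu : u =ᵐ[volume.restrict U] u') (hw : w =ᵐ[volume.restrict U] w') :
    HasWeakDeriv U u' w' v := by
  have aux : ∀ {a a' : E → ℝ}, a =ᵐ[volume.restrict U] a' → LocallyIntegrableOn a U volume →
      LocallyIntegrableOn a' U volume := by
    intro a a' haa ha x hx
    obtain ⟨s, hs, hi⟩ := ha x hx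
    refine ⟨s ∩ U, inter_mem hs self_mem_nhdsWithin, ?_⟩
    exact (hi.mono_set inter_subset_left).congr_fun_ae
      (haa.filter_mono (ae_mono (Measure.restrict_mono inter_subset_right le_rfl)))
  refine ⟨aux hu h.left, aux hw h.right, fun ψ hψ hc hs => ?_⟩
  rw [ae_eq_restrict_iff_indicator_ae_eq hU] at hu hw
  have e1 : ∫ y, u' y * fderiv ℝ ψ y v = ∫ y, u y * fderiv ℝ ψ y v := by
    refine integral_congr_ae ?_
    filter_upwards [hu] with y hy
    by_cases hyU : y ∈ U
    · simp only [hyU, indicator_of_mem] at hy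
      simp only [hy]
    · simp only [(integral_eq_setIntegral_of_test hs _ v).1 y hyU]
  have e2 : ∫ y, w' y * ψ y = ∫ y, w y * ψ y := by
    refine integral_congr_ae ?_
    filter_upwards [hw] with y hy
    by_cases hyU : y ∈ U
    · simp only [hyU, indicator_of_mem] at hy
      simp only [hy]
    · simp only [(integral_eq_setIntegral_of_test hs _ v).2 y hyU]
  rw [e1, e2, h.eq ψ hψ hc hs]

theorem HasWeakDeriv.add (hf : HasWeakDeriv U f F v) (hg : HasWeakDeriv U g G v) :
    HasWeakDeriv U (f + g) (F + G) v := by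
  refine ⟨hf.left.add hg.left, hf.right.add hg.right, fun ψ hψ hc hs => ?_⟩
  simp only [Pi.add_apply, add_mul]
  rw [integral_add (integrable_mul_fderiv hf.left hψ hc hs v)
    (integrable_mul_fderiv hg.left hψ hc hs v),
    integral_add (integrable_mul_of_tsupport_subset hf.right hψ.continuous hc hs)
    (integrable_mul_of_tsupport_subset hg.right hψ.continuous hc hs), hf.eq ψ hψ hc hs,
    hg.eq ψ hψ hc hs]
  ring

theorem HasWeakDeriv.const_smul (hf : HasWeakDeriv U f F v) (c : ℝ) :
    HasWeakDeriv U (c • f) (c • F) v := by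
  refine ⟨hf.left.smul c, hf.right.smul c, fun ψ hψ hc hs => ?_⟩
  simp only [Pi.smul_apply, smul_eq_mul, mul_assoc, integral_const_mul, hf.eq ψ hψ hc hs]
  ring

/-- Weak derivatives are stable under convergence in `L^1_loc`. -/
theorem HasWeakDeriv.of_tendsto {fk Fk : ℕ → E → ℝ}
    (h : ∀ k, HasWeakDeriv U (fk k) (Fk k) v)
    (hf : LocallyIntegrableOn f U volume) (hF : LocallyIntegrableOn F U volume)
    (h1 : ∀ K ⊆ U, IsCompact K →
      Tendsto (fun k => eLpNorm (fk k - f) 1 (volume.restrict K)) atTop (𝓝 0))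
    (h2 : ∀ K ⊆ U, IsCompact K →
      Tendsto (fun k => eLpNorm (Fk k - F) 1 (volume.restrict K)) atTop (𝓝 0)) :
    HasWeakDeriv U f F v := by
  have aux : ∀ (a : E → ℝ) (ak : ℕ → E → ℝ), LocallyIntegrableOn a U volume →
      (∀ k, LocallyIntegrableOn (ak k) U volume) →
      (∀ K ⊆ U, IsCompact K →
        Tendsto (fun k => eLpNorm (ak k - a) 1 (volume.restrict K)) atTop (𝓝 0)) →
      ∀ ψ : E → ℝ, Continuous ψ → HasCompactSupport ψ → tsupport ψ ⊆ U →
      Tendsto (fun k => ∫ y, ak k y * ψ y) atTop (𝓝 (∫ y, a y * ψ y)) := by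
    intro a ak ha hak hlim ψ hψ hc hs
    refine tendsto_integral_of_L1' _
      (integrable_mul_of_tsupport_subset ha hψ hc hs).aestronglyMeasurable
      (Eventually.of_forall fun k => integrable_mul_of_tsupport_subset (hak k) hψ hc hs) ?_
    -- Boundedness of the test function turns `L¹` convergence on its support into convergence of
    -- the pairings.
    obtain ⟨C, hC⟩ := hψ.bounded_above_of_compact_support hc
    have hK := hlim _ hs hc
    have hK' : Tendsto (fun k => ENNReal.ofReal C * eLpNorm (ak k - a) 1
        (volume.restrict (tsupport ψ))) atTop (𝓝 0) := by
      simpa using ENNReal.Tendsto.const_mul hK (Or.inr ENNReal.ofReal_ne_top)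
    refine tendsto_of_tendsto_of_tendsto_of_le_of_le tendsto_const_nhds hK'
      (fun k => zero_le) fun k => ?_
    have e : ((fun y => ak k y * ψ y) - fun y => a y * ψ y) =
        (tsupport ψ).indicator fun y => (ak k - a) y * ψ y := by
      ext y
      by_cases hy : y ∈ tsupport ψ
      · simp [hy, sub_mul]
      · simp [hy, image_eq_zero_of_notMem_tsupport hy]
    change eLpNorm ((fun y => ak k y * ψ y) - fun y => a y * ψ y) 1 volume ≤ _
    rw [e, eLpNorm_indicator_eq_eLpNorm_restrict (isClosed_tsupport ψ).measurableSet]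
    refine eLpNorm_le_mul_eLpNorm_of_ae_le_mul (Eventually.of_forall fun y => ?_) 1
    rw [norm_mul, mul_comm]
    gcongr
    exact hC y
  refine ⟨hf, hF, fun ψ hψ hc hs => ?_⟩
  have t1 := aux f fk hf (fun k => (h k).left) h1 _ (continuous_fderiv_apply_of_contDiff hψ v)
    (hasCompactSupport_fderiv_apply hc v) ((tsupport_fderiv_apply_subset' ψ v).trans hs)
  have t2 := aux F Fk hF (fun k => (h k).right) h2 ψ hψ.continuous hc hs
  refine tendsto_nhds_unique t1 (t2.neg.congr fun k => ?_)
  rw [(h k).eq ψ hψ hc hs]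

/-- Smooth functions on the whole space have weak derivatives. -/
theorem integral_mul_fderiv_eq_neg {h ψ : E → ℝ} (hh : ContDiff ℝ 1 h) (hψ : ContDiff ℝ ∞ ψ)
    (hc : HasCompactSupport ψ) (v : E) :
    ∫ y, h y * fderiv ℝ ψ y v = -∫ y, fderiv ℝ h y v * ψ y := by
  have hd : Continuous fun y => fderiv ℝ h y v :=
    (hh.continuous_fderiv one_ne_zero).clm_apply continuous_const
  refine integral_mul_fderiv_eq_neg_fderiv_mul_of_integrable ?_ ?_ ?_
    (fun x _ => (hh.differentiable one_ne_zero) x)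
    (fun x _ => (hψ.differentiable (by simp)) x)
  · exact (hd.mul hψ.continuous).integrable_of_hasCompactSupport hc.mul_left
  · exact (hh.continuous.mul (continuous_fderiv_apply_of_contDiff hψ v)).integrable_of_hasCompactSupport
      (hasCompactSupport_fderiv_apply hc v).mul_left
  · exact (hh.continuous.mul hψ.continuous).integrable_of_hasCompactSupport hc.mul_left

/-- Mollification commutes with the weak derivative. -/
theorem HasWeakDeriv.fderiv_mollify (h : HasWeakDeriv univ f F v) (k : ℕ) (x : E) :
    fderiv ℝ (mollify k f) x v = mollify k F x := by
  have hfl : LocallyIntegrable f volume := locallyIntegrableOn_univ.1 h.left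
  set ρ := (bumpSeq E k).normed (volume : Measure E) with hρ
  have hρs : ContDiff ℝ ∞ ρ := (bumpSeq E k).contDiff_normed
  have hρc : HasCompactSupport ρ := (bumpSeq E k).hasCompactSupport_normed
  have hD := hρc.hasFDerivAt_convolution_left (μ := volume) (ContinuousLinearMap.lsmul ℝ ℝ)
    (hρs.of_le (by simp)) hfl x
  have hD' : fderiv ℝ (mollify k f) x v
      = ((fderiv ℝ ρ ⋆[(ContinuousLinearMap.lsmul ℝ ℝ).precompL E, volume] f) x) v := by
    rw [← hD.fderiv]; rfl
  have hex := ((hρc.fderiv ℝ).convolutionExists_left (μ := volume)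
    ((ContinuousLinearMap.lsmul ℝ ℝ).precompL E) (hρs.continuous_fderiv (by simp)) hfl
    x).integrable_swap
  rw [hD', convolution_eq_swap, ContinuousLinearMap.integral_apply hex, mollify,
    convolution_eq_swap]
  simp only [ContinuousLinearMap.precompL_apply, ContinuousLinearMap.lsmul_apply, smul_eq_mul]
  -- For fixed `x` the reflected kernel `y ↦ ρ (x - y)` is itself a test function, and the weak
  -- formulation with it is the assertion.
  have hψs : ContDiff ℝ ∞ fun y => ρ (x - y) := hρs.comp (contDiff_const.sub contDiff_id)
  have hψc : HasCompactSupport fun y => ρ (x - y) :=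
    hρc.comp_homeomorph (Homeomorph.subLeft x)
  have key := h.eq _ hψs hψc (subset_univ _)
  have hder : ∀ y, fderiv ℝ (fun y => ρ (x - y)) y v = -(fderiv ℝ ρ (x - y) v) := by
    intro y
    have : HasFDerivAt (fun y => ρ (x - y))
        ((fderiv ℝ ρ (x - y)).comp (-ContinuousLinearMap.id ℝ E)) y := by
      refine ((hρs.differentiable (by simp)) (x - y)).hasFDerivAt.comp y ?_
      simpa using (hasFDerivAt_id (𝕜 := ℝ) y).const_sub x
    rw [this.fderiv]; simp
  simp only [hder, mul_neg, integral_neg, neg_inj] at key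
  simp only [mul_comm _ (f _), mul_comm _ (F _)]
  exact key

/-- Localisation of a weak derivative by a smooth cutoff. -/
theorem HasWeakDeriv.smul_cutoff (h : HasWeakDeriv U u w v) {η : E → ℝ} (hη : ContDiff ℝ ∞ η)
    (hc : HasCompactSupport η) (hs : tsupport η ⊆ U) :
    HasWeakDeriv univ (fun y => u y * η y) (fun y => w y * η y + u y * fderiv ℝ η y v) v ∧
      Integrable (fun y => u y * η y) ∧
      Integrable (fun y => w y * η y + u y * fderiv ℝ η y v) := by
  have i1 := integrable_mul_of_tsupport_subset h.left hη.continuous hc hs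
  have i2 := (integrable_mul_of_tsupport_subset h.right hη.continuous hc hs).add
    (integrable_mul_fderiv h.left hη hc hs v)
  refine ⟨⟨i1.locallyIntegrable.locallyIntegrableOn _, i2.locallyIntegrable.locallyIntegrableOn _,
    fun ψ hψ hψc _ => ?_⟩, i1, i2⟩
  have hsub : tsupport (fun y => η y * ψ y) ⊆ U :=
    (tsupport_mul_subset_left).trans hs
  have hcc : HasCompactSupport fun y => η y * ψ y := hc.mul_right
  -- Testing `u` against `η ψ` instead of `ψ`; the derivative of `η` contributes the term `u ∂η`.
  have key := h.eq (fun y => η y * ψ y) (hη.mul hψ) hcc hsub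
  have hder : ∀ y, fderiv ℝ (fun y => η y * ψ y) y v
      = η y * fderiv ℝ ψ y v + ψ y * fderiv ℝ η y v := by
    intro y
    rw [fderiv_fun_mul ((hη.differentiable (by simp)) y) ((hψ.differentiable (by simp)) y)]
    simp
  have j1 : Integrable fun y => u y * (η y * fderiv ℝ ψ y v) :=
    integrable_mul_of_tsupport_subset h.left
      (hη.continuous.mul (continuous_fderiv_apply_of_contDiff hψ v)) hc.mul_right
      ((tsupport_mul_subset_left).trans hs)
  have j2 : Integrable fun y => u y * (ψ y * fderiv ℝ η y v) :=
    integrable_mul_of_tsupport_subset h.left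
      (hψ.continuous.mul (continuous_fderiv_apply_of_contDiff hη v)) hψc.mul_right
      ((tsupport_mul_subset_right).trans ((tsupport_fderiv_apply_subset' η v).trans hs))
  have j3 : Integrable fun y => w y * (η y * ψ y) :=
    integrable_mul_of_tsupport_subset h.right (hη.continuous.mul hψ.continuous) hcc hsub
  simp only [hder, mul_add] at key
  rw [integral_add j1 j2] at key
  have e1 : ∀ y, (w y * η y + u y * fderiv ℝ η y v) * ψ y
      = w y * (η y * ψ y) + u y * (ψ y * fderiv ℝ η y v) := fun y => by ring
  simp only [e1, mul_assoc]
  rw [integral_add j3 j2]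
  linarith

end WeakDeriv


/-! ### Smooth truncations of the identity. -/

section Truncation

/-- A smooth bounded truncation of the identity. -/
noncomputable def softTrunc (c s : ℝ) : ℝ := c * Real.arctan (s / c)

theorem hasDerivAt_softTrunc {c : ℝ} (hc : 0 < c) (s : ℝ) :
    HasDerivAt (softTrunc c) (1 / (1 + (s / c) ^ 2)) s := by
  have h1 : HasDerivAt (fun s : ℝ => s / c) (1 / c) s := (hasDerivAt_id s).div_const c
  have h2 := (h1.arctan).const_mul c
  convert! h2 using 1
  field_simp

theorem deriv_softTrunc {c : ℝ} (hc : 0 < c) (s : ℝ) :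
    deriv (softTrunc c) s = 1 / (1 + (s / c) ^ 2) :=
  (hasDerivAt_softTrunc hc s).deriv

theorem contDiff_softTrunc (c : ℝ) : ContDiff ℝ 1 (softTrunc c) :=
  contDiff_const.mul (Real.contDiff_arctan.comp (contDiff_id.div_const c))

theorem norm_deriv_softTrunc_le {c : ℝ} (hc : 0 < c) (s : ℝ) : ‖deriv (softTrunc c) s‖ ≤ 1 := by
  rw [deriv_softTrunc hc, Real.norm_of_nonneg (by positivity), div_le_one (by positivity)]
  nlinarith [sq_nonneg (s / c)]

theorem norm_softTrunc_le_norm {c : ℝ} (hc : 0 < c) (s : ℝ) : ‖softTrunc c s‖ ≤ ‖s‖ := by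
  have := Convex.norm_image_sub_le_of_norm_deriv_le (f := softTrunc c) (C := 1)
    (fun x _ => (hasDerivAt_softTrunc hc x).differentiableAt)
    (fun x _ => norm_deriv_softTrunc_le hc x) convex_univ (mem_univ 0) (mem_univ s)
  simpa [softTrunc] using this

theorem norm_softTrunc_le {c : ℝ} (hc : 0 < c) (s : ℝ) : ‖softTrunc c s‖ ≤ c * (Real.pi / 2) := by
  rw [softTrunc, norm_mul, Real.norm_of_nonneg hc.le]
  gcongr
  rw [Real.norm_eq_abs, abs_le]
  exact ⟨(Real.neg_pi_div_two_lt_arctan _).le, (Real.arctan_lt_pi_div_two _).le⟩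

theorem tendsto_deriv_softTrunc (s : ℝ) :
    Tendsto (fun j : ℕ => deriv (softTrunc ((j : ℝ) + 1)) s) atTop (𝓝 1) := by
  have h1 : Tendsto (fun j : ℕ => s / ((j : ℝ) + 1)) atTop (𝓝 0) := by
    simpa [div_eq_mul_inv] using
      (tendsto_one_div_add_atTop_nhds_zero_nat (𝕜 := ℝ)).const_mul s
  have h2 : Tendsto (fun j : ℕ => 1 / (1 + (s / ((j : ℝ) + 1)) ^ 2)) atTop (𝓝 1) := by
    have := (tendsto_const_nhds (x := (1 : ℝ))).div ((h1.pow 2).const_add 1) (by simp)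
    simpa [Pi.div_def] using this
  exact h2.congr fun j => (deriv_softTrunc (by positivity) s).symm

/-- For `s ≠ 0` this is the derivative of `arctan` at `0` being 1, read along the points `s / (j +
1)`. -/
theorem tendsto_softTrunc (s : ℝ) :
    Tendsto (fun j : ℕ => softTrunc ((j : ℝ) + 1) s) atTop (𝓝 s) := by
  have h1 : HasDerivAt Real.arctan 1 0 := by simpa using Real.hasDerivAt_arctan 0
  by_cases hs : s = 0
  · simp [hs, softTrunc]
  have h2 := h1.tendsto_slope
  have h3 : Tendsto (fun j : ℕ => s / ((j : ℝ) + 1)) atTop (𝓝[≠] 0) := by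
    refine tendsto_nhdsWithin_iff.2 ⟨?_, Eventually.of_forall fun j => ?_⟩
    · simpa [div_eq_mul_inv] using
        (tendsto_one_div_add_atTop_nhds_zero_nat (𝕜 := ℝ)).const_mul s
    · exact div_ne_zero hs (by positivity)
  have h4 := (h2.comp h3).const_mul s
  rw [mul_one] at h4
  refine h4.congr fun j => ?_
  simp only [Function.comp, slope_def_field, softTrunc, Real.arctan_zero, sub_zero]
  field_simp

end Truncation

/-! ### Products and locally Lipschitz functions. -/

section Product

variable {E : Type*} [NormedAddCommGroup E] [InnerProductSpace ℝ E] [FiniteDimensional ℝ E]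
  [MeasurableSpace E] [BorelSpace E]

variable {U : Set E} {u w f g F G : E → ℝ} {v : E}

/-- The cutoff is 1 near every point of `K` and not merely on `K`, so that its derivative also
vanishes on `K`. -/
theorem exists_smooth_cutoff {K U : Set E} (hK : IsCompact K) (hU : IsOpen U) (hKU : K ⊆ U) :
    ∃ η : E → ℝ, ContDiff ℝ ∞ η ∧ HasCompactSupport η ∧ tsupport η ⊆ U ∧
      (∀ y ∈ K, η =ᶠ[𝓝 y] fun _ => 1) ∧ ∀ y, η y ∈ Icc (0 : ℝ) 1 := by
  obtain ⟨L, hL, hKL, hLU⟩ := exists_compact_between hK hU hKU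
  obtain ⟨η, h1, h0, h01⟩ := exists_contMDiffMap_one_nhds_of_subset_interior (n := ⊤)
    𝓘(ℝ, E) hK.isClosed hKL
  have hts : tsupport η ⊆ L := by
    refine closure_minimal (fun y hy => ?_) hL.isClosed
    by_contra hyL
    exact hy (h0 y hyL)
  refine ⟨η, η.contMDiff.contDiff, hL.of_isClosed_subset (isClosed_tsupport _) hts,
    hts.trans hLU, fun y hy => ?_, h01⟩
  exact (eventually_nhdsSet_iff_forall.1 h1) y hy

/-- Write `aₖ wₖ = aₖ (wₖ - w) + aₖ w`: the first term tends to zero in `L¹`, the second is handled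
by dominated convergence. -/
theorem tendsto_integral_mul_of_bounded {α : Type*} [MeasurableSpace α] {μ : Measure α}
    {a : α → ℝ} {ak : ℕ → α → ℝ} {w : α → ℝ} {wk : ℕ → α → ℝ} {C : ℝ}
    (hak : ∀ k, AEStronglyMeasurable (ak k) μ) (hb : ∀ k x, ‖ak k x‖ ≤ C)
    (ha : ∀ᵐ x ∂μ, Tendsto (fun k => ak k x) atTop (𝓝 (a x)))
    (hw : Integrable w μ) (hwk : ∀ k, Integrable (wk k) μ)
    (hlim : Tendsto (fun k => eLpNorm (wk k - w) 1 μ) atTop (𝓝 0)) :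
    Tendsto (fun k => ∫ x, ak k x * wk k x ∂μ) atTop (𝓝 (∫ x, a x * w x ∂μ)) := by
  have i1 : ∀ k, Integrable (fun x => ak k x * (wk k - w) x) μ := fun k =>
    ((hwk k).sub hw).bdd_mul (hak k) (Eventually.of_forall (hb k))
  have i2 : ∀ k, Integrable (fun x => ak k x * w x) μ := fun k =>
    hw.bdd_mul (hak k) (Eventually.of_forall (hb k))
  have h1 : Tendsto (fun k => ∫ x, ak k x * (wk k - w) x ∂μ) atTop (𝓝 0) := by
    rw [tendsto_zero_iff_enorm_tendsto_zero]
    have hC : Tendsto (fun k => ENNReal.ofReal C * eLpNorm (wk k - w) 1 μ) atTop (𝓝 0) := by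
      simpa using ENNReal.Tendsto.const_mul hlim (Or.inr ENNReal.ofReal_ne_top)
    refine tendsto_of_tendsto_of_tendsto_of_le_of_le tendsto_const_nhds hC
      (fun k => zero_le) fun k => ?_
    refine (enorm_integral_le_lintegral_enorm _).trans ?_
    rw [← eLpNorm_one_eq_lintegral_enorm]
    refine eLpNorm_le_mul_eLpNorm_of_ae_le_mul (Eventually.of_forall fun y => ?_) 1
    rw [norm_mul]
    gcongr
    exact hb k y
  have h2 : Tendsto (fun k => ∫ x, ak k x * w x ∂μ) atTop (𝓝 (∫ x, a x * w x ∂μ)) := by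
    refine tendsto_integral_of_dominated_convergence (fun x => C * ‖w x‖)
      (fun k => (i2 k).aestronglyMeasurable) (hw.norm.const_mul C) (fun k => ?_) ?_
    · refine Eventually.of_forall fun x => ?_
      rw [norm_mul]
      gcongr
      exact hb k x
    · filter_upwards [ha] with x hx using hx.mul_const _
  have h3 := h1.add h2
  rw [zero_add] at h3
  refine h3.congr fun k => ?_
  rw [← integral_add (i1 k) (i2 k)]
  congr 1 with x
  simp only [Pi.sub_apply]
  ring

/-- The product rule after composition with a bounded Lipschitz function. -/
theorem HasWeakDeriv.integral_comp_mul_comp (hU : IsOpen U) (hf : HasWeakDeriv U f F v)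
    (hg : HasWeakDeriv U g G v) {Φ : ℝ → ℝ} (hΦ : ContDiff ℝ 1 Φ) {B : ℝ}
    (hB : ∀ s, ‖Φ s‖ ≤ B) (hΦ' : ∀ s, ‖deriv Φ s‖ ≤ 1) {ψ : E → ℝ} (hψ : ContDiff ℝ ∞ ψ)
    (hc : HasCompactSupport ψ) (hs : tsupport ψ ⊆ U) :
    ∫ y, Φ (f y) * Φ (g y) * fderiv ℝ ψ y v =
      -∫ y, (deriv Φ (f y) * F y * Φ (g y) + Φ (f y) * (deriv Φ (g y) * G y)) * ψ y := by
  -- Multiplying by a cutoff equal to 1 near the support of `ψ` makes both functions weakly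
  -- differentiable on the whole space, where mollification is available; nothing changes on the
  -- support of `ψ`.
  obtain ⟨η, hη, hηc, hηs, hη1, -⟩ := exists_smooth_cutoff hc hU hs
  obtain ⟨wf, if1, if2⟩ := hf.smul_cutoff hη hηc hηs
  obtain ⟨wg, ig1, ig2⟩ := hg.smul_cutoff hη hηc hηs
  set f' := fun y => f y * η y with hf'
  set g' := fun y => g y * η y with hg'
  set F' := fun y => F y * η y + f y * fderiv ℝ η y v with hF'
  set G' := fun y => G y * η y + g y * fderiv ℝ η y v with hG'
  have hdΦ : Continuous (deriv Φ) := hΦ.continuous_deriv le_rfl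
  have hB0 : 0 ≤ B := (norm_nonneg _).trans (hB 0)
  have hon : ∀ y ∈ tsupport ψ, f' y = f y ∧ g' y = g y ∧ F' y = F y ∧ G' y = G y := by
    intro y hy
    have h1 : η y = 1 := (hη1 y hy).eq_of_nhds
    have h2 : fderiv ℝ η y = 0 := by rw [(hη1 y hy).fderiv_eq]; simp
    simp [hf', hg', hF', hG', h1, h2]
  obtain ⟨Cψ, hCψ⟩ := hψ.continuous.bounded_above_of_compact_support hc
  have hdψ := continuous_fderiv_apply_of_contDiff hψ v
  have mf : ∀ k, ContDiff ℝ 1 (mollify k f') := fun k =>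
    (contDiff_mollify k if1.locallyIntegrable).of_le (by simp)
  have mg : ∀ k, ContDiff ℝ 1 (mollify k g') := fun k =>
    (contDiff_mollify k ig1.locallyIntegrable).of_le (by simp)
  have af := ae_tendsto_mollify if1.locallyIntegrable
  have ag := ae_tendsto_mollify ig1.locallyIntegrable
  have lF : Tendsto (fun k => eLpNorm (mollify k F' - F') 1 volume) atTop (𝓝 0) :=
    tendsto_eLpNorm_mollify le_rfl (by simp) (memLp_one_iff_integrable.2 if2)
  have lG : Tendsto (fun k => eLpNorm (mollify k G' - G') 1 volume) atTop (𝓝 0) :=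
    tendsto_eLpNorm_mollify le_rfl (by simp) (memLp_one_iff_integrable.2 ig2)
  have iF : ∀ k, Integrable (mollify k F') := fun k => by
    refine memLp_one_iff_integrable.1 ⟨(contDiff_mollify k
      if2.locallyIntegrable).continuous.aestronglyMeasurable, ?_⟩
    exact (eLpNorm_mollify_le k le_rfl (by simp) if2.aestronglyMeasurable).trans_lt
      (memLp_one_iff_integrable.2 if2).2
  have iG : ∀ k, Integrable (mollify k G') := fun k => by
    refine memLp_one_iff_integrable.1 ⟨(contDiff_mollify k
      ig2.locallyIntegrable).continuous.aestronglyMeasurable, ?_⟩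
    exact (eLpNorm_mollify_le k le_rfl (by simp) ig2.aestronglyMeasurable).trans_lt
      (memLp_one_iff_integrable.2 ig2).2
  have cΦf : ∀ k, Continuous fun y => Φ (mollify k f' y) := fun k =>
    hΦ.continuous.comp (mf k).continuous
  have cΦg : ∀ k, Continuous fun y => Φ (mollify k g' y) := fun k =>
    hΦ.continuous.comp (mg k).continuous
  have cdf : ∀ k, Continuous fun y => deriv Φ (mollify k f' y) := fun k =>
    hdΦ.comp (mf k).continuous
  have cdg : ∀ k, Continuous fun y => deriv Φ (mollify k g' y) := fun k =>
    hdΦ.comp (mg k).continuous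
  -- the three limits
  have t1 : Tendsto (fun k => ∫ y, Φ (mollify k f' y) * Φ (mollify k g' y) * fderiv ℝ ψ y v) atTop
      (𝓝 (∫ y, Φ (f' y) * Φ (g' y) * fderiv ℝ ψ y v)) := by
    refine tendsto_integral_mul_of_bounded (C := B * B)
      (fun k => ((cΦf k).mul (cΦg k)).aestronglyMeasurable) (fun k x => ?_) ?_
      (hdψ.integrable_of_hasCompactSupport (hasCompactSupport_fderiv_apply hc v))
      (fun k => (hdψ.integrable_of_hasCompactSupport (hasCompactSupport_fderiv_apply hc v)))
      (by simp)
    · rw [norm_mul]; gcongr <;> exact hB _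
    · filter_upwards [af, ag] with y h1 h2
      exact ((hΦ.continuous.tendsto _).comp h1).mul ((hΦ.continuous.tendsto _).comp h2)
  have t2 : Tendsto (fun k => ∫ y, (deriv Φ (mollify k f' y) * Φ (mollify k g' y) * ψ y)
      * mollify k F' y) atTop (𝓝 (∫ y, (deriv Φ (f' y) * Φ (g' y) * ψ y) * F' y)) := by
    refine tendsto_integral_mul_of_bounded (C := 1 * B * Cψ)
      (fun k => (((cdf k).mul (cΦg k)).mul hψ.continuous).aestronglyMeasurable) (fun k x => ?_) ?_
      if2 iF lF
    · rw [norm_mul, norm_mul]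
      gcongr
      exacts [hΦ' _, hB _, hCψ x]
    · filter_upwards [af, ag] with y h1 h2
      exact (((hdΦ.tendsto _).comp h1).mul ((hΦ.continuous.tendsto _).comp h2)).mul_const _
  have t3 : Tendsto (fun k => ∫ y, (Φ (mollify k f' y) * deriv Φ (mollify k g' y) * ψ y)
      * mollify k G' y) atTop (𝓝 (∫ y, (Φ (f' y) * deriv Φ (g' y) * ψ y) * G' y)) := by
    refine tendsto_integral_mul_of_bounded (C := B * 1 * Cψ)
      (fun k => (((cΦf k).mul (cdg k)).mul hψ.continuous).aestronglyMeasurable) (fun k x => ?_) ?_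
      ig2 iG lG
    · rw [norm_mul, norm_mul]
      gcongr
      exacts [hB _, hΦ' _, hCψ x]
    · filter_upwards [af, ag] with y h1 h2
      exact (((hΦ.continuous.tendsto _).comp h1).mul ((hdΦ.tendsto _).comp h2)).mul_const _
  have j2 : ∀ k, Integrable fun y => (deriv Φ (mollify k f' y) * Φ (mollify k g' y) * ψ y)
      * mollify k F' y := fun k => by
    refine (iF k).bdd_mul (c := 1 * B * Cψ)
      (((cdf k).mul (cΦg k)).mul hψ.continuous).aestronglyMeasurable
      (Eventually.of_forall fun x => ?_)
    rw [norm_mul, norm_mul]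
    gcongr
    exacts [hΦ' _, hB _, hCψ x]
  have j3 : ∀ k, Integrable fun y => (Φ (mollify k f' y) * deriv Φ (mollify k g' y) * ψ y)
      * mollify k G' y := fun k => by
    refine (iG k).bdd_mul (c := B * 1 * Cψ)
      (((cΦf k).mul (cdg k)).mul hψ.continuous).aestronglyMeasurable
      (Eventually.of_forall fun x => ?_)
    rw [norm_mul, norm_mul]
    gcongr
    exacts [hB _, hΦ' _, hCψ x]
  have j2' : Integrable fun y => (deriv Φ (f' y) * Φ (g' y) * ψ y) * F' y := by
    refine if2.bdd_mul (c := 1 * B * Cψ)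
      (((hdΦ.comp_aestronglyMeasurable if1.aestronglyMeasurable).mul
        (hΦ.continuous.comp_aestronglyMeasurable ig1.aestronglyMeasurable)).mul
          hψ.continuous.aestronglyMeasurable) (Eventually.of_forall fun x => ?_)
    rw [norm_mul, norm_mul]
    gcongr
    exacts [hΦ' _, hB _, hCψ x]
  have j3' : Integrable fun y => (Φ (f' y) * deriv Φ (g' y) * ψ y) * G' y := by
    refine ig2.bdd_mul (c := B * 1 * Cψ)
      (((hΦ.continuous.comp_aestronglyMeasurable if1.aestronglyMeasurable).mul
        (hdΦ.comp_aestronglyMeasurable ig1.aestronglyMeasurable)).mul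
          hψ.continuous.aestronglyMeasurable) (Eventually.of_forall fun x => ?_)
    rw [norm_mul, norm_mul]
    gcongr
    exacts [hB _, hΦ' _, hCψ x]
  -- For the mollified functions this is the classical product and chain rule with integration by
  -- parts. The bound on `Φ` and on its derivative allows the passage to the limit, since the
  -- mollified derivatives converge in `L¹`.
  have hk : ∀ k, ∫ y, Φ (mollify k f' y) * Φ (mollify k g' y) * fderiv ℝ ψ y v
      = -((∫ y, (deriv Φ (mollify k f' y) * Φ (mollify k g' y) * ψ y) * mollify k F' y)
        + ∫ y, (Φ (mollify k f' y) * deriv Φ (mollify k g' y) * ψ y) * mollify k G' y) := by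
    intro k
    have hibp := integral_mul_fderiv_eq_neg ((hΦ.comp (mf k)).mul (hΦ.comp (mg k))) hψ hc v
    simp only [Function.comp_apply] at hibp
    rw [hibp, ← integral_add (j2 k) (j3 k)]
    congr 2 with y
    have hd1 := (hΦ.differentiable one_ne_zero (mollify k f' y)).hasDerivAt.comp_hasFDerivAt y
      ((mf k).differentiable one_ne_zero y).hasFDerivAt
    have hd2 := (hΦ.differentiable one_ne_zero (mollify k g' y)).hasDerivAt.comp_hasFDerivAt y
      ((mg k).differentiable one_ne_zero y).hasFDerivAt
    have hd := (hd1.mul hd2).fderiv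
    simp only [Function.comp_def] at hd ⊢
    rw [show (fun y => Φ (mollify k f' y) * Φ (mollify k g' y)) =
      (fun y => Φ (mollify k f' y)) * fun y => Φ (mollify k g' y) from rfl, hd]
    simp only [add_apply, smul_apply, smul_eq_mul,
      wf.fderiv_mollify, wg.fderiv_mollify]
    ring
  have hlim := tendsto_nhds_unique t1 (((t2.add t3).neg).congr fun k => (hk k).symm)
  have e1 : ∫ y, Φ (f y) * Φ (g y) * fderiv ℝ ψ y v
      = ∫ y, Φ (f' y) * Φ (g' y) * fderiv ℝ ψ y v := by
    congr 1 with y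
    by_cases hy : y ∈ tsupport ψ
    · rw [(hon y hy).1, (hon y hy).2.1]
    · rw [(integral_eq_setIntegral_of_test subset_rfl (fun y => Φ (f y) * Φ (g y)) v).1 y hy,
        (integral_eq_setIntegral_of_test subset_rfl (fun y => Φ (f' y) * Φ (g' y)) v).1 y hy]
  rw [e1, hlim, ← integral_add j2' j3']
  congr 2 with y
  by_cases hy : y ∈ tsupport ψ
  · rw [(hon y hy).1, (hon y hy).2.1, (hon y hy).2.2.1, (hon y hy).2.2.2]
    ring
  · rw [image_eq_zero_of_notMem_tsupport hy]
    ring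

/-- The product rule for weak derivatives. -/
theorem HasWeakDeriv.mul (hU : IsOpen U) (hf : HasWeakDeriv U f F v)
    (hg : HasWeakDeriv U g G v) (h1 : LocallyIntegrableOn (fun y => f y * g y) U volume)
    (h2 : LocallyIntegrableOn (fun y => F y * g y) U volume)
    (h3 : LocallyIntegrableOn (fun y => f y * G y) U volume) :
    HasWeakDeriv U (fun y => f y * g y) (fun y => F y * g y + f y * G y) v := by
  refine ⟨h1, h2.add h3, fun ψ hψ hc hs => ?_⟩
  have hpos : ∀ j : ℕ, (0 : ℝ) < (j : ℝ) + 1 := fun j => by positivity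
  -- The truncations at height `j + 1` satisfy `|Φ s| ≤ |s|` and `|Φ'| ≤ 1`, so the three locally
  -- integrable products `f g`, `F g` and `f G` dominate all integrands as `j → ∞`.
  have key := fun j : ℕ => hf.integral_comp_mul_comp hU hg (contDiff_softTrunc ((j : ℝ) + 1))
    (norm_softTrunc_le (hpos j)) (norm_deriv_softTrunc_le (hpos j)) hψ hc hs
  have I1 := integrable_mul_fderiv h1 hψ hc hs v
  have I2 := integrable_mul_of_tsupport_subset h2 hψ.continuous hc hs
  have I3 := integrable_mul_of_tsupport_subset h3 hψ.continuous hc hs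
  -- measurability on the support of the test function
  have hmK : ∀ {a : E → ℝ}, LocallyIntegrableOn a U volume →
      AEStronglyMeasurable a (volume.restrict (tsupport ψ)) := fun ha =>
    (ha.integrableOn_compact_subset hs hc).aestronglyMeasurable
  have hind : ∀ (a b : E → ℝ), (∀ y ∉ tsupport ψ, b y = 0) → Continuous b →
      AEStronglyMeasurable a (volume.restrict (tsupport ψ)) →
      AEStronglyMeasurable (fun y => a y * b y) volume := by
    intro a b hb hbc ha
    have : (fun y => a y * b y) = (tsupport ψ).indicator (fun y => a y * b y) := by
      ext y
      by_cases hy : y ∈ tsupport ψ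
      · simp [hy]
      · simp [hy, hb y hy]
    rw [this]
    exact (aestronglyMeasurable_indicator_iff (isClosed_tsupport ψ).measurableSet).2
      (ha.mul hbc.aestronglyMeasurable)
  have hz0 : ∀ y ∉ tsupport ψ, ψ y = 0 := fun y hy => image_eq_zero_of_notMem_tsupport hy
  have hz1 : ∀ y ∉ tsupport ψ, fderiv ℝ ψ y v = 0 := fun y hy => by
    simpa using (integral_eq_setIntegral_of_test subset_rfl (fun _ => 1) v).1 y hy
  have cT : ∀ j : ℕ, Continuous (softTrunc ((j : ℝ) + 1)) := fun j =>
    (contDiff_softTrunc _).continuous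
  have cT' : ∀ j : ℕ, Continuous (deriv (softTrunc ((j : ℝ) + 1))) := fun j =>
    (contDiff_softTrunc _).continuous_deriv le_rfl
  have mf := hmK hf.left
  have mg := hmK hg.left
  have mF := hmK hf.right
  have mG := hmK hg.right
  have T1 : Tendsto (fun j : ℕ => ∫ y, softTrunc ((j : ℝ) + 1) (f y) *
      softTrunc ((j : ℝ) + 1) (g y) * fderiv ℝ ψ y v) atTop
      (𝓝 (∫ y, f y * g y * fderiv ℝ ψ y v)) := by
    refine tendsto_integral_of_dominated_convergence (fun y => ‖f y * g y * fderiv ℝ ψ y v‖)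
      (fun j => hind _ _ hz1 (continuous_fderiv_apply_of_contDiff hψ v)
        (((cT j).comp_aestronglyMeasurable mf).mul ((cT j).comp_aestronglyMeasurable mg)))
      I1.norm (fun j => Eventually.of_forall fun y => ?_) (Eventually.of_forall fun y => ?_)
    · simp only [norm_mul]
      gcongr <;> exact norm_softTrunc_le_norm (hpos j) _
    · exact ((tendsto_softTrunc _).mul (tendsto_softTrunc _)).mul_const _
  have T2 : Tendsto (fun j : ℕ => ∫ y, (deriv (softTrunc ((j : ℝ) + 1)) (f y) * F y *
      softTrunc ((j : ℝ) + 1) (g y) + softTrunc ((j : ℝ) + 1) (f y) *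
        (deriv (softTrunc ((j : ℝ) + 1)) (g y) * G y)) * ψ y) atTop
      (𝓝 (∫ y, (F y * g y + f y * G y) * ψ y)) := by
    refine tendsto_integral_of_dominated_convergence
      (fun y => ‖F y * g y * ψ y‖ + ‖f y * G y * ψ y‖)
      (fun j => hind _ _ hz0 hψ.continuous
        (((((cT' j).comp_aestronglyMeasurable mf).mul mF).mul
          ((cT j).comp_aestronglyMeasurable mg)).add
          (((cT j).comp_aestronglyMeasurable mf).mul
            (((cT' j).comp_aestronglyMeasurable mg).mul mG))))
      (I2.norm.add I3.norm) (fun j => Eventually.of_forall fun y => ?_)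
      (Eventually.of_forall fun y => ?_)
    · rw [add_mul]
      refine (norm_add_le _ _).trans (add_le_add ?_ ?_)
      · simp only [norm_mul]
        gcongr
        · exact mul_le_of_le_one_left (norm_nonneg _) (norm_deriv_softTrunc_le (hpos j) _)
        · exact norm_softTrunc_le_norm (hpos j) _
      · simp only [norm_mul]
        gcongr
        · exact norm_softTrunc_le_norm (hpos j) _
        · exact mul_le_of_le_one_left (norm_nonneg _) (norm_deriv_softTrunc_le (hpos j) _)
    · have := ((((tendsto_deriv_softTrunc (f y)).mul_const (F y)).mul (tendsto_softTrunc (g y))).add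
        ((tendsto_softTrunc (f y)).mul
          ((tendsto_deriv_softTrunc (g y)).mul_const (G y)))).mul_const (ψ y)
      simpa using this
  exact tendsto_nhds_unique T1 (T2.neg.congr fun j => (key j).symm)

/-- A locally Lipschitz function is weakly differentiable. -/
theorem hasWeakDeriv_of_locallyLipschitzOn (hU : IsOpen U) (hu : LocallyLipschitzOn U u) (v : E) :
    HasWeakDeriv U u (fun y => fderiv ℝ u y v) v ∧
      ∀ᵐ y ∂(volume.restrict U), DifferentiableAt ℝ u y := by
  -- Near a compact subset of `U` the function agrees with a globally Lipschitz one, by extension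
  -- from a compact neighbourhood. Rademacher's theorem and integration by parts for Lipschitz
  -- functions then apply.
  have hcpt : ∀ K ⊆ U, IsCompact K → ∃ (C : ℝ≥0) (g : E → ℝ), LipschitzWith C g ∧
      ∀ y ∈ K, u =ᶠ[𝓝 y] g := by
    intro K hKU hK
    obtain ⟨K', hK', hKK', hK'U⟩ := exists_compact_between hK hU hKU
    obtain ⟨C, hC⟩ := (hu.mono hK'U).exists_lipschitzOnWith_of_compact hK'
    obtain ⟨g, hg, hgu⟩ := hC.extend_real
    refine ⟨C, g, hg, fun y hy => ?_⟩
    filter_upwards [isOpen_interior.mem_nhds (hKK' hy)] with z hz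
    exact hgu (interior_subset hz)
  refine ⟨⟨hu.continuousOn.locallyIntegrableOn hU.measurableSet, ?_, ?_⟩, ?_⟩
  · rw [locallyIntegrableOn_iff hU.isLocallyClosed]
    intro K hKU hK
    obtain ⟨C, g, hg, hgu⟩ := hcpt K hKU hK
    refine Measure.integrableOn_of_bounded (M := C * ‖v‖) hK.measure_lt_top.ne
      (measurable_fderiv_apply_const ℝ u v).aestronglyMeasurable ?_
    refine (ae_restrict_iff' hK.measurableSet).2 (Eventually.of_forall fun y hy => ?_)
    rw [(hgu y hy).fderiv_eq]
    exact (ContinuousLinearMap.le_opNorm _ _).trans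
      (mul_le_mul_of_nonneg_right (norm_fderiv_le_of_lipschitz ℝ hg) (norm_nonneg _))
  · intro ψ hψ hc hs
    obtain ⟨C, g, hg, hgu⟩ := hcpt _ hs hc
    obtain ⟨D, hD⟩ := ContDiff.lipschitzWith_of_hasCompactSupport hc hψ (by simp)
    have key := hg.integral_lineDeriv_mul_eq (μ := (volume : Measure E)) hD hc v
    have e1 : ∫ y, u y * fderiv ℝ ψ y v = -∫ y, lineDeriv ℝ ψ y (-v) * g y := by
      rw [← integral_neg]
      congr 1 with y
      rw [((hψ.differentiable (by simp)) y).lineDeriv_eq_fderiv, map_neg]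
      by_cases hy : y ∈ tsupport ψ
      · rw [(hgu y hy).eq_of_nhds]; ring
      · have := (integral_eq_setIntegral_of_test subset_rfl (fun _ => (1 : ℝ)) v).1 y hy
        rw [one_mul] at this
        simp [this]
    rw [e1, ← key]
    congr 1
    refine integral_congr_ae ?_
    filter_upwards [hg.ae_differentiableAt (μ := (volume : Measure E))] with y hy
    rw [hy.lineDeriv_eq_fderiv]
    by_cases hyψ : y ∈ tsupport ψ
    · rw [(hgu y hyψ).fderiv_eq]
    · simp [image_eq_zero_of_notMem_tsupport hyψ]
  · rw [ae_restrict_iff' hU.measurableSet, ae_iff]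
    refine measure_null_of_locally_null _ fun x hx => ?_
    have hx' : x ∈ U := by
      by_contra h
      exact hx fun h' => absurd h' h
    obtain ⟨K, hK, hxK, hKU⟩ := exists_compact_subset hU hx'
    obtain ⟨C, g, hg, hgu⟩ := hcpt K hKU hK
    have h0 := hg.ae_differentiableAt (μ := (volume : Measure E))
    rw [ae_iff] at h0
    refine ⟨{y | ¬(y ∈ U → DifferentiableAt ℝ u y)} ∩ interior K,
      inter_mem self_mem_nhdsWithin (mem_nhdsWithin_of_mem_nhds (isOpen_interior.mem_nhds hxK)), ?_⟩
    refine measure_mono_null (fun y hy => ?_) h0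
    obtain ⟨hy1, hy2⟩ := hy
    intro hd
    exact hy1 fun _ => (hgu y (interior_subset hy2)).differentiableAt_iff.2 hd

end Product


/-! ### Coordinate vector fields and changes of charts. -/

section ChartGeometry

variable {n : ℕ} {M : Type*} [MetricSpace M] [ChartedSpace (EuclideanSpace ℝ (Fin n)) M]
  [IsManifold (𝓡 n) ∞ M]

local notation "𝔼" => EuclideanSpace ℝ (Fin n)

theorem mdifferentiableAt_chart_symm (x : M) {y : 𝔼} (hy : y ∈ (chartAt 𝔼 x).target) :
    MDifferentiableAt 𝓘(ℝ, 𝔼) (𝓡 n) (chartAt 𝔼 x).symm y :=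
  (mdifferentiable_chart (I := 𝓡 n) x).mdifferentiableAt_symm hy

theorem mdifferentiableAt_chart (x : M) {z : M} (hz : z ∈ (chartAt 𝔼 x).source) :
    MDifferentiableAt (𝓡 n) 𝓘(ℝ, 𝔼) (chartAt 𝔼 x) z :=
  (mdifferentiable_chart (I := 𝓡 n) x).mdifferentiableAt hz

/-- The differential of the inverse chart as a linear equivalence. -/
noncomputable def chartEquiv (x : M) {y : 𝔼} (hy : y ∈ (chartAt 𝔼 x).target) :
    𝔼 ≃L[ℝ] TangentSpace (𝓡 n) ((chartAt 𝔼 x).symm y) :=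
  ((mdifferentiable_chart (I := 𝓡 n) x).symm).mfderiv hy

theorem chartEquiv_apply (x : M) {y : 𝔼} (hy : y ∈ (chartAt 𝔼 x).target) (v : 𝔼) :
    chartEquiv x hy v = chartVector x y v := rfl

theorem chartVector_smul (x : M) (y v : 𝔼) (c : ℝ) :
    chartVector x y (c • v) = c • chartVector x y v :=
  map_smul (mfderiv 𝓘(ℝ, 𝔼) (𝓡 n) (chartAt 𝔼 x).symm y) c v

theorem chartVector_eq_sum (x : M) (y v : 𝔼) :
    chartVector x y v = ∑ i, v i • chartVector x y (EuclideanSpace.single i 1) := by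
  have : v = ∑ i, v i • (EuclideanSpace.single i (1 : ℝ) : 𝔼) := by
    have := (EuclideanSpace.basisFun (Fin n) ℝ).sum_repr v
    simpa using this.symm
  conv_lhs => rw [this]
  have h := map_sum (mfderiv 𝓘(ℝ, 𝔼) (𝓡 n) (chartAt 𝔼 x).symm y)
    (fun i => v i • (EuclideanSpace.single i (1 : ℝ) : 𝔼)) Finset.univ
  refine h.trans (Finset.sum_congr rfl fun i _ => ?_)
  exact chartVector_smul x y _ _

/-- The transition map between two charts. -/
theorem chartVector_transition (x x' : M) {y : 𝔼} (hy : y ∈ (chartAt 𝔼 x').target)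
    (hy' : (chartAt 𝔼 x').symm y ∈ (chartAt 𝔼 x).source) :
    ∃ A : 𝔼 →L[ℝ] 𝔼, HasFDerivAt (fun z => chartAt 𝔼 x ((chartAt 𝔼 x').symm z)) A y ∧
      ∀ v w : 𝔼, ∀ B : (z : M) → TangentSpace (𝓡 n) z → TangentSpace (𝓡 n) z → ℝ,
        B _ (chartVector x' y v) (chartVector x' y w) =
        B _ (chartVector x (chartAt 𝔼 x ((chartAt 𝔼 x').symm y)) (A v))
          (chartVector x (chartAt 𝔼 x ((chartAt 𝔼 x').symm y)) (A w)) := by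
  set z := (chartAt 𝔼 x').symm y with hz
  have d1 := mdifferentiableAt_chart_symm x' hy
  have d2 := mdifferentiableAt_chart x hy'
  have d3 := d2.comp y d1
  have d3' : DifferentiableAt ℝ (fun z => chartAt 𝔼 x ((chartAt 𝔼 x').symm z)) y :=
    d3.differentiableAt
  refine ⟨_, d3'.hasFDerivAt, fun v w B => ?_⟩
  have hch : ∀ v : 𝔼, fderiv ℝ (fun z => chartAt 𝔼 x ((chartAt 𝔼 x').symm z)) y v
      = mfderiv (𝓡 n) 𝓘(ℝ, 𝔼) (chartAt 𝔼 x) z (chartVector x' y v) := by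
    intro v
    have h : mfderiv 𝓘(ℝ, 𝔼) 𝓘(ℝ, 𝔼) (chartAt 𝔼 x ∘ (chartAt 𝔼 x').symm) y =
      (mfderiv (𝓡 n) 𝓘(ℝ, 𝔼) (chartAt 𝔼 x) z).comp
        (mfderiv 𝓘(ℝ, 𝔼) (𝓡 n) (chartAt 𝔼 x').symm y) := mfderiv_comp y d2 d1
    have h2 : mfderiv 𝓘(ℝ, 𝔼) 𝓘(ℝ, 𝔼) (chartAt 𝔼 x ∘ (chartAt 𝔼 x').symm) y
      = fderiv ℝ (chartAt 𝔼 x ∘ (chartAt 𝔼 x').symm) y := mfderiv_eq_fderiv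
    rw [h2] at h
    exact congrArg (fun T => T v) h
  -- Going to the other chart and back fixes `u`, but its image lives over a base point equal to `z`
  -- only through `left_inv`. Hence the heterogeneous equality, and the form `B` given at all points
  -- at once, so that the base point can be rewritten.
  have hinv : ∀ u : TangentSpace (𝓡 n) z, HEq (chartVector x (chartAt 𝔼 x z)
      (mfderiv (𝓡 n) 𝓘(ℝ, 𝔼) (chartAt 𝔼 x) z u)) u := by
    intro u
    have h := (mdifferentiable_chart (I := 𝓡 n) x).symm_comp_deriv hy'
    exact heq_of_eq (congrArg (fun T => T u) h)
  have hzz : (chartAt 𝔼 x).symm (chartAt 𝔼 x z) = z := (chartAt 𝔼 x).left_inv hy'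
  rw [hch v, hch w]
  have h1 := hinv (chartVector x' y v)
  have h2 := hinv (chartVector x' y w)
  revert h1 h2
  generalize chartVector x (chartAt 𝔼 x z) (mfderiv (𝓡 n) 𝓘(ℝ, 𝔼) (chartAt 𝔼 x) z
    (chartVector x' y v)) = a
  generalize chartVector x (chartAt 𝔼 x z) (mfderiv (𝓡 n) 𝓘(ℝ, 𝔼) (chartAt 𝔼 x) z
    (chartVector x' y w)) = b
  revert a b
  rw [hzz]
  intro a b h1 h2
  rw [eq_of_heq h1, eq_of_heq h2]

variable [RiemannianBundle (fun x : M => TangentSpace (𝓡 n) x)]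
  [IsContMDiffRiemannianBundle (𝓡 n) ∞ (EuclideanSpace ℝ (Fin n))
      (fun x : M => TangentSpace (𝓡 n) x)]

theorem isContinuousRiemannianBundle_tangent :
    IsContinuousRiemannianBundle 𝔼 (fun x : M => TangentSpace (𝓡 n) x) := by
  obtain ⟨g, hg, hg'⟩ := ‹IsContMDiffRiemannianBundle (𝓡 n) ∞ 𝔼
    (fun x : M => TangentSpace (𝓡 n) x)›.exists_contMDiff
  exact ⟨g, hg.continuous, hg'⟩

/-- The section is the tangent map of the inverse chart composed with the constant section `y ↦ (y,
v)`. -/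
theorem continuousOn_chartVector_section (x : M) (v : 𝔼) :
    ContinuousOn (fun y => (⟨(chartAt 𝔼 x).symm y, chartVector x y v⟩ :
        TotalSpace 𝔼 (fun z : M => TangentSpace (𝓡 n) z))) (chartAt 𝔼 x).target := by
  have h1 : ContMDiffOn 𝓘(ℝ, 𝔼) (𝓡 n) 1 (chartAt 𝔼 x).symm (chartAt 𝔼 x).target :=
    contMDiffOn_chart_symm
  have h2 := h1.continuousOn_tangentMapWithin le_rfl
    (chartAt 𝔼 x).open_target.uniqueMDiffOn
  have h3 : Continuous fun y : 𝔼 => (tangentBundleModelSpaceHomeomorph 𝓘(ℝ, 𝔼)).symm (y, v) :=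
    (tangentBundleModelSpaceHomeomorph 𝓘(ℝ, 𝔼)).symm.continuous.comp
      (continuous_id.prodMk continuous_const)
  have h4 := h2.comp (h3.continuousOn (s := (chartAt 𝔼 x).target)) (fun y hy => by
    exact hy)
  refine h4.congr fun y hy => ?_
  have e : mfderivWithin 𝓘(ℝ, 𝔼) (𝓡 n) (chartAt 𝔼 x).symm (chartAt 𝔼 x).target y
      = mfderiv 𝓘(ℝ, 𝔼) (𝓡 n) (chartAt 𝔼 x).symm y :=
    mfderivWithin_of_isOpen (chartAt 𝔼 x).open_target hy
  change (⟨(chartAt 𝔼 x).symm y, chartVector x y v⟩ : TangentBundle (𝓡 n) M) =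
    ⟨(chartAt 𝔼 x).symm y, mfderivWithin 𝓘(ℝ, 𝔼) (𝓡 n) (chartAt 𝔼 x).symm (chartAt 𝔼 x).target y v⟩
  rw [e]
  rfl

theorem continuousOn_inner_chartVector (x : M) (v w : 𝔼) :
    ContinuousOn (fun y => inner ℝ (chartVector x y v) (chartVector x y w))
      (chartAt 𝔼 x).target := by
  have := isContinuousRiemannianBundle_tangent (n := n) (M := M)
  exact ContinuousOn.inner_bundle (F := 𝔼) (E := fun x : M => TangentSpace (𝓡 n) x)
    (continuousOn_chartVector_section x v) (continuousOn_chartVector_section x w)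

end ChartGeometry


/-! ### The Riemannian measure is `√(det g) dy` in every chart. -/

theorem measurableSet_inter_preimage_of_continuousOn {α β : Type*} [TopologicalSpace α]
    [MeasurableSpace α] [BorelSpace α] [TopologicalSpace β] [MeasurableSpace β] [BorelSpace β]
    {f : α → β} {s : Set α} (hs : MeasurableSet s) (hf : ContinuousOn f s) {t : Set β}
    (ht : MeasurableSet t) : MeasurableSet (s ∩ f ⁻¹' t) := by
  have h1 : Measurable (s.domRestrict f) :=
    (continuousOn_iff_continuous_domRestrict.1 hf).measurable
  have h2 := hs.subtype_image (h1 ht)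
  convert h2 using 1
  ext y
  simp [Set.domRestrict_apply, and_comm]

section RiemannianMeasure

variable {n : ℕ} {M : Type*} [MetricSpace M] [SecondCountableTopology M] [MeasurableSpace M]
  [BorelSpace M] [ChartedSpace (EuclideanSpace ℝ (Fin n)) M]
  [IsManifold (𝓡 n) ∞ M]
  [RiemannianBundle (fun x : M => TangentSpace (𝓡 n) x)]
  [IsContMDiffRiemannianBundle (𝓡 n) ∞ (EuclideanSpace ℝ (Fin n))
      (fun x : M => TangentSpace (𝓡 n) x)]

local notation "𝔼" => EuclideanSpace ℝ (Fin n)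

theorem continuousOn_det_gramMatrix (x : M) :
    ContinuousOn (fun y => (gramMatrix (n := n) x y).det) (chartAt 𝔼 x).target := by
  simp only [Matrix.det_apply]
  refine continuousOn_finsetSum _ fun σ _ => ContinuousOn.const_smul ?_ _
  exact continuousOn_finsetProd _ fun i _ => continuousOn_inner_chartVector x _ _

theorem det_gramMatrix_pos (x : M) {y : 𝔼} (hy : y ∈ (chartAt 𝔼 x).target) :
    0 < (gramMatrix (n := n) x y).det := by
  have hli : LinearIndependent ℝ fun i : Fin n =>
      chartVector x y (EuclideanSpace.single i (1 : ℝ)) := by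
    have h1 : LinearIndependent ℝ fun i : Fin n => (EuclideanSpace.single i (1 : ℝ) : 𝔼) := by
      have h := (EuclideanSpace.basisFun (Fin n) ℝ).orthonormal.linearIndependent
      have e : (fun i : Fin n => (EuclideanSpace.single i (1 : ℝ) : 𝔼)) =
          EuclideanSpace.basisFun (Fin n) ℝ := by ext1 i; simp
      rw [e]
      exact h
    exact h1.map' (chartEquiv x hy).toLinearEquiv.toLinearMap
      (LinearEquiv.ker _)
  exact (Matrix.posDef_gram_of_linearIndependent hli).det_pos

/-- The density of the Riemannian measure in a chart. -/
noncomputable def chartDensity (x : M) (y : 𝔼) : ℝ≥0∞ :=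
  ENNReal.ofReal (Real.sqrt (gramMatrix x y).det)

theorem continuousOn_chartDensity (x : M) :
    ContinuousOn (chartDensity (n := n) x) (chartAt 𝔼 x).target :=
  ENNReal.continuous_ofReal.comp_continuousOn (continuousOn_det_gramMatrix x).sqrt

theorem chartDensity_pos (x : M) {y : 𝔼} (hy : y ∈ (chartAt 𝔼 x).target) :
    0 < chartDensity (n := n) x y :=
  ENNReal.ofReal_pos.2 (Real.sqrt_pos.2 (det_gramMatrix_pos x hy))

theorem aemeasurable_chartDensity (x : M) :
    AEMeasurable (chartDensity (n := n) x) (volume.restrict (chartAt 𝔼 x).target) :=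
  (continuousOn_chartDensity x).aemeasurable (chartAt 𝔼 x).open_target.measurableSet

/-- The Gram matrices are related by `G' = Nᵀ G N` with `N` the Jacobian matrix of the transition
map, so the square roots of the determinants differ by its absolute determinant. -/
theorem chartDensity_transition (x x' : M) {y : 𝔼} (hy : y ∈ (chartAt 𝔼 x').target)
    (hy' : (chartAt 𝔼 x').symm y ∈ (chartAt 𝔼 x).source) :
    ∃ A : 𝔼 →L[ℝ] 𝔼, HasFDerivAt (fun z => chartAt 𝔼 x ((chartAt 𝔼 x').symm z)) A y ∧
      chartDensity (n := n) x' y = ENNReal.ofReal |A.det| *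
        chartDensity (n := n) x (chartAt 𝔼 x ((chartAt 𝔼 x').symm y)) := by
  obtain ⟨A, hA, hB⟩ := chartVector_transition x x' hy hy'
  refine ⟨A, hA, ?_⟩
  set y' := chartAt 𝔼 x ((chartAt 𝔼 x').symm y) with hy'def
  let N : Matrix (Fin n) (Fin n) ℝ :=
    LinearMap.toMatrix (EuclideanSpace.basisFun (Fin n) ℝ).toBasis
      (EuclideanSpace.basisFun (Fin n) ℝ).toBasis A.toLinearMap
  have hN : ∀ k i, N k i = A (EuclideanSpace.single i 1) k := by
    intro k i
    simp [N, LinearMap.toMatrix_apply]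
  have hdet : N.det = A.det := LinearMap.det_toMatrix _ _
  have hG : gramMatrix (n := n) x' y = N.transpose * gramMatrix (n := n) x y' * N := by
    refine Matrix.ext fun i j => ?_
    have h1 := hB (EuclideanSpace.single i 1) (EuclideanSpace.single j 1)
      (fun z a b => inner ℝ a b)
    have h2 : gramMatrix (n := n) x' y i j = _ := h1
    rw [h2, chartVector_eq_sum x y' (A _),
      chartVector_eq_sum x y' (A (EuclideanSpace.single j 1)), sum_inner, Matrix.mul_assoc,
      Matrix.mul_apply]
    refine Finset.sum_congr rfl fun k _ => ?_
    rw [inner_sum, Matrix.transpose_apply, hN, Matrix.mul_apply, Finset.mul_sum]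
    refine Finset.sum_congr rfl fun l _ => ?_
    rw [real_inner_smul_left, real_inner_smul_right, hN, gramMatrix, Matrix.of_apply]
    ring
  rw [chartDensity, chartDensity, hG, Matrix.det_mul, Matrix.det_mul, Matrix.det_transpose, hdet,
    ← ENNReal.ofReal_mul (abs_nonneg _)]
  congr 1
  rw [show A.det * (gramMatrix x y').det * A.det = A.det ^ 2 * (gramMatrix x y').det by ring,
    Real.sqrt_mul (sq_nonneg _), Real.sqrt_sq_eq_abs]

/-- The measure of the chart around `x`, as a measure on the target of the chart. -/
noncomputable def chartMeasure (x : M) : Measure 𝔼 :=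
  (volume.restrict (chartAt 𝔼 x).target).withDensity (chartDensity x)

theorem chartMeasure_ac (x : M) :
    chartMeasure (n := n) x ≪ volume.restrict (chartAt 𝔼 x).target :=
  withDensity_absolutelyContinuous _ _

theorem ac_chartMeasure (x : M) :
    volume.restrict (chartAt 𝔼 x).target ≪ chartMeasure (n := n) x := by
  refine withDensity_absolutelyContinuous' (aemeasurable_chartDensity x) ?_
  refine (ae_restrict_iff' (chartAt 𝔼 x).open_target.measurableSet).2
    (Eventually.of_forall fun y hy => (chartDensity_pos x hy).ne')

theorem aemeasurable_chart_symm (x : M) :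
    AEMeasurable (chartAt 𝔼 x).symm (chartMeasure (n := n) x) :=
  ((chartAt 𝔼 x).continuousOn_symm.aemeasurable
    (chartAt 𝔼 x).open_target.measurableSet).mono_ac (chartMeasure_ac x)

theorem chartVolume_eq_map (x : M) :
    chartVolume (n := n) x = (chartMeasure x).map (chartAt 𝔼 x).symm := rfl

theorem chartVolume_apply (x : M) {s : Set M} (hs : MeasurableSet s) :
    chartVolume (n := n) x s =
      ∫⁻ y in (chartAt 𝔼 x).target ∩ (chartAt 𝔼 x).symm ⁻¹' s, chartDensity x y := by
  rw [chartVolume_eq_map, Measure.map_apply_of_aemeasurable (aemeasurable_chart_symm x) hs]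
  have hm := measurableSet_inter_preimage_of_continuousOn
    (chartAt 𝔼 x).open_target.measurableSet (chartAt 𝔼 x).continuousOn_symm hs
  have h1 : chartMeasure (n := n) x ((chartAt 𝔼 x).symm ⁻¹' s)
      = chartMeasure (n := n) x ((chartAt 𝔼 x).target ∩ (chartAt 𝔼 x).symm ⁻¹' s) := by
    refine (Measure.measure_inter_eq_of_ae ?_).symm
    exact (chartMeasure_ac x).ae_le (ae_restrict_mem (chartAt 𝔼 x).open_target.measurableSet)
  rw [h1, chartMeasure, withDensity_apply _ hm, Measure.restrict_restrict hm,
    inter_assoc, inter_comm _ (chartAt 𝔼 x).target, ← inter_assoc, inter_self, inter_comm]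

/-- Change of variables under the transition map: its Jacobian factor is the one in
`chartDensity_transition`. -/
theorem chartVolume_eq_of_subset (x x' : M) {s : Set M} (hs : MeasurableSet s)
    (hx : s ⊆ (chartAt 𝔼 x).source) (hx' : s ⊆ (chartAt 𝔼 x').source) :
    chartVolume (n := n) x s = chartVolume (n := n) x' s := by
  rw [chartVolume_apply x hs, chartVolume_apply x' hs]
  set S := (chartAt 𝔼 x).target ∩ (chartAt 𝔼 x).symm ⁻¹' s
  set S' := (chartAt 𝔼 x').target ∩ (chartAt 𝔼 x').symm ⁻¹' s with hS'def
  set τ : 𝔼 → 𝔼 := fun z => chartAt 𝔼 x ((chartAt 𝔼 x').symm z) with hτ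
  have hS' : MeasurableSet S' := measurableSet_inter_preimage_of_continuousOn
    (chartAt 𝔼 x').open_target.measurableSet (chartAt 𝔼 x').continuousOn_symm hs
  choose! A hA hdens using fun (y : 𝔼) (hy : y ∈ S') =>
    chartDensity_transition x x' hy.1 (hx hy.2)
  have himg : S = τ '' S' := by
    ext y
    constructor
    · rintro ⟨h1, h2⟩
      refine ⟨chartAt 𝔼 x' ((chartAt 𝔼 x).symm y), ⟨(chartAt 𝔼 x').map_source (hx' h2), ?_⟩, ?_⟩
      · rw [mem_preimage, (chartAt 𝔼 x').left_inv (hx' h2)]; exact h2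
      · simp only [hτ]
        rw [(chartAt 𝔼 x').left_inv (hx' h2), (chartAt 𝔼 x).right_inv h1]
    · rintro ⟨z, ⟨h1, h2⟩, rfl⟩
      refine ⟨(chartAt 𝔼 x).map_source (hx h2), ?_⟩
      simp only [hτ]
      rw [mem_preimage, (chartAt 𝔼 x).left_inv (hx h2)]; exact h2
  have hinj : InjOn τ S' := by
    intro a ha b hb hab
    exact (chartAt 𝔼 x').symm.injOn ha.1 hb.1
      ((chartAt 𝔼 x).injOn (hx ha.2) (hx hb.2) hab)
  rw [himg, lintegral_image_eq_lintegral_abs_det_fderiv_mul volume hS'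
    (fun y hy => (hA y hy).hasFDerivWithinAt) hinj]
  exact (setLIntegral_congr_fun hS' fun y hy => hdens y hy).symm

theorem chartVolume_source_compl (x : M) :
    chartVolume (n := n) x ((chartAt 𝔼 x).source)ᶜ = 0 := by
  rw [chartVolume_apply x (chartAt 𝔼 x).open_source.measurableSet.compl]
  have : (chartAt 𝔼 x).target ∩ (chartAt 𝔼 x).symm ⁻¹' ((chartAt 𝔼 x).source)ᶜ = ∅ := by
    ext y
    simp only [mem_inter_iff, mem_preimage, mem_compl_iff, mem_empty_iff_false, iff_false, not_and,
      not_not]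
    exact fun hy => (chartAt 𝔼 x).map_target hy
  rw [this]
  simp

/-- On the domain of a chart the Riemannian measure is `√(det g) dy`. -/
theorem riemannianVolume_restrict_source (x : M) :
    (riemannianVolume n M).restrict (chartAt 𝔼 x).source = chartVolume (n := n) x := by
  set S := (chartAt 𝔼 x).source
  have hS : MeasurableSet S := (chartAt 𝔼 x).open_source.measurableSet
  have hself : (chartVolume (n := n) x).restrict S = chartVolume (n := n) x := by
    refine Measure.restrict_eq_self_of_ae_mem ?_
    rw [ae_iff]
    exact chartVolume_source_compl x
  refine le_antisymm ?_ ?_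
  -- Each chart measure is dominated by that of `x` plus infinite mass off the chart at `x`. The
  -- bound passes to the supremum, and restriction to the chart removes the infinite part.
  · have hle : riemannianVolume n M ≤ chartVolume (n := n) x + (⊤ : Measure M).restrict Sᶜ := by
      refine iSup_le fun x' => ?_
      refine Measure.le_iff.2 fun s hs => ?_
      rw [Measure.add_apply, Measure.restrict_apply hs]
      rw [← measure_inter_add_sdiff s hS]
      set S' := (chartAt 𝔼 x').source
      have hS' : MeasurableSet S' := (chartAt 𝔼 x').open_source.measurableSet
      refine add_le_add ?_ ?_
      · have h0 : chartVolume (n := n) x' (s ∩ S) = chartVolume (n := n) x' (S' ∩ (s ∩ S)) := by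
          refine (Measure.measure_inter_eq_of_ae ?_).symm
          rw [ae_iff]
          exact chartVolume_source_compl x'
        rw [h0, chartVolume_eq_of_subset x' x (hS'.inter (hs.inter hS)) inter_subset_left
          (inter_subset_right.trans inter_subset_right)]
        exact measure_mono (inter_subset_right.trans inter_subset_left)
      · rw [Set.sdiff_eq]
        exact Measure.le_iff.1 le_top _ (hs.inter hS.compl)
    calc (riemannianVolume n M).restrict S
        ≤ (chartVolume (n := n) x + (⊤ : Measure M).restrict Sᶜ).restrict S :=
          Measure.restrict_mono le_rfl hle
      _ = chartVolume (n := n) x := by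
          rw [Measure.restrict_add, hself, Measure.restrict_restrict hS, inter_compl_self,
            Measure.restrict_empty, add_zero]
  · rw [← hself]
    exact Measure.restrict_mono le_rfl (le_iSup (fun x : M => chartVolume (n := n) x) x)

end RiemannianMeasure


/-! ### Null sets, measurability and norms transferred between the manifold and its charts. -/

section RiemannianMeasure

variable {n : ℕ} {M : Type*} [MetricSpace M] [SecondCountableTopology M] [MeasurableSpace M]
  [BorelSpace M] [ChartedSpace (EuclideanSpace ℝ (Fin n)) M]
  [IsManifold (𝓡 n) ∞ M]
  [RiemannianBundle (fun x : M => TangentSpace (𝓡 n) x)]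
  [IsContMDiffRiemannianBundle (𝓡 n) ∞ (EuclideanSpace ℝ (Fin n))
      (fun x : M => TangentSpace (𝓡 n) x)]

local notation "𝔼" => EuclideanSpace ℝ (Fin n)

theorem aemeasurable_chart_symm_volume (x : M) :
    AEMeasurable (chartAt 𝔼 x).symm (volume.restrict (chartAt 𝔼 x).target) :=
  (chartAt 𝔼 x).continuousOn_symm.aemeasurable (chartAt 𝔼 x).open_target.measurableSet

theorem aemeasurable_chart (x : M) (μ : Measure M) :
    AEMeasurable (chartAt 𝔼 x) (μ.restrict (chartAt 𝔼 x).source) :=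
  (chartAt 𝔼 x).continuousOn.aemeasurable (chartAt 𝔼 x).open_source.measurableSet

/-- The density is positive on the target, so a null set of the manifold is Lebesgue null in the
chart. -/
theorem map_chart_symm_ac (x : M) :
    (volume.restrict (chartAt 𝔼 x).target).map (chartAt 𝔼 x).symm ≪ riemannianVolume n M := by
  refine Measure.AbsolutelyContinuous.mk fun s hs h0 => ?_
  rw [Measure.map_apply_of_aemeasurable (aemeasurable_chart_symm_volume x) hs]
  refine ac_chartMeasure x ?_
  rw [← Measure.map_apply_of_aemeasurable (aemeasurable_chart_symm x) hs, ← chartVolume_eq_map,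
    ← riemannianVolume_restrict_source]
  exact le_antisymm ((Measure.restrict_apply_le _ _).trans h0.le) zero_le

theorem map_chart_eq (x : M) :
    ((riemannianVolume n M).restrict (chartAt 𝔼 x).source).map (chartAt 𝔼 x)
      = chartMeasure (n := n) x := by
  have h : AEMeasurable (chartAt 𝔼 x) ((chartMeasure (n := n) x).map (chartAt 𝔼 x).symm) := by
    rw [← chartVolume_eq_map, ← riemannianVolume_restrict_source]
    exact aemeasurable_chart x _
  rw [riemannianVolume_restrict_source, chartVolume_eq_map,
    AEMeasurable.map_map_of_aemeasurable h (aemeasurable_chart_symm x)]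
  conv_rhs => rw [← Measure.map_id (μ := chartMeasure (n := n) x)]
  refine Measure.map_congr ?_
  refine (chartMeasure_ac x).ae_le ?_
  filter_upwards [ae_restrict_mem (chartAt 𝔼 x).open_target.measurableSet] with y hy
  exact (chartAt 𝔼 x).right_inv hy

theorem ae_chart_of_ae {P : M → Prop} (h : ∀ᵐ z ∂(riemannianVolume n M), P z) (x : M) :
    ∀ᵐ y ∂(volume.restrict (chartAt 𝔼 x).target), P ((chartAt 𝔼 x).symm y) :=
  ae_of_ae_map (aemeasurable_chart_symm_volume x) ((map_chart_symm_ac x).ae_le h)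

variable (n M) in
theorem exists_countable_chart_cover :
    ∃ s : Set M, s.Countable ∧ ⋃ x ∈ s, (chartAt 𝔼 x).source = univ :=
  TopologicalSpace.countable_cover_nhds fun x : M => chart_source_mem_nhds 𝔼 x

theorem ae_of_ae_chart {P : M → Prop}
    (h : ∀ x : M, ∀ᵐ y ∂(volume.restrict (chartAt 𝔼 x).target), P ((chartAt 𝔼 x).symm y)) :
    ∀ᵐ z ∂(riemannianVolume n M), P z := by
  obtain ⟨s, hs, hcov⟩ := exists_countable_chart_cover n M
  rw [← Measure.restrict_univ (μ := riemannianVolume n M), ← hcov, ae_restrict_biUnion_iff _ hs]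
  intro x _
  have h1 : ∀ᵐ y ∂(((riemannianVolume n M).restrict (chartAt 𝔼 x).source).map (chartAt 𝔼 x)),
      P ((chartAt 𝔼 x).symm y) := by
    rw [map_chart_eq]
    exact (chartMeasure_ac x).ae_le (h x)
  filter_upwards [ae_of_ae_map (aemeasurable_chart x _) h1,
    ae_restrict_mem (chartAt 𝔼 x).open_source.measurableSet] with z hz hzs
  rwa [(chartAt 𝔼 x).left_inv hzs] at hz

theorem aestronglyMeasurable_chart {F : Type*} [TopologicalSpace F] {f : M → F}
    (hf : AEStronglyMeasurable f (riemannianVolume n M)) (x : M) :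
    AEStronglyMeasurable (fun y => f ((chartAt 𝔼 x).symm y))
      (volume.restrict (chartAt 𝔼 x).target) :=
  (hf.mono_ac (map_chart_symm_ac x)).comp_aemeasurable (aemeasurable_chart_symm_volume x)

theorem aestronglyMeasurable_of_chart {F : Type*} [TopologicalSpace F]
    [TopologicalSpace.PseudoMetrizableSpace F] {f : M → F}
    (hf : ∀ x : M, AEStronglyMeasurable (fun y => f ((chartAt 𝔼 x).symm y))
      (volume.restrict (chartAt 𝔼 x).target)) :
    AEStronglyMeasurable f (riemannianVolume n M) := by
  obtain ⟨s, hs, hcov⟩ := exists_countable_chart_cover n M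
  have := hs.to_subtype
  rw [← Measure.restrict_univ (μ := riemannianVolume n M), ← hcov, biUnion_eq_iUnion,
    aestronglyMeasurable_iUnion_iff]
  intro x
  have h1 : AEStronglyMeasurable (fun y => f ((chartAt 𝔼 (x : M)).symm y))
      (((riemannianVolume n M).restrict (chartAt 𝔼 (x : M)).source).map (chartAt 𝔼 (x : M))) := by
    rw [map_chart_eq]
    exact (hf x).mono_ac (chartMeasure_ac _)
  refine (h1.comp_aemeasurable (aemeasurable_chart _ _)).congr ?_
  filter_upwards [ae_restrict_mem (chartAt 𝔼 (x : M)).open_source.measurableSet] with z hz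
  simp only [Function.comp]
  rw [(chartAt 𝔼 (x : M)).left_inv hz]

/-- On a compact part of a chart the continuous positive density is bounded above and away from
zero. This is what makes the `L^p` norms there comparable with Euclidean ones. -/
theorem exists_chartDensity_bounds (x : M) {K : Set 𝔼} (hK : IsCompact K)
    (hKt : K ⊆ (chartAt 𝔼 x).target) :
    ∃ c : ℝ≥0, c ≠ 0 ∧ volume.restrict K ≤ (c : ℝ≥0∞) • chartMeasure (n := n) x ∧
      (chartMeasure (n := n) x).restrict K ≤ (c : ℝ≥0∞) • volume.restrict K := by
  have hc : ContinuousOn (fun y => Real.sqrt (gramMatrix (n := n) x y).det) K :=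
    ((continuousOn_det_gramMatrix x).sqrt).mono hKt
  have hpos : ∀ y ∈ K, 0 < Real.sqrt (gramMatrix (n := n) x y).det := fun y hy =>
    Real.sqrt_pos.2 (det_gramMatrix_pos x (hKt hy))
  obtain ⟨C1, hC1⟩ := hK.exists_bound_of_continuousOn hc
  obtain ⟨C2, hC2⟩ := hK.exists_bound_of_continuousOn (hc.inv₀ fun y hy => (hpos y hy).ne')
  set c : ℝ≥0 := Real.toNNReal (max (max C1 C2) 1) with hcdef
  have hc1 : (c : ℝ) = max (max C1 C2) 1 := Real.coe_toNNReal _ (by positivity)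
  have hd1 : ∀ y ∈ K, chartDensity (n := n) x y ≤ c := by
    intro y hy
    rw [chartDensity, ← ENNReal.ofReal_coe_nnreal, hc1]
    refine ENNReal.ofReal_le_ofReal ?_
    have := hC1 y hy
    rw [Real.norm_of_nonneg (Real.sqrt_nonneg _)] at this
    exact this.trans ((le_max_left _ _).trans (le_max_left _ _))
  have hd2 : ∀ y ∈ K, 1 ≤ c * chartDensity (n := n) x y := by
    intro y hy
    have h := hC2 y hy
    have hp := hpos y hy
    rw [chartDensity, ← ENNReal.ofReal_coe_nnreal, hc1, ← ENNReal.ofReal_mul (by positivity),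
      ← ENNReal.ofReal_one]
    refine ENNReal.ofReal_le_ofReal ?_
    rw [Pi.inv_apply, norm_inv, Real.norm_of_nonneg hp.le] at h
    have h2 : (Real.sqrt (gramMatrix (n := n) x y).det)⁻¹ ≤ max (max C1 C2) 1 :=
      h.trans ((le_max_right _ _).trans (le_max_left _ _))
    rwa [inv_le_iff_one_le_mul₀ hp] at h2
  have hKm := hK.measurableSet
  refine ⟨c, ?_, ?_, ?_⟩
  · have : (0 : ℝ) < c := by rw [hc1]; positivity
    exact_mod_cast this.ne'
  · refine Measure.le_iff.2 fun s hs => ?_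
    rw [Measure.smul_apply, smul_eq_mul, chartMeasure, withDensity_apply _ hs,
      Measure.restrict_restrict hs, Measure.restrict_apply hs]
    calc volume (s ∩ K) = ∫⁻ y in s ∩ K, 1 := by simp
      _ ≤ ∫⁻ y in s ∩ K, c * chartDensity (n := n) x y :=
          setLIntegral_mono' (hs.inter hKm) fun y hy => hd2 y hy.2
      _ = c * ∫⁻ y in s ∩ K, chartDensity (n := n) x y := lintegral_const_mul' _ _ (by simp)
      _ ≤ _ := by
          gcongr
  · refine Measure.le_iff.2 fun s hs => ?_
    rw [Measure.smul_apply, smul_eq_mul, Measure.restrict_apply hs, Measure.restrict_apply hs,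
      chartMeasure, withDensity_apply _ (hs.inter hKm), Measure.restrict_restrict (hs.inter hKm),
      inter_eq_self_of_subset_left (inter_subset_right.trans hKt)]
    calc ∫⁻ y in s ∩ K, chartDensity (n := n) x y ≤ ∫⁻ y in s ∩ K, c :=
          setLIntegral_mono' (hs.inter hKm) fun y hy => hd1 y hy.2
      _ = c * volume (s ∩ K) := by simp

theorem exists_eLpNorm_chart_le (x : M) {K : Set 𝔼} (hK : IsCompact K)
    (hKt : K ⊆ (chartAt 𝔼 x).target) (p : ℝ≥0∞) :
    ∃ C : ℝ≥0, ∀ {F : Type} [NormedAddCommGroup F] (f : M → F),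
      AEStronglyMeasurable f (riemannianVolume n M) →
      eLpNorm (fun y => f ((chartAt 𝔼 x).symm y)) p (volume.restrict K) ≤
        C * eLpNorm f p (riemannianVolume n M) := by
  obtain ⟨c, hc0, hc, -⟩ := exists_chartDensity_bounds x hK hKt
  refine ⟨c ^ (1 / p).toReal, fun f hf => ?_⟩
  have hf' : AEStronglyMeasurable f ((chartMeasure (n := n) x).map (chartAt 𝔼 x).symm) := by
    rw [← chartVolume_eq_map, ← riemannianVolume_restrict_source]
    exact hf.mono_measure Measure.restrict_le_self
  calc eLpNorm (fun y => f ((chartAt 𝔼 x).symm y)) p (volume.restrict K)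
      ≤ eLpNorm (fun y => f ((chartAt 𝔼 x).symm y)) p ((c : ℝ≥0∞) • chartMeasure (n := n) x) :=
        eLpNorm_mono_measure _ hc
    _ = (c : ℝ≥0∞) ^ (1 / p).toReal *
        eLpNorm (fun y => f ((chartAt 𝔼 x).symm y)) p (chartMeasure (n := n) x) := by
        rw [eLpNorm_smul_measure_of_ne_zero (by exact_mod_cast hc0), smul_eq_mul]
    _ ≤ _ := by
        rw [ENNReal.coe_rpow_of_nonneg _ ENNReal.toReal_nonneg]
        gcongr
        have := eLpNorm_map_measure (p := p) hf' (aemeasurable_chart_symm x)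
        rw [Function.comp_def] at this
        rw [← this, ← chartVolume_eq_map, ← riemannianVolume_restrict_source]
        exact eLpNorm_mono_measure _ Measure.restrict_le_self

theorem exists_eLpNorm_le_chart (x : M) {K : Set 𝔼} (hK : IsCompact K)
    (hKt : K ⊆ (chartAt 𝔼 x).target) (p : ℝ≥0∞) :
    ∃ C : ℝ≥0, ∀ {F : Type} [NormedAddCommGroup F] (f : M → F),
      AEStronglyMeasurable f (riemannianVolume n M) →
      (∀ z ∉ (chartAt 𝔼 x).symm '' K, f z = 0) →
      eLpNorm f p (riemannianVolume n M) ≤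
        C * eLpNorm (fun y => f ((chartAt 𝔼 x).symm y)) p (volume.restrict K) := by
  obtain ⟨c, hc0, -, hc⟩ := exists_chartDensity_bounds x hK hKt
  refine ⟨c ^ (1 / p).toReal, fun f hf h0 => ?_⟩
  have hf' : AEStronglyMeasurable f ((chartMeasure (n := n) x).map (chartAt 𝔼 x).symm) := by
    rw [← chartVolume_eq_map, ← riemannianVolume_restrict_source]
    exact hf.mono_measure Measure.restrict_le_self
  have hsub : (chartAt 𝔼 x).symm '' K ⊆ (chartAt 𝔼 x).source := by
    rintro _ ⟨y, hy, rfl⟩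
    exact (chartAt 𝔼 x).map_target (hKt hy)
  have e1 : eLpNorm f p (riemannianVolume n M)
      = eLpNorm f p ((riemannianVolume n M).restrict (chartAt 𝔼 x).source) := by
    refine (eLpNorm_restrict_eq_of_support_subset ?_).symm
    intro z hz
    by_contra h
    exact hz (h0 z fun h' => h (hsub h'))
  have e2 := eLpNorm_map_measure (p := p) hf' (aemeasurable_chart_symm x)
  rw [Function.comp_def, ← chartVolume_eq_map, ← riemannianVolume_restrict_source] at e2
  have e3 : eLpNorm (fun y => f ((chartAt 𝔼 x).symm y)) p (chartMeasure (n := n) x) =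
      eLpNorm (fun y => f ((chartAt 𝔼 x).symm y)) p ((chartMeasure (n := n) x).restrict K) := by
    rw [← eLpNorm_indicator_eq_eLpNorm_restrict hK.measurableSet]
    refine eLpNorm_congr_ae ((chartMeasure_ac x).ae_le ?_)
    filter_upwards [ae_restrict_mem (chartAt 𝔼 x).open_target.measurableSet] with y hy
    by_cases hyK : y ∈ K
    · simp [hyK]
    · rw [indicator_of_notMem hyK]
      refine h0 _ ?_
      rintro ⟨y', hy', he⟩
      exact hyK ((chartAt 𝔼 x).symm.injOn (hKt hy') hy he ▸ hy')
  rw [e1, e2, e3]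
  refine (eLpNorm_mono_measure _ hc).trans ?_
  rw [eLpNorm_smul_measure_of_ne_zero (by exact_mod_cast hc0), smul_eq_mul,
    ENNReal.coe_rpow_of_nonneg _ ENNReal.toReal_nonneg]

theorem riemannianVolume_isLocallyFinite : IsLocallyFiniteMeasure (riemannianVolume n M) := by
  refine ⟨fun x => ?_⟩
  obtain ⟨K, hK, hxK, hKt⟩ := exists_compact_subset (chartAt 𝔼 x).open_target
    (mem_chart_target 𝔼 x)
  obtain ⟨c, hc0, -, hc⟩ := exists_chartDensity_bounds x hK hKt
  refine ⟨(chartAt 𝔼 x).source ∩ (chartAt 𝔼 x) ⁻¹' (interior K), ?_, ?_⟩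
  · exact ((chartAt 𝔼 x).isOpen_inter_preimage isOpen_interior).mem_nhds
      ⟨mem_chart_source 𝔼 x, hxK⟩
  · have hm : MeasurableSet ((chartAt 𝔼 x).source ∩ (chartAt 𝔼 x) ⁻¹' (interior K)) :=
      ((chartAt 𝔼 x).isOpen_inter_preimage isOpen_interior).measurableSet
    have h1 : riemannianVolume n M ((chartAt 𝔼 x).source ∩ (chartAt 𝔼 x) ⁻¹' (interior K))
        = chartMeasure (n := n) x (interior K) := by
      rw [← map_chart_eq, Measure.map_apply_of_aemeasurable (aemeasurable_chart x _)
        isOpen_interior.measurableSet, Measure.restrict_apply' (chartAt 𝔼 x).open_source.measurableSet,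
        inter_comm]
    rw [h1]
    calc chartMeasure (n := n) x (interior K) ≤ chartMeasure (n := n) x K :=
          measure_mono interior_subset
      _ = (chartMeasure (n := n) x).restrict K univ := by simp
      _ ≤ ((c : ℝ≥0∞) • volume.restrict K) univ := hc univ
      _ < ⊤ := by
          simp only [Measure.smul_apply, Measure.restrict_apply_univ, smul_eq_mul]
          exact ENNReal.mul_lt_top ENNReal.coe_lt_top hK.measure_lt_top

theorem riemannianVolume_isOpenPos : (riemannianVolume n M).IsOpenPosMeasure := by
  refine ⟨fun U hU ⟨x, hx⟩ h0 => ?_⟩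
  have h1 := map_chart_symm_ac (n := n) x h0
  rw [Measure.map_apply_of_aemeasurable (aemeasurable_chart_symm_volume x) hU.measurableSet,
    Measure.restrict_apply' (chartAt 𝔼 x).open_target.measurableSet, inter_comm] at h1
  have hopen := (chartAt 𝔼 x).symm.isOpen_inter_preimage hU
  have hne : ((chartAt 𝔼 x).target ∩ (chartAt 𝔼 x).symm ⁻¹' U).Nonempty :=
    ⟨chartAt 𝔼 x x, mem_chart_target 𝔼 x, by
      rw [mem_preimage, (chartAt 𝔼 x).left_inv (mem_chart_source 𝔼 x)]; exact hx⟩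
  exact (hopen.measure_pos volume hne).ne' h1

/-- By homogeneity only unit vectors matter, and on the compact set `K × sphere` the continuous
function `‖chartVector x y v‖` has no zeros. -/
theorem exists_norm_chartVector_bounds (x : M) {K : Set 𝔼} (hK : IsCompact K)
    (hKt : K ⊆ (chartAt 𝔼 x).target) :
    ∃ C : ℝ, 0 < C ∧ (∀ y ∈ K, ∀ v : 𝔼, ‖chartVector x y v‖ ≤ C * ‖v‖) ∧
      ∀ y ∈ K, ∀ v : 𝔼, ‖v‖ ≤ C * ‖chartVector x y v‖ := by
  have hq : ∀ y v, ‖chartVector x y v‖ ^ 2 = ∑ i, ∑ j, v i * v j *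
      inner ℝ (chartVector x y (EuclideanSpace.single i (1 : ℝ) : 𝔼))
        (chartVector x y (EuclideanSpace.single j (1 : ℝ))) := by
    intro y v
    rw [← real_inner_self_eq_norm_sq, chartVector_eq_sum x y v, sum_inner]
    refine Finset.sum_congr rfl fun i _ => ?_
    rw [inner_sum]
    refine Finset.sum_congr rfl fun j _ => ?_
    rw [real_inner_smul_left, real_inner_smul_right]
    ring
  have hcont : ContinuousOn (fun q : 𝔼 × 𝔼 => ‖chartVector x q.1 q.2‖)
      (K ×ˢ Metric.sphere (0 : 𝔼) 1) := by
    have : (fun q : 𝔼 × 𝔼 => ‖chartVector x q.1 q.2‖)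
        = fun q => Real.sqrt (‖chartVector x q.1 q.2‖ ^ 2) := by
      ext q; rw [Real.sqrt_sq (norm_nonneg _)]
    rw [this]
    refine ContinuousOn.sqrt ?_
    simp only [hq]
    refine continuousOn_finsetSum _ fun i _ => continuousOn_finsetSum _ fun j _ => ?_
    refine ContinuousOn.mul (by fun_prop) ?_
    exact (continuousOn_inner_chartVector x _ _).comp continuousOn_fst fun q hq => hKt hq.1
  have hcompact : IsCompact (K ×ˢ Metric.sphere (0 : 𝔼) 1) := hK.prod (isCompact_sphere _ _)
  have hpos : ∀ q ∈ K ×ˢ Metric.sphere (0 : 𝔼) 1, ‖chartVector x q.1 q.2‖ ≠ 0 := by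
    rintro ⟨y, v⟩ ⟨hy, hv⟩ h0
    have h1 : chartEquiv x (hKt hy) v = 0 := norm_eq_zero.1 h0
    rw [map_eq_zero_iff _ (chartEquiv x (hKt hy)).injective] at h1
    simp [h1] at hv
  obtain ⟨C1, hC1⟩ := hcompact.exists_bound_of_continuousOn hcont
  obtain ⟨C2, hC2⟩ := hcompact.exists_bound_of_continuousOn (hcont.inv₀ hpos)
  have hscale : ∀ (y v : 𝔼), v ≠ 0 →
      ‖chartVector x y v‖ = ‖v‖ * ‖chartVector x y (‖v‖⁻¹ • v)‖ := by
    intro y v hv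
    rw [chartVector_smul, norm_smul, norm_inv, norm_norm, ← mul_assoc,
      mul_inv_cancel₀ (norm_ne_zero_iff.2 hv), one_mul]
  have hsph : ∀ v : 𝔼, v ≠ 0 → ‖v‖⁻¹ • v ∈ Metric.sphere (0 : 𝔼) 1 := by
    intro v hv
    rw [mem_sphere_zero_iff_norm, norm_smul, norm_inv, norm_norm,
      inv_mul_cancel₀ (norm_ne_zero_iff.2 hv)]
  have hz : ∀ y : 𝔼, chartVector x y (0 : 𝔼) = 0 := fun y => by
    simpa using chartVector_smul x y (0 : 𝔼) 0
  refine ⟨max (max C1 C2) 1, by positivity, fun y hy v => ?_, fun y hy v => ?_⟩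
  · by_cases hv : v = 0
    · simp [hv, hz]
    · rw [hscale y v hv, mul_comm]
      gcongr
      have := hC1 (y, ‖v‖⁻¹ • v) ⟨hy, hsph v hv⟩
      rw [norm_norm] at this
      exact this.trans ((le_max_left _ _).trans (le_max_left _ _))
  · by_cases hv : v = 0
    · simp [hv, hz]
    · have h1 := hC2 (y, ‖v‖⁻¹ • v) ⟨hy, hsph v hv⟩
      have h2 := hpos (y, ‖v‖⁻¹ • v) ⟨hy, hsph v hv⟩
      rw [Pi.inv_apply, norm_inv, norm_norm] at h1
      have h3 : ‖chartVector x y (‖v‖⁻¹ • v)‖⁻¹ ≤ max (max C1 C2) 1 :=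
        h1.trans ((le_max_right _ _).trans (le_max_left _ _))
      have hp : 0 < ‖chartVector x y (‖v‖⁻¹ • v)‖ := lt_of_le_of_ne (norm_nonneg _) (Ne.symm h2)
      rw [inv_le_iff_one_le_mul₀ hp] at h3
      rw [hscale y v hv]
      calc ‖v‖ = ‖v‖ * 1 := (mul_one _).symm
        _ ≤ ‖v‖ * (max (max C1 C2) 1 * ‖chartVector x y (‖v‖⁻¹ • v)‖) := by gcongr
        _ = _ := by ring

/-- A tangent vector is controlled by its components. -/
theorem exists_norm_le_sum_inner (x : M) {K : Set 𝔼} (hK : IsCompact K)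
    (hKt : K ⊆ (chartAt 𝔼 x).target) :
    ∃ C : ℝ, 0 < C ∧ ∀ y ∈ K, ∀ ξ : TangentSpace (𝓡 n) ((chartAt 𝔼 x).symm y),
      ‖ξ‖ ≤ C * ∑ i, |inner ℝ ξ (chartVector x y (EuclideanSpace.single i (1 : ℝ)))| := by
  obtain ⟨C, hC, -, hC2⟩ := exists_norm_chartVector_bounds x hK hKt
  refine ⟨C, hC, fun y hy ξ => ?_⟩
  obtain ⟨v, rfl⟩ := (chartEquiv x (hKt hy)).surjective ξ
  rw [chartEquiv_apply]
  set ξ := chartVector x y v with hξ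
  by_cases h0 : ‖ξ‖ = 0
  · rw [h0]; positivity
  have hp : 0 < ‖ξ‖ := lt_of_le_of_ne (norm_nonneg _) (Ne.symm h0)
  -- One factor of `ξ` in `⟨ξ, ξ⟩` is expanded in the coordinate vectors; its coefficients are at
  -- most `‖v‖ ≤ C ‖ξ‖`, and a factor `‖ξ‖` cancels.
  have h1 : ‖ξ‖ * ‖ξ‖ ≤ ‖ξ‖ *
      (C * ∑ i, |inner ℝ ξ (chartVector x y (EuclideanSpace.single i (1 : ℝ)))|) := by
    calc ‖ξ‖ * ‖ξ‖ = inner ℝ ξ ξ := (real_inner_self_eq_norm_mul_norm ξ).symm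
      _ = ∑ i, v i * inner ℝ ξ (chartVector x y (EuclideanSpace.single i (1 : ℝ))) := by
          conv_lhs => rw [hξ]
          nth_rewrite 2 [chartVector_eq_sum x y v]
          rw [inner_sum]
          refine Finset.sum_congr rfl fun i _ => ?_
          rw [real_inner_smul_right]
      _ ≤ ∑ i, ‖v‖ * |inner ℝ ξ (chartVector x y (EuclideanSpace.single i (1 : ℝ)))| := by
          refine Finset.sum_le_sum fun i _ => ?_
          refine (le_abs_self _).trans ?_
          rw [abs_mul]
          gcongr
          exact PiLp.norm_apply_le v i
      _ = ‖v‖ * ∑ i, |inner ℝ ξ (chartVector x y (EuclideanSpace.single i (1 : ℝ)))| := by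
          rw [Finset.mul_sum]
      _ ≤ (C * ‖ξ‖) * ∑ i, |inner ℝ ξ (chartVector x y (EuclideanSpace.single i (1 : ℝ)))| := by
          gcongr
          exact hC2 y hy v
      _ = _ := by ring
  exact le_of_mul_le_mul_left h1 hp

/-- If `ξ` has coordinates `v`, its inner products with the coordinate vectors form `G v`, and `‖ξ‖²
= v · G v = (G v) · G⁻¹ (G v)`. The length is thus a function of the components tested by weak
gradients. -/
theorem norm_sq_eq_gramMatrix_inv (x : M) {y : 𝔼} (hy : y ∈ (chartAt 𝔼 x).target)
    (ξ : TangentSpace (𝓡 n) ((chartAt 𝔼 x).symm y)) :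
    ‖ξ‖ ^ 2 = (fun i => inner ℝ ξ (chartVector x y (EuclideanSpace.single i (1 : ℝ)))) ⬝ᵥ
      ((gramMatrix x y)⁻¹.mulVec
        fun i => inner ℝ ξ (chartVector x y (EuclideanSpace.single i (1 : ℝ)))) := by
  obtain ⟨v, rfl⟩ := (chartEquiv x hy).surjective ξ
  rw [chartEquiv_apply]
  have ha : (fun i => inner ℝ (chartVector x y v)
      (chartVector x y (EuclideanSpace.single i (1 : ℝ)))) = (gramMatrix x y).mulVec v := by
    ext i
    rw [chartVector_eq_sum x y v, sum_inner, Matrix.mulVec, dotProduct]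
    refine Finset.sum_congr rfl fun j _ => ?_
    rw [real_inner_smul_left, gramMatrix, Matrix.of_apply, real_inner_comm, mul_comm]
  have hu : IsUnit (gramMatrix (n := n) x y).det := (det_gramMatrix_pos x hy).ne'.isUnit
  rw [← real_inner_self_eq_norm_sq]
  nth_rewrite 2 [ha]
  rw [Matrix.mulVec_mulVec, Matrix.nonsing_inv_mul _ hu, Matrix.one_mulVec]
  nth_rewrite 2 [chartVector_eq_sum x y v]
  rw [inner_sum, dotProduct]
  refine Finset.sum_congr rfl fun i _ => ?_
  rw [real_inner_smul_right, mul_comm]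

/-- A weak gradient is a bare section with measurable components. Its length is measurable because
`G⁻¹` is continuous in the chart. -/
theorem aestronglyMeasurable_norm_of_chart {X : (z : M) → TangentSpace (𝓡 n) z}
    (hX : ∀ (x : M) (v : 𝔼), AEStronglyMeasurable
      (fun y => inner ℝ (X ((chartAt 𝔼 x).symm y)) (chartVector x y v))
      (volume.restrict (chartAt 𝔼 x).target)) :
    AEStronglyMeasurable (fun z => ‖X z‖) (riemannianVolume n M) := by
  refine aestronglyMeasurable_of_chart fun x => ?_
  have hG : ContinuousOn (fun y => (gramMatrix (n := n) x y)) (chartAt 𝔼 x).target :=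
    continuousOn_pi.2 fun i => continuousOn_pi.2 fun j => continuousOn_inner_chartVector x _ _
  have hadj : ContinuousOn (fun y => (gramMatrix (n := n) x y).adjugate) (chartAt 𝔼 x).target :=
    (continuous_id.matrix_adjugate).comp_continuousOn hG
  have hinv : ContinuousOn (fun y => (gramMatrix (n := n) x y)⁻¹) (chartAt 𝔼 x).target := by
    simp only [Matrix.inv_def, Ring.inverse_eq_inv']
    exact ((continuousOn_det_gramMatrix x).inv₀ fun y hy => (det_gramMatrix_pos x hy).ne').smul hadj
  have hm : ∀ i j, AEStronglyMeasurable (fun y => (gramMatrix (n := n) x y)⁻¹ i j)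
      (volume.restrict (chartAt 𝔼 x).target) := fun i j =>
    ContinuousOn.aestronglyMeasurable
      ((continuousOn_pi.1 ((continuousOn_pi.1 hinv) i)) j) (chartAt 𝔼 x).open_target.measurableSet
  have h1 : AEStronglyMeasurable (fun y => Real.sqrt (∑ i, inner ℝ (X ((chartAt 𝔼 x).symm y))
      (chartVector x y (EuclideanSpace.single i (1 : ℝ))) *
        ∑ j, (gramMatrix (n := n) x y)⁻¹ i j * inner ℝ (X ((chartAt 𝔼 x).symm y))
          (chartVector x y (EuclideanSpace.single j (1 : ℝ)))))
      (volume.restrict (chartAt 𝔼 x).target) := by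
    refine Real.continuous_sqrt.comp_aestronglyMeasurable ?_
    refine Finset.aestronglyMeasurable_fun_sum _ fun i _ => (hX x _).mul ?_
    exact Finset.aestronglyMeasurable_fun_sum _ fun j _ => (hm i j).mul (hX x _)
  refine h1.congr ?_
  filter_upwards [ae_restrict_mem (chartAt 𝔼 x).open_target.measurableSet] with y hy
  rw [← Real.sqrt_sq (norm_nonneg (X ((chartAt 𝔼 x).symm y))), norm_sq_eq_gramMatrix_inv x hy]
  rfl

end RiemannianMeasure


/-! ### A doubling measure on a complete space makes it proper. -/

section DoublingMeasure

variable {M : Type*} [MetricSpace M] [MeasurableSpace M] [BorelSpace M] {μ : Measure M}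

theorem measure_ball_two_pow_le {C : ℝ≥0} (hC : ∀ (x : M) (ρ : ℝ), 0 < ρ →
    μ (Metric.ball x (2 * ρ)) ≤ C * μ (Metric.ball x ρ)) (x : M) {ρ : ℝ} (hρ : 0 < ρ) (j : ℕ) :
    μ (Metric.ball x (2 ^ j * ρ)) ≤ (C : ℝ≥0∞) ^ j * μ (Metric.ball x ρ) := by
  induction j with
  | zero => simp
  | succ j ih =>
    calc μ (Metric.ball x (2 ^ (j + 1) * ρ)) = μ (Metric.ball x (2 * (2 ^ j * ρ))) := by
          congr 2; ring
      _ ≤ C * μ (Metric.ball x (2 ^ j * ρ)) := hC x _ (by positivity)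
      _ ≤ C * ((C : ℝ≥0∞) ^ j * μ (Metric.ball x ρ)) := by gcongr
      _ = _ := by ring

theorem Doubling.measure_ball_lt_top [IsLocallyFiniteMeasure μ] (hD : Doubling μ) (x : M) (R : ℝ) :
    μ (Metric.ball x R) < ⊤ := by
  obtain ⟨C, hC⟩ := hD
  obtain ⟨s, hs, hfin⟩ := μ.finiteAt_nhds x
  obtain ⟨ρ, hρ, hρs⟩ := Metric.mem_nhds_iff.1 hs
  obtain ⟨j, hj⟩ := pow_unbounded_of_one_lt (R / ρ) (one_lt_two (α := ℝ))
  calc μ (Metric.ball x R) ≤ μ (Metric.ball x (2 ^ j * ρ)) := by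
        refine measure_mono (Metric.ball_subset_ball ?_)
        rw [div_lt_iff₀ hρ] at hj
        exact hj.le
    _ ≤ (C : ℝ≥0∞) ^ j * μ (Metric.ball x ρ) := measure_ball_two_pow_le hC x hρ j
    _ < ⊤ := ENNReal.mul_lt_top (by finiteness) ((measure_mono hρs).trans_lt hfin)

/-- A complete metric space with a doubling measure is proper. -/
theorem Doubling.properSpace [CompleteSpace M] [IsLocallyFiniteMeasure μ] [μ.IsOpenPosMeasure]
    (hD : Doubling μ) : ProperSpace M := by
  have hfin := fun x R => hD.measure_ball_lt_top (μ := μ) x R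
  obtain ⟨C, hC⟩ := hD
  have htb : ∀ (x : M) (R : ℝ), 0 < R → TotallyBounded (Metric.ball x R) := by
    intro x R hR
    rw [Metric.totallyBounded_iff]
    intro ε hε
    -- With `2^j ε/2 > 2R + ε`, the `2^j`-fold dilate of any ball of radius `ε/2` centred in `B(x,
    -- R)` contains `B(x, R + ε)`.
    obtain ⟨j, hj⟩ := pow_unbounded_of_one_lt ((2 * R + ε) / (ε / 2)) (one_lt_two (α := ℝ))
    rw [div_lt_iff₀ (by positivity)] at hj
    -- `P k`: the ball contains `k` points with mutual distances at least `ε`. The balls of radius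
    -- `ε/2` about them are disjoint in `B(x, R + ε)` and each carries at least the fraction
    -- `C^(-j)` of its measure, so `k ≤ C^j`.
    let P : ℕ → Prop := fun k => ∃ t : Finset M, t.card = k ∧ (t : Set M) ⊆ Metric.ball x R ∧
      (t : Set M).Pairwise fun a b => ε ≤ dist a b
    have hbound : ∀ k, P k → (k : ℝ≥0∞) ≤ (C : ℝ≥0∞) ^ j := by
      rintro k ⟨t, rfl, ht, hsep⟩
      set B := Metric.ball x (R + ε)
      have hB0 : μ B ≠ 0 := (Metric.measure_ball_pos μ x (by positivity)).ne'
      have hBt : μ B ≠ ⊤ := (hfin x _).ne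
      have h1 : ∑ a ∈ t, μ (Metric.ball a (ε / 2)) ≤ μ B := by
        rw [← measure_biUnion_finset]
        · refine measure_mono (iUnion₂_subset fun a ha => ?_)
          refine Metric.ball_subset_ball' ?_
          have := ht ha
          rw [Metric.mem_ball] at this
          linarith
        · intro a ha b hb hab
          refine Metric.ball_disjoint_ball ?_
          have := hsep ha hb hab
          linarith
        · exact fun _ _ => measurableSet_ball
      have h2 : ∀ a ∈ t, μ B ≤ (C : ℝ≥0∞) ^ j * μ (Metric.ball a (ε / 2)) := by
        intro a ha
        refine le_trans (measure_mono (Metric.ball_subset_ball' ?_))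
          (measure_ball_two_pow_le hC a (by positivity : 0 < ε / 2) j)
        have := ht ha
        rw [Metric.mem_ball, dist_comm] at this
        linarith
      have h3 : (t.card : ℝ≥0∞) * μ B ≤ (C : ℝ≥0∞) ^ j * μ B := by
        calc (t.card : ℝ≥0∞) * μ B = ∑ a ∈ t, μ B := by simp
          _ ≤ ∑ a ∈ t, (C : ℝ≥0∞) ^ j * μ (Metric.ball a (ε / 2)) := Finset.sum_le_sum h2
          _ = (C : ℝ≥0∞) ^ j * ∑ a ∈ t, μ (Metric.ball a (ε / 2)) := by rw [Finset.mul_sum]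
          _ ≤ _ := by gcongr
      exact (ENNReal.mul_le_mul_iff_left hB0 hBt).1 h3
    obtain ⟨N, hN⟩ := exists_nat_gt ((C : ℝ) ^ j)
    have hbN : ∀ k, P k → k ≤ N := by
      intro k hk
      have h1 := hbound k hk
      have h2 : (k : ℝ≥0) ≤ C ^ j := by exact_mod_cast h1
      have h3 : (k : ℝ) ≤ (C : ℝ) ^ j := by exact_mod_cast h2
      exact_mod_cast (h3.trans hN.le)
    classical
    have h0 : P 0 := ⟨∅, by simp⟩
    -- A separated set of maximal cardinality is an `ε`-net: a point left uncovered could be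
    -- adjoined to it.
    obtain ⟨t, htc, ht, hsep⟩ := Nat.findGreatest_spec (P := P) (Nat.zero_le N) h0
    refine ⟨t, t.finite_toSet, fun y hy => ?_⟩
    by_contra hcon
    simp only [mem_iUnion, not_exists, Metric.mem_ball, not_lt] at hcon
    have hyt : y ∉ t := fun h => by
      have := hcon y h
      rw [dist_self] at this
      linarith
    have hP : P (t.card + 1) := by
      refine ⟨insert y t, Finset.card_insert_of_notMem hyt, ?_, ?_⟩
      · rw [Finset.coe_insert]
        exact insert_subset hy ht
      · rw [Finset.coe_insert]
        refine hsep.insert fun b hb hne => ⟨hcon b hb, ?_⟩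
        rw [dist_comm]
        exact hcon b hb
    have := Nat.le_findGreatest (hbN _ hP) hP
    omega
  refine ⟨fun x r => ?_⟩
  refine isCompact_iff_totallyBounded_isComplete.2 ⟨?_, Metric.isClosed_closedBall.isComplete⟩
  refine (htb x (max r 0 + 1) (by positivity)).subset (Metric.closedBall_subset_ball ?_)
  linarith [le_max_left r 0]

end DoublingMeasure


/-! ### Gradients of smooth and of Lipschitz functions. -/

section Gradient

variable {n : ℕ} {M : Type*} [MetricSpace M] [ChartedSpace (EuclideanSpace ℝ (Fin n)) M]
  [IsManifold (𝓡 n) ∞ M]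
  [RiemannianBundle (fun x : M => TangentSpace (𝓡 n) x)]
  [IsContMDiffRiemannianBundle (𝓡 n) ∞ (EuclideanSpace ℝ (Fin n))
      (fun x : M => TangentSpace (𝓡 n) x)]

local notation "𝔼" => EuclideanSpace ℝ (Fin n)

theorem finiteDimensional_tangentSpace (z : M) :
    FiniteDimensional ℝ (TangentSpace (𝓡 n) z) :=
  inferInstanceAs (FiniteDimensional ℝ 𝔼)

theorem completeSpace_tangentSpace (z : M) : CompleteSpace (TangentSpace (𝓡 n) z) := by
  have := finiteDimensional_tangentSpace (n := n) z
  exact FiniteDimensional.complete ℝ (TangentSpace (𝓡 n) z)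

theorem exists_inner_eq_mfderiv (f : M → ℝ) (z : M) :
    ∃ ξ : TangentSpace (𝓡 n) z, ∀ w : TangentSpace (𝓡 n) z,
      inner ℝ ξ w = (mfderiv (𝓡 n) 𝓘(ℝ, ℝ) f z w : ℝ) := by
  have := completeSpace_tangentSpace (n := n) z
  let T : TangentSpace (𝓡 n) z →L[ℝ] ℝ := mfderiv (𝓡 n) 𝓘(ℝ, ℝ) f z
  exact ⟨(InnerProductSpace.toDual ℝ (TangentSpace (𝓡 n) z)).symm T, fun w =>
    InnerProductSpace.toDual_symm_apply⟩

/-- The Riemannian gradient of a differentiable function. -/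
noncomputable def mgrad (f : M → ℝ) (z : M) : TangentSpace (𝓡 n) z :=
  (exists_inner_eq_mfderiv f z).choose

theorem inner_mgrad (f : M → ℝ) (z : M) (w : TangentSpace (𝓡 n) z) :
    inner ℝ (mgrad f z) w = (mfderiv (𝓡 n) 𝓘(ℝ, ℝ) f z w : ℝ) :=
  (exists_inner_eq_mfderiv f z).choose_spec w

theorem mgrad_eq_zero_of_not_mdifferentiableAt {f : M → ℝ} {z : M}
    (h : ¬ MDifferentiableAt (𝓡 n) 𝓘(ℝ, ℝ) f z) : mgrad (n := n) f z = 0 := by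
  rw [← inner_self_eq_zero (𝕜 := ℝ), inner_mgrad, mfderiv_zero_of_not_mdifferentiableAt h]
  rfl

theorem mdifferentiableAt_of_chart {f : M → ℝ} (x : M) {y : 𝔼} (hy : y ∈ (chartAt 𝔼 x).target)
    (hd : DifferentiableAt ℝ (fun y => f ((chartAt 𝔼 x).symm y)) y) :
    MDifferentiableAt (𝓡 n) 𝓘(ℝ, ℝ) f ((chartAt 𝔼 x).symm y) := by
  have hs := (chartAt 𝔼 x).map_target hy
  have h1 := mdifferentiableAt_chart (n := n) x hs
  have h2 : MDifferentiableAt 𝓘(ℝ, 𝔼) 𝓘(ℝ, ℝ) (fun y => f ((chartAt 𝔼 x).symm y))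
      (chartAt 𝔼 x ((chartAt 𝔼 x).symm y)) := by
    rw [(chartAt 𝔼 x).right_inv hy]
    exact hd.mdifferentiableAt
  refine (h2.comp _ h1).congr_of_eventuallyEq ?_
  filter_upwards [(chartAt 𝔼 x).open_source.mem_nhds hs] with z hz
  simp [(chartAt 𝔼 x).left_inv hz]

theorem inner_mgrad_chartVector {f : M → ℝ} (x : M) {y : 𝔼} (hy : y ∈ (chartAt 𝔼 x).target)
    (hd : MDifferentiableAt (𝓡 n) 𝓘(ℝ, ℝ) f ((chartAt 𝔼 x).symm y)) (v : 𝔼) :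
    inner ℝ (mgrad f ((chartAt 𝔼 x).symm y)) (chartVector x y v) =
      fderiv ℝ (fun y => f ((chartAt 𝔼 x).symm y)) y v := by
  rw [inner_mgrad]
  have h : mfderiv 𝓘(ℝ, 𝔼) 𝓘(ℝ, ℝ) (f ∘ (chartAt 𝔼 x).symm) y =
      (mfderiv (𝓡 n) 𝓘(ℝ, ℝ) f ((chartAt 𝔼 x).symm y)).comp
        (mfderiv 𝓘(ℝ, 𝔼) (𝓡 n) (chartAt 𝔼 x).symm y) :=
    mfderiv_comp y hd (mdifferentiableAt_chart_symm x hy)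
  have h2 : mfderiv 𝓘(ℝ, 𝔼) 𝓘(ℝ, ℝ) (f ∘ (chartAt 𝔼 x).symm) y
      = fderiv ℝ (f ∘ (chartAt 𝔼 x).symm) y := mfderiv_eq_fderiv
  rw [h2] at h
  exact (congrArg (fun T => T v) h).symm

theorem isWeakGradient_iff {u : M → ℝ} {X : (z : M) → TangentSpace (𝓡 n) z} :
    IsWeakGradient u X ↔ ∀ (x : M) (v : 𝔼),
      HasWeakDeriv (chartAt 𝔼 x).target (fun y => u ((chartAt 𝔼 x).symm y))
        (fun y => inner ℝ (X ((chartAt 𝔼 x).symm y)) (chartVector x y v)) v := by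
  constructor
  · intro h x v
    exact ⟨(h x).1, ((h x).2 v).1, ((h x).2 v).2⟩
  · intro h x
    exact ⟨(h x 0).left, fun v => ⟨(h x v).right, (h x v).eq⟩⟩

/-- In a chart, Rademacher's theorem gives differentiability almost everywhere, where `mgrad` has
the classical partial derivatives as components; the exceptional null set does not matter. -/
theorem isWeakGradient_mgrad {f : M → ℝ}
    (hf : ∀ x : M, LocallyLipschitzOn (chartAt 𝔼 x).target fun y => f ((chartAt 𝔼 x).symm y)) :
    IsWeakGradient f (mgrad (n := n) f) := by
  refine isWeakGradient_iff.2 fun x v => ?_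
  obtain ⟨h1, h2⟩ := hasWeakDeriv_of_locallyLipschitzOn (chartAt 𝔼 x).open_target (hf x) v
  refine h1.congr_ae (chartAt 𝔼 x).open_target.measurableSet EventuallyEq.rfl ?_
  filter_upwards [h2, ae_restrict_mem (chartAt 𝔼 x).open_target.measurableSet] with y hy hyt
  exact (inner_mgrad_chartVector x hyt (mdifferentiableAt_of_chart x hyt hy) v).symm

theorem contDiffOn_chart {f : M → ℝ} (hf : ContMDiff (𝓡 n) 𝓘(ℝ, ℝ) ∞ f) (x : M) :
    ContDiffOn ℝ ∞ (fun y => f ((chartAt 𝔼 x).symm y)) (chartAt 𝔼 x).target := by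
  have h : ContMDiffOn 𝓘(ℝ, 𝔼) (𝓡 n) ∞ (chartAt 𝔼 x).symm (chartAt 𝔼 x).target :=
    contMDiffOn_chart_symm
  exact (hf.comp_contMDiffOn h).contDiffOn

theorem isWeakGradient_of_contMDiff {f : M → ℝ} (hf : ContMDiff (𝓡 n) 𝓘(ℝ, ℝ) ∞ f) :
    IsWeakGradient f (mgrad (n := n) f) := by
  refine isWeakGradient_mgrad fun x y hy => ?_
  have h1 := (contDiffOn_chart hf x).contDiffAt ((chartAt 𝔼 x).open_target.mem_nhds hy)
  obtain ⟨K, t, ht, hK⟩ := (h1.of_le (m := 1) (by simp)).exists_lipschitzOnWith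
  exact ⟨K, t, mem_nhdsWithin_of_mem_nhds ht, hK⟩

/-- The distance of a Riemannian manifold is at most the length of any curve joining the points,
here the image of a segment under the inverse chart. -/
theorem dist_chart_symm_le [IsRiemannianManifold (𝓡 n) M] (x : M) {y v : 𝔼} {A : ℝ}
    (hseg : ∀ s ∈ Icc (0 : ℝ) 1, y + s • v ∈ (chartAt 𝔼 x).target)
    (hA : ∀ s ∈ Icc (0 : ℝ) 1, ‖chartVector x (y + s • v) v‖ ≤ A) :
    dist ((chartAt 𝔼 x).symm y) ((chartAt 𝔼 x).symm (y + v)) ≤ A := by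
  have hA0 : 0 ≤ A := (norm_nonneg _).trans (hA 0 (by simp))
  let γ : ℝ → M := fun s => (chartAt 𝔼 x).symm (y + s • v)
  have hsm : ContMDiffOn 𝓘(ℝ, 𝔼) (𝓡 n) 1 (chartAt 𝔼 x).symm (chartAt 𝔼 x).target :=
    contMDiffOn_chart_symm
  have haff : ContMDiff 𝓘(ℝ, ℝ) 𝓘(ℝ, 𝔼) 1 (fun s : ℝ => y + s • v) := by
    have : ContDiff ℝ 1 (fun s : ℝ => y + s • v) := by fun_prop
    exact this.contMDiff
  have hγ : ContMDiffOn 𝓘(ℝ, ℝ) (𝓡 n) 1 γ (Icc 0 1) :=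
    hsm.comp haff.contMDiffOn fun s hs => hseg s hs
  have h1 := Manifold.riemannianEDist_le_pathELength (I := 𝓡 n) (x := (chartAt 𝔼 x).symm y)
    (y := (chartAt 𝔼 x).symm (y + v)) hγ (by simp [γ]) (by simp [γ]) zero_le_one
  rw [← IsRiemannianManifold.out, Manifold.pathELength_eq_lintegral_mfderiv_Icc] at h1
  have h2 : ∫⁻ t in Icc (0 : ℝ) 1, ‖mfderiv 𝓘(ℝ, ℝ) (𝓡 n) γ t 1‖ₑ ≤ ENNReal.ofReal A := by
    calc ∫⁻ t in Icc (0 : ℝ) 1, ‖mfderiv 𝓘(ℝ, ℝ) (𝓡 n) γ t 1‖ₑ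
        ≤ ∫⁻ t in Icc (0 : ℝ) 1, ENNReal.ofReal A := by
          refine setLIntegral_mono' measurableSet_Icc fun s hs => ?_
          have hd : HasFDerivAt (fun s : ℝ => y + s • v)
              (ContinuousLinearMap.toSpanSingleton ℝ v) s := by
            have := (((hasDerivAt_id s).smul_const v).const_add y).hasFDerivAt
            simpa using this
          have hch := (mdifferentiableAt_chart_symm x (hseg s hs)).hasMFDerivAt.comp s
            hd.hasMFDerivAt
          have e1 : mfderiv 𝓘(ℝ, ℝ) (𝓡 n) γ s 1 = chartVector x (y + s • v) v := by
            have : mfderiv 𝓘(ℝ, ℝ) (𝓡 n) γ s = _ := hch.mfderiv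
            rw [this]
            change mfderiv 𝓘(ℝ, 𝔼) (𝓡 n) (chartAt 𝔼 x).symm (y + s • v) ((1 : ℝ) • v) = _
            rw [one_smul]
            rfl
          rw [e1, ← ofReal_norm]
          exact ENNReal.ofReal_le_ofReal (hA s hs)
      _ = ENNReal.ofReal A := by simp
  have h3 := h1.trans h2
  rw [edist_dist] at h3
  exact (ENNReal.ofReal_le_ofReal_iff hA0).1 h3

/-- A difference quotient of `f` along a short coordinate segment is at most `L` times the length of
the segment's image divided by `t`, and that ratio tends to the length of the coordinate vector.
Hence every directional derivative is at most `L` times the length of the direction. -/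
theorem norm_mgrad_le [IsRiemannianManifold (𝓡 n) M] {f : M → ℝ} {L : ℝ≥0} (hf : LipschitzWith L f)
    (z : M) : ‖mgrad (n := n) f z‖ ≤ L := by
  by_cases hd : MDifferentiableAt (𝓡 n) 𝓘(ℝ, ℝ) f z
  swap
  · rw [mgrad_eq_zero_of_not_mdifferentiableAt hd]; simp
  set y := chartAt 𝔼 z z with hy
  have hyt : y ∈ (chartAt 𝔼 z).target := mem_chart_target 𝔼 z
  have hz : (chartAt 𝔼 z).symm y = z := (chartAt 𝔼 z).left_inv (mem_chart_source 𝔼 z)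
  have hd' : MDifferentiableAt (𝓡 n) 𝓘(ℝ, ℝ) f ((chartAt 𝔼 z).symm y) := by rwa [hz]
  suffices H : ∀ v : 𝔼, fderiv ℝ (fun y => f ((chartAt 𝔼 z).symm y)) y v ≤
      L * ‖chartVector z y v‖ by
    have key : ‖mgrad (n := n) f ((chartAt 𝔼 z).symm y)‖ ≤ L := by
      -- The direction is the gradient itself, for which `H` reads `‖∇f‖² ≤ L ‖∇f‖`.
      obtain ⟨v, hv⟩ := (chartEquiv z hyt).surjective (mgrad (n := n) f ((chartAt 𝔼 z).symm y))
      rw [chartEquiv_apply] at hv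
      have h1 := H v
      rw [← inner_mgrad_chartVector z hyt hd', hv, real_inner_self_eq_norm_mul_norm] at h1
      by_cases h0 : ‖mgrad (n := n) f ((chartAt 𝔼 z).symm y)‖ = 0
      · rw [h0]; positivity
      · exact le_of_mul_le_mul_right h1 (lt_of_le_of_ne (norm_nonneg _) (Ne.symm h0))
    rwa [hz] at key
  intro v
  have hdf : DifferentiableAt ℝ (fun y => f ((chartAt 𝔼 z).symm y)) y :=
    (hd'.comp y (mdifferentiableAt_chart_symm z hyt)).differentiableAt
  have hline : HasDerivAt (fun t : ℝ => f ((chartAt 𝔼 z).symm (y + t • v)))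
      (fderiv ℝ (fun y => f ((chartAt 𝔼 z).symm y)) y v) 0 := by
    have h1 : HasFDerivAt (fun y => f ((chartAt 𝔼 z).symm y))
      (fderiv ℝ (fun y => f ((chartAt 𝔼 z).symm y)) y) (y + (0 : ℝ) • v) := by
      simpa using hdf.hasFDerivAt
    have h2 : HasDerivAt (fun t : ℝ => y + t • v) v 0 := by
      simpa using ((hasDerivAt_id (0 : ℝ)).smul_const v).const_add y
    exact h1.comp_hasDerivAt 0 h2
  refine le_of_forall_pos_le_add fun ε hε => ?_
  set ε' := ε / (L + 1) with hε'
  have hε'0 : 0 < ε' := by positivity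
  have hcont : ContinuousAt (fun y' => ‖chartVector z y' v‖) y := by
    have h1 : ContinuousOn (fun y' => ‖chartVector z y' v‖) (chartAt 𝔼 z).target := by
      have h2 := (continuousOn_inner_chartVector z v v).sqrt
      refine h2.congr fun y' _ => ?_
      beta_reduce
      rw [real_inner_self_eq_norm_sq, Real.sqrt_sq (norm_nonneg _)]
    exact h1.continuousAt ((chartAt 𝔼 z).open_target.mem_nhds hyt)
  have hnb : ∀ᶠ y' in 𝓝 y, y' ∈ (chartAt 𝔼 z).target ∧
      ‖chartVector z y' v‖ < ‖chartVector z y v‖ + ε' :=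
    ((chartAt 𝔼 z).open_target.eventually_mem hyt).and
      (hcont.eventually (gt_mem_nhds (by linarith)))
  obtain ⟨δ, hδ, hball⟩ := Metric.eventually_nhds_iff.1 hnb
  have hδ' : 0 < δ / (‖v‖ + 1) := by positivity
  -- For these `t` the segment from `y` to `y + t v` stays in the ball of radius `δ`; the `+ 1`
  -- covers `v = 0`.
  have hquot : ∀ t ∈ Ioo (0 : ℝ) (δ / (‖v‖ + 1)),
      t⁻¹ * (f ((chartAt 𝔼 z).symm (y + t • v)) - f ((chartAt 𝔼 z).symm y)) ≤
        L * (‖chartVector z y v‖ + ε') := by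
    intro t ht
    have hmem : ∀ s ∈ Icc (0 : ℝ) 1, dist (y + s • (t • v)) y < δ := by
      intro s hs
      rw [dist_self_add_left, norm_smul, norm_smul, Real.norm_of_nonneg hs.1,
        Real.norm_of_nonneg ht.1.le]
      have h1 : s * (t * ‖v‖) ≤ 1 * (t * ‖v‖) := by
        have := ht.1.le
        gcongr
        exact hs.2
      have h2 : t * (‖v‖ + 1) < δ := (lt_div_iff₀ (by positivity)).1 ht.2
      nlinarith [ht.1]
    have hdist := dist_chart_symm_le z (y := y) (v := t • v)
      (A := t * (‖chartVector z y v‖ + ε'))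
      (fun s hs => (hball (hmem s hs)).1) (fun s hs => by
        rw [chartVector_smul, norm_smul, Real.norm_of_nonneg ht.1.le]
        have := ht.1.le
        gcongr
        exact (hball (hmem s hs)).2.le)
    have hl := hf.dist_le_mul ((chartAt 𝔼 z).symm (y + t • v)) ((chartAt 𝔼 z).symm y)
    rw [Real.dist_eq, dist_comm] at hl
    have h3 : f ((chartAt 𝔼 z).symm (y + t • v)) - f ((chartAt 𝔼 z).symm y) ≤
        L * (t * (‖chartVector z y v‖ + ε')) :=
      (le_abs_self _).trans (hl.trans (by gcongr))
    rw [inv_mul_le_iff₀ ht.1]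
    linarith
  have hlim := hline.tendsto_slope_zero_right
  simp only [zero_add, zero_smul, add_zero, smul_eq_mul] at hlim
  have hle : fderiv ℝ (fun y => f ((chartAt 𝔼 z).symm y)) y v ≤
      L * (‖chartVector z y v‖ + ε') := by
    refine le_of_tendsto hlim ?_
    filter_upwards [Ioo_mem_nhdsGT hδ'] with t ht using hquot t ht
  refine hle.trans ?_
  rw [mul_add]
  gcongr
  rw [hε', mul_div_assoc', div_le_iff₀ (by positivity)]
  nlinarith [L.2]

/-- A closed ball in the chart is convex, so segments stay inside it, and there the lengths of
coordinate vectors are uniformly bounded. -/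
theorem locallyLipschitzOn_chart [SecondCountableTopology M] [MeasurableSpace M]
    [BorelSpace M] [IsRiemannianManifold (𝓡 n) M] {f : M → ℝ} {L : ℝ≥0}
    (hf : LipschitzWith L f) (x : M) :
    LocallyLipschitzOn (chartAt 𝔼 x).target fun y => f ((chartAt 𝔼 x).symm y) := by
  intro y hy
  obtain ⟨r, hr, hrt⟩ := Metric.nhds_basis_closedBall.mem_iff.1
    ((chartAt 𝔼 x).open_target.mem_nhds hy)
  obtain ⟨C, hC, hC1, -⟩ := exists_norm_chartVector_bounds x (isCompact_closedBall y r) hrt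
  refine ⟨L * ⟨C, hC.le⟩, Metric.closedBall y r,
    mem_nhdsWithin_of_mem_nhds (Metric.closedBall_mem_nhds y hr), ?_⟩
  refine hf.lipschitzOnWith.comp (LipschitzOnWith.of_dist_le_mul fun a ha b hb => ?_)
    (mapsTo_univ _ _)
  have hseg : ∀ s ∈ Icc (0 : ℝ) 1, a + s • (b - a) ∈ Metric.closedBall y r := fun s hs => by
    exact (convex_closedBall y r).add_smul_sub_mem ha hb hs
  have := dist_chart_symm_le x (y := a) (v := b - a) (A := C * ‖b - a‖)
    (fun s hs => hrt (hseg s hs)) (fun s hs => hC1 _ (hseg s hs) _)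
  rw [add_sub_cancel] at this
  rw [dist_eq_norm a b, norm_sub_rev]
  exact this

end Gradient


/-! ### Calculus of weak gradients. -/

section WeakGradient

variable {n : ℕ} {M : Type*} [MetricSpace M] [SecondCountableTopology M]
  [MeasurableSpace M] [BorelSpace M] [ChartedSpace (EuclideanSpace ℝ (Fin n)) M]
  [IsManifold (𝓡 n) ∞ M]
  [RiemannianBundle (fun x : M => TangentSpace (𝓡 n) x)]
  [IsContMDiffRiemannianBundle (𝓡 n) ∞ (EuclideanSpace ℝ (Fin n))
      (fun x : M => TangentSpace (𝓡 n) x)]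

local notation "𝔼" => EuclideanSpace ℝ (Fin n)

variable {u f g : M → ℝ} {X Y : (z : M) → TangentSpace (𝓡 n) z} {p : ℝ≥0∞}

theorem IsWeakGradient.add (hf : IsWeakGradient f X) (hg : IsWeakGradient g Y) :
    IsWeakGradient (fun z => f z + g z) (fun z => X z + Y z) := by
  refine isWeakGradient_iff.2 fun x v => ?_
  simp only [inner_add_left]
  exact (isWeakGradient_iff.1 hf x v).add (isWeakGradient_iff.1 hg x v)

theorem IsWeakGradient.const_smul (hf : IsWeakGradient f X) (c : ℝ) :
    IsWeakGradient (fun z => c * f z) (fun z => c • X z) := by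
  refine isWeakGradient_iff.2 fun x v => ?_
  simp only [real_inner_smul_left]
  exact (isWeakGradient_iff.1 hf x v).const_smul c

theorem IsWeakGradient.neg (hf : IsWeakGradient f X) :
    IsWeakGradient (fun z => - f z) (fun z => - X z) := by
  simpa using hf.const_smul (-1)

theorem IsWeakGradient.sub (hf : IsWeakGradient f X) (hg : IsWeakGradient g Y) :
    IsWeakGradient (fun z => f z - g z) (fun z => X z - Y z) := by
  simpa only [sub_eq_add_neg] using hf.add hg.neg

theorem isWeakGradient_zero :
    IsWeakGradient (fun _ : M => (0 : ℝ)) (fun z => (0 : TangentSpace (𝓡 n) z)) := by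
  refine isWeakGradient_iff.2 fun x v => ⟨?_, ?_, ?_⟩
  · exact locallyIntegrableOn_const 0
  · simpa using locallyIntegrableOn_const (E := ℝ) (μ := (volume : Measure 𝔼)) 0
  · simp

theorem IsWeakGradient.sum {ι : Type*} (s : Finset ι) {f : ι → M → ℝ}
    {X : ι → (z : M) → TangentSpace (𝓡 n) z} (h : ∀ i ∈ s, IsWeakGradient (f i) (X i)) :
    IsWeakGradient (fun z => ∑ i ∈ s, f i z) (fun z => ∑ i ∈ s, X i z) := by
  classical
  induction s using Finset.induction_on with
  | empty => simpa using isWeakGradient_zero (n := n) (M := M)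
  | insert a s ha ih =>
    simp only [Finset.sum_insert ha]
    exact (h a (by simp)).add (ih fun i hi => h i (by simp [hi]))

theorem IsWeakGradient.aestronglyMeasurable_inner (hf : IsWeakGradient f X) (x : M) (v : 𝔼) :
    AEStronglyMeasurable (fun y => inner ℝ (X ((chartAt 𝔼 x).symm y)) (chartVector x y v))
      (volume.restrict (chartAt 𝔼 x).target) :=
  (isWeakGradient_iff.1 hf x v).right.aestronglyMeasurable

theorem IsWeakGradient.aestronglyMeasurable_norm (hf : IsWeakGradient f X) :
    AEStronglyMeasurable (fun z => ‖X z‖) (riemannianVolume n M) :=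
  aestronglyMeasurable_norm_of_chart hf.aestronglyMeasurable_inner

theorem IsWeakGradient.aestronglyMeasurable (hf : IsWeakGradient f X) :
    AEStronglyMeasurable f (riemannianVolume n M) :=
  aestronglyMeasurable_of_chart fun x => (isWeakGradient_iff.1 hf x 0).left.aestronglyMeasurable

/-- The `L^p` norms are compared on a compact part of the chart, and there finite measure gives `L^p
⊆ L¹`. This reduces local integrability to global `L^p` bounds. -/
theorem exists_eLpNorm_one_chart_le (hp : 1 ≤ p) (x : M) {K : Set 𝔼} (hK : IsCompact K)
    (hKt : K ⊆ (chartAt 𝔼 x).target) :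
    ∃ C : ℝ≥0, ∀ f : M → ℝ, AEStronglyMeasurable f (riemannianVolume n M) →
      eLpNorm (fun y => f ((chartAt 𝔼 x).symm y)) 1 (volume.restrict K) ≤
        C * eLpNorm f p (riemannianVolume n M) := by
  obtain ⟨C, hC⟩ := exists_eLpNorm_chart_le x hK hKt p
  have hfin : (volume.restrict K univ) ^ (1 / (1 : ℝ≥0∞).toReal - 1 / p.toReal) ≠ ⊤ := by
    refine ENNReal.rpow_ne_top_of_nonneg ?_ (by simpa using hK.measure_lt_top.ne)
    rcases eq_or_ne p ⊤ with rfl | hpt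
    · simp
    · have : (1 : ℝ) ≤ p.toReal := by simpa using ENNReal.toReal_mono hpt hp
      simpa using inv_le_one_of_one_le₀ this
  refine ⟨C * ENNReal.toNNReal
    ((volume.restrict K univ) ^ (1 / (1 : ℝ≥0∞).toReal - 1 / p.toReal)), fun f hf => ?_⟩
  have hm := (aestronglyMeasurable_chart hf x).mono_measure (Measure.restrict_mono hKt le_rfl)
  refine (eLpNorm_le_eLpNorm_mul_rpow_measure_univ hp hm).trans ?_
  rw [ENNReal.coe_mul, ENNReal.coe_toNNReal hfin, mul_right_comm]
  gcongr
  exact hC f hf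

theorem locallyIntegrableOn_chart_of_memLp (hp : 1 ≤ p)
    (hf : MemLp f p (riemannianVolume n M)) (x : M) :
    LocallyIntegrableOn (fun y => f ((chartAt 𝔼 x).symm y)) (chartAt 𝔼 x).target volume := by
  refine (locallyIntegrableOn_iff (chartAt 𝔼 x).open_target.isLocallyClosed).2 fun K hKt hK => ?_
  obtain ⟨C, hC⟩ := exists_eLpNorm_one_chart_le hp x hK hKt
  refine memLp_one_iff_integrable.1 ⟨(aestronglyMeasurable_chart hf.1 x).mono_measure
    (Measure.restrict_mono hKt le_rfl), (hC f hf.1).trans_lt ?_⟩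
  exact ENNReal.mul_lt_top ENNReal.coe_lt_top hf.2

theorem exists_eLpNorm_inner_chart_le_restrict (q : ℝ≥0∞) (x : M) {K : Set 𝔼} (hK : IsCompact K)
    (hKt : K ⊆ (chartAt 𝔼 x).target) (v : 𝔼) :
    ∃ C : ℝ≥0, ∀ X : (z : M) → TangentSpace (𝓡 n) z,
      eLpNorm (fun y => inner ℝ (X ((chartAt 𝔼 x).symm y)) (chartVector x y v)) q
          (volume.restrict K) ≤
        C * eLpNorm (fun y => ‖X ((chartAt 𝔼 x).symm y)‖) q (volume.restrict K) := by
  obtain ⟨A, hA, hA1, -⟩ := exists_norm_chartVector_bounds x hK hKt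
  refine ⟨(A * ‖v‖).toNNReal, fun X => ?_⟩
  refine eLpNorm_le_nnreal_smul_eLpNorm_of_ae_le_mul (c := (A * ‖v‖).toNNReal) ?_ q
  filter_upwards [ae_restrict_mem hK.measurableSet] with y hy
  rw [← NNReal.coe_le_coe, NNReal.coe_mul, coe_nnnorm, coe_nnnorm, Real.coe_toNNReal _
    (by positivity), norm_norm, mul_comm]
  exact (norm_inner_le_norm _ _).trans (by gcongr; exact hA1 y hy v)

theorem exists_eLpNorm_inner_chart_le (hp : 1 ≤ p) (x : M) {K : Set 𝔼} (hK : IsCompact K)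
    (hKt : K ⊆ (chartAt 𝔼 x).target) (v : 𝔼) :
    ∃ C : ℝ≥0, ∀ X : (z : M) → TangentSpace (𝓡 n) z,
      AEStronglyMeasurable (fun z => ‖X z‖) (riemannianVolume n M) →
      eLpNorm (fun y => inner ℝ (X ((chartAt 𝔼 x).symm y)) (chartVector x y v)) 1
          (volume.restrict K) ≤
        C * eLpNorm (fun z => ‖X z‖) p (riemannianVolume n M) := by
  obtain ⟨C, hC⟩ := exists_eLpNorm_one_chart_le hp x hK hKt
  obtain ⟨A, hA⟩ := exists_eLpNorm_inner_chart_le_restrict 1 x hK hKt v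
  refine ⟨A * C, fun X hX => ?_⟩
  rw [ENNReal.coe_mul, mul_assoc]
  exact (hA X).trans (mul_le_mul_right (hC _ hX) _)

theorem locallyIntegrableOn_inner_chart (hp : 1 ≤ p)
    (hX : MemLp (fun z => ‖X z‖) p (riemannianVolume n M)) (x : M) (v : 𝔼)
    (hm : AEStronglyMeasurable (fun y => inner ℝ (X ((chartAt 𝔼 x).symm y)) (chartVector x y v))
      (volume.restrict (chartAt 𝔼 x).target)) :
    LocallyIntegrableOn
      (fun y => inner ℝ (X ((chartAt 𝔼 x).symm y)) (chartVector x y v))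
      (chartAt 𝔼 x).target volume := by
  refine (locallyIntegrableOn_iff (chartAt 𝔼 x).open_target.isLocallyClosed).2 fun K hKt hK => ?_
  obtain ⟨C, hC⟩ := exists_eLpNorm_inner_chart_le hp x hK hKt v
  refine memLp_one_iff_integrable.1 ⟨hm.mono_measure (Measure.restrict_mono hKt le_rfl),
    (hC X hX.1).trans_lt ?_⟩
  exact ENNReal.mul_lt_top ENNReal.coe_lt_top hX.2

/-- The product rule for weak gradients. -/
theorem IsWeakGradient.mul (hp : 1 ≤ p) (hf : IsWeakGradient f X) (hg : IsWeakGradient g Y)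
    (h1 : MemLp (fun z => f z * g z) p (riemannianVolume n M))
    (h2 : MemLp (fun z => ‖X z‖ * g z) p (riemannianVolume n M))
    (h3 : MemLp (fun z => f z * ‖Y z‖) p (riemannianVolume n M)) :
    IsWeakGradient (fun z => f z * g z) (fun z => g z • X z + f z • Y z) := by
  refine isWeakGradient_iff.2 fun x v => ?_
  have hF := isWeakGradient_iff.1 hf x v
  have hG := isWeakGradient_iff.1 hg x v
  have h := hF.mul (chartAt 𝔼 x).open_target hG (locallyIntegrableOn_chart_of_memLp hp h1 x) ?_ ?_
  · refine h.congr_ae (chartAt 𝔼 x).open_target.measurableSet EventuallyEq.rfl (.of_forall ?_)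
    intro y
    simp only [inner_add_left, real_inner_smul_left]
    ring
  · have := locallyIntegrableOn_inner_chart (X := fun z => g z • X z) hp (x := x) (v := v)
      (h2.congr_norm ?_ (.of_forall fun z => ?_)) ?_
    · simpa only [real_inner_smul_left, mul_comm] using this
    · simp only [norm_smul]
      exact hg.aestronglyMeasurable.norm.mul hf.aestronglyMeasurable_norm
    · simp [norm_smul, mul_comm]
    · simp only [real_inner_smul_left]
      exact hG.left.aestronglyMeasurable.mul hF.right.aestronglyMeasurable
  · have := locallyIntegrableOn_inner_chart (X := fun z => f z • Y z) hp (x := x) (v := v)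
      (h3.congr_norm ?_ (.of_forall fun z => ?_)) ?_
    · simpa only [real_inner_smul_left] using this
    · simp only [norm_smul]
      exact hf.aestronglyMeasurable.norm.mul hg.aestronglyMeasurable_norm
    · simp [norm_smul]
    · simp only [real_inner_smul_left]
      exact hF.left.aestronglyMeasurable.mul hG.right.aestronglyMeasurable

end WeakGradient

/-! ### Summation of weak gradients. -/

section Series

/-- On a set of finite measure `L^p` norms control `L¹` norms, so the sum of the absolute values is
integrable there and hence finite almost everywhere. -/
theorem ae_summable_of_tsum_eLpNorm_ne_top {α : Type*} [MeasurableSpace α] {μ : Measure α}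
    [SigmaFinite μ] {p : ℝ≥0∞} (hp : 1 ≤ p) {a : ℕ → α → ℝ} (ha : ∀ j, AEStronglyMeasurable (a j) μ)
    (h : ∑' j, eLpNorm (a j) p μ ≠ ⊤) : ∀ᵐ z ∂μ, Summable fun j => ‖a j z‖ := by
  refine ae_of_forall_measure_lt_top_ae_restrict _ fun s _ hμs => ?_
  have hm : ∀ j, AEStronglyMeasurable (a j) (μ.restrict s) := fun j => (ha j).restrict
  have hfin : (μ.restrict s univ) ^ (1 / (1 : ℝ≥0∞).toReal - 1 / p.toReal) ≠ ⊤ := by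
    refine ENNReal.rpow_ne_top_of_nonneg ?_ (by simpa using hμs.ne)
    rcases eq_or_ne p ⊤ with rfl | hpt
    · simp
    · have : (1 : ℝ) ≤ p.toReal := by simpa using ENNReal.toReal_mono hpt hp
      simpa using inv_le_one_of_one_le₀ this
  have h1 : ∫⁻ z in s, ∑' j, ‖a j z‖ₑ ∂μ ≠ ⊤ := by
    rw [lintegral_tsum fun j => (hm j).enorm]
    refine ne_top_of_le_ne_top (b := (∑' j, eLpNorm (a j) p μ) *
      (μ.restrict s univ) ^ (1 / (1 : ℝ≥0∞).toReal - 1 / p.toReal)) (ENNReal.mul_ne_top h hfin) ?_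
    rw [← ENNReal.tsum_mul_right]
    refine ENNReal.tsum_le_tsum fun j => ?_
    rw [← eLpNorm_one_eq_lintegral_enorm]
    refine (eLpNorm_le_eLpNorm_mul_rpow_measure_univ hp (hm j)).trans ?_
    gcongr
    exact Measure.restrict_le_self
  filter_upwards [ae_lt_top' (AEMeasurable.tsum fun j => (hm j).enorm) h1] with z hz
  have := ENNReal.summable_toReal hz.ne
  simpa using this

theorem enorm_inner_sum_sub_inner_tsum_le {F : Type*} [NormedAddCommGroup F]
    [InnerProductSpace ℝ F] [CompleteSpace F] {a : ℕ → F} (ha : Summable fun j => ‖a j‖) (k : ℕ)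
    (w : F) : ‖inner ℝ (∑ j ∈ Finset.range k, a j) w - inner ℝ (∑' j, a j) w‖ₑ ≤
      ∑' j, ‖inner ℝ (a (j + k)) w‖ₑ := by
  have hs := Summable.of_norm ha
  rw [← hs.sum_add_tsum_nat_add k, inner_add_left, sub_add_cancel_left, enorm_neg]
  have hsk : HasSum (fun j => a (j + k)) _ := ((summable_nat_add_iff k).2 hs).hasSum
  have h2 : HasSum (fun j => inner ℝ (a (j + k)) w) (inner ℝ (∑' j, a (j + k)) w) := by
    have := hsk.mapL (innerSL ℝ w)
    simpa only [innerSL_apply_apply, real_inner_comm] using this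
  rw [← h2.tsum_eq]
  exact enorm_tsum_le_tsum_enorm

variable {n : ℕ} {M : Type*} [MetricSpace M] [SecondCountableTopology M]
  [MeasurableSpace M] [BorelSpace M] [ChartedSpace (EuclideanSpace ℝ (Fin n)) M]
  [IsManifold (𝓡 n) ∞ M]
  [RiemannianBundle (fun x : M => TangentSpace (𝓡 n) x)]
  [IsContMDiffRiemannianBundle (𝓡 n) ∞ (EuclideanSpace ℝ (Fin n))
      (fun x : M => TangentSpace (𝓡 n) x)]

local notation "𝔼" => EuclideanSpace ℝ (Fin n)

/-- Weak gradients can be summed: if `∑ uⱼ = u` in `L^p` and `∑ ‖∇uⱼ‖_p < ∞`, then `u` has a weak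
gradient in `L^p`. -/
theorem exists_isWeakGradient_of_series {p : ℝ≥0∞} (hp : 1 ≤ p) {u : M → ℝ} {uj : ℕ → M → ℝ}
    {X : ℕ → (z : M) → TangentSpace (𝓡 n) z} (hX : ∀ j, IsWeakGradient (uj j) (X j))
    (hu : MemLp u p (riemannianVolume n M))
    (hlim : Tendsto (fun k => eLpNorm (fun z => ∑ j ∈ Finset.range k, uj j z - u z) p
      (riemannianVolume n M)) atTop (𝓝 0))
    (hsum : ∑' j, eLpNorm (fun z => ‖X j z‖) p (riemannianVolume n M) ≠ ⊤) :
    ∃ Z : (z : M) → TangentSpace (𝓡 n) z, IsWeakGradient u Z ∧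
      eLpNorm (fun z => ‖Z z‖) p (riemannianVolume n M) ≤
        ∑' j, eLpNorm (fun z => ‖X j z‖) p (riemannianVolume n M) := by
  have := riemannianVolume_isLocallyFinite (n := n) (M := M)
  set μ := riemannianVolume n M with hμ
  let P : ℕ → (z : M) → TangentSpace (𝓡 n) z := fun k z => ∑ j ∈ Finset.range k, X j z
  have hP : ∀ k, IsWeakGradient (fun z => ∑ j ∈ Finset.range k, uj j z) (P k) := fun k =>
    IsWeakGradient.sum _ fun j _ => hX j
  -- The limit field is the pointwise sum of the series in each tangent space, absolutely convergent
  -- almost everywhere. No Banach space of `L^p` vector fields is required.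
  let Z : (z : M) → TangentSpace (𝓡 n) z := fun z => ∑' j, X j z
  have hs := ae_summable_of_tsum_eLpNorm_ne_top hp (fun j => (hX j).aestronglyMeasurable_norm) hsum
  simp only [norm_norm] at hs
  have hPZ : ∀ᵐ z ∂μ, Tendsto (fun k => P k z) atTop (𝓝 (Z z)) := by
    filter_upwards [hs] with z hz
    have := completeSpace_tangentSpace (n := n) z
    exact (Summable.of_norm hz).hasSum.tendsto_sum_nat
  have hPn : ∀ k, eLpNorm (fun z => ‖P k z‖) p μ ≤ ∑' j, eLpNorm (fun z => ‖X j z‖) p μ := by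
    intro k
    calc eLpNorm (fun z => ‖P k z‖) p μ ≤ eLpNorm (∑ j ∈ Finset.range k, fun z => ‖X j z‖) p μ := by
          refine eLpNorm_mono_real fun z => ?_
          rw [norm_norm, Finset.sum_apply]
          exact norm_sum_le _ _
      _ ≤ ∑ j ∈ Finset.range k, eLpNorm (fun z => ‖X j z‖) p μ :=
          eLpNorm_sum_le (fun j _ => (hX j).aestronglyMeasurable_norm) hp
      _ ≤ _ := ENNReal.sum_le_tsum _
  have hcompm : ∀ (x : M) (v : 𝔼), AEStronglyMeasurable
      (fun y => inner ℝ (Z ((chartAt 𝔼 x).symm y)) (chartVector x y v))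
      (volume.restrict (chartAt 𝔼 x).target) := by
    intro x v
    refine aestronglyMeasurable_of_tendsto_ae atTop
      (fun k => (hP k).aestronglyMeasurable_inner x v) ?_
    filter_upwards [ae_chart_of_ae hPZ x] with y hy
    exact hy.inner tendsto_const_nhds
  have hZm : AEStronglyMeasurable (fun z => ‖Z z‖) μ := aestronglyMeasurable_norm_of_chart hcompm
  have hZn : eLpNorm (fun z => ‖Z z‖) p μ ≤ ∑' j, eLpNorm (fun z => ‖X j z‖) p μ := by
    -- Fatou: the partial sums obey the bound uniformly and their lengths converge almost
    -- everywhere.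
    refine (Lp.eLpNorm_lim_le_liminf_eLpNorm (fun k => (hP k).aestronglyMeasurable_norm) _ ?_).trans
      ?_
    · filter_upwards [hPZ] with z hz using hz.norm
    · refine liminf_le_of_le (by isBoundedDefault) fun b hb => ?_
      obtain ⟨k, hk⟩ := hb.exists
      exact hk.trans (hPn k)
  have hZmem : MemLp (fun z => ‖Z z‖) p μ := ⟨hZm, hZn.trans_lt (lt_top_iff_ne_top.2 hsum)⟩
  refine ⟨Z, isWeakGradient_iff.2 fun x v => ?_, hZn⟩
  refine HasWeakDeriv.of_tendsto (fun k => isWeakGradient_iff.1 (hP k) x v)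
    (locallyIntegrableOn_chart_of_memLp hp hu x)
    (locallyIntegrableOn_inner_chart hp hZmem x v (hcompm x v)) ?_ ?_
  · intro K hKt hK
    obtain ⟨C, hC⟩ := exists_eLpNorm_one_chart_le hp x hK hKt
    refine tendsto_of_tendsto_of_tendsto_of_le_of_le tendsto_const_nhds
      (h := fun k => C * eLpNorm (fun z => ∑ j ∈ Finset.range k, uj j z - u z) p μ) ?_
      (fun k => zero_le) fun k => ?_
    swap
    · have hm : AEStronglyMeasurable (fun z => ∑ j ∈ Finset.range k, uj j z - u z) μ :=
        (hP k).aestronglyMeasurable.sub hu.1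
      have h := hC (fun z => ∑ j ∈ Finset.range k, uj j z - u z) hm
      exact h
    simpa using ENNReal.Tendsto.const_mul hlim (Or.inr ENNReal.coe_ne_top)
  · intro K hKt hK
    obtain ⟨C, hC⟩ := exists_eLpNorm_inner_chart_le hp x hK hKt v
    -- The components of the partial sums approach those of `Z` in `L¹(K)` at the rate of the tail
    -- of the series of norms.
    have htail : Tendsto (fun k => C * ∑' j, eLpNorm (fun z => ‖X (j + k) z‖) p μ) atTop (𝓝 0) := by
      simpa using ENNReal.Tendsto.const_mul (ENNReal.tendsto_sum_nat_add _ hsum)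
        (Or.inr ENNReal.coe_ne_top)
    refine tendsto_of_tendsto_of_tendsto_of_le_of_le tendsto_const_nhds htail (fun k => zero_le)
      fun k => ?_
    have hae : ∀ᵐ y ∂(volume.restrict K),
        ‖inner ℝ (P k ((chartAt 𝔼 x).symm y)) (chartVector x y v) -
          inner ℝ (Z ((chartAt 𝔼 x).symm y)) (chartVector x y v)‖ₑ ≤
        ∑' j, ‖inner ℝ (X (j + k) ((chartAt 𝔼 x).symm y)) (chartVector x y v)‖ₑ := by
      filter_upwards [ae_mono (Measure.restrict_mono hKt le_rfl) (ae_chart_of_ae hs x)] with y hy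
      have := completeSpace_tangentSpace (n := n) ((chartAt 𝔼 x).symm y)
      exact enorm_inner_sum_sub_inner_tsum_le hy k _
    calc eLpNorm ((fun y => inner ℝ (P k ((chartAt 𝔼 x).symm y)) (chartVector x y v)) - fun y =>
            inner ℝ (Z ((chartAt 𝔼 x).symm y)) (chartVector x y v)) 1 (volume.restrict K)
        ≤ ∫⁻ y in K, ∑' j, ‖inner ℝ (X (j + k) ((chartAt 𝔼 x).symm y)) (chartVector x y v)‖ₑ := by
          rw [eLpNorm_one_eq_lintegral_enorm]
          exact lintegral_mono_ae hae
      _ = ∑' j, ∫⁻ y in K, ‖inner ℝ (X (j + k) ((chartAt 𝔼 x).symm y)) (chartVector x y v)‖ₑ :=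
          lintegral_tsum fun j => (((hX (j + k)).aestronglyMeasurable_inner x v).mono_measure
            (Measure.restrict_mono hKt le_rfl)).enorm
      _ ≤ ∑' j, C * eLpNorm (fun z => ‖X (j + k) z‖) p μ := by
          refine ENNReal.tsum_le_tsum fun j => ?_
          rw [← eLpNorm_one_eq_lintegral_enorm]
          exact hC _ (hX (j + k)).aestronglyMeasurable_norm
      _ = _ := ENNReal.tsum_mul_left

end Series


/-! ### Approximation by functions with compact support. -/

theorem tendsto_eLpNorm_zero_of_dominated {α : Type*} [MeasurableSpace α] {μ : Measure α}
    {r : ℝ≥0∞} (hr0 : r ≠ 0) (hr : r ≠ ⊤) {f : ℕ → α → ℝ} {g : α → ℝ} (hg : MemLp g r μ)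
    (hf : ∀ k, AEStronglyMeasurable (f k) μ) (hfg : ∀ k, ∀ᵐ z ∂μ, ‖f k z‖ ≤ ‖g z‖)
    (hlim : ∀ᵐ z ∂μ, Tendsto (fun k => f k z) atTop (𝓝 0)) :
    Tendsto (fun k => eLpNorm (f k) r μ) atTop (𝓝 0) := by
  have hrr : 0 < r.toReal := ENNReal.toReal_pos hr0 hr
  simp only [eLpNorm_eq_lintegral_rpow_enorm_toReal hr0 hr]
  have h := tendsto_lintegral_of_dominated_convergence' (μ := μ) (f := fun _ => 0)
    (F := fun k z => ‖f k z‖ₑ ^ r.toReal) (fun z => ‖g z‖ₑ ^ r.toReal)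
    (fun k => (hf k).enorm.pow_const _)
    (fun k => by
      filter_upwards [hfg k] with z hz
      exact ENNReal.rpow_le_rpow (enorm_le_iff_norm_le.2 hz) hrr.le)
    (by
      have := hg.2
      rw [eLpNorm_lt_top_iff_lintegral_rpow_enorm_lt_top hr0 hr] at this
      exact this.ne)
    (by
      filter_upwards [hlim] with z hz
      have h1 : Tendsto (fun k => ‖f k z‖ₑ) atTop (𝓝 0) := by simpa using hz.enorm
      have h2 := h1.ennrpow_const r.toReal
      rwa [ENNReal.zero_rpow_of_pos hrr] at h2)
  simp only [lintegral_zero] at h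
  have h2 := h.ennrpow_const (1 / r.toReal)
  rwa [ENNReal.zero_rpow_of_pos (by positivity)] at h2

section Density

variable {n : ℕ} {M : Type*} [MetricSpace M] [SecondCountableTopology M]
  [MeasurableSpace M] [BorelSpace M] [ChartedSpace (EuclideanSpace ℝ (Fin n)) M]
  [IsManifold (𝓡 n) ∞ M]
  [RiemannianBundle (fun x : M => TangentSpace (𝓡 n) x)]
  [IsContMDiffRiemannianBundle (𝓡 n) ∞ (EuclideanSpace ℝ (Fin n))
      (fun x : M => TangentSpace (𝓡 n) x)]

local notation "𝔼" => EuclideanSpace ℝ (Fin n)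

theorem mgrad_eq_zero_of_notMem_tsupport {f : M → ℝ} {z : M} (hz : z ∉ tsupport f) :
    mgrad (n := n) f z = 0 := by
  have h0 : f =ᶠ[𝓝 z] fun _ => 0 := notMem_tsupport_iff_eventuallyEq.1 hz
  rw [← inner_self_eq_zero (𝕜 := ℝ), inner_mgrad, h0.mfderiv_eq, mfderiv_const]
  rfl

/-- Applied to the members of a partition of unity, so that multiplication by them preserves
gradients in `L^r`. -/
theorem exists_norm_mgrad_le_on_compact {f : M → ℝ} (hf : ContMDiff (𝓡 n) 𝓘(ℝ, ℝ) ∞ f) (x : M)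
    {S : Set M} (hS : IsCompact S) (hSx : S ⊆ (chartAt 𝔼 x).source) :
    ∃ C : ℝ, 0 ≤ C ∧ ∀ z ∈ S, ‖mgrad (n := n) f z‖ ≤ C := by
  set K := chartAt 𝔼 x '' S with hK
  have hKc : IsCompact K := hS.image_of_continuousOn ((chartAt 𝔼 x).continuousOn.mono hSx)
  have hKt : K ⊆ (chartAt 𝔼 x).target := by
    rintro _ ⟨z, hz, rfl⟩
    exact (chartAt 𝔼 x).map_source (hSx hz)
  obtain ⟨C, hC, h⟩ := exists_norm_le_sum_inner (n := n) x hKc hKt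
  have hcont : ContinuousOn (fun y => ∑ i : Fin n, |fderiv ℝ (fun y => f ((chartAt 𝔼 x).symm y)) y
      (EuclideanSpace.single i (1 : ℝ))|) K := by
    refine continuousOn_finsetSum _ fun i _ => ContinuousOn.abs ?_
    exact (((contDiffOn_chart hf x).continuousOn_fderiv_of_isOpen (chartAt 𝔼 x).open_target
      (by simp)).mono hKt).clm_apply continuousOn_const
  obtain ⟨B, hB⟩ := hKc.exists_bound_of_continuousOn hcont
  refine ⟨C * max B 0, by positivity, fun z hz => ?_⟩
  have hzK : chartAt 𝔼 x z ∈ K := ⟨z, hz, rfl⟩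
  have h1 := h _ hzK (mgrad (n := n) f ((chartAt 𝔼 x).symm (chartAt 𝔼 x z)))
  have h2 : ∀ i : Fin n, inner ℝ (mgrad (n := n) f ((chartAt 𝔼 x).symm (chartAt 𝔼 x z)))
      (chartVector x (chartAt 𝔼 x z) (EuclideanSpace.single i (1 : ℝ))) =
      fderiv ℝ (fun y => f ((chartAt 𝔼 x).symm y)) (chartAt 𝔼 x z)
        (EuclideanSpace.single i (1 : ℝ)) := fun i =>
    inner_mgrad_chartVector x (hKt hzK) ((hf.mdifferentiable (by simp)) _) _
  simp only [h2] at h1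
  rw [(chartAt 𝔼 x).left_inv (hSx hz)] at h1
  refine h1.trans ?_
  gcongr
  exact (le_abs_self _).trans ((hB _ hzK).trans (le_max_left _ _))

/-- The distance cutoff. -/
noncomputable def distCutoff (o : M) (k : ℕ) (z : M) : ℝ :=
  max (min 1 (2 - dist o z / ((k : ℝ) + 1))) 0

theorem distCutoff_mem (o : M) (k : ℕ) (z : M) : distCutoff o k z ∈ Icc (0 : ℝ) 1 :=
  ⟨le_max_right _ _, max_le (min_le_left _ _) zero_le_one⟩

theorem lipschitzWith_distCutoff (o : M) (k : ℕ) :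
    LipschitzWith (1 / ((k : ℝ≥0) + 1)) (distCutoff o k) := by
  refine LipschitzWith.max_const (LipschitzWith.const_min ?_ 1) 0
  refine LipschitzWith.of_dist_le_mul fun a b => ?_
  have h : |dist o a - dist o b| ≤ dist a b := by
    rw [dist_comm o a, dist_comm o b]; exact abs_dist_sub_le a b o
  push_cast
  rw [Real.dist_eq, sub_sub_sub_cancel_left, ← sub_div, abs_div, abs_sub_comm,
    abs_of_pos (by positivity : (0 : ℝ) < (k : ℝ) + 1), div_mul_eq_mul_div, one_mul]
  gcongr

theorem distCutoff_eq_one {o z : M} {k : ℕ} (h : dist o z ≤ (k : ℝ) + 1) :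
    distCutoff o k z = 1 := by
  have : dist o z / ((k : ℝ) + 1) ≤ 1 := (div_le_one (by positivity)).2 h
  rw [distCutoff, min_eq_left (by linarith), max_eq_left zero_le_one]

theorem tsupport_distCutoff_subset (o : M) (k : ℕ) :
    tsupport (distCutoff o k) ⊆ Metric.closedBall o (2 * ((k : ℝ) + 1)) := by
  refine closure_minimal (fun z hz => ?_) Metric.isClosed_closedBall
  by_contra hzb
  rw [Metric.mem_closedBall, not_le, dist_comm] at hzb
  apply hz
  have : 2 ≤ dist o z / ((k : ℝ) + 1) := (le_div_iff₀ (by positivity)).2 hzb.le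
  rw [distCutoff, max_eq_right]
  exact (min_le_right _ _).trans (by linarith)

/-- Multiply by the distance cutoffs `χₖ`. The unwanted term `u ∇χₖ` has length at most `|u| / (k +
1)`, and properness of `M` makes the supports compact. -/
theorem exists_compact_support_approx [ProperSpace M] [IsRiemannianManifold (𝓡 n) M] [Nonempty M]
    {r : ℝ≥0∞} (hr1 : 1 ≤ r) (hr : r ≠ ⊤) {u : M → ℝ} {X : (z : M) → TangentSpace (𝓡 n) z}
    (hX : IsWeakGradient u X) (hu : MemLp u r (riemannianVolume n M))
    (hXr : MemLp (fun z => ‖X z‖) r (riemannianVolume n M)) {ε : ℝ≥0∞} (hε : ε ≠ 0) :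
    ∃ (u' : M → ℝ) (X' : (z : M) → TangentSpace (𝓡 n) z) (T : Set M),
      IsWeakGradient u' X' ∧ MemLp u' r (riemannianVolume n M) ∧
      MemLp (fun z => ‖X' z‖) r (riemannianVolume n M) ∧ IsCompact T ∧
      (∀ z ∉ T, u' z = 0 ∧ X' z = 0) ∧
      eLpNorm (fun z => u z - u' z) r (riemannianVolume n M) ≤ ε ∧
      eLpNorm (fun z => ‖X z - X' z‖) r (riemannianVolume n M) ≤ ε := by
  set μ := riemannianVolume n M
  have hr0 : r ≠ 0 := (zero_lt_one.trans_le hr1).ne'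
  let o : M := Classical.arbitrary M
  let χ : ℕ → M → ℝ := distCutoff o
  have hχ1 : ∀ k z, ‖χ k z‖ ≤ 1 := fun k z => by
    rw [Real.norm_of_nonneg (distCutoff_mem o k z).1]; exact (distCutoff_mem o k z).2
  have hχc : ∀ k, Continuous (χ k) := fun k => (lipschitzWith_distCutoff o k).continuous
  have hχg : ∀ k, IsWeakGradient (χ k) (mgrad (n := n) (χ k)) := fun k =>
    isWeakGradient_mgrad fun x => locallyLipschitzOn_chart (lipschitzWith_distCutoff o k) x
  have hχn : ∀ k z, ‖mgrad (n := n) (χ k) z‖ ≤ 1 / ((k : ℝ) + 1) := fun k z =>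
    (norm_mgrad_le (lipschitzWith_distCutoff o k) z).trans_eq (by push_cast; rfl)
  have hχev : ∀ z, ∀ᶠ k in atTop, χ k z = 1 := fun z => by
    obtain ⟨N, hN⟩ := exists_nat_ge (dist o z)
    filter_upwards [eventually_ge_atTop N] with k hk
    refine distCutoff_eq_one (hN.trans ?_)
    have : (N : ℝ) ≤ k := by exact_mod_cast hk
    linarith
  have m1 : ∀ k, MemLp (fun z => u z * χ k z) r μ := fun k =>
    hu.of_le (hu.1.mul (hχc k).aestronglyMeasurable) (.of_forall fun z => by
      rw [norm_mul]; exact mul_le_of_le_one_right (norm_nonneg _) (hχ1 k z))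
  have m2 : ∀ k, MemLp (fun z => ‖X z‖ * χ k z) r μ := fun k =>
    hXr.of_le (hXr.1.mul (hχc k).aestronglyMeasurable) (.of_forall fun z => by
      rw [norm_mul]; exact mul_le_of_le_one_right (norm_nonneg _) (hχ1 k z))
  have hk1 : ∀ k : ℕ, 1 / ((k : ℝ) + 1) ≤ 1 := fun k => by
    rw [div_le_one (by positivity)]; linarith [(Nat.cast_nonneg k : (0 : ℝ) ≤ k)]
  have m3 : ∀ k, MemLp (fun z => u z * ‖mgrad (n := n) (χ k) z‖) r μ := fun k =>
    hu.of_le (hu.1.mul (hχg k).aestronglyMeasurable_norm) (.of_forall fun z => by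
      rw [norm_mul, norm_norm]
      exact mul_le_of_le_one_right (norm_nonneg _) ((hχn k z).trans (hk1 k)))
  have hprod : ∀ k, IsWeakGradient (fun z => u z * χ k z)
      (fun z => χ k z • X z + u z • mgrad (n := n) (χ k) z) := fun k =>
    hX.mul hr1 (hχg k) (m1 k) (m2 k) (m3 k)
  have l1 : Tendsto (fun k => eLpNorm (fun z => u z - u z * χ k z) r μ) atTop (𝓝 0) := by
    refine tendsto_eLpNorm_zero_of_dominated hr0 hr hu (fun k => hu.1.sub (m1 k).1) (fun k => ?_) ?_
    · refine .of_forall fun z => ?_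
      rw [← mul_one_sub, norm_mul]
      refine mul_le_of_le_one_right (norm_nonneg _) ?_
      have := distCutoff_mem o k z
      rw [Real.norm_of_nonneg (sub_nonneg.2 this.2)]
      linarith [this.1]
    · refine .of_forall fun z => tendsto_const_nhds.congr' ?_
      filter_upwards [hχev z] with k hk
      rw [hk]; simp
  -- The integrand is dominated by `‖X‖ + |u|`. At a given point `χₖ = 1` eventually, and then only
  -- `u ∇χₖ` remains.
  have l2 : Tendsto (fun k => eLpNorm (fun z => ‖X z - (χ k z • X z + u z • mgrad (n := n) (χ k) z)‖)
      r μ) atTop (𝓝 0) := by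
    refine tendsto_eLpNorm_zero_of_dominated hr0 hr (hXr.add hu.norm)
      (fun k => (hX.sub (hprod k)).aestronglyMeasurable_norm) (fun k => ?_) ?_
    · refine .of_forall fun z => ?_
      have := distCutoff_mem o k z
      have e : X z - (χ k z • X z + u z • mgrad (n := n) (χ k) z) =
          (1 - χ k z) • X z - u z • mgrad (n := n) (χ k) z := by
        rw [sub_smul, one_smul]; abel
      rw [e, norm_norm, Pi.add_apply, Real.norm_of_nonneg (by positivity : 0 ≤ ‖X z‖ + ‖u z‖)]
      refine (norm_sub_le _ _).trans (add_le_add ?_ ?_)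
      · rw [norm_smul]
        refine mul_le_of_le_one_left (norm_nonneg _) ?_
        rw [Real.norm_of_nonneg (sub_nonneg.2 this.2)]
        linarith [this.1]
      · rw [norm_smul]
        exact mul_le_of_le_one_right (norm_nonneg _) ((hχn k z).trans (hk1 k))
    · refine .of_forall fun z => ?_
      have h0 : Tendsto (fun k : ℕ => ‖u z‖ * (1 / ((k : ℝ) + 1))) atTop (𝓝 0) := by
        simpa using tendsto_one_div_add_atTop_nhds_zero_nat.const_mul ‖u z‖
      refine squeeze_zero' (.of_forall fun k => norm_nonneg _) ?_ h0
      filter_upwards [hχev z] with k hk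
      rw [hk, one_smul, sub_add_cancel_left, norm_neg, norm_smul]
      gcongr
      exact hχn k z
  obtain ⟨k, hk1, hk2⟩ := ((ENNReal.tendsto_nhds_zero.1 l1 ε (pos_iff_ne_zero.2 hε)).and
    (ENNReal.tendsto_nhds_zero.1 l2 ε (pos_iff_ne_zero.2 hε))).exists
  refine ⟨_, _, tsupport (χ k), hprod k, m1 k, ?_, ?_, ?_, hk1, hk2⟩
  · refine ((m2 k).norm.add (m3 k).norm).of_le (hprod k).aestronglyMeasurable_norm
      (.of_forall fun z => ?_)
    rw [norm_norm, Pi.add_apply]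
    refine (norm_add_le _ _).trans (le_trans (le_of_eq ?_) (le_abs_self _))
    simp only [norm_smul, norm_mul, norm_norm]
    ring
  · exact (isCompact_closedBall o _).of_isClosed_subset (isClosed_tsupport _)
      (tsupport_distCutoff_subset o k)
  · intro z hz
    simp [image_eq_zero_of_notMem_tsupport hz, mgrad_eq_zero_of_notMem_tsupport hz]

end Density


/-! ### Density of smooth functions with compact support. -/

section Density

variable {n : ℕ} {M : Type*} [MetricSpace M] [SecondCountableTopology M]
  [MeasurableSpace M] [BorelSpace M] [ChartedSpace (EuclideanSpace ℝ (Fin n)) M]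
  [IsManifold (𝓡 n) ∞ M]
  [RiemannianBundle (fun x : M => TangentSpace (𝓡 n) x)]
  [IsContMDiffRiemannianBundle (𝓡 n) ∞ (EuclideanSpace ℝ (Fin n))
      (fun x : M => TangentSpace (𝓡 n) x)]

local notation "𝔼" => EuclideanSpace ℝ (Fin n)

/-- A function on the target of a chart, transported to the manifold. -/
noncomputable def chartPull (x : M) (F : 𝔼 → ℝ) : M → ℝ :=
  (chartAt 𝔼 x).source.indicator fun z => F (chartAt 𝔼 x z)

theorem chartPull_symm (x : M) (F : 𝔼 → ℝ) {y : 𝔼} (hy : y ∈ (chartAt 𝔼 x).target) :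
    chartPull x F ((chartAt 𝔼 x).symm y) = F y := by
  rw [chartPull, indicator_of_mem ((chartAt 𝔼 x).map_target hy), (chartAt 𝔼 x).right_inv hy]

theorem chartPull_eq_zero (x : M) {F : 𝔼 → ℝ} {K : Set 𝔼} (hF : ∀ y ∉ K, F y = 0) {z : M}
    (hz : z ∉ (chartAt 𝔼 x).symm '' K) : chartPull x F z = 0 := by
  by_cases hzs : z ∈ (chartAt 𝔼 x).source
  · rw [chartPull, indicator_of_mem hzs]
    exact hF _ fun h => hz ⟨_, h, (chartAt 𝔼 x).left_inv hzs⟩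
  · exact indicator_of_notMem hzs _

theorem tsupport_chartPull_subset (x : M) {F : 𝔼 → ℝ} {K : Set 𝔼} (hK : IsCompact K)
    (hKt : K ⊆ (chartAt 𝔼 x).target) (hF : ∀ y ∉ K, F y = 0) :
    tsupport (chartPull x F) ⊆ (chartAt 𝔼 x).symm '' K := by
  have hc : IsCompact ((chartAt 𝔼 x).symm '' K) :=
    hK.image_of_continuousOn ((chartAt 𝔼 x).continuousOn_symm.mono hKt)
  refine closure_minimal (fun z hz => ?_) hc.isClosed
  by_contra h
  exact hz (chartPull_eq_zero x hF h)

theorem contMDiff_chartPull (x : M) {F : 𝔼 → ℝ} {K : Set 𝔼} (hK : IsCompact K)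
    (hKt : K ⊆ (chartAt 𝔼 x).target) (hF : ∀ y ∉ K, F y = 0) (hs : ContDiff ℝ ∞ F) :
    ContMDiff (𝓡 n) 𝓘(ℝ, ℝ) ∞ (chartPull x F) := by
  intro z
  by_cases hz : z ∈ (chartAt 𝔼 x).source
  · have h1 : ContMDiffAt (𝓡 n) (𝓡 n) ∞ (chartAt 𝔼 x) z :=
      contMDiffOn_chart.contMDiffAt ((chartAt 𝔼 x).open_source.mem_nhds hz)
    refine (hs.contMDiff.contMDiffAt.comp z h1).congr_of_eventuallyEq ?_
    filter_upwards [(chartAt 𝔼 x).open_source.mem_nhds hz] with z' hz'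
    exact indicator_of_mem hz' _
  · have h0 : z ∉ tsupport (chartPull x F) := fun h => by
      obtain ⟨y, hy, rfl⟩ := tsupport_chartPull_subset x hK hKt hF h
      exact hz ((chartAt 𝔼 x).map_target (hKt hy))
    exact contMDiffAt_const.congr_of_eventuallyEq (notMem_tsupport_iff_eventuallyEq.1 h0)

theorem fderiv_chartPull_symm (x : M) (F : 𝔼 → ℝ) {y : 𝔼} (hy : y ∈ (chartAt 𝔼 x).target) :
    fderiv ℝ (fun y => chartPull x F ((chartAt 𝔼 x).symm y)) y = fderiv ℝ F y := by
  refine Filter.EventuallyEq.fderiv_eq ?_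
  filter_upwards [(chartAt 𝔼 x).open_target.mem_nhds hy] with y' hy'
  exact chartPull_symm x F hy'

/-- Transport `w` to the chart, extend it by zero, mollify and transport back. Mollification
commutes with the weak partial derivatives, which control the length of the gradient on compact
sets. -/
theorem exists_contMDiff_approx_of_chart {r : ℝ≥0∞} (hr1 : 1 ≤ r) (hr : r ≠ ⊤) (x : M)
    {w : M → ℝ} {W : (z : M) → TangentSpace (𝓡 n) z} (hW : IsWeakGradient w W)
    (hw : MemLp w r (riemannianVolume n M))
    (hWr : MemLp (fun z => ‖W z‖) r (riemannianVolume n M)) {S : Set M} (hS : IsCompact S)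
    (hSx : S ⊆ (chartAt 𝔼 x).source) (h0 : ∀ z ∉ S, w z = 0 ∧ W z = 0)
    {ε : ℝ≥0∞} (hε : ε ≠ 0) :
    ∃ (φ : M → ℝ) (Y : (z : M) → TangentSpace (𝓡 n) z), ContMDiff (𝓡 n) 𝓘(ℝ, ℝ) ∞ φ ∧
      HasCompactSupport φ ∧ IsWeakGradient φ Y ∧
      eLpNorm (fun z => w z - φ z) r (riemannianVolume n M) ≤ ε ∧
      eLpNorm (fun z => ‖W z - Y z‖) r (riemannianVolume n M) ≤ ε := by
  set μ := riemannianVolume n M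
  set K := chartAt 𝔼 x '' S with hK
  have hKc : IsCompact K := hS.image_of_continuousOn ((chartAt 𝔼 x).continuousOn.mono hSx)
  have hKt : K ⊆ (chartAt 𝔼 x).target := by
    rintro _ ⟨z, hz, rfl⟩
    exact (chartAt 𝔼 x).map_source (hSx hz)
  have h0K : ∀ y ∈ (chartAt 𝔼 x).target, y ∉ K →
      w ((chartAt 𝔼 x).symm y) = 0 ∧ W ((chartAt 𝔼 x).symm y) = 0 := fun y hy hyK =>
    h0 _ fun h => hyK ⟨_, h, (chartAt 𝔼 x).right_inv hy⟩
  -- The fixed compact neighbourhood `K'` contains the supports of all mollifications at scales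
  -- below `δ`, so one set of comparison constants serves for all of them.
  obtain ⟨δ, hδ, hδt⟩ := hKc.exists_cthickening_subset_open (chartAt 𝔼 x).open_target hKt
  set K' := Metric.cthickening δ K with hK'
  have hK'c : IsCompact K' := hKc.cthickening
  have hKK' : K ⊆ K' := Metric.self_subset_cthickening K
  -- As `w` already vanishes off `S`, multiplication by `η` changes nothing in the target; it only
  -- erases the junk values of the inverse chart outside.
  obtain ⟨η, hη, hηc, hηt, hη1, -⟩ := exists_smooth_cutoff hKc (chartAt 𝔼 x).open_target hKt
  have hηK : ∀ y ∈ K, η y = 1 := fun y hy => (hη1 y hy).self_of_nhds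
  have hηd : ∀ y ∈ K, fderiv ℝ η y = 0 := fun y hy => by
    rw [(hη1 y hy).fderiv_eq]; simp
  let F : 𝔼 → ℝ := fun y => w ((chartAt 𝔼 x).symm y) * η y
  let G : 𝔼 → 𝔼 → ℝ := fun v y =>
    inner ℝ (W ((chartAt 𝔼 x).symm y)) (chartVector x y v) * η y
  have hηoff : ∀ y ∉ (chartAt 𝔼 x).target, η y = 0 ∧ fderiv ℝ η y = 0 := fun y hy =>
    ⟨image_eq_zero_of_notMem_tsupport fun h => hy (hηt h),
      image_eq_zero_of_notMem_tsupport fun h => hy (hηt (tsupport_fderiv_subset ℝ h))⟩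
  have hFt : ∀ y ∈ (chartAt 𝔼 x).target, F y = w ((chartAt 𝔼 x).symm y) := fun y hy => by
    by_cases hyK : y ∈ K
    · simp [F, hηK y hyK]
    · simp [F, (h0K y hy hyK).1]
  have hGt : ∀ v, ∀ y ∈ (chartAt 𝔼 x).target, G v y =
      inner ℝ (W ((chartAt 𝔼 x).symm y)) (chartVector x y v) := fun v y hy => by
    by_cases hyK : y ∈ K
    · simp [G, hηK y hyK]
    · simp [G, (h0K y hy hyK).2]
  have hF0 : ∀ y ∉ K, F y = 0 := fun y hyK => by
    by_cases hy : y ∈ (chartAt 𝔼 x).target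
    · rw [hFt y hy, (h0K y hy hyK).1]
    · simp [F, (hηoff y hy).1]
  have hG0 : ∀ v, ∀ y ∉ K, G v y = 0 := fun v y hyK => by
    by_cases hy : y ∈ (chartAt 𝔼 x).target
    · rw [hGt v y hy, (h0K y hy hyK).2, inner_zero_left]
    · simp [G, (hηoff y hy).1]
  have hFG : ∀ v, HasWeakDeriv univ F (G v) v := fun v => by
    have h := ((isWeakGradient_iff.1 hW x v).smul_cutoff hη hηc hηt).1
    have e : (fun y => inner ℝ (W ((chartAt 𝔼 x).symm y)) (chartVector x y v) * η y +
        w ((chartAt 𝔼 x).symm y) * fderiv ℝ η y v) = G v := by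
      funext y
      simp only [G, add_eq_left, mul_eq_zero]
      by_cases hyK : y ∈ K
      · right; rw [hηd y hyK]; rfl
      by_cases hy : y ∈ (chartAt 𝔼 x).target
      · exact Or.inl (h0K y hy hyK).1
      · right; rw [(hηoff y hy).2]; rfl
    rw [e] at h
    exact h
  have hFl : LocallyIntegrable F volume := locallyIntegrableOn_univ.1 (hFG 0).left
  have hGl : ∀ v, LocallyIntegrable (G v) volume := fun v =>
    locallyIntegrableOn_univ.1 (hFG v).right
  have hFmem : MemLp F r volume := by
    refine ⟨hFl.aestronglyMeasurable, ?_⟩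
    obtain ⟨C, hC⟩ := exists_eLpNorm_chart_le x hKc hKt r
    rw [← eLpNorm_restrict_eq_of_support_subset (s := K) fun y hy => by
      by_contra h; exact hy (hF0 y h)]
    refine lt_of_le_of_lt ?_ (ENNReal.mul_lt_top (ENNReal.coe_lt_top (r := C)) hw.2)
    refine le_trans (le_of_eq (eLpNorm_congr_ae ?_)) (hC w hw.1)
    filter_upwards [ae_restrict_mem hKc.measurableSet] with y hy using hFt y (hKt hy)
  have hGmem : ∀ v, MemLp (G v) r volume := fun v => by
    refine ⟨(hGl v).aestronglyMeasurable, ?_⟩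
    obtain ⟨C, hC⟩ := exists_eLpNorm_chart_le x hKc hKt r
    obtain ⟨A, hA⟩ := exists_eLpNorm_inner_chart_le_restrict r x hKc hKt v
    rw [← eLpNorm_restrict_eq_of_support_subset (s := K) fun y hy => by
      by_contra h; exact hy (hG0 v y h)]
    refine lt_of_le_of_lt (b := A * (C * eLpNorm (fun z => ‖W z‖) r μ)) ?_
      (ENNReal.mul_lt_top ENNReal.coe_lt_top (ENNReal.mul_lt_top ENNReal.coe_lt_top hWr.2))
    refine le_trans (le_of_eq (eLpNorm_congr_ae ?_)) ((hA W).trans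
      (mul_le_mul_right (hC (fun z => ‖W z‖) hWr.1) _))
    filter_upwards [ae_restrict_mem hKc.measurableSet] with y hy using hGt v y (hKt hy)
  have hkey : ∀ᶠ k : ℕ in atTop, ∀ y ∉ K', mollify k F y = 0 := by
    have h1 := tendsto_one_div_add_atTop_nhds_zero_nat (𝕜 := ℝ)
    filter_upwards [h1.eventually (gt_mem_nhds hδ)] with k hk y hy
    refine image_eq_zero_of_notMem_tsupport fun h => hy ?_
    have h2 := tsupport_mollify_subset k F h
    refine Metric.cthickening_mono hk.le _ (Metric.cthickening_subset_of_subset _ ?_ h2)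
    exact closure_minimal (fun y hy => by by_contra h; exact hy (hF0 y h)) hKc.isClosed
  obtain ⟨C, hC⟩ := exists_eLpNorm_le_chart x hK'c hδt r
  obtain ⟨A, hA0, hA⟩ := exists_norm_le_sum_inner (n := n) x hK'c hδt
  let e : Fin n → 𝔼 := fun i => EuclideanSpace.single i (1 : ℝ)
  have lim1 : Tendsto (fun k => C * eLpNorm (mollify k F - F) r volume) atTop (𝓝 0) := by
    simpa using ENNReal.Tendsto.const_mul (tendsto_eLpNorm_mollify hr1 hr hFmem)
      (Or.inr ENNReal.coe_ne_top)
  have lim2 : Tendsto (fun k => C * (A.toNNReal * ∑ i, eLpNorm (mollify k (G (e i)) - G (e i)) r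
      volume)) atTop (𝓝 0) := by
    have h1 : Tendsto (fun k => ∑ i, eLpNorm (mollify k (G (e i)) - G (e i)) r volume) atTop
        (𝓝 0) := by
      simpa using tendsto_finsetSum Finset.univ fun i _ =>
        tendsto_eLpNorm_mollify hr1 hr (hGmem (e i))
    have h2 : Tendsto (fun k => (A.toNNReal : ℝ≥0∞) *
        ∑ i, eLpNorm (mollify k (G (e i)) - G (e i)) r volume) atTop (𝓝 0) := by
      simpa using ENNReal.Tendsto.const_mul h1 (Or.inr ENNReal.coe_ne_top)
    simpa using ENNReal.Tendsto.const_mul h2 (Or.inr ENNReal.coe_ne_top)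
  obtain ⟨k, hk0, hk1, hk2⟩ := (hkey.and
    ((ENNReal.tendsto_nhds_zero.1 lim1 ε (pos_iff_ne_zero.2 hε)).and
    (ENNReal.tendsto_nhds_zero.1 lim2 ε (pos_iff_ne_zero.2 hε)))).exists
  set φ := chartPull x (mollify k F) with hφ
  have hφs : ContMDiff (𝓡 n) 𝓘(ℝ, ℝ) ∞ φ :=
    contMDiff_chartPull x hK'c hδt hk0 (contDiff_mollify k hFl)
  have hts := tsupport_chartPull_subset x hK'c hδt hk0
  have himc : IsCompact ((chartAt 𝔼 x).symm '' K') :=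
    hK'c.image_of_continuousOn ((chartAt 𝔼 x).continuousOn_symm.mono hδt)
  have hφg := isWeakGradient_of_contMDiff hφs
  have hS' : ∀ z ∉ (chartAt 𝔼 x).symm '' K', z ∉ S := fun z hz hzS =>
    hz ⟨_, hKK' ⟨z, hzS, rfl⟩, (chartAt 𝔼 x).left_inv (hSx hzS)⟩
  have hz1 : ∀ z ∉ (chartAt 𝔼 x).symm '' K', w z - φ z = 0 := fun z hz => by
    rw [(h0 z (hS' z hz)).1, hφ, chartPull_eq_zero x hk0 hz, sub_zero]
  have hz2 : ∀ z ∉ (chartAt 𝔼 x).symm '' K', ‖W z - mgrad (n := n) φ z‖ = 0 := fun z hz => by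
    rw [(h0 z (hS' z hz)).2, mgrad_eq_zero_of_notMem_tsupport fun h => hz (hts h), sub_zero,
      norm_zero]
  refine ⟨φ, mgrad (n := n) φ, hφs, himc.of_isClosed_subset (isClosed_tsupport _) hts, hφg, ?_, ?_⟩
  · have hm : AEStronglyMeasurable (fun z => w z - φ z) μ :=
      hw.1.sub hφs.continuous.aestronglyMeasurable
    refine (hC (fun z => w z - φ z) hm hz1).trans (le_trans (mul_le_mul_right ?_ _) hk1)
    calc _ = eLpNorm (F - mollify k F) r (volume.restrict K') := by
          refine eLpNorm_congr_ae ?_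
          filter_upwards [ae_restrict_mem hK'c.measurableSet] with y hy
          rw [hφ, chartPull_symm x _ (hδt hy), Pi.sub_apply, hFt y (hδt hy)]
      _ ≤ eLpNorm (F - mollify k F) r volume := eLpNorm_mono_measure _ Measure.restrict_le_self
      _ = _ := eLpNorm_sub_comm _ _ _ _
  · refine (hC (fun z => ‖W z - mgrad (n := n) φ z‖) (hW.sub hφg).aestronglyMeasurable_norm
      hz2).trans (le_trans (mul_le_mul_right ?_ _) hk2)
    have hml : ∀ i, AEStronglyMeasurable (mollify k (G (e i)) - G (e i)) volume := fun i =>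
      (contDiff_mollify k (hGl (e i))).continuous.aestronglyMeasurable.sub
        (hGmem (e i)).1
    calc eLpNorm (fun y => ‖W ((chartAt 𝔼 x).symm y) - mgrad (n := n) φ ((chartAt 𝔼 x).symm y)‖) r
          (volume.restrict K')
        ≤ A.toNNReal • eLpNorm (∑ i, fun y => ‖(mollify k (G (e i)) - G (e i)) y‖) r
            (volume.restrict K') := by
          refine eLpNorm_le_nnreal_smul_eLpNorm_of_ae_le_mul (c := A.toNNReal) ?_ r
          filter_upwards [ae_restrict_mem hK'c.measurableSet] with y hy
          rw [← NNReal.coe_le_coe, NNReal.coe_mul, coe_nnnorm, coe_nnnorm,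
            Real.coe_toNNReal _ hA0.le, norm_norm, Finset.sum_apply]
          refine (hA y hy _).trans ?_
          gcongr
          refine le_trans (le_of_eq ?_) (le_abs_self _)
          refine Finset.sum_congr rfl fun i _ => ?_
          rw [inner_sub_left, inner_mgrad_chartVector x (hδt hy)
            ((hφs.mdifferentiable (by simp)) _), hφ, fderiv_chartPull_symm x _ (hδt hy),
            (hFG _).fderiv_mollify, Pi.sub_apply, hGt _ y (hδt hy), ← Real.norm_eq_abs,
            norm_sub_rev]
      _ ≤ A.toNNReal * ∑ i, eLpNorm (mollify k (G (e i)) - G (e i)) r volume := by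
          rw [ENNReal.smul_def, smul_eq_mul]
          gcongr
          refine (eLpNorm_sum_le (fun i _ => (hml i).norm.restrict) hr1).trans ?_
          refine Finset.sum_le_sum fun i _ => ?_
          rw [eLpNorm_norm]
          exact eLpNorm_mono_measure _ Measure.restrict_le_self

/-- The components of `X - Y` are weak derivatives of zero, so they vanish almost everywhere by the
fundamental lemma of the calculus of variations, and they determine the length. -/
theorem IsWeakGradient.ae_eq {u : M → ℝ} {X Y : (z : M) → TangentSpace (𝓡 n) z}
    (hX : IsWeakGradient u X) (hY : IsWeakGradient u Y) :
    ∀ᵐ z ∂(riemannianVolume n M), X z = Y z := by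
  have hD := hX.sub hY
  refine ae_of_ae_chart fun x => ?_
  have h : ∀ i : Fin n, ∀ᵐ y ∂(volume.restrict (chartAt 𝔼 x).target),
      inner ℝ (X ((chartAt 𝔼 x).symm y) - Y ((chartAt 𝔼 x).symm y))
        (chartVector x y (EuclideanSpace.single i (1 : ℝ))) = 0 := by
    intro i
    have hd := isWeakGradient_iff.1 hD x (EuclideanSpace.single i (1 : ℝ))
    rw [ae_restrict_iff' (chartAt 𝔼 x).open_target.measurableSet]
    refine (chartAt 𝔼 x).open_target.ae_eq_zero_of_integral_contDiff_smul_eq_zero hd.right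
      fun ψ hψ hc hs => ?_
    have := hd.eq ψ hψ hc hs
    simp only [sub_self, zero_mul, integral_zero] at this
    simpa [mul_comm] using this.symm
  filter_upwards [ae_all_iff.2 h, ae_restrict_mem (chartAt 𝔼 x).open_target.measurableSet]
    with y hy hyt
  have hn := norm_sq_eq_gramMatrix_inv x hyt (X ((chartAt 𝔼 x).symm y) - Y ((chartAt 𝔼 x).symm y))
  simp only [hy] at hn
  have h0 : ‖X ((chartAt 𝔼 x).symm y) - Y ((chartAt 𝔼 x).symm y)‖ ^ 2 = 0 := by
    rw [hn]; exact zero_dotProduct _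
  exact sub_eq_zero.1 (norm_eq_zero.1 (pow_eq_zero_iff two_ne_zero |>.1 h0))

/-- Smooth functions with compact support are dense in the first order Sobolev spaces of a
complete manifold with the doubling property. -/
theorem exists_contMDiff_approx [ProperSpace M] [IsRiemannianManifold (𝓡 n) M]
    {r : ℝ≥0∞} (hr1 : 1 ≤ r) (hr : r ≠ ⊤) {u : M → ℝ} {X : (z : M) → TangentSpace (𝓡 n) z}
    (hX : IsWeakGradient u X) (hu : MemLp u r (riemannianVolume n M))
    (hXr : MemLp (fun z => ‖X z‖) r (riemannianVolume n M)) {ε : ℝ≥0∞} (hε : ε ≠ 0) :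
    ∃ (φ : M → ℝ) (Y : (z : M) → TangentSpace (𝓡 n) z), ContMDiff (𝓡 n) 𝓘(ℝ, ℝ) ∞ φ ∧
      HasCompactSupport φ ∧ IsWeakGradient φ Y ∧
      eLpNorm (fun z => u z - φ z) r (riemannianVolume n M) ≤ ε ∧
      eLpNorm (fun z => ‖X z - Y z‖) r (riemannianVolume n M) ≤ ε := by
  -- The cutoffs are centred at a point of `M`, so the empty manifold is treated apart.
  rcases isEmpty_or_nonempty M with hM | hM
  · refine ⟨u, X, fun z => isEmptyElim z, ?_, hX, by simp, by simp⟩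
    exact (Set.toFinite _).isCompact
  set μ := riemannianVolume n M
  have hε2 : ε / 2 ≠ 0 := (ENNReal.half_pos hε).ne'
  obtain ⟨u', X', T, hX', hu', hXr', hT, h0, e1, e2⟩ :=
    exists_compact_support_approx hr1 hr hX hu hXr hε2
  -- After cutting off to the compact set `T`, only finitely many members of the partition meet `T`,
  -- and each product `u' ρᵢ` lives in a single chart.
  obtain ⟨ρ, hρ⟩ := SmoothPartitionOfUnity.exists_isSubordinate (𝓡 n) hT.isClosed
    (fun x : M => (chartAt 𝔼 x).source) (fun x => (chartAt 𝔼 x).open_source)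
    (fun x _ => mem_iUnion.2 ⟨x, mem_chart_source 𝔼 x⟩)
  have hfin := ρ.locallyFinite.finite_nonempty_inter_compact hT
  set I := hfin.toFinset with hI
  have hsum : ∀ z ∈ T, ∑ i ∈ I, ρ i z = 1 := fun z hz => by
    rw [← ρ.sum_eq_one hz]
    refine (finsum_eq_sum_of_support_subset _ fun i hi => ?_).symm
    rw [hI, Finite.coe_toFinset]
    exact ⟨z, hi, hz⟩
  have hρs : ∀ i, ContMDiff (𝓡 n) 𝓘(ℝ, ℝ) ∞ (ρ i) := fun i => (ρ i).contMDiff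
  have hρg : ∀ i, IsWeakGradient (ρ i) (mgrad (n := n) (ρ i)) := fun i =>
    isWeakGradient_of_contMDiff (hρs i)
  have hloc : ∀ i, ∃ (w : M → ℝ) (W : (z : M) → TangentSpace (𝓡 n) z),
      IsWeakGradient w W ∧ MemLp w r μ ∧ MemLp (fun z => ‖W z‖) r μ ∧
      (∀ z ∉ T ∩ tsupport (ρ i), w z = 0 ∧ W z = 0) ∧ w = fun z => u' z * ρ i z := by
    intro i
    obtain ⟨C, hC0, hC⟩ := exists_norm_mgrad_le_on_compact (hρs i) i
      (hT.inter_right (isClosed_tsupport (ρ i))) (inter_subset_right.trans (hρ i))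
    have hle : ∀ z, ‖ρ i z‖ ≤ 1 := fun z => by
      rw [Real.norm_of_nonneg (ρ.nonneg i z)]; exact ρ.le_one i z
    have m1 : MemLp (fun z => u' z * ρ i z) r μ :=
      hu'.of_le (hu'.1.mul (hρs i).continuous.aestronglyMeasurable) (.of_forall fun z => by
        rw [norm_mul]; exact mul_le_of_le_one_right (norm_nonneg _) (hle z))
    have m2 : MemLp (fun z => ‖X' z‖ * ρ i z) r μ :=
      hXr'.of_le (hXr'.1.mul (hρs i).continuous.aestronglyMeasurable) (.of_forall fun z => by
        rw [norm_mul]; exact mul_le_of_le_one_right (norm_nonneg _) (hle z))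
    have m3 : MemLp (fun z => u' z * ‖mgrad (n := n) (ρ i) z‖) r μ := by
      refine (hu'.const_mul C).of_le (hu'.1.mul (hρg i).aestronglyMeasurable_norm)
        (.of_forall fun z => ?_)
      rw [norm_mul, norm_mul, norm_norm, mul_comm, Real.norm_of_nonneg hC0]
      by_cases hzT : z ∈ T
      · by_cases hz : z ∈ tsupport (ρ i)
        · gcongr
          exact hC z ⟨hzT, hz⟩
        · rw [mgrad_eq_zero_of_notMem_tsupport hz, norm_zero, zero_mul]; positivity
      · simp [(h0 z hzT).1]
    refine ⟨_, _, hX'.mul hr1 (hρg i) m1 m2 m3, m1, ?_, fun z hz => ?_, rfl⟩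
    · refine (m2.norm.add m3.norm).of_le
        (hX'.mul hr1 (hρg i) m1 m2 m3).aestronglyMeasurable_norm (.of_forall fun z => ?_)
      rw [norm_norm, Pi.add_apply]
      refine (norm_add_le _ _).trans (le_trans (le_of_eq ?_) (le_abs_self _))
      simp only [norm_smul, norm_mul, norm_norm]
      ring
    · by_cases hzT : z ∈ T
      · have hz' : z ∉ tsupport (ρ i) := fun h => hz ⟨hzT, h⟩
        simp [image_eq_zero_of_notMem_tsupport hz', mgrad_eq_zero_of_notMem_tsupport hz']
      · simp [h0 z hzT]
  choose w W hW hw hWr hwW hwu using hloc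
  -- The error `ε/2` is shared among the pieces; the `+ 1` keeps the divisor nonzero when no piece
  -- occurs.
  have hεI : ε / 2 / ((I.card : ℝ≥0∞) + 1) ≠ 0 :=
    (ENNReal.div_pos hε2 (by simp)).ne'
  have happ := fun i => exists_contMDiff_approx_of_chart hr1 hr i (hW i) (hw i) (hWr i)
    (hT.inter_right (isClosed_tsupport (ρ i))) (inter_subset_right.trans (hρ i)) (hwW i) hεI
  choose φ Y hφ hφc hY a1 a2 using happ
  have hbound : ∑ _i ∈ I, ε / 2 / ((I.card : ℝ≥0∞) + 1) ≤ ε / 2 := by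
    rw [Finset.sum_const, nsmul_eq_mul, ← mul_div_assoc]
    refine ENNReal.div_le_of_le_mul ?_
    rw [mul_comm]
    gcongr
    exact le_self_add
  have hφg := IsWeakGradient.sum I (fun i _ => hY i)
  have hwg := IsWeakGradient.sum I (fun i _ => hW i)
  have hwsum : ∀ z, ∑ i ∈ I, w i z = u' z := fun z => by
    simp only [hwu, ← Finset.mul_sum]
    by_cases hz : z ∈ T
    · rw [hsum z hz, mul_one]
    · rw [(h0 z hz).1, zero_mul]
  simp only [hwsum] at hwg
  have hφsm : ContMDiff (𝓡 n) 𝓘(ℝ, ℝ) ∞ fun z => ∑ i ∈ I, φ i z :=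
    contMDiff_finsetSum fun i _ => hφ i
  -- The pieces add up to `u'` exactly, but their gradients add up to `X'` only almost everywhere,
  -- by uniqueness.
  have hae := hX'.ae_eq hwg
  refine ⟨_, _, hφsm, ?_, hφg, ?_, ?_⟩
  · have hU : IsCompact (⋃ i ∈ I, tsupport (φ i)) := I.finite_toSet.isCompact_biUnion fun i _ => hφc i
    refine hU.of_isClosed_subset (isClosed_tsupport _) (closure_minimal (fun z hz => ?_) hU.isClosed)
    obtain ⟨i, hi, hne⟩ := Finset.exists_ne_zero_of_sum_ne_zero hz
    exact mem_iUnion₂.2 ⟨i, hi, subset_tsupport _ hne⟩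
  · have e : (fun z => u z - ∑ i ∈ I, φ i z) =
        (fun z => u z - u' z) + ∑ i ∈ I, fun z => w i z - φ i z := by
      funext z
      rw [Pi.add_apply, Finset.sum_apply, Finset.sum_sub_distrib, hwsum]
      ring
    rw [e]
    have hm : ∀ i ∈ I, AEStronglyMeasurable (fun z => w i z - φ i z) μ := fun i _ =>
      (hw i).1.sub (hφ i).continuous.aestronglyMeasurable
    calc _ ≤ eLpNorm (fun z => u z - u' z) r μ + eLpNorm (∑ i ∈ I, fun z => w i z - φ i z) r μ :=
          eLpNorm_add_le (hu.1.sub hu'.1) (Finset.aestronglyMeasurable_sum _ hm) hr1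
      _ ≤ ε / 2 + ε / 2 := add_le_add e1 ((eLpNorm_sum_le hm hr1).trans
          ((Finset.sum_le_sum fun i _ => a1 i).trans hbound))
      _ = ε := ENNReal.add_halves ε
  · have hm : ∀ i ∈ I, AEStronglyMeasurable (fun z => ‖W i z - Y i z‖) μ := fun i _ =>
      ((hW i).sub (hY i)).aestronglyMeasurable_norm
    calc _ ≤ eLpNorm ((fun z => ‖X z - X' z‖) + ∑ i ∈ I, fun z => ‖W i z - Y i z‖) r μ := by
          refine eLpNorm_mono_ae ?_
          filter_upwards [hae] with z hz
          rw [norm_norm, Pi.add_apply, Finset.sum_apply]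
          refine le_trans ?_ (le_abs_self _)
          have e : X z - ∑ i ∈ I, Y i z = (X z - X' z) + ∑ i ∈ I, (W i z - Y i z) := by
            rw [Finset.sum_sub_distrib, ← hz]; abel
          rw [e]
          exact (norm_add_le _ _).trans (add_le_add_right (norm_sum_le _ _) _)
      _ ≤ eLpNorm (fun z => ‖X z - X' z‖) r μ + eLpNorm (∑ i ∈ I, fun z => ‖W i z - Y i z‖) r μ :=
          eLpNorm_add_le (hX.sub hX').aestronglyMeasurable_norm
            (Finset.aestronglyMeasurable_sum _ hm) hr1
      _ ≤ ε / 2 + ε / 2 := add_le_add e2 ((eLpNorm_sum_le hm hr1).trans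
          ((Finset.sum_le_sum fun i _ => a2 i).trans hbound))
      _ = ε := ENNReal.add_halves ε

end Density


/-! ### Resolvents and the Balakrishnan integral. -/

section Operators

variable {H : Type*} [NormedAddCommGroup H] [NormedSpace ℂ H] {L : H →ₗ.[ℂ] H} {w : ℝ}

theorem neg_ofReal_notMem_sector {ν : ℝ} (hν : ν < Real.pi) {t : ℝ} (ht : 0 < t) :
    -(t : ℂ) ∉ sector ν := by
  rintro (h | h)
  · simp [ht.ne'] at h
  · rw [← Complex.ofReal_neg, Complex.arg_ofReal_of_neg (by linarith), abs_of_pos Real.pi_pos] at h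
    linarith

theorem IsOfType.isResolventAt (hL : IsOfType L w) (hw : w < Real.pi / 2) {t : ℝ} (ht : 0 < t) :
    IsResolventAt L (-(t : ℂ)) (resolventOp L (-(t : ℂ))) := by
  have h : ∃ R, IsResolventAt L (-(t : ℂ)) R :=
    hL.1 _ (neg_ofReal_notMem_sector (by linarith [Real.pi_pos]) ht)
  rw [resolventOp, dif_pos h]
  exact h.choose_spec

theorem IsOfType.exists_norm_resolventOp_le (hL : IsOfType L w) (hw : w < Real.pi / 2) :
    ∃ c : ℝ, 0 ≤ c ∧ ∀ t : ℝ, 0 < t → ‖resolventOp L (-(t : ℂ))‖ ≤ c / t := by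
  obtain ⟨c, hc⟩ := hL.2 (Real.pi / 2) hw
  have h : ∀ t : ℝ, 0 < t → ‖resolventOp L (-(t : ℂ))‖ ≤ c / t := fun t ht => by
    have := hc _ (neg_ofReal_notMem_sector (by linarith [Real.pi_pos]) ht)
    rwa [norm_neg, Complex.norm_real, Real.norm_of_nonneg ht.le] at this
  refine ⟨c, ?_, h⟩
  have := (norm_nonneg _).trans (h 1 one_pos)
  simpa using this

theorem IsOfType.resolventOp_apply_map (hL : IsOfType L w) (hw : w < Real.pi / 2) {t : ℝ}
    (ht : 0 < t) (x : L.domain) :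
    resolventOp L (-(t : ℂ)) (L x) = (x : H) - (t : ℂ) • resolventOp L (-(t : ℂ)) x := by
  have h := (hL.isResolventAt hw ht).2 x
  rw [neg_smul, sub_neg_eq_add, map_add, map_smul] at h
  exact eq_sub_of_add_eq h

theorem IsOfType.resolventOp_sub (hL : IsOfType L w) (hw : w < Real.pi / 2) {s t : ℝ}
    (hs : 0 < s) (ht : 0 < t) (y : H) :
    resolventOp L (-(s : ℂ)) y - resolventOp L (-(t : ℂ)) y =
      ((t : ℂ) - s) • resolventOp L (-(s : ℂ)) (resolventOp L (-(t : ℂ)) y) := by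
  obtain ⟨hx, h1⟩ := (hL.isResolventAt hw ht).1 y
  have h2 := hL.resolventOp_apply_map hw hs ⟨_, hx⟩
  have h3 : L ⟨resolventOp L (-(t : ℂ)) y, hx⟩ = y - (t : ℂ) • resolventOp L (-(t : ℂ)) y := by
    rw [neg_smul, sub_neg_eq_add] at h1
    exact eq_sub_of_add_eq h1
  rw [h3, map_sub, map_smul] at h2
  simp only at h2
  rw [sub_smul]
  rw [sub_eq_iff_eq_add] at h2 ⊢
  rw [h2]
  abel

theorem IsOfType.continuousOn_resolventOp (hL : IsOfType L w) (hw : w < Real.pi / 2) (y : H) :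
    ContinuousOn (fun t : ℝ => resolventOp L (-(t : ℂ)) y) (Ioi 0) := by
  obtain ⟨c, hc0, hc⟩ := hL.exists_norm_resolventOp_le hw
  intro t ht
  refine ContinuousAt.continuousWithinAt ?_
  have ht0 : (0 : ℝ) < t := ht
  rw [ContinuousAt, tendsto_iff_norm_sub_tendsto_zero]
  have hlim : Tendsto (fun s : ℝ => |t - s| * (c / s) * ‖resolventOp L (-(t : ℂ)) y‖) (𝓝 t)
      (𝓝 (|t - t| * (c / t) * ‖resolventOp L (-(t : ℂ)) y‖)) := by
    have : ContinuousAt (fun s : ℝ => |t - s| * (c / s) * ‖resolventOp L (-(t : ℂ)) y‖) t := by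
      fun_prop (disch := exact ht0.ne')
    exact this
  rw [sub_self, abs_zero, zero_mul, zero_mul] at hlim
  refine squeeze_zero' (.of_forall fun s => norm_nonneg _) ?_ hlim
  filter_upwards [lt_mem_nhds ht0] with s hs
  rw [hL.resolventOp_sub hw hs ht0, norm_smul, mul_assoc]
  have h1 : ‖(t : ℂ) - s‖ = |t - s| := by
    rw [← Complex.ofReal_sub, Complex.norm_real, Real.norm_eq_abs]
  rw [h1]
  gcongr
  exact ((resolventOp L (-(s : ℂ))).le_opNorm _).trans (by gcongr; exact hc s hs)

/-- Near `0` the vector `(t + L)⁻¹ L x = x - t (t + L)⁻¹ x` is bounded, and at infinity the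
resolvent is `O(1/t)`; the integrand is thus `O(t^(α-1))` and `O(t^(α-2))`. Convergence is what
makes `balakrishnan` additive. -/
theorem IsOfType.integrableOn_balakrishnan (hL : IsOfType L w) (hw : w < Real.pi / 2)
    {α : ℝ} (h0 : 0 < α) (h1 : α < 1) (x : L.domain) :
    IntegrableOn (fun t : ℝ => ((t ^ (α - 1) : ℝ) : ℂ) • resolventOp L (-(t : ℂ)) (L x))
      (Ioi 0) := by
  obtain ⟨c, hc0, hc⟩ := hL.exists_norm_resolventOp_le hw
  have hm : ContinuousOn (fun t : ℝ => ((t ^ (α - 1) : ℝ) : ℂ) • resolventOp L (-(t : ℂ)) (L x))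
      (Ioi 0) := by
    refine ContinuousOn.smul (Complex.continuous_ofReal.comp_continuousOn ?_)
      (hL.continuousOn_resolventOp hw _)
    exact fun t ht => (Real.continuousAt_rpow_const _ _
      (Or.inl (ne_of_gt ht))).continuousWithinAt
  rw [← Ioc_union_Ioi_eq_Ioi zero_le_one]
  refine IntegrableOn.union ?_ ?_
  · have hi : IntegrableOn (fun t : ℝ => ((1 + c) * ‖(x : H)‖) * t ^ (α - 1)) (Ioc 0 1) := by
      refine Integrable.const_mul ?_ _
      exact (intervalIntegrable_iff_integrableOn_Ioc_of_le zero_le_one).1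
        (intervalIntegral.intervalIntegrable_rpow' (by linarith))
    refine hi.mono' ((hm.mono Ioc_subset_Ioi_self).aestronglyMeasurable measurableSet_Ioc) ?_
    filter_upwards [ae_restrict_mem measurableSet_Ioc] with t ht
    have ht0 := ht.1
    rw [norm_smul, Complex.norm_real, Real.norm_of_nonneg (by positivity), mul_comm]
    gcongr
    rw [hL.resolventOp_apply_map hw ht0, add_mul, one_mul]
    refine (norm_sub_le _ _).trans (add_le_add_right ?_ _)
    rw [norm_smul, Complex.norm_real, Real.norm_of_nonneg ht0.le]
    calc t * ‖resolventOp L (-(t : ℂ)) x‖ ≤ t * (c / t * ‖(x : H)‖) := by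
          gcongr
          exact ((resolventOp L (-(t : ℂ))).le_opNorm _).trans (by gcongr; exact hc t ht0)
      _ = c * ‖(x : H)‖ := by field_simp
  · have hi : IntegrableOn (fun t : ℝ => (c * ‖L x‖) * t ^ (α - 2)) (Ioi 1) :=
      (integrableOn_Ioi_rpow_of_lt (by linarith) one_pos).const_mul _
    refine hi.mono' ((hm.mono (Ioi_subset_Ioi zero_le_one)).aestronglyMeasurable
      measurableSet_Ioi) ?_
    filter_upwards [ae_restrict_mem measurableSet_Ioi] with t ht
    have ht0 : (0 : ℝ) < t := lt_trans one_pos ht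
    rw [norm_smul, Complex.norm_real, Real.norm_of_nonneg (by positivity)]
    calc t ^ (α - 1) * ‖resolventOp L (-(t : ℂ)) (L x)‖ ≤ t ^ (α - 1) * (c / t * ‖L x‖) := by
          gcongr
          exact ((resolventOp L (-(t : ℂ))).le_opNorm _).trans (by gcongr; exact hc t ht0)
      _ = c * ‖L x‖ * t ^ (α - 2) := by
          have : t ^ (α - 2) = t ^ (α - 1) / t := by
            rw [show α - 2 = (α - 1) - 1 by ring, Real.rpow_sub_one ht0.ne']
          rw [this]
          ring

theorem IsOfType.balakrishnan_add (hL : IsOfType L w) (hw : w < Real.pi / 2)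
    {α : ℝ} (h0 : 0 < α) (h1 : α < 1) (x y : L.domain) :
    balakrishnan L α (x + y) = balakrishnan L α x + balakrishnan L α y := by
  simp only [balakrishnan]
  rw [← smul_add, ← integral_add (hL.integrableOn_balakrishnan hw h0 h1 x)
    (hL.integrableOn_balakrishnan hw h0 h1 y)]
  simp only [LinearPMap.map_add, map_add, smul_add]

theorem balakrishnan_neg {α : ℝ} (x : L.domain) :
    balakrishnan L α (-x) = -balakrishnan L α x := by
  simp only [balakrishnan, LinearPMap.map_neg, map_neg, smul_neg, integral_neg]

theorem isFracPow_zero {α : ℝ} : IsFracPow L α 0 0 :=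
  ⟨fun _ => 0, by simp, by simp [balakrishnan]⟩

theorem IsFracPow.neg {α : ℝ} {u v : H} (h : IsFracPow L α u v) : IsFracPow L α (-u) (-v) := by
  obtain ⟨x, h1, h2⟩ := h
  refine ⟨fun k => -x k, by simpa using h1.neg, ?_⟩
  simpa only [balakrishnan_neg] using h2.neg

theorem IsOfType.isFracPow_add (hL : IsOfType L w) (hw : w < Real.pi / 2)
    {α : ℝ} (h0 : 0 < α) (h1 : α < 1) {u v u' v' : H} (h : IsFracPow L α u v)
    (h' : IsFracPow L α u' v') : IsFracPow L α (u + u') (v + v') := by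
  obtain ⟨x, hx1, hx2⟩ := h
  obtain ⟨y, hy1, hy2⟩ := h'
  refine ⟨fun k => x k + y k, by simpa using hx1.add hy1, ?_⟩
  simpa only [hL.balakrishnan_add hw h0 h1] using hx2.add hy2

theorem IsOfType.isFracPow_sub (hL : IsOfType L w) (hw : w < Real.pi / 2)
    {α : ℝ} (h0 : 0 < α) (h1 : α < 1) {u v u' v' : H} (h : IsFracPow L α u v)
    (h' : IsFracPow L α u' v') : IsFracPow L α (u - u') (v - v') := by
  simpa only [sub_eq_add_neg] using hL.isFracPow_add hw h0 h1 h h'.neg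

end Operators

/-! ### The operator `L^{1/m}` on `L^p`. -/

section RootLp

variable {M : Type*} [MeasurableSpace M] {μ : Measure M} {L : Lp ℂ 2 μ →ₗ.[ℂ] Lp ℂ 2 μ}
  {w m : ℝ} {p : ℝ≥0∞} {f g h k : M → ℂ}

theorem one_div_mem_Ioo (hm : 1 < m) : 0 < 1 / m ∧ 1 / m < 1 :=
  ⟨by positivity, (div_lt_one (by linarith)).2 hm⟩

theorem isRootLp_zero : IsRootLp L m p (fun _ => (0 : ℂ)) fun _ => 0 := by
  have h0 : (0 : Lp ℂ 2 μ) =ᵐ[μ] fun _ => (0 : ℂ) := Lp.coeFn_zero _ _ _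
  have hm : MemLp (0 : Lp ℂ 2 μ) p μ := (MemLp.zero' (ε := ℂ)).ae_eq h0.symm
  refine ⟨MemLp.zero', MemLp.zero', fun _ => 0, fun _ => 0, fun _ => ⟨isFracPow_zero, hm, hm⟩, ?_, ?_⟩
  all_goals
    refine tendsto_const_nhds.congr fun _ => ?_
    simp only [sub_zero]
    rw [eLpNorm_congr_ae h0, eLpNorm_zero']

theorem IsRootLp.exists_approx (hf : IsRootLp L m p f h) {ε : ℝ≥0∞} (hε : ε ≠ 0) :
    ∃ u v : Lp ℂ 2 μ, IsFracPow L (1 / m) u v ∧ MemLp u p μ ∧ MemLp v p μ ∧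
      eLpNorm (fun z => u z - f z) p μ ≤ ε ∧ eLpNorm (fun z => v z - h z) p μ ≤ ε := by
  obtain ⟨-, -, u, v, huv, hu, hv⟩ := hf
  obtain ⟨j, h1, h2⟩ := ((ENNReal.tendsto_nhds_zero.1 hu ε (pos_iff_ne_zero.2 hε)).and
    (ENNReal.tendsto_nhds_zero.1 hv ε (pos_iff_ne_zero.2 hε))).exists
  exact ⟨u j, v j, (huv j).1, (huv j).2.1, (huv j).2.2, h1, h2⟩

/-- Replaces sequences by approximation to within any `ε`, which makes the graph visibly closed and
spares diagonal sequences. -/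
theorem isRootLp_of_approx (hf : MemLp f p μ) (hh : MemLp h p μ)
    (H : ∀ ε : ℝ≥0∞, ε ≠ 0 → ∃ u v : Lp ℂ 2 μ, IsFracPow L (1 / m) u v ∧ MemLp u p μ ∧
      MemLp v p μ ∧ eLpNorm (fun z => u z - f z) p μ ≤ ε ∧ eLpNorm (fun z => v z - h z) p μ ≤ ε) :
    IsRootLp L m p f h := by
  have hlim : Tendsto (fun j : ℕ => ((j : ℝ≥0∞) + 1)⁻¹) atTop (𝓝 0) := by
    have := (tendsto_add_atTop_iff_nat 1).2 ENNReal.tendsto_inv_nat_nhds_zero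
    simpa using this
  choose u v h1 h2 h3 h4 h5 using fun j : ℕ => H ((j : ℝ≥0∞) + 1)⁻¹ (by simp)
  refine ⟨hf, hh, u, v, fun j => ⟨h1 j, h2 j, h3 j⟩, ?_, ?_⟩
  · exact tendsto_of_tendsto_of_tendsto_of_le_of_le tendsto_const_nhds hlim (fun _ => zero_le) h4
  · exact tendsto_of_tendsto_of_tendsto_of_le_of_le tendsto_const_nhds hlim (fun _ => zero_le) h5

theorem IsOfType.isRootLp_add (hL : IsOfType L w) (hw : w < Real.pi / 2) (hm : 1 < m)
    (hp : 1 ≤ p) (hf : IsRootLp L m p f h) (hg : IsRootLp L m p g k) :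
    IsRootLp L m p (fun z => f z + g z) fun z => h z + k z := by
  refine isRootLp_of_approx (hf.1.add hg.1) (hf.2.1.add hg.2.1) fun ε hε => ?_
  have hε2 : ε / 2 ≠ 0 := (ENNReal.half_pos hε).ne'
  obtain ⟨u, v, h1, h2, h3, h4, h5⟩ := hf.exists_approx hε2
  obtain ⟨u', v', h1', h2', h3', h4', h5'⟩ := hg.exists_approx hε2
  obtain ⟨hα0, hα1⟩ := one_div_mem_Ioo hm
  have key : ∀ {a b : Lp ℂ 2 μ} {F G : M → ℂ}, MemLp a p μ → MemLp b p μ → MemLp F p μ →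
      MemLp G p μ → eLpNorm (fun z => a z - F z) p μ ≤ ε / 2 →
      eLpNorm (fun z => b z - G z) p μ ≤ ε / 2 →
      eLpNorm (fun z => (a + b : Lp ℂ 2 μ) z - (F z + G z)) p μ ≤ ε := by
    intro a b F G ha hb hF hG e1 e2
    calc _ = eLpNorm ((fun z => a z - F z) + fun z => b z - G z) p μ := by
          refine eLpNorm_congr_ae ?_
          filter_upwards [Lp.coeFn_add a b] with z hz
          rw [hz, Pi.add_apply, Pi.add_apply]; ring
      _ ≤ ε / 2 + ε / 2 := (eLpNorm_add_le (ha.sub hF).1 (hb.sub hG).1 hp).trans (add_le_add e1 e2)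
      _ = ε := ENNReal.add_halves ε
  exact ⟨u + u', v + v', hL.isFracPow_add hw hα0 hα1 h1 h1',
    (h2.add h2').ae_eq (Lp.coeFn_add u u').symm, (h3.add h3').ae_eq (Lp.coeFn_add v v').symm,
    key h2 h2' hf.1 hg.1 h4 h4', key h3 h3' hf.2.1 hg.2.1 h5 h5'⟩

theorem IsOfType.isRootLp_sum (hL : IsOfType L w) (hw : w < Real.pi / 2) (hm : 1 < m)
    (hp : 1 ≤ p) {fj hj : ℕ → M → ℂ} (hf : ∀ j, IsRootLp L m p (fj j) (hj j)) (N : ℕ) :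
    IsRootLp L m p (fun z => ∑ j ∈ Finset.range N, fj j z)
      fun z => ∑ j ∈ Finset.range N, hj j z := by
  induction N with
  | zero => simpa using isRootLp_zero
  | succ N ih =>
    simp only [Finset.sum_range_succ]
    exact hL.isRootLp_add hw hm hp ih (hf N)

/-- The closed operator `L^{1/m}` on `L^p` commutes with absolutely convergent series. -/
theorem IsOfType.exists_isRootLp_of_series (hL : IsOfType L w) (hw : w < Real.pi / 2) (hm : 1 < m)
    (hp : 1 ≤ p) {fj hj : ℕ → M → ℂ} (hf : ∀ j, IsRootLp L m p (fj j) (hj j)) (hfp : MemLp f p μ)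
    (hlim : Tendsto (fun N => eLpNorm (fun z => ∑ j ∈ Finset.range N, fj j z - f z) p μ) atTop
      (𝓝 0)) (hsum : ∑' j, eLpNorm (hj j) p μ ≠ ⊤) :
    ∃ h : M → ℂ, IsRootLp L m p f h ∧ eLpNorm h p μ ≤ ∑' j, eLpNorm (hj j) p μ := by
  have : Fact (1 ≤ p) := ⟨hp⟩
  let a : ℕ → Lp ℂ p μ := fun j => (hf j).2.1.toLp
  have ha : ∀ j, ‖a j‖ₑ = eLpNorm (hj j) p μ := fun j => Lp.enorm_toLp _
  have hsa : Summable a := by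
    refine Summable.of_enorm ?_
    simpa only [ha] using hsum
  have hN : ∀ N, (fun z => ∑ j ∈ Finset.range N, hj j z) =ᵐ[μ]
      (∑ j ∈ Finset.range N, a j : Lp ℂ p μ) := fun N => by
    have h1 : ∀ j, a j =ᵐ[μ] hj j := fun j => MemLp.coeFn_toLp _
    filter_upwards [Lp.coeFn_finsetSum (Finset.range N) a, ae_all_iff.2 h1] with z hz h1z
    rw [hz, Finset.sum_apply]
    exact Finset.sum_congr rfl fun j _ => (h1z j).symm
  have hlim2 : Tendsto (fun N => eLpNorm (fun z => ∑ j ∈ Finset.range N, hj j z -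
      (∑' j, a j : Lp ℂ p μ) z) p μ) atTop (𝓝 0) := by
    have h1 : Tendsto (fun N => ‖(∑ j ∈ Finset.range N, a j) - ∑' j, a j‖ₑ) atTop (𝓝 0) := by
      have := (hsa.hasSum.tendsto_sum_nat.sub_const (∑' j, a j)).enorm
      simpa using this
    refine h1.congr fun N => ?_
    rw [Lp.enorm_def]
    refine eLpNorm_congr_ae ?_
    filter_upwards [hN N, Lp.coeFn_sub (∑ j ∈ Finset.range N, a j) (∑' j, a j)] with z hz hz2
    rw [hz2, Pi.sub_apply, hz]
  have hmem : MemLp (∑' j, a j : Lp ℂ p μ) p μ := Lp.memLp _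
  -- Completeness of `L^p` supplies the value. A partial sum is within `ε/2` of the limit in both
  -- components, and an element of the `L²` graph within `ε/2` of that partial sum.
  refine ⟨(∑' j, a j : Lp ℂ p μ), isRootLp_of_approx hfp hmem fun ε hε => ?_, ?_⟩
  · have hε2 : ε / 2 ≠ 0 := (ENNReal.half_pos hε).ne'
    obtain ⟨N, hN1, hN2⟩ := ((ENNReal.tendsto_nhds_zero.1 hlim _ (pos_iff_ne_zero.2 hε2)).and
      (ENNReal.tendsto_nhds_zero.1 hlim2 _ (pos_iff_ne_zero.2 hε2))).exists
    have hr := hL.isRootLp_sum hw hm hp hf N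
    obtain ⟨u, v, h1, h2, h3, h4, h5⟩ := hr.exists_approx hε2
    have key : ∀ {b F G : M → ℂ}, MemLp b p μ → MemLp F p μ → MemLp G p μ →
        eLpNorm (fun z => b z - F z) p μ ≤ ε / 2 → eLpNorm (fun z => F z - G z) p μ ≤ ε / 2 →
        eLpNorm (fun z => b z - G z) p μ ≤ ε := by
      intro b F G hb hF hG e1 e2
      calc _ = eLpNorm ((fun z => b z - F z) + fun z => F z - G z) p μ := by
            congr 1; funext z; simp
        _ ≤ ε / 2 + ε / 2 :=
            (eLpNorm_add_le (hb.sub hF).1 (hF.sub hG).1 hp).trans (add_le_add e1 e2)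
        _ = ε := ENNReal.add_halves ε
    exact ⟨u, v, h1, h2, h3, key h2 hr.1 hfp h4 hN1, key h3 hr.2.1 hmem h5 hN2⟩
  · rw [← Lp.enorm_def]
    refine enorm_tsum_le_tsum_enorm.trans (le_of_eq ?_)
    exact tsum_congr ha

end RootLp


/-! ### Telescoping series with summable norms. -/

section Increments

/-- The increments of a sequence. -/
def increments {A : Type*} [AddGroup A] (a : ℕ → A) : ℕ → A
  | 0 => a 0
  | j + 1 => a (j + 1) - a j

theorem sum_increments {A : Type*} [AddCommGroup A] (a : ℕ → A) (N : ℕ) :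
    ∑ j ∈ Finset.range (N + 1), increments a j = a N := by
  induction N with
  | zero => simp [increments]
  | succ N ih => rw [Finset.sum_range_succ, ih, increments, add_sub_cancel]

/-- Here `a j` is the norm of the `j`-th increment of a sequence lying within `δ j` of a limit of
norm `b`: neighbours differ by at most `δ (j+1) + δ j`, and every error is counted at most twice. -/
theorem tsum_le_of_increments {a δ : ℕ → ℝ≥0∞} {b : ℝ≥0∞} (h0 : a 0 ≤ b + δ 0)
    (h : ∀ j, a (j + 1) ≤ δ (j + 1) + δ j) : ∑' j, a j ≤ b + 2 * ∑' j, δ j := by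
  have e : ∀ c : ℕ → ℝ≥0∞, ∑' j, c j = c 0 + ∑' j, c (j + 1) := fun c =>
    tsum_eq_zero_add' ENNReal.summable
  calc ∑' j, a j = a 0 + ∑' j, a (j + 1) := e a
    _ ≤ (b + δ 0) + ∑' j, (δ (j + 1) + δ j) := add_le_add h0 (ENNReal.tsum_le_tsum h)
    _ = b + ((δ 0 + ∑' j, δ (j + 1)) + ∑' j, δ j) := by rw [ENNReal.tsum_add]; ring
    _ = b + 2 * ∑' j, δ j := by rw [← e δ, two_mul]

/-- The cap by 1 keeps the errors summable also for `ε = ⊤`. -/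
theorem exists_summable_errors {ε : ℝ≥0∞} (hε : ε ≠ 0) :
    ∃ δ : ℕ → ℝ≥0∞, (∀ j, δ j ≠ 0) ∧ 2 * ∑' j, δ j ≤ ε ∧ Tendsto δ atTop (𝓝 0) := by
  have hε' : min ε 1 ≠ 0 := by simp [hε]
  obtain ⟨δ, h1, h2⟩ := ENNReal.exists_pos_sum_of_countable' (ENNReal.half_pos hε').ne' ℕ
  refine ⟨δ, fun j => (h1 j).ne', ?_, ENNReal.tendsto_atTop_zero_of_tsum_ne_top h2.ne_top⟩
  calc 2 * ∑' j, δ j ≤ 2 * (min ε 1 / 2) := by gcongr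
    _ = min ε 1 := ENNReal.mul_div_cancel two_ne_zero ENNReal.ofNat_ne_top
    _ ≤ ε := min_le_left _ _

end Increments

/-! ### Extension of the two Riesz inequalities to closures. -/

section Riesz

variable {n : ℕ} {M : Type*} [MetricSpace M] [SecondCountableTopology M]
  [MeasurableSpace M] [BorelSpace M] [ChartedSpace (EuclideanSpace ℝ (Fin n)) M]
  [IsManifold (𝓡 n) ∞ M]
  [RiemannianBundle (fun x : M => TangentSpace (𝓡 n) x)]
  [IsContMDiffRiemannianBundle (𝓡 n) ∞ (EuclideanSpace ℝ (Fin n))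
      (fun x : M => TangentSpace (𝓡 n) x)]

local notation "𝔼" => EuclideanSpace ℝ (Fin n)
local notation "𝓥" => riemannianVolume n M

variable {L : Lp ℂ 2 (riemannianVolume n M) →ₗ.[ℂ] Lp ℂ 2 (riemannianVolume n M)}
  {w m : ℝ} {p q r : ℝ≥0∞}

theorem norm_left_le_gradLength (X Y : (z : M) → TangentSpace (𝓡 n) z) (z : M) :
    ‖X z‖ ≤ gradLength X Y z :=
  Real.le_sqrt_of_sq_le (by nlinarith [sq_nonneg ‖Y z‖])

theorem norm_right_le_gradLength (X Y : (z : M) → TangentSpace (𝓡 n) z) (z : M) :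
    ‖Y z‖ ≤ gradLength X Y z :=
  Real.le_sqrt_of_sq_le (by nlinarith [sq_nonneg ‖X z‖])

theorem gradLength_le (X Y : (z : M) → TangentSpace (𝓡 n) z) (z : M) :
    gradLength X Y z ≤ ‖X z‖ + ‖Y z‖ :=
  (Real.sqrt_le_left (by positivity)).2 (by nlinarith [norm_nonneg (X z), norm_nonneg (Y z)])

theorem eLpNorm_gradLength_le (hp : 1 ≤ p) {f g : M → ℝ} {X Y : (z : M) → TangentSpace (𝓡 n) z}
    (hX : IsWeakGradient f X) (hY : IsWeakGradient g Y) :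
    eLpNorm (gradLength X Y) p (riemannianVolume n M) ≤
      eLpNorm (fun z => ‖X z‖) p (riemannianVolume n M) +
        eLpNorm (fun z => ‖Y z‖) p (riemannianVolume n M) := by
  refine le_trans (eLpNorm_mono_real (g := (fun z => ‖X z‖) + fun z => ‖Y z‖) fun z => ?_)
    (eLpNorm_add_le hX.aestronglyMeasurable_norm hY.aestronglyMeasurable_norm hp)
  rw [Real.norm_of_nonneg (show 0 ≤ gradLength X Y z from Real.sqrt_nonneg _)]
  exact gradLength_le X Y z

theorem eLpNorm_sub_le_add_of_le {α E : Type*} [MeasurableSpace α] {μ : Measure α}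
    [NormedAddCommGroup E] {a b g : α → E} (hp : 1 ≤ p) (ha : AEStronglyMeasurable a μ)
    (hb : AEStronglyMeasurable b μ) (hg : AEStronglyMeasurable g μ) {s t : ℝ≥0∞}
    (h1 : eLpNorm (fun z => a z - g z) p μ ≤ s) (h2 : eLpNorm (fun z => b z - g z) p μ ≤ t) :
    eLpNorm (fun z => a z - b z) p μ ≤ s + t := by
  have e : (fun z => a z - b z) = (fun z => a z - g z) - fun z => b z - g z := by
    funext z; simp
  rw [e]
  exact (eLpNorm_sub_le (ha.sub hg) (hb.sub hg) hp).trans (add_le_add h1 h2)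

theorem eLpNorm_le_add_of_le {α E : Type*} [MeasurableSpace α] {μ : Measure α}
    [NormedAddCommGroup E] {a g : α → E} (hp : 1 ≤ p) (ha : AEStronglyMeasurable a μ)
    (hg : AEStronglyMeasurable g μ) {s : ℝ≥0∞}
    (h1 : eLpNorm (fun z => a z - g z) p μ ≤ s) : eLpNorm a p μ ≤ eLpNorm g p μ + s := by
  have e : a = g + fun z => a z - g z := by funext z; simp
  calc eLpNorm a p μ = eLpNorm (g + fun z => a z - g z) p μ := by rw [← e]
    _ ≤ _ := (eLpNorm_add_le hg (ha.sub hg) hp).trans (add_le_add_right h1 _)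

/-- If the Riesz transform is bounded on `L^p`, then functions with `L^{1/m} f ∈ L^p` have a
gradient in `L^p`. -/
theorem exists_gradient_of_isRootLp (hL : IsOfType L w) (hw : w < Real.pi / 2) (hm : 1 < m)
    (hp : 1 ≤ p) (hR : RieszBounded n L m p) :
    ∃ C : ℝ≥0, ∀ f h : M → ℂ, IsRootLp L m p f h → ∀ ε : ℝ≥0∞, ε ≠ 0 →
      ∃ X Y : (z : M) → TangentSpace (𝓡 n) z, IsWeakGradientC f X Y ∧
        eLpNorm (gradLength X Y) p (riemannianVolume n M) ≤
          C * (eLpNorm h p (riemannianVolume n M) + ε) := by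
  obtain ⟨C, hC⟩ := hR
  refine ⟨2 * C, fun f h hfh ε hε => ?_⟩
  obtain ⟨hα0, hα1⟩ := one_div_mem_Ioo hm
  obtain ⟨δ, hδ0, hδs, hδl⟩ := exists_summable_errors (ε := min ε 1) (by simp [hε])
  choose u v huv hu hv hun hvn using fun j => hfh.exists_approx (hδ0 j)
  -- The Riesz bound is applied to the increments and not to the `u j`. It then yields fields with
  -- summable norms at once, without comparing gradients chosen independently for different `j`.
  have hD : ∀ j, IsFracPow L (1 / m) (increments u j) (increments v j) := fun j => by
    cases j with
    | zero => exact huv 0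
    | succ j => exact hL.isFracPow_sub hw hα0 hα1 (huv (j + 1)) (huv j)
  have hDv : ∀ j, MemLp (increments v j : Lp ℂ 2 𝓥) p 𝓥 := fun j => by
    cases j with
    | zero => simpa only [increments] using hv 0
    | succ j =>
      simp only [increments]
      exact ((hv (j + 1)).sub (hv j)).ae_eq (Lp.coeFn_sub _ _).symm
  choose X Y hXY hn using fun j => hC _ _ (hD j) (hDv j)
  have hsum : ∑' j, eLpNorm (increments v j : Lp ℂ 2 𝓥) p 𝓥 ≤ eLpNorm h p 𝓥 + min ε 1 := by
    refine (tsum_le_of_increments (δ := δ) (b := eLpNorm h p 𝓥) ?_ fun j => ?_).trans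
      (add_le_add_right hδs _)
    · simp only [increments]
      exact eLpNorm_le_add_of_le hp (hv 0).1 hfh.2.1.1 (hvn 0)
    · simp only [increments]
      refine le_trans (le_of_eq (eLpNorm_congr_ae (Lp.coeFn_sub _ _))) ?_
      exact eLpNorm_sub_le_add_of_le hp (hv (j + 1)).1 (hv j).1 hfh.2.1.1 (hvn (j + 1)) (hvn j)
  have hlim : Tendsto (fun N => eLpNorm (fun z => ∑ j ∈ Finset.range N, (increments u j : Lp ℂ 2 𝓥) z - f z)
      p 𝓥) atTop (𝓝 0) := by
    rw [← tendsto_add_atTop_iff_nat 1]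
    refine tendsto_of_tendsto_of_tendsto_of_le_of_le tendsto_const_nhds hδl (fun _ => zero_le)
      fun N => le_trans (le_of_eq (eLpNorm_congr_ae ?_)) (hun N)
    have h1 := Lp.coeFn_finsetSum (Finset.range (N + 1)) (increments u)
    rw [sum_increments] at h1
    filter_upwards [h1] with z hz
    rw [hz, Finset.sum_apply]
  have hXs : ∑' j, eLpNorm (gradLength (X j) (Y j)) p 𝓥 ≤ C * (eLpNorm h p 𝓥 + min ε 1) := by
    refine (ENNReal.tsum_le_tsum hn).trans ?_
    rw [ENNReal.tsum_mul_left]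
    gcongr
  have hfin : (C : ℝ≥0∞) * (eLpNorm h p 𝓥 + min ε 1) ≠ ⊤ :=
    ENNReal.mul_ne_top ENNReal.coe_ne_top (ENNReal.add_ne_top.2 ⟨hfh.2.1.2.ne, by simp⟩)
  have hX1 : ∑' j, eLpNorm (fun z => ‖X j z‖) p 𝓥 ≤ C * (eLpNorm h p 𝓥 + min ε 1) :=
    (ENNReal.tsum_le_tsum fun j => eLpNorm_mono_real fun z => by
      rw [norm_norm]; exact norm_left_le_gradLength (X j) (Y j) z).trans hXs
  have hY1 : ∑' j, eLpNorm (fun z => ‖Y j z‖) p 𝓥 ≤ C * (eLpNorm h p 𝓥 + min ε 1) :=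
    (ENNReal.tsum_le_tsum fun j => eLpNorm_mono_real fun z => by
      rw [norm_norm]; exact norm_right_le_gradLength (X j) (Y j) z).trans hXs
  obtain ⟨Z, hZ, hZn⟩ := exists_isWeakGradient_of_series hp (fun j => (hXY j).1)
    (u := fun z => (f z).re) hfh.1.re
    (tendsto_of_tendsto_of_tendsto_of_le_of_le tendsto_const_nhds hlim (fun _ => zero_le)
      fun N => eLpNorm_mono fun z => by
        rw [← Complex.re_sum, ← Complex.sub_re]; exact Complex.abs_re_le_norm _)
    (ne_top_of_le_ne_top hfin hX1)
  obtain ⟨Z', hZ', hZn'⟩ := exists_isWeakGradient_of_series hp (fun j => (hXY j).2)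
    (u := fun z => (f z).im) hfh.1.im
    (tendsto_of_tendsto_of_tendsto_of_le_of_le tendsto_const_nhds hlim (fun _ => zero_le)
      fun N => eLpNorm_mono fun z => by
        rw [← Complex.im_sum, ← Complex.sub_im]; exact Complex.abs_im_le_norm _)
    (ne_top_of_le_ne_top hfin hY1)
  -- The two real fields are each bounded by `C (‖h‖ + ε)`; this is the factor 2 in the constant.
  refine ⟨Z, Z', ⟨hZ, hZ'⟩, (eLpNorm_gradLength_le hp hZ hZ').trans ?_⟩
  have hle : (C : ℝ≥0∞) * (eLpNorm h p 𝓥 + min ε 1) ≤ C * (eLpNorm h p 𝓥 + ε) := by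
    gcongr
    exact min_le_left _ _
  rw [ENNReal.coe_mul, ENNReal.coe_ofNat, mul_assoc, two_mul]
  exact add_le_add (hZn.trans (hX1.trans hle)) (hZn'.trans (hY1.trans hle))

/-- If the reverse Riesz inequality holds on `L^p`, then functions with a gradient in `L^p`
belong to the domain of `L^{1/m}` in `L^p`. -/
theorem exists_isRootLp_of_gradient [ProperSpace M] [IsRiemannianManifold (𝓡 n) M]
    (hL : IsOfType L w) (hw : w < Real.pi / 2) (hm : 1 < m)
    (hp : 1 ≤ p) (hp' : p ≠ ⊤) (hR : ReverseRiesz n L m p) :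
    ∃ C : ℝ≥0, ∀ (f : M → ℂ) (X Y : (z : M) → TangentSpace (𝓡 n) z),
      MemLp f p (riemannianVolume n M) → IsWeakGradientC f X Y →
      MemLp (fun z => ‖X z‖) p (riemannianVolume n M) →
      MemLp (fun z => ‖Y z‖) p (riemannianVolume n M) → ∀ ε : ℝ≥0∞, ε ≠ 0 →
      ∃ h : M → ℂ, IsRootLp L m p f h ∧ eLpNorm h p (riemannianVolume n M) ≤
        C * (eLpNorm (fun z => ‖X z‖) p (riemannianVolume n M) +
          eLpNorm (fun z => ‖Y z‖) p (riemannianVolume n M) + ε) := by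
  obtain ⟨C, hC⟩ := hR
  refine ⟨C, fun f X Y hf hXY hX hY ε hε => ?_⟩
  -- Real and imaginary parts are approximated separately, each with half of the admissible error.
  obtain ⟨δ, hδ0, hδs, hδl⟩ := exists_summable_errors (ENNReal.half_pos (a := min ε 1)
    (by simp [hε])).ne'
  choose φ A hφ hφc hA hφn hAn using fun j =>
    exists_contMDiff_approx hp hp' hXY.1 hf.re hX (hδ0 j)
  choose ψ B hψ hψc hB hψn hBn using fun j =>
    exists_contMDiff_approx hp hp' hXY.2 hf.im hY (hδ0 j)
  have hAi : ∀ j, IsWeakGradient (increments φ j) (increments A j) := fun j => by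
    cases j with
    | zero => exact hA 0
    | succ j => exact (hA (j + 1)).sub (hA j)
  have hBi : ∀ j, IsWeakGradient (increments ψ j) (increments B j) := fun j => by
    cases j with
    | zero => exact hB 0
    | succ j => exact (hB (j + 1)).sub (hB j)
  have hsm : ∀ (φ : ℕ → M → ℝ), (∀ j, ContMDiff (𝓡 n) 𝓘(ℝ, ℝ) ∞ (φ j)) →
      ∀ j, ContMDiff (𝓡 n) 𝓘(ℝ, ℝ) ∞ (increments φ j) := fun φ hφ j => by
    cases j with
    | zero => exact hφ 0
    | succ j => exact (hφ (j + 1)).sub (hφ j)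
  have hsc : ∀ (φ : ℕ → M → ℝ), (∀ j, HasCompactSupport (φ j)) →
      ∀ j, HasCompactSupport (increments φ j) := fun φ hφ j => by
    cases j with
    | zero => exact hφ 0
    | succ j => exact (hφ (j + 1)).sub (hφ j)
  have hsum : ∀ (X : (z : M) → TangentSpace (𝓡 n) z) (u : M → ℝ) (φ : ℕ → M → ℝ)
      (A : ℕ → (z : M) → TangentSpace (𝓡 n) z), MemLp (fun z => ‖X z‖) p 𝓥 →
      IsWeakGradient u X → (∀ j, IsWeakGradient (φ j) (A j)) →
      (∀ j, eLpNorm (fun z => ‖X z - A j z‖) p 𝓥 ≤ δ j) →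
      ∑' j, eLpNorm (fun z => ‖increments A j z‖) p 𝓥 ≤
        eLpNorm (fun z => ‖X z‖) p 𝓥 + min ε 1 / 2 := by
    intro X u φ A hX hu hA hAn
    refine (tsum_le_of_increments (δ := δ) (b := eLpNorm (fun z => ‖X z‖) p 𝓥) ?_ fun j => ?_).trans
      (add_le_add_right hδs _)
    · refine le_trans (eLpNorm_mono_real (g := (fun z => ‖X z‖) + fun z => ‖X z - A 0 z‖)
        fun z => ?_) ((eLpNorm_add_le hX.1 (hu.sub (hA 0)).aestronglyMeasurable_norm hp).trans
          (add_le_add_right (hAn 0) _))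
      rw [norm_norm, Pi.add_apply]
      have e : increments A 0 z = X z - (X z - A 0 z) := (sub_sub_cancel _ _).symm
      rw [e]
      exact norm_sub_le _ _
    · refine le_trans (eLpNorm_mono_real (g := (fun z => ‖X z - A (j + 1) z‖) +
        fun z => ‖X z - A j z‖) fun z => ?_)
        ((eLpNorm_add_le (hu.sub (hA (j + 1))).aestronglyMeasurable_norm
          (hu.sub (hA j)).aestronglyMeasurable_norm hp).trans
          (add_le_add (hAn (j + 1)) (hAn j)))
      rw [norm_norm, Pi.add_apply]
      simp only [increments, Pi.sub_apply]
      have e : A (j + 1) z - A j z = (X z - A j z) - (X z - A (j + 1) z) := by abel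
      rw [e]
      exact (norm_sub_le (X z - A j z) (X z - A (j + 1) z)).trans_eq (add_comm _ _)
  let Φ : ℕ → M → ℂ := fun j z => (φ j z : ℂ) + (ψ j z : ℂ) * Complex.I
  -- The increments are still smooth with compact support, so the reverse Riesz inequality applies
  -- to each; the series then converges in the graph of `L^{1/m}` on `L^p`.
  let F : ℕ → M → ℂ := fun j z => (increments φ j z : ℂ) + (increments ψ j z : ℂ) * Complex.I
  have hFs : ∀ j, ContMDiff (𝓡 n) 𝓘(ℝ, ℂ) ∞ (F j) := fun j => by
    have h1 : ContDiff ℝ ∞ (fun t : ℝ => (t : ℂ)) := Complex.ofRealCLM.contDiff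
    have h2 : ContDiff ℝ ∞ (fun t : ℝ => (t : ℂ) * Complex.I) := h1.mul contDiff_const
    exact (h1.contMDiff.comp (hsm φ hφ j)).add (h2.contMDiff.comp (hsm ψ hψ j))
  have hFc : ∀ j, HasCompactSupport (F j) := fun j => by
    have h1 : HasCompactSupport (fun z => (increments φ j z : ℂ)) :=
      (hsc φ hφc j).comp_left (g := fun t : ℝ => (t : ℂ)) (by simp)
    have h2 : HasCompactSupport (fun z => (increments ψ j z : ℂ) * Complex.I) :=
      (hsc ψ hψc j).comp_left (g := fun t : ℝ => (t : ℂ) * Complex.I) (by simp)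
    exact h1.add h2
  have hFg : ∀ j, IsWeakGradientC (F j) (increments A j) (increments B j) := fun j => by
    refine ⟨?_, ?_⟩
    · simpa [F] using hAi j
    · simpa [F] using hBi j
  choose h hr hn using fun j => hC (F j) (hFs j) (hFc j) _ _ (hFg j)
  have hhs : ∑' j, eLpNorm (h j) p 𝓥 ≤ C * (eLpNorm (fun z => ‖X z‖) p 𝓥 +
      eLpNorm (fun z => ‖Y z‖) p 𝓥 + min ε 1) := by
    calc ∑' j, eLpNorm (h j) p 𝓥 ≤ ∑' j, C * (eLpNorm (fun z => ‖increments A j z‖) p 𝓥 +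
          eLpNorm (fun z => ‖increments B j z‖) p 𝓥) := by
          refine ENNReal.tsum_le_tsum fun j => (hn j).trans ?_
          gcongr
          exact eLpNorm_gradLength_le hp (hAi j) (hBi j)
      _ = C * (∑' j, eLpNorm (fun z => ‖increments A j z‖) p 𝓥 +
          ∑' j, eLpNorm (fun z => ‖increments B j z‖) p 𝓥) := by
          rw [ENNReal.tsum_mul_left, ENNReal.tsum_add]
      _ ≤ C * ((eLpNorm (fun z => ‖X z‖) p 𝓥 + min ε 1 / 2) +
          (eLpNorm (fun z => ‖Y z‖) p 𝓥 + min ε 1 / 2)) := by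
          gcongr
          · exact hsum X _ φ A hX hXY.1 hA hAn
          · exact hsum Y _ ψ B hY hXY.2 hB hBn
      _ = _ := by rw [add_add_add_comm, ENNReal.add_halves]
  have hlim : Tendsto (fun N => eLpNorm (fun z => ∑ j ∈ Finset.range N, F j z - f z) p 𝓥) atTop
      (𝓝 0) := by
    rw [← tendsto_add_atTop_iff_nat 1]
    have h2δ : Tendsto (fun N => δ N + δ N) atTop (𝓝 0) := by simpa using hδl.add hδl
    refine tendsto_of_tendsto_of_tendsto_of_le_of_le tendsto_const_nhds h2δ (fun _ => zero_le)
      fun N => ?_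
    have e : ∀ z, ∑ j ∈ Finset.range (N + 1), F j z = Φ N z := fun z => by
      have h1 := congrFun (sum_increments φ N) z
      have h2 := congrFun (sum_increments ψ N) z
      rw [Finset.sum_apply] at h1 h2
      simp only [F, Φ, Finset.sum_add_distrib, ← Finset.sum_mul, ← Complex.ofReal_sum, h1, h2]
    simp only [e]
    refine le_trans (eLpNorm_mono_real (g := (fun z => ‖(f z).re - φ N z‖) +
      fun z => ‖(f z).im - ψ N z‖) fun z => ?_) ((eLpNorm_add_le ?_ ?_ hp).trans ?_)
    · refine (Complex.norm_le_abs_re_add_abs_im _).trans (le_of_eq ?_)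
      simp [Φ, abs_sub_comm]
    · exact (hf.re.1.sub (hφ N).continuous.aestronglyMeasurable).norm
    · exact (hf.im.1.sub (hψ N).continuous.aestronglyMeasurable).norm
    · rw [eLpNorm_norm, eLpNorm_norm]
      exact add_le_add (hφn N) (hψn N)
  have hfin : (C : ℝ≥0∞) * (eLpNorm (fun z => ‖X z‖) p 𝓥 + eLpNorm (fun z => ‖Y z‖) p 𝓥 +
      min ε 1) ≠ ⊤ :=
    ENNReal.mul_ne_top ENNReal.coe_ne_top (ENNReal.add_ne_top.2
      ⟨ENNReal.add_ne_top.2 ⟨hX.2.ne, hY.2.ne⟩, by simp⟩)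
  obtain ⟨k, hk1, hk2⟩ := hL.exists_isRootLp_of_series hw hm hp hr hf hlim
    (ne_top_of_le_ne_top hfin hhs)
  refine ⟨k, hk1, hk2.trans (hhs.trans ?_)⟩
  gcongr
  exact min_le_left _ _

end Riesz


/-! ### The norm of `W^{1,p}_L`, and Hölder's inequality. -/

section Norm

variable {M : Type*} [MeasurableSpace M] {μ : Measure M} {L : Lp ℂ 2 μ →ₗ.[ℂ] Lp ℂ 2 μ}
  {m : ℝ} {p : ℝ≥0∞} {f h : M → ℂ}

theorem normW_le_of_isRootLp (hf : IsRootLp L m p f h) :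
    normW L m p f ≤ eLpNorm f p μ + eLpNorm h p μ :=
  add_le_add_right (iInf₂_le h hf) _

theorem MemW.normW_lt_top (hf : MemW L m p f) : normW L m p f < ⊤ := by
  obtain ⟨h, hh⟩ := hf
  exact (normW_le_of_isRootLp hh).trans_lt (ENNReal.add_lt_top.2 ⟨hh.1.2, hh.2.1.2⟩)

theorem MemW.memLp (hf : MemW L m p f) : MemLp f p μ := hf.choose_spec.1

theorem eLpNorm_le_normW (f : M → ℂ) : eLpNorm f p μ ≤ normW L m p f := le_self_add

/-- The infimum over the values of `L^{1/m} f` need not be attained, hence the slack `ε`, carried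
along until the final estimates. -/
theorem MemW.exists_isRootLp_le (hf : MemW L m p f) {ε : ℝ≥0∞} (hε : ε ≠ 0) :
    ∃ h, IsRootLp L m p f h ∧ eLpNorm h p μ ≤ normW L m p f + ε := by
  have hlt : (⨅ (h : M → ℂ) (_ : IsRootLp L m p f h), eLpNorm h p μ) <
      (⨅ (h : M → ℂ) (_ : IsRootLp L m p f h), eLpNorm h p μ) + ε :=
    ENNReal.lt_add_right (ne_top_of_le_ne_top hf.normW_lt_top.ne le_add_self) hε
  obtain ⟨h, hh⟩ := iInf_lt_iff.1 hlt
  obtain ⟨h1, h2⟩ := iInf_lt_iff.1 hh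
  exact ⟨h, h1, h2.le.trans (by gcongr; exact le_add_self)⟩

end Norm

theorem eLpNorm_mul_le_of_holder {α 𝕜 : Type*} [MeasurableSpace α] {μ : Measure α}
    [NormedField 𝕜] {p q r : ℝ≥0∞} [p.HolderTriple q r] {a b : α → 𝕜}
    (ha : AEStronglyMeasurable a μ) (hb : AEStronglyMeasurable b μ) :
    eLpNorm (fun z => a z * b z) r μ ≤ eLpNorm a p μ * eLpNorm b q μ :=
  eLpNorm_smul_le_mul_eLpNorm (φ := a) (f := b) hb ha

theorem memLp_mul_of_holder {α 𝕜 : Type*} [MeasurableSpace α] {μ : Measure α}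
    [NormedField 𝕜] {p q r : ℝ≥0∞} [p.HolderTriple q r] {a b : α → 𝕜}
    (ha : MemLp a p μ) (hb : MemLp b q μ) : MemLp (fun z => a z * b z) r μ :=
  MemLp.mul (φ := a) (f := b) hb ha

/-! ### The Leibniz rule. -/

section Leibniz

variable {n : ℕ} {M : Type*} [MetricSpace M] [SecondCountableTopology M]
  [MeasurableSpace M] [BorelSpace M] [ChartedSpace (EuclideanSpace ℝ (Fin n)) M]
  [IsManifold (𝓡 n) ∞ M]
  [RiemannianBundle (fun x : M => TangentSpace (𝓡 n) x)]
  [IsContMDiffRiemannianBundle (𝓡 n) ∞ (EuclideanSpace ℝ (Fin n))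
      (fun x : M => TangentSpace (𝓡 n) x)]

local notation "𝓥" => riemannianVolume n M

variable {p₁ q₁ p₂ q₂ r : ℝ≥0∞}

/-- The product rule in Hölder exponents. -/
theorem IsWeakGradient.mul_holder [p₁.HolderTriple q₁ r] [p₂.HolderTriple q₂ r] (hr : 1 ≤ r)
    {a b : M → ℝ} {X Y : (z : M) → TangentSpace (𝓡 n) z} (hX : IsWeakGradient a X)
    (hY : IsWeakGradient b Y) (ha₁ : MemLp a p₁ 𝓥) (ha₂ : MemLp a p₂ 𝓥)
    (hXp : MemLp (fun z => ‖X z‖) p₁ 𝓥) (hb : MemLp b q₁ 𝓥)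
    (hYq : MemLp (fun z => ‖Y z‖) q₂ 𝓥) :
    IsWeakGradient (fun z => a z * b z) (fun z => b z • X z + a z • Y z) ∧
      eLpNorm (fun z => ‖b z • X z + a z • Y z‖) r 𝓥 ≤
        eLpNorm (fun z => ‖X z‖) p₁ 𝓥 * eLpNorm b q₁ 𝓥 +
          eLpNorm a p₂ 𝓥 * eLpNorm (fun z => ‖Y z‖) q₂ 𝓥 := by
  have h1 : MemLp (fun z => a z * b z) r 𝓥 := memLp_mul_of_holder ha₁ hb
  have h2 : MemLp (fun z => ‖X z‖ * b z) r 𝓥 := memLp_mul_of_holder hXp hb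
  have h3 : MemLp (fun z => a z * ‖Y z‖) r 𝓥 := memLp_mul_of_holder ha₂ hYq
  refine ⟨hX.mul hr hY h1 h2 h3, ?_⟩
  calc eLpNorm (fun z => ‖b z • X z + a z • Y z‖) r 𝓥
      ≤ eLpNorm ((fun z => ‖‖X z‖ * b z‖) + fun z => ‖a z * ‖Y z‖‖) r 𝓥 := by
        refine eLpNorm_mono_real fun z => ?_
        rw [norm_norm, Pi.add_apply]
        refine (norm_add_le _ _).trans (le_of_eq ?_)
        rw [norm_smul, norm_smul, norm_mul, norm_mul, norm_norm, norm_norm, mul_comm]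
    _ ≤ eLpNorm (fun z => ‖X z‖ * b z) r 𝓥 + eLpNorm (fun z => a z * ‖Y z‖) r 𝓥 := by
        refine (eLpNorm_add_le h2.1.norm h3.1.norm hr).trans (le_of_eq ?_)
        rw [eLpNorm_norm, eLpNorm_norm]
    _ ≤ _ := add_le_add (eLpNorm_mul_le_of_holder hXp.1 hb.1)
        (eLpNorm_mul_le_of_holder ha₂.1 hYq.1)

theorem eLpNorm_re_le {p : ℝ≥0∞} (f : M → ℂ) :
    eLpNorm (fun z => (f z).re) p 𝓥 ≤ eLpNorm f p 𝓥 :=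
  eLpNorm_mono fun z => Complex.abs_re_le_norm (f z)

theorem eLpNorm_im_le {p : ℝ≥0∞} (f : M → ℂ) :
    eLpNorm (fun z => (f z).im) p 𝓥 ≤ eLpNorm f p 𝓥 :=
  eLpNorm_mono fun z => Complex.abs_im_le_norm (f z)

theorem eLpNorm_norm_left_le {p : ℝ≥0∞} (X Y : (z : M) → TangentSpace (𝓡 n) z) :
    eLpNorm (fun z => ‖X z‖) p 𝓥 ≤ eLpNorm (gradLength X Y) p 𝓥 :=
  eLpNorm_mono_real fun z => by rw [norm_norm]; exact norm_left_le_gradLength X Y z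

theorem eLpNorm_norm_right_le {p : ℝ≥0∞} (X Y : (z : M) → TangentSpace (𝓡 n) z) :
    eLpNorm (fun z => ‖Y z‖) p 𝓥 ≤ eLpNorm (gradLength X Y) p 𝓥 :=
  eLpNorm_mono_real fun z => by rw [norm_norm]; exact norm_right_le_gradLength X Y z

/-- Real and imaginary parts of `f g` are each a combination of two real products; this accounts for
the factor 2. -/
theorem exists_isWeakGradientC_mul [p₁.HolderTriple q₁ r] [p₂.HolderTriple q₂ r] (hr : 1 ≤ r)
    {f g : M → ℂ} {X Y X' Y' : (z : M) → TangentSpace (𝓡 n) z}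
    (hf : IsWeakGradientC f X Y) (hg : IsWeakGradientC g X' Y')
    (hf₁ : MemLp f p₁ 𝓥) (hf₂ : MemLp f p₂ 𝓥) (hg₁ : MemLp g q₁ 𝓥)
    (hX : eLpNorm (gradLength X Y) p₁ 𝓥 < ⊤) (hX' : eLpNorm (gradLength X' Y') q₂ 𝓥 < ⊤) :
    ∃ Z Z' : (z : M) → TangentSpace (𝓡 n) z, IsWeakGradientC (fun z => f z * g z) Z Z' ∧
      eLpNorm (fun z => ‖Z z‖) r 𝓥 ≤ 2 * (eLpNorm (gradLength X Y) p₁ 𝓥 * eLpNorm g q₁ 𝓥 +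
        eLpNorm f p₂ 𝓥 * eLpNorm (gradLength X' Y') q₂ 𝓥) ∧
      eLpNorm (fun z => ‖Z' z‖) r 𝓥 ≤ 2 * (eLpNorm (gradLength X Y) p₁ 𝓥 * eLpNorm g q₁ 𝓥 +
        eLpNorm f p₂ 𝓥 * eLpNorm (gradLength X' Y') q₂ 𝓥) := by
  have aX : MemLp (fun z => ‖X z‖) p₁ 𝓥 :=
    ⟨hf.1.aestronglyMeasurable_norm, (eLpNorm_norm_left_le X Y).trans_lt hX⟩
  have aY : MemLp (fun z => ‖Y z‖) p₁ 𝓥 :=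
    ⟨hf.2.aestronglyMeasurable_norm, (eLpNorm_norm_right_le X Y).trans_lt hX⟩
  have aX' : MemLp (fun z => ‖X' z‖) q₂ 𝓥 :=
    ⟨hg.1.aestronglyMeasurable_norm, (eLpNorm_norm_left_le X' Y').trans_lt hX'⟩
  have aY' : MemLp (fun z => ‖Y' z‖) q₂ 𝓥 :=
    ⟨hg.2.aestronglyMeasurable_norm, (eLpNorm_norm_right_le X' Y').trans_lt hX'⟩
  obtain ⟨g1, n1⟩ := hf.1.mul_holder (q₁ := q₁) (p₂ := p₂) (q₂ := q₂) hr hg.1 hf₁.re hf₂.re aX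
    hg₁.re aX'
  obtain ⟨g2, n2⟩ := hf.2.mul_holder (q₁ := q₁) (p₂ := p₂) (q₂ := q₂) hr hg.2 hf₁.im hf₂.im aY
    hg₁.im aY'
  obtain ⟨g3, n3⟩ := hf.1.mul_holder (q₁ := q₁) (p₂ := p₂) (q₂ := q₂) hr hg.2 hf₁.re hf₂.re aX
    hg₁.im aY'
  obtain ⟨g4, n4⟩ := hf.2.mul_holder (q₁ := q₁) (p₂ := p₂) (q₂ := q₂) hr hg.1 hf₁.im hf₂.im aY
    hg₁.re aX'
  have e1 := eLpNorm_re_le (n := n) (p := q₁) g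
  have e2 := eLpNorm_im_le (n := n) (p := q₁) g
  have e3 := eLpNorm_re_le (n := n) (p := p₂) f
  have e4 := eLpNorm_im_le (n := n) (p := p₂) f
  have l1 := eLpNorm_norm_left_le (p := p₁) X Y
  have l2 := eLpNorm_norm_right_le (p := p₁) X Y
  have l3 := eLpNorm_norm_left_le (p := q₂) X' Y'
  have l4 := eLpNorm_norm_right_le (p := q₂) X' Y'
  refine ⟨fun z => ((g z).re • X z + (f z).re • X' z) - ((g z).im • Y z + (f z).im • Y' z),
    fun z => ((g z).im • X z + (f z).re • Y' z) + ((g z).re • Y z + (f z).im • X' z),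
    ⟨?_, ?_⟩, ?_, ?_⟩
  · simpa only [Complex.mul_re] using g1.sub g2
  · simpa only [Complex.mul_im] using g3.add g4
  · rw [two_mul]
    refine le_trans (eLpNorm_mono_real (g := (fun z => ‖(g z).re • X z + (f z).re • X' z‖) +
      fun z => ‖(g z).im • Y z + (f z).im • Y' z‖) fun z => ?_)
      ((eLpNorm_add_le g1.aestronglyMeasurable_norm g2.aestronglyMeasurable_norm hr).trans
        (add_le_add (n1.trans ?_) (n2.trans ?_)))
    · rw [norm_norm, Pi.add_apply]; exact norm_sub_le _ _
    · gcongr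
    · gcongr
  · rw [two_mul]
    refine le_trans (eLpNorm_mono_real (g := (fun z => ‖(g z).im • X z + (f z).re • Y' z‖) +
      fun z => ‖(g z).re • Y z + (f z).im • X' z‖) fun z => ?_)
      ((eLpNorm_add_le g3.aestronglyMeasurable_norm g4.aestronglyMeasurable_norm hr).trans
        (add_le_add (n3.trans ?_) (n4.trans ?_)))
    · rw [norm_norm, Pi.add_apply]; exact norm_add_le _ _
    · gcongr
    · gcongr

variable {L : Lp ℂ 2 (riemannianVolume n M) →ₗ.[ℂ] Lp ℂ 2 (riemannianVolume n M)}
  {w m : ℝ}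

/-- The Leibniz rule for `L^{1/m}`. -/
theorem exists_leibniz [ProperSpace M] [IsRiemannianManifold (𝓡 n) M]
    (hL : IsOfType L w) (hw : w < Real.pi / 2) (hm : 1 < m)
    (hr : 1 ≤ r) (hr' : r ≠ ⊤) (hp₁ : r ≤ p₁) (hq₂ : r ≤ q₂)
    (e₁ : r⁻¹ = p₁⁻¹ + q₁⁻¹) (e₂ : r⁻¹ = p₂⁻¹ + q₂⁻¹)
    (hR₁ : RieszBounded n L m p₁) (hR₂ : RieszBounded n L m q₂) (hR : ReverseRiesz n L m r) :
    ∃ C : ℝ≥0, ∀ f g : M → ℂ, MemW L m p₁ f → MemLp f p₂ 𝓥 → MemW L m q₂ g → MemLp g q₁ 𝓥 →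
      MemW L m r (fun x => f x * g x) ∧
        normW L m r (fun x => f x * g x) ≤
          C * (normW L m p₁ f * eLpNorm g q₁ 𝓥 + eLpNorm f p₂ 𝓥 * normW L m q₂ g) := by
  have i₁ : p₁.HolderTriple q₁ r := ⟨e₁.symm⟩
  have i₂ : p₂.HolderTriple q₂ r := ⟨e₂.symm⟩
  obtain ⟨C₁, hC₁⟩ := exists_gradient_of_isRootLp hL hw hm (hr.trans hp₁) hR₁
  obtain ⟨C₂, hC₂⟩ := exists_gradient_of_isRootLp hL hw hm (hr.trans hq₂) hR₂
  obtain ⟨C₃, hC₃⟩ := exists_isRootLp_of_gradient hL hw hm hr hr' hR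
  -- One constant for both Riesz bounds.
  set K : ℝ≥0 := C₁ + C₂
  have main : ∀ f g : M → ℂ, MemW L m p₁ f → MemLp f p₂ 𝓥 → MemW L m q₂ g → MemLp g q₁ 𝓥 →
      ∀ ε : ℝ≥0∞, ε ≠ 0 → ε ≠ ⊤ → ∃ h, IsRootLp L m r (fun x => f x * g x) h ∧
        eLpNorm h r 𝓥 ≤ C₃ * (4 * (K * ((normW L m p₁ f + (ε + ε)) * eLpNorm g q₁ 𝓥 +
          eLpNorm f p₂ 𝓥 * (normW L m q₂ g + (ε + ε)))) + ε) := by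
    intro f g hf hf' hg hg' ε hε hεt
    obtain ⟨h₁, hh₁, hn₁⟩ := hf.exists_isRootLp_le hε
    obtain ⟨h₂, hh₂, hn₂⟩ := hg.exists_isRootLp_le hε
    obtain ⟨X, Y, hXY, hN⟩ := hC₁ f h₁ hh₁ ε hε
    obtain ⟨X', Y', hXY', hN'⟩ := hC₂ g h₂ hh₂ ε hε
    have b₁ : eLpNorm (gradLength X Y) p₁ 𝓥 ≤ K * (normW L m p₁ f + (ε + ε)) := by
      refine hN.trans ?_
      rw [← add_assoc]
      gcongr
      exact le_self_add
    have b₂ : eLpNorm (gradLength X' Y') q₂ 𝓥 ≤ K * (normW L m q₂ g + (ε + ε)) := by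
      refine hN'.trans ?_
      rw [← add_assoc]
      gcongr
      exact le_add_self
    have f₁ : (K : ℝ≥0∞) * (normW L m p₁ f + (ε + ε)) < ⊤ := ENNReal.mul_lt_top
      ENNReal.coe_lt_top (by simp [hf.normW_lt_top, hεt.lt_top])
    have f₂ : (K : ℝ≥0∞) * (normW L m q₂ g + (ε + ε)) < ⊤ := ENNReal.mul_lt_top
      ENNReal.coe_lt_top (by simp [hg.normW_lt_top, hεt.lt_top])
    obtain ⟨Z, Z', hZ, hz, hz'⟩ := exists_isWeakGradientC_mul (q₁ := q₁) (p₂ := p₂) hr hXY hXY'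
      hf.memLp hf' hg' (b₁.trans_lt f₁) (b₂.trans_lt f₂)
    have hfin : 2 * (eLpNorm (gradLength X Y) p₁ 𝓥 * eLpNorm g q₁ 𝓥 +
        eLpNorm f p₂ 𝓥 * eLpNorm (gradLength X' Y') q₂ 𝓥) < ⊤ :=
      ENNReal.mul_lt_top (by simp) (ENNReal.add_lt_top.2
        ⟨ENNReal.mul_lt_top (b₁.trans_lt f₁) hg'.2, ENNReal.mul_lt_top hf'.2 (b₂.trans_lt f₂)⟩)
    have hfg : MemLp (fun x => f x * g x) r 𝓥 := memLp_mul_of_holder hf.memLp hg'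
    obtain ⟨h, hh, hhn⟩ := hC₃ _ Z Z' hfg hZ
      ⟨hZ.1.aestronglyMeasurable_norm, hz.trans_lt hfin⟩
      ⟨hZ.2.aestronglyMeasurable_norm, hz'.trans_lt hfin⟩ ε hε
    refine ⟨h, hh, hhn.trans ?_⟩
    gcongr
    calc _ ≤ _ := add_le_add hz hz'
      _ = 4 * (eLpNorm (gradLength X Y) p₁ 𝓥 * eLpNorm g q₁ 𝓥 +
        eLpNorm f p₂ 𝓥 * eLpNorm (gradLength X' Y') q₂ 𝓥) := by ring
      _ ≤ 4 * ((K * (normW L m p₁ f + (ε + ε))) * eLpNorm g q₁ 𝓥 +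
          eLpNorm f p₂ 𝓥 * (K * (normW L m q₂ g + (ε + ε)))) := by gcongr
      _ = _ := by ring
  -- The 1 pays for `‖fg‖_r` by Hölder. The 4 comes from two real fields, each bounded with a factor
  -- 2.
  refine ⟨1 + 4 * C₃ * K, fun f g hf hf' hg hg' => ⟨?_, ?_⟩⟩
  · obtain ⟨h, hh, -⟩ := main f g hf hf' hg hg' 1 one_ne_zero ENNReal.one_ne_top
    exact ⟨h, hh⟩
  set A := normW L m p₁ f
  set B := normW L m q₂ g
  set b := eLpNorm g q₁ 𝓥
  set a := eLpNorm f p₂ 𝓥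
  have hfg : eLpNorm (fun x => f x * g x) r 𝓥 ≤ A * b :=
    (eLpNorm_mul_le_of_holder hf.memLp.1 hg'.1).trans
      (mul_le_mul_left (eLpNorm_le_normW f) _)
  refine ENNReal.le_of_forall_pos_le_add fun η hη _ => ?_
  -- `D` is the total coefficient of `ε` in the bound supplied by `main`; with `ε = η / (D + 1)` the
  -- excess is at most `η`.
  set D : ℝ≥0∞ := C₃ * (8 * (K * (b + a)) + 1)
  have hD : D ≠ ⊤ := ENNReal.mul_ne_top ENNReal.coe_ne_top (ENNReal.add_ne_top.2
    ⟨ENNReal.mul_ne_top (by simp) (ENNReal.mul_ne_top ENNReal.coe_ne_top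
      (ENNReal.add_ne_top.2 ⟨hg'.2.ne, hf'.2.ne⟩)), by simp⟩)
  have hD1 : D + 1 ≠ ⊤ := ENNReal.add_ne_top.2 ⟨hD, by simp⟩
  obtain ⟨h, hh, hhn⟩ := main f g hf hf' hg hg' (η / (D + 1))
    (ENNReal.div_pos (by simpa using hη.ne') hD1).ne'
    (ENNReal.div_ne_top (by simp) (by simp))
  set ε : ℝ≥0∞ := η / (D + 1)
  have hε : D * ε ≤ η := by
    calc D * ε ≤ (D + 1) * ε := by gcongr; exact le_self_add
      _ ≤ η := ENNReal.mul_div_le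
  calc normW L m r (fun x => f x * g x)
      ≤ A * b + C₃ * (4 * (K * ((A + (ε + ε)) * b + a * (B + (ε + ε)))) + ε) :=
        (normW_le_of_isRootLp hh).trans (add_le_add hfg hhn)
    _ = (A * b + 4 * C₃ * K * (A * b + a * B)) + D * ε := by simp only [D]; ring
    _ ≤ ((A * b + a * B) + 4 * C₃ * K * (A * b + a * B)) + η := by
        gcongr
        exact le_self_add
    _ = _ := by push_cast; ring

end Leibniz


/-! ### Averages over balls for a doubling measure. -/

section Averages

variable {M : Type*} [MetricSpace M] [SecondCountableTopology M] [MeasurableSpace M] [BorelSpace M]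
  {μ : Measure M} [IsLocallyFiniteMeasure μ] [μ.IsOpenPosMeasure]

theorem measurableSet_dist_lt (R : ℝ) : MeasurableSet {q : M × M | dist q.1 q.2 < R} :=
  measurableSet_lt (measurable_fst.dist measurable_snd) measurable_const

theorem measurable_measure_ball (R : ℝ) : Measurable fun x => μ (Metric.ball x R) := by
  have e : (fun x => μ (Metric.ball x R)) =
      fun x => μ (Prod.mk x ⁻¹' {q : M × M | dist q.1 q.2 < R}) := by
    funext x
    congr 1
    ext y
    simp [dist_comm]
  rw [e]
  exact measurable_measure_prodMk_left (measurableSet_dist_lt R)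

theorem measure_ball_ne_zero (x : M) {R : ℝ} (hR : 0 < R) : μ (Metric.ball x R) ≠ 0 :=
  (Metric.measure_ball_pos μ x hR).ne'

theorem inv_measure_ball_le {C : ℝ≥0} (hC : ∀ (x : M) (ρ : ℝ), 0 < ρ →
    μ (Metric.ball x (2 * ρ)) ≤ C * μ (Metric.ball x ρ)) {x y : M} {R : ℝ} (hR : 0 < R)
    (hxy : dist x y < R) :
    (μ (Metric.ball x R))⁻¹ ≤ C * (μ (Metric.ball y R))⁻¹ := by
  have hsub : Metric.ball y R ⊆ Metric.ball x (2 * R) := by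
    refine Metric.ball_subset_ball' ?_
    rw [dist_comm] at hxy
    linarith
  have h1 : μ (Metric.ball y R) ≤ C * μ (Metric.ball x R) := (measure_mono hsub).trans (hC x R hR)
  rw [ENNReal.inv_le_iff_inv_le, ENNReal.mul_inv (Or.inr (by
    simpa using measure_ball_ne_zero y hR)) (Or.inl ENNReal.coe_ne_top), inv_inv]
  rw [← ENNReal.div_eq_inv_mul]
  exact ENNReal.div_le_of_le_mul' h1

/-- Balls of equal radius with centres closer than the radius have comparable measures, so the
integrand is at most `C / μ(B(y, R))`. -/
theorem lintegral_inv_measure_ball_le (hD : Doubling μ) {C : ℝ≥0} (hC : ∀ (x : M) (ρ : ℝ), 0 < ρ →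
    μ (Metric.ball x (2 * ρ)) ≤ C * μ (Metric.ball x ρ)) (y : M) {R : ℝ} (hR : 0 < R) :
    ∫⁻ x in Metric.ball y R, (μ (Metric.ball x R))⁻¹ ∂μ ≤ C := by
  calc ∫⁻ x in Metric.ball y R, (μ (Metric.ball x R))⁻¹ ∂μ
      ≤ ∫⁻ _ in Metric.ball y R, C * (μ (Metric.ball y R))⁻¹ ∂μ :=
        setLIntegral_mono' measurableSet_ball fun x hx => inv_measure_ball_le hC hR hx
    _ = C := by
        rw [setLIntegral_const, mul_assoc, ENNReal.inv_mul_cancel (measure_ball_ne_zero y hR)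
          (hD.measure_ball_lt_top y R).ne, mul_one]

/-- Tonelli on the set `{d(x, y) < R}`, which is symmetric in `x` and `y`. -/
theorem lintegral_ball_swap {G : M → ℝ≥0∞} (hG : AEMeasurable G μ) {V : M → ℝ≥0∞}
    (hV : Measurable V) (R : ℝ) :
    ∫⁻ x, V x * ∫⁻ y in Metric.ball x R, G y ∂μ ∂μ =
      ∫⁻ y, G y * ∫⁻ x in Metric.ball y R, V x ∂μ ∂μ ∧
    AEMeasurable (fun x => V x * ∫⁻ y in Metric.ball x R, G y ∂μ) μ := by
  let F : M → M → ℝ≥0∞ := fun x y =>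
    {q : M × M | dist q.1 q.2 < R}.indicator (fun q => V q.1 * G q.2) (x, y)
  have hF : AEMeasurable (Function.uncurry F) (μ.prod μ) :=
    ((hV.comp measurable_fst).aemeasurable.mul hG.comp_snd).indicator (measurableSet_dist_lt R)
  have e1 : ∀ x, V x * ∫⁻ y in Metric.ball x R, G y ∂μ = ∫⁻ y, F x y ∂μ := fun x => by
    rw [← lintegral_const_mul'' _ hG.restrict, ← lintegral_indicator measurableSet_ball]
    refine lintegral_congr fun y => ?_
    simp only [F, indicator, Metric.mem_ball, mem_ofPred_eq, dist_comm]
  have e2 : ∀ y, G y * ∫⁻ x in Metric.ball y R, V x ∂μ = ∫⁻ x, F x y ∂μ := fun y => by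
    rw [← lintegral_const_mul _ hV, ← lintegral_indicator measurableSet_ball]
    refine lintegral_congr fun x => ?_
    simp only [F, indicator, Metric.mem_ball, mem_ofPred_eq, mul_comm]
  refine ⟨?_, ?_⟩
  · simp only [e1, e2]
    exact lintegral_lintegral_swap hF
  · simp only [e1]
    exact hF.lintegral_prod_right

theorem lintegral_average_le (hD : Doubling μ) {C : ℝ≥0} (hC : ∀ (x : M) (ρ : ℝ), 0 < ρ →
    μ (Metric.ball x (2 * ρ)) ≤ C * μ (Metric.ball x ρ)) {G : M → ℝ≥0∞} (hG : AEMeasurable G μ)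
    {R : ℝ} (hR : 0 < R) :
    ∫⁻ x, (μ (Metric.ball x R))⁻¹ * ∫⁻ y in Metric.ball x R, G y ∂μ ∂μ ≤ C * ∫⁻ y, G y ∂μ := by
  have h := (lintegral_ball_swap hG (measurable_measure_ball (μ := μ) R).inv R).1
  simp only [Pi.inv_apply] at h
  rw [h, ← lintegral_const_mul'' _ hG]
  refine lintegral_mono fun y => ?_
  rw [mul_comm]
  exact mul_le_mul_left (lintegral_inv_measure_ball_le hD hC y hR) _

/-- Insert `1 = μ(B(y,R))⁻¹ ∫ 1_{B(y,R)}(x) dμ(x)`, exchange the integrals and use the hypothesis on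
each ball `B(x, R)`. It passes from local sup bounds to a global integral bound without a covering
argument. -/
theorem lintegral_le_lintegral_of_ball_bound (hD : Doubling μ) {C : ℝ≥0} (hC : ∀ (x : M) (ρ : ℝ), 0 < ρ →
    μ (Metric.ball x (2 * ρ)) ≤ C * μ (Metric.ball x ρ)) {G N : M → ℝ≥0∞} (hG : AEMeasurable G μ)
    {R : ℝ} (hR : 0 < R) (hN : ∀ x, ∀ᵐ y ∂(μ.restrict (Metric.ball x R)), G y ≤ N x) :
    ∫⁻ y, G y ∂μ ≤ C * ∫⁻ x, N x ∂μ := by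
  have hV := (measurable_measure_ball (μ := μ) R).inv
  calc ∫⁻ y, G y ∂μ = ∫⁻ y, (G y * (μ (Metric.ball y R))⁻¹) * μ (Metric.ball y R) ∂μ := by
        refine lintegral_congr fun y => ?_
        rw [mul_assoc, ENNReal.inv_mul_cancel (measure_ball_ne_zero y hR)
          (hD.measure_ball_lt_top y R).ne, mul_one]
    _ = ∫⁻ x, ∫⁻ y in Metric.ball x R, G y * (μ (Metric.ball y R))⁻¹ ∂μ ∂μ := by
        have := (lintegral_ball_swap (hG.mul hV.aemeasurable) (measurable_const (a := 1)) R).1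
        simpa using this.symm
    _ ≤ ∫⁻ x, C * N x ∂μ := by
        refine lintegral_mono fun x => ?_
        calc ∫⁻ y in Metric.ball x R, G y * (μ (Metric.ball y R))⁻¹ ∂μ
            ≤ ∫⁻ y in Metric.ball x R, N x * (μ (Metric.ball y R))⁻¹ ∂μ := by
              refine lintegral_mono_ae ?_
              filter_upwards [hN x] with y hy
              gcongr
          _ = N x * ∫⁻ y in Metric.ball x R, (μ (Metric.ball y R))⁻¹ ∂μ :=
              lintegral_const_mul _ hV
          _ ≤ C * N x := by
              rw [mul_comm]
              exact mul_le_mul_left (lintegral_inv_measure_ball_le hD hC x hR) _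
    _ = C * ∫⁻ x, N x ∂μ := lintegral_const_mul' _ _ ENNReal.coe_ne_top

end Averages

/-- Cauchy–Schwarz with respect to the weights `c k`. -/
theorem tsum_mul_rpow_two_le (c a : ℕ → ℝ≥0∞) :
    (∑' k, c k * a k) ^ (2 : ℝ) ≤ (∑' k, c k) * ∑' k, c k * a k ^ (2 : ℝ) := by
  have h : ∑' k, c k * a k ≤
      (∑' k, c k) ^ (1 - (2 : ℝ)⁻¹) * (∑' k, c k * a k ^ (2 : ℝ)) ^ (2 : ℝ)⁻¹ := by
    refine ENNReal.tsum_le_of_sum_range_le fun n => ?_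
    refine (ENNReal.inner_le_weight_mul_Lp_of_nonneg _ one_le_two c a).trans ?_
    gcongr
    · exact ENNReal.sum_le_tsum _
    · exact ENNReal.sum_le_tsum _
  refine (ENNReal.rpow_le_rpow h zero_le_two).trans (le_of_eq ?_)
  rw [ENNReal.mul_rpow_of_nonneg _ _ zero_le_two, ← ENNReal.rpow_mul, ← ENNReal.rpow_mul]
  norm_num

/-! ### Consequences of off-diagonal decay. -/

section Decay

variable {M : Type*} [MetricSpace M] [SecondCountableTopology M] [MeasurableSpace M] [BorelSpace M]
  {μ : Measure M} [IsLocallyFiniteMeasure μ] [μ.IsOpenPosMeasure]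

theorem eLpNorm_two_rpow {f : M → ℂ} (ν : Measure M) :
    eLpNorm f 2 ν ^ (2 : ℝ) = ∫⁻ z, ‖f z‖ₑ ^ (2 : ℝ) ∂ν := by
  have := eLpNorm_nnreal_pow_eq_lintegral (μ := ν) (f := f) (p := 2) two_ne_zero
  simpa using this

theorem isProbabilityMeasure_average (hD : Doubling μ) (x : M) {R : ℝ} (hR : 0 < R) :
    IsProbabilityMeasure ((μ (Metric.ball x R))⁻¹ • μ.restrict (Metric.ball x R)) :=
  ⟨by simp [ENNReal.inv_mul_cancel (measure_ball_ne_zero x hR) (hD.measure_ball_lt_top x R).ne]⟩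

/-- Off-diagonal decay implies boundedness in `L^2`. -/
theorem lintegral_le_of_offDiagonal (hD : Doubling μ) {s : ℝ≥0∞} (hs2 : s ≤ 2) {c : ℕ → ℝ≥0∞}
    {C : ℝ≥0} (hC : ∀ (x : M) (ρ : ℝ), 0 < ρ →
      μ (Metric.ball x (2 * ρ)) ≤ C * μ (Metric.ball x ρ)) {A : ℝ≥0} {R : ℝ} (hR : 0 < R)
    {f F : M → ℂ} (hf : AEStronglyMeasurable f μ) (hF : AEStronglyMeasurable F μ)
    (h : ∀ x, eLpNorm F ⊤ (μ.restrict (Metric.ball x R)) ≤ A * ∑' k : ℕ, c k *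
      eLpNorm f s ((μ (Metric.ball x (2 ^ k * R)))⁻¹ • μ.restrict (Metric.ball x (2 ^ k * R)))) :
    ∫⁻ y, ‖F y‖ₑ ^ (2 : ℝ) ∂μ ≤
      (C * A * ∑' k, c k) ^ (2 : ℝ) * ∫⁻ y, ‖f y‖ₑ ^ (2 : ℝ) ∂μ := by
  have hRk : ∀ k : ℕ, 0 < 2 ^ k * R := fun k => by positivity
  have hG : AEMeasurable (fun y => ‖f y‖ₑ ^ (2 : ℝ)) μ := hf.enorm.pow_const _
  -- `N x` bounds `|F|²` on the ball at `x`: Cauchy–Schwarz in `k`, then Jensen to raise the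
  -- exponent `s` to 2. Each averaging operator is bounded on `L¹` uniformly in its radius, so the
  -- sum over `k` converges.
  let N : M → ℝ≥0∞ := fun x => (A : ℝ≥0∞) ^ (2 : ℝ) * ((∑' k, c k) * ∑' k, c k *
    ((μ (Metric.ball x (2 ^ k * R)))⁻¹ * ∫⁻ y in Metric.ball x (2 ^ k * R), ‖f y‖ₑ ^ (2 : ℝ) ∂μ))
  have hN : ∀ x, ∀ᵐ y ∂(μ.restrict (Metric.ball x R)), ‖F y‖ₑ ^ (2 : ℝ) ≤ N x := by
    intro x
    have h1 : ∀ᵐ y ∂(μ.restrict (Metric.ball x R)), ‖F y‖ₑ ≤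
        eLpNorm F ⊤ (μ.restrict (Metric.ball x R)) := by
      rw [eLpNorm_exponent_top]; exact ae_le_eLpNormEssSup
    filter_upwards [h1] with y hy
    refine (ENNReal.rpow_le_rpow (hy.trans (h x)) zero_le_two).trans ?_
    rw [ENNReal.mul_rpow_of_nonneg _ _ zero_le_two]
    refine mul_le_mul_right ((tsum_mul_rpow_two_le _ _).trans ?_) _
    gcongr with k
    have := isProbabilityMeasure_average hD x (hRk k)
    refine (ENNReal.rpow_le_rpow (eLpNorm_le_eLpNorm_of_exponent_le hs2
      ((hf.restrict).smul_measure _)) zero_le_two).trans (le_of_eq ?_)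
    rw [eLpNorm_two_rpow, lintegral_smul_measure, smul_eq_mul]
  refine (lintegral_le_lintegral_of_ball_bound hD hC (hF.enorm.pow_const _) hR hN).trans ?_
  have hm : ∀ k, AEMeasurable (fun x => (μ (Metric.ball x (2 ^ k * R)))⁻¹ *
      ∫⁻ y in Metric.ball x (2 ^ k * R), ‖f y‖ₑ ^ (2 : ℝ) ∂μ) μ := fun k =>
    (lintegral_ball_swap hG (measurable_measure_ball (2 ^ k * R)).inv _).2
  have hm2 : AEMeasurable (fun x => ∑' k, c k * ((μ (Metric.ball x (2 ^ k * R)))⁻¹ *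
      ∫⁻ y in Metric.ball x (2 ^ k * R), ‖f y‖ₑ ^ (2 : ℝ) ∂μ)) μ :=
    AEMeasurable.tsum fun k => (hm k).const_mul _
  simp only [N]
  rw [lintegral_const_mul'' _ (hm2.const_mul _), lintegral_const_mul'' _ hm2,
    lintegral_tsum fun k => (hm k).const_mul _]
  calc _ ≤ (C : ℝ≥0∞) * ((A : ℝ≥0∞) ^ (2 : ℝ) * ((∑' k, c k) * ∑' k, c k *
        (C * ∫⁻ y, ‖f y‖ₑ ^ (2 : ℝ) ∂μ))) := by
        gcongr with k
        rw [lintegral_const_mul'' _ (hm k)]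
        gcongr
        exact lintegral_average_le hD hC hG (hRk k)
    _ = _ := by
        rw [ENNReal.tsum_mul_right]
        simp only [ENNReal.rpow_two]
        ring

/-- Off-diagonal decay and a lower bound for the volume of balls imply `L^p`-`L^∞` bounds. -/
theorem eLpNorm_top_le_of_offDiagonal (hD : Doubling μ) {s p : ℝ≥0∞} (hsp : s ≤ p)
    {c : ℕ → ℝ≥0∞} {A : ℝ≥0} {R : ℝ} (hR : 0 < R) {V : ℝ≥0∞}
    (hV : ∀ x, V ≤ μ (Metric.ball x R)) {f F : M → ℂ} (hf : AEStronglyMeasurable f μ)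
    (h : ∀ x, eLpNorm F ⊤ (μ.restrict (Metric.ball x R)) ≤ A * ∑' k : ℕ, c k *
      eLpNorm f s ((μ (Metric.ball x (2 ^ k * R)))⁻¹ • μ.restrict (Metric.ball x (2 ^ k * R)))) :
    eLpNorm F ⊤ μ ≤ A * (∑' k, c k) * (V⁻¹ ^ (1 / p).toReal * eLpNorm f p μ) := by
  have hRk : ∀ k : ℕ, R ≤ 2 ^ k * R := fun k =>
    le_mul_of_one_le_left hR.le (one_le_pow₀ one_le_two)
  have hx : ∀ x, eLpNorm F ⊤ (μ.restrict (Metric.ball x R)) ≤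
      A * (∑' k, c k) * (V⁻¹ ^ (1 / p).toReal * eLpNorm f p μ) := by
    intro x
    refine (h x).trans ?_
    rw [mul_assoc, ← ENNReal.tsum_mul_right]
    gcongr with k
    -- For a normalised measure the exponent may be raised from `s` to `p`. Undoing the
    -- normalisation costs `V^(-1/p)`, since all the balls have measure at least `V`.
    have := isProbabilityMeasure_average hD x (hR.trans_le (hRk k))
    refine (eLpNorm_le_eLpNorm_of_exponent_le hsp ((hf.restrict).smul_measure _)).trans ?_
    rw [eLpNorm_smul_measure_of_ne_zero
      (ENNReal.inv_ne_zero.2 (hD.measure_ball_lt_top x _).ne), smul_eq_mul]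
    gcongr
    · exact (hV x).trans (measure_mono (Metric.ball_subset_ball (hRk k)))
    · exact Measure.restrict_le_self
  -- Countably many balls of radius `R` cover `M`, so the uniform local bounds give an essential
  -- supremum.
  obtain ⟨S, hS, hcov⟩ := TopologicalSpace.countable_cover_nhds
    fun x : M => Metric.ball_mem_nhds x hR
  rw [eLpNorm_exponent_top]
  refine eLpNormEssSup_le_of_ae_enorm_bound ?_
  generalize (A : ℝ≥0∞) * (∑' k, c k) * (V⁻¹ ^ (1 / p).toReal * eLpNorm f p μ) = B at hx
  rw [← Measure.restrict_univ (μ := μ), ← hcov, ae_restrict_biUnion_iff _ hS]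
  intro x _
  have h1 : ∀ᵐ y ∂(μ.restrict (Metric.ball x R)), ‖F y‖ₑ ≤
      eLpNorm F ⊤ (μ.restrict (Metric.ball x R)) := by
    rw [eLpNorm_exponent_top]; exact ae_le_eLpNormEssSup
  filter_upwards [h1] with y hy using hy.trans (hx x)

end Decay


/-! ### Bounds for the semigroup. -/

section DecaySemigroup

variable {M : Type*} [MetricSpace M] [SecondCountableTopology M] [MeasurableSpace M] [BorelSpace M]
  {μ : Measure M} [IsLocallyFiniteMeasure μ] [μ.IsOpenPosMeasure]

theorem tsum_two_rpow_ne_top {δ : ℝ} (hδ : 0 < δ) :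
    ∑' k : ℕ, ENNReal.ofReal ((2 : ℝ) ^ (-(δ * k))) ≠ ⊤ := by
  have e : ∀ k : ℕ, (2 : ℝ) ^ (-(δ * k)) = ((2 : ℝ) ^ (-δ)) ^ k := fun k => by
    rw [← Real.rpow_natCast, ← Real.rpow_mul zero_le_two, neg_mul]
  simp only [e]
  have h1 : (2 : ℝ) ^ (-δ) < 1 := Real.rpow_lt_one_of_one_lt_of_neg one_lt_two (by linarith)
  rw [← ENNReal.ofReal_tsum_of_nonneg (fun k => by positivity)
    (summable_geometric_of_lt_one (by positivity) h1)]
  exact ENNReal.ofReal_ne_top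

/-- The `L²` bound, uniform in `t`, makes Laplace transforms of the semigroup converge. The
`L^p`–`L^∞` bound measures its singularity as `t → 0`. -/
theorem OffDiagonalDecay.exists_semigroup_bounds {L : Lp ℂ 2 μ →ₗ.[ℂ] Lp ℂ 2 μ} {m : ℝ}
    (hm : 1 < m) (hD : Doubling μ) {s p : ℝ≥0∞} (hs2 : s ≤ 2) (hp1 : 1 ≤ p) (hsp : s ≤ p)
    (hp : p ≠ ⊤) (h : OffDiagonalDecay L m s) {d : ℝ} (hV : VolumeLowerBound μ d) :
    ∃ T : ℝ → Lp ℂ 2 μ →L[ℂ] Lp ℂ 2 μ, IsSemigroupOf L T ∧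
      (∃ K : ℝ, 0 ≤ K ∧ ∀ t, 0 ≤ t → ‖T t‖ ≤ K) ∧
      ∃ B : ℝ, 0 ≤ B ∧ ∀ t, 0 < t → ∀ f : Lp ℂ 2 μ, eLpNorm (T t f) ⊤ μ ≤
        ENNReal.ofReal (B * (min 1 t) ^ (-(d / (m * p.toReal)))) * eLpNorm f p μ := by
  obtain ⟨T, hT, δ, hδ, A, hA⟩ := h
  obtain ⟨C, hC⟩ := id hD
  obtain ⟨c, hc, hV⟩ := hV
  set W := ∑' k : ℕ, ENNReal.ofReal ((2 : ℝ) ^ (-(δ * k))) with hWdef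
  have hW : W ≠ ⊤ := tsum_two_rpow_ne_top (by linarith)
  have hpp : 0 < p.toReal := ENNReal.toReal_pos (zero_lt_one.trans_le hp1).ne' hp
  refine ⟨T, hT, ⟨max 1 (C * A * W).toReal, by positivity, fun t ht => ?_⟩,
    (A * W).toReal * c ^ (-(1 / p.toReal)), by positivity, fun t ht f => ?_⟩
  · rcases ht.eq_or_lt with rfl | ht
    · rw [hT.zero]
      exact ContinuousLinearMap.norm_id_le.trans (le_max_left _ _)
    · refine ContinuousLinearMap.opNorm_le_bound _ (by positivity) fun f => ?_
      have hR : 0 < t ^ (1 / m) := by positivity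
      have h1 := lintegral_le_of_offDiagonal hD hs2 hC hR (Lp.aestronglyMeasurable f)
        (Lp.aestronglyMeasurable (T t f)) (fun x => hA t ht x f)
      rw [← eLpNorm_two_rpow, ← eLpNorm_two_rpow, ← ENNReal.mul_rpow_of_nonneg _ _ zero_le_two,
        ENNReal.rpow_le_rpow_iff zero_lt_two] at h1
      have hfin : (C : ℝ≥0∞) * A * W ≠ ⊤ := ENNReal.mul_ne_top
        (ENNReal.mul_ne_top ENNReal.coe_ne_top ENNReal.coe_ne_top) hW
      have h2 := ENNReal.toReal_mono (ENNReal.mul_ne_top hfin (Lp.eLpNorm_ne_top f)) h1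
      rw [ENNReal.toReal_mul, ← Lp.norm_def, ← Lp.norm_def] at h2
      exact h2.trans (by gcongr; exact le_max_right _ _)
  · have hR : 0 < t ^ (1 / m) := by positivity
    -- The volume bound is available for radii up to 1 only, so larger balls are compared with one
    -- of radius 1. Balls of radius `t^(1/m)` have measure at least `c τ^(d/m)`, and the power
    -- `-1/p` of this is the stated factor.
    set τ : ℝ := min 1 t with hτ
    have hτ0 : 0 < τ := lt_min one_pos ht
    have hτ1 : τ ^ (1 / m) ≤ 1 := Real.rpow_le_one hτ0.le (min_le_left _ _) (by positivity)
    have hVx : ∀ x, ENNReal.ofReal (c * (τ ^ (1 / m)) ^ d) ≤ μ (Metric.ball x (t ^ (1 / m))) :=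
      fun x => (hV x _ (by positivity) hτ1).trans (measure_mono (Metric.ball_subset_ball (by
        have : τ ≤ t := min_le_right _ _
        gcongr)))
    refine (eLpNorm_top_le_of_offDiagonal hD hsp hR hVx (Lp.aestronglyMeasurable f)
      (fun x => hA t ht x f)).trans ?_
    rw [← mul_assoc]
    gcongr
    have hcτ : 0 < c * (τ ^ (1 / m)) ^ d := by positivity
    rw [← ENNReal.ofReal_inv_of_pos hcτ, ENNReal.ofReal_rpow_of_pos (by positivity)]
    have e : ∀ r q : ℝ, ENNReal.ofReal ((A * W).toReal * r * q) =
        A * W * ENNReal.ofReal (r * q) := fun r q => by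
      rw [mul_assoc, ENNReal.ofReal_mul ENNReal.toReal_nonneg,
        ENNReal.ofReal_toReal (ENNReal.mul_ne_top ENNReal.coe_ne_top hW)]
    rw [e]
    refine mul_le_mul_right (ENNReal.ofReal_le_ofReal (le_of_eq ?_)) _
    rw [one_div p, ENNReal.toReal_inv, Real.inv_rpow hcτ.le, ← Real.rpow_neg hcτ.le,
      Real.mul_rpow hc.le (by positivity), ← Real.rpow_mul hτ0.le, ← Real.rpow_mul hτ0.le,
      one_div p.toReal]
    congr 2
    field_simp

end DecaySemigroup


/-! ### Beta and Gamma integrals. -/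

section Kernels

variable {E : Type*} [NormedAddCommGroup E] [NormedSpace ℝ E] [CompleteSpace E]

theorem integrableOn_rpow_neg_mul_inv {α : ℝ} (h0 : 0 < α) (h1 : α < 1) :
    IntegrableOn (fun σ : ℝ => σ ^ (-α) * (1 + σ)⁻¹) (Ioi 0) := by
  have hcont : ContinuousOn (fun σ : ℝ => σ ^ (-α) * (1 + σ)⁻¹) (Ioi 0) := by
    intro σ (hσ : 0 < σ)
    refine ContinuousAt.continuousWithinAt ?_
    refine (Real.continuousAt_rpow_const _ _ (Or.inl hσ.ne')).mul
      (ContinuousAt.inv₀ (by fun_prop) (by positivity))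
  rw [← Ioc_union_Ioi_eq_Ioi zero_le_one]
  refine IntegrableOn.union ?_ ?_
  · have h := (intervalIntegral.intervalIntegrable_rpow' (a := 0) (b := 1)
      (show -1 < -α by linarith)).1
    refine Integrable.mono' h ((hcont.mono Ioc_subset_Ioi_self).aestronglyMeasurable
      measurableSet_Ioc) ?_
    filter_upwards [ae_restrict_mem measurableSet_Ioc] with σ hσ
    have := hσ.1
    rw [Real.norm_of_nonneg (by positivity)]
    exact mul_le_of_le_one_right (by positivity) (inv_le_one_of_one_le₀ (by linarith))
  · have h := integrableOn_Ioi_rpow_of_lt (show -α - 1 < -1 by linarith) one_pos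
    refine Integrable.mono' h ((hcont.mono (Ioi_subset_Ioi zero_le_one)).aestronglyMeasurable
      measurableSet_Ioi) ?_
    filter_upwards [ae_restrict_mem measurableSet_Ioi] with σ (hσ : 1 < σ)
    have : 0 < σ := by linarith
    rw [Real.norm_of_nonneg (by positivity), Real.rpow_sub_one this.ne', div_eq_mul_inv]
    gcongr
    linarith

theorem integrableOn_of_norm_le_exp {ψ : ℝ → E} (hψ : ContinuousOn ψ (Ioi 0)) {K ε : ℝ}
    (hε : 0 < ε) (hb : ∀ y, 0 < y → ‖ψ y‖ ≤ K * Real.exp (-ε * y)) : IntegrableOn ψ (Ioi 0) := by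
  refine Integrable.mono' ((exp_neg_integrableOn_Ioi 0 hε).const_mul K)
    (hψ.aestronglyMeasurable measurableSet_Ioi) ?_
  filter_upwards [ae_restrict_mem measurableSet_Ioi] with y hy using hb y hy

/-- Substituting `s = r σ` turns `r^(α-1) s^(-α) ds` into `σ^(-α) dσ`. After Fubini, `y = r (1 + σ)`
separates the variables. -/
theorem integral_rpow_integral_rpow_add_aux {α : ℝ} (h0 : 0 < α) (h1 : α < 1) {ψ : ℝ → E}
    (hψ : ContinuousOn ψ (Ioi 0)) (hi : IntegrableOn ψ (Ioi 0)) :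
    ∫ r in Ioi (0 : ℝ), r ^ (α - 1) • ∫ s in Ioi (0 : ℝ), s ^ (-α) • ψ (r + s) =
      (∫ σ in Ioi (0 : ℝ), σ ^ (-α) * (1 + σ)⁻¹) • ∫ y in Ioi (0 : ℝ), ψ y := by
  have e1 : ∀ r ∈ Ioi (0 : ℝ), r ^ (α - 1) • ∫ s in Ioi (0 : ℝ), s ^ (-α) • ψ (r + s) =
      ∫ σ in Ioi (0 : ℝ), σ ^ (-α) • ψ (r * (1 + σ)) := by
    intro r (hr : 0 < r)
    have h := integral_comp_mul_left_Ioi (fun s => s ^ (-α) • ψ (r + s)) 0 hr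
    rw [mul_zero, eq_comm, inv_smul_eq_iff₀ hr.ne'] at h
    rw [h, smul_smul, ← integral_smul]
    refine setIntegral_congr_fun measurableSet_Ioi fun σ (hσ : 0 < σ) => ?_
    rw [smul_smul, Real.mul_rpow hr.le hσ.le, ← mul_assoc]
    congr 1
    · rw [← Real.rpow_add_one hr.ne', ← Real.rpow_add hr]
      simp
    · ring_nf
  have hcomp : ∀ (φ : ℝ → E), ∀ σ ∈ Ioi (0 : ℝ), ∫ r in Ioi (0 : ℝ), φ (r * (1 + σ)) =
      (1 + σ)⁻¹ • ∫ y in Ioi (0 : ℝ), φ y := fun φ σ (hσ : 0 < σ) => by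
    simpa using integral_comp_mul_right_Ioi φ 0 (show 0 < 1 + σ by linarith)
  have hcompn : ∀ σ ∈ Ioi (0 : ℝ), ∫ r in Ioi (0 : ℝ), ‖ψ (r * (1 + σ))‖ =
      (1 + σ)⁻¹ * ∫ y in Ioi (0 : ℝ), ‖ψ y‖ := fun σ (hσ : 0 < σ) => by
    simpa using integral_comp_mul_right_Ioi (fun y => ‖ψ y‖) 0 (show 0 < 1 + σ by linarith)
  have hint : Integrable (Function.uncurry fun r σ : ℝ => σ ^ (-α) • ψ (r * (1 + σ)))
      ((volume.restrict (Ioi 0)).prod (volume.restrict (Ioi 0))) := by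
    have hmeas : AEStronglyMeasurable
        (Function.uncurry fun r σ : ℝ => σ ^ (-α) • ψ (r * (1 + σ)))
        ((volume.restrict (Ioi 0)).prod (volume.restrict (Ioi 0))) := by
      rw [Measure.prod_restrict]
      refine ContinuousOn.aestronglyMeasurable ?_ (measurableSet_Ioi.prod measurableSet_Ioi)
      refine ContinuousOn.smul (fun q hq => ?_) (hψ.comp (by fun_prop) fun q hq => ?_)
      · exact ((Real.continuousAt_rpow_const _ _ (Or.inl (ne_of_gt hq.2))).comp
          continuousAt_snd).continuousWithinAt
      · have h1 : 0 < q.1 := hq.1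
        have h2 : 0 < q.2 := hq.2
        exact show 0 < q.1 * (1 + q.2) by positivity
    rw [integrable_prod_iff' hmeas]
    refine ⟨?_, ?_⟩
    · filter_upwards [ae_restrict_mem measurableSet_Ioi] with σ (hσ : 0 < σ)
      have := (integrableOn_Ioi_comp_mul_right_iff ψ 0 (show 0 < 1 + σ by linarith)).2 (by simpa)
      exact Integrable.smul (σ ^ (-α)) this
    · refine ((integrableOn_rpow_neg_mul_inv h0 h1).mul_const
        (∫ y in Ioi (0 : ℝ), ‖ψ y‖)).congr ?_
      filter_upwards [ae_restrict_mem measurableSet_Ioi] with σ hσ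
      have hσ' : 0 < σ := hσ
      simp only [Function.uncurry, norm_smul]
      rw [integral_const_mul, hcompn σ hσ, Real.norm_of_nonneg (by positivity), mul_assoc]
  rw [setIntegral_congr_fun measurableSet_Ioi e1, integral_integral_swap hint,
    ← integral_smul_const]
  refine setIntegral_congr_fun measurableSet_Ioi fun σ hσ => ?_
  rw [integral_smul, hcomp ψ σ hσ, smul_smul]

/-- The previous identity for `ψ(y) = e^(-y)`: its left side factors into two Gamma integrals. -/
theorem integral_rpow_neg_mul_inv {α : ℝ} (h0 : 0 < α) (h1 : α < 1) :
    ∫ σ in Ioi (0 : ℝ), σ ^ (-α) * (1 + σ)⁻¹ = Real.Gamma α * Real.Gamma (1 - α) := by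
  have hi : IntegrableOn (fun y : ℝ => Real.exp (-y)) (Ioi 0) := by
    simpa using exp_neg_integrableOn_Ioi 0 one_pos
  have h := integral_rpow_integral_rpow_add_aux h0 h1 (ψ := fun y => Real.exp (-y))
    (by fun_prop) hi
  rw [integral_exp_neg_Ioi_zero, smul_eq_mul, mul_one] at h
  rw [← h]
  have e : ∀ a : ℝ, 0 < a → Real.Gamma a = ∫ x in Ioi (0 : ℝ), x ^ (a - 1) * Real.exp (-x) :=
    fun a ha => by
      rw [Real.Gamma_eq_integral ha]
      simp only [mul_comm]
  rw [e α h0, e (1 - α) (by linarith), ← integral_mul_const]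
  refine setIntegral_congr_fun measurableSet_Ioi fun r _ => ?_
  simp only [smul_eq_mul]
  rw [mul_assoc, ← integral_const_mul, ← integral_const_mul, ← integral_const_mul]
  congr 1
  funext s
  rw [neg_add, Real.exp_add]
  ring_nf

theorem integral_rpow_integral_rpow_add {α : ℝ} (h0 : 0 < α) (h1 : α < 1) {ψ : ℝ → E}
    (hψ : ContinuousOn ψ (Ioi 0)) (hi : IntegrableOn ψ (Ioi 0)) :
    ∫ r in Ioi (0 : ℝ), r ^ (α - 1) • ∫ s in Ioi (0 : ℝ), s ^ (-α) • ψ (r + s) =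
      (Real.pi / Real.sin (Real.pi * α)) • ∫ y in Ioi (0 : ℝ), ψ y := by
  rw [integral_rpow_integral_rpow_add_aux h0 h1 hψ hi, integral_rpow_neg_mul_inv h0 h1,
    Real.Gamma_mul_Gamma_one_sub]

theorem integrableOn_rpow_smul_of_norm_le_exp {a : ℝ} (ha : -1 < a) {ψ : ℝ → E}
    (hψ : ContinuousOn ψ (Ioi 0)) {K ε : ℝ} (hε : 0 < ε)
    (hb : ∀ y, 0 < y → ‖ψ y‖ ≤ K * Real.exp (-ε * y)) :
    IntegrableOn (fun s => s ^ a • ψ s) (Ioi 0) := by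
  have h := integrableOn_rpow_mul_exp_neg_mul_rpow ha one_pos hε
  simp only [Real.rpow_one] at h
  refine Integrable.mono' (h.const_mul K) (ContinuousOn.aestronglyMeasurable
    (ContinuousOn.smul (fun s (hs : 0 < s) => (Real.continuousAt_rpow_const _ _
      (Or.inl hs.ne')).continuousWithinAt) hψ) measurableSet_Ioi) ?_
  filter_upwards [ae_restrict_mem measurableSet_Ioi] with y (hy : 0 < y)
  rw [norm_smul, Real.norm_of_nonneg (by positivity)]
  calc _ ≤ y ^ a * (K * Real.exp (-ε * y)) := by gcongr; exact hb y hy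
    _ = _ := by ring

/-- Fubini and `∫ t^(α-1) e^(-ts) dt = Γ(α) s^(-α)`. It converts Balakrishnan's integral of
resolvents into an integral of the semigroup. -/
theorem integral_rpow_integral_exp {α : ℝ} (h0 : 0 < α) (h1 : α < 1) {ψ : ℝ → E}
    (hψ : ContinuousOn ψ (Ioi 0)) {K ε : ℝ} (hε : 0 < ε)
    (hb : ∀ y, 0 < y → ‖ψ y‖ ≤ K * Real.exp (-ε * y)) :
    ∫ t in Ioi (0 : ℝ), t ^ (α - 1) • ∫ s in Ioi (0 : ℝ), Real.exp (-(t * s)) • ψ s =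
      Real.Gamma α • ∫ s in Ioi (0 : ℝ), s ^ (-α) • ψ s := by
  have hG : ∀ s ∈ Ioi (0 : ℝ), ∫ t in Ioi (0 : ℝ), t ^ (α - 1) * Real.exp (-(t * s)) =
      Real.Gamma α * s ^ (-α) := fun s (hs : 0 < s) => by
    have := Real.integral_rpow_mul_exp_neg_mul_Ioi h0 hs
    simp only [mul_comm _ s]
    rw [this, mul_comm, Real.rpow_neg hs.le, one_div, Real.inv_rpow hs.le]
  have hint : Integrable (Function.uncurry fun t s : ℝ =>
      (t ^ (α - 1) * Real.exp (-(t * s))) • ψ s)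
      ((volume.restrict (Ioi 0)).prod (volume.restrict (Ioi 0))) := by
    have hmeas : AEStronglyMeasurable (Function.uncurry fun t s : ℝ =>
        (t ^ (α - 1) * Real.exp (-(t * s))) • ψ s)
        ((volume.restrict (Ioi 0)).prod (volume.restrict (Ioi 0))) := by
      rw [Measure.prod_restrict]
      refine ContinuousOn.aestronglyMeasurable ?_ (measurableSet_Ioi.prod measurableSet_Ioi)
      refine ContinuousOn.smul (ContinuousOn.mul (fun q hq => ?_) (by fun_prop))
        (hψ.comp (by fun_prop) fun q hq => hq.2)
      exact ((Real.continuousAt_rpow_const _ _ (Or.inl (ne_of_gt hq.1))).comp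
          continuousAt_fst).continuousWithinAt
    rw [integrable_prod_iff' hmeas]
    refine ⟨?_, ?_⟩
    · filter_upwards [ae_restrict_mem measurableSet_Ioi] with s (hs : 0 < s)
      have h := integrableOn_rpow_mul_exp_neg_mul_rpow (show -1 < α - 1 by linarith) one_pos hs
      simp only [Real.rpow_one] at h
      refine (Integrable.smul_const h (ψ s)).congr (Eventually.of_forall fun t => ?_)
      simp only [Function.uncurry]
      ring_nf
    · refine ((integrableOn_rpow_smul_of_norm_le_exp (show -1 < -α by linarith) hψ hε
        hb).norm.const_mul (Real.Gamma α)).congr ?_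
      filter_upwards [ae_restrict_mem measurableSet_Ioi] with s hs
      have hs' : 0 < s := hs
      have e : ∫ t in Ioi (0 : ℝ), ‖(t ^ (α - 1) * Real.exp (-(t * s))) • ψ s‖ =
          ∫ t in Ioi (0 : ℝ), (t ^ (α - 1) * Real.exp (-(t * s))) * ‖ψ s‖ :=
        setIntegral_congr_fun measurableSet_Ioi fun t (ht : 0 < t) => by
          rw [norm_smul, Real.norm_of_nonneg (by positivity)]
      simp only [Function.uncurry]
      rw [e, integral_mul_const, hG s hs, norm_smul, Real.norm_of_nonneg (by positivity),
        mul_assoc]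
  simp only [← integral_smul, smul_smul]
  rw [integral_integral_swap hint]
  refine setIntegral_congr_fun measurableSet_Ioi fun s hs => ?_
  rw [integral_smul_const, hG s hs]

end Kernels


/-! ### Resolvent and fractional power through the semigroup. -/

section Laplace

variable {H : Type*} [NormedAddCommGroup H] [NormedSpace ℂ H] [CompleteSpace H]
  {L : H →ₗ.[ℂ] H} {T : ℝ → H →L[ℂ] H} {w K : ℝ}

/-- The generator controls right difference quotients only, and a right derivative is enough for the
fundamental theorem of calculus. -/
theorem IsSemigroupOf.hasDerivWithinAt (hT : IsSemigroupOf L T) (x : L.domain) {s : ℝ}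
    (hs : 0 ≤ s) : HasDerivWithinAt (fun t => T t x) (-(T s (L x))) (Ioi s) s := by
  rw [hasDerivWithinAt_iff_tendsto_slope' self_notMem_Ioi]
  have h := (hT.generator x (L x)).1 ⟨x.2, rfl⟩
  have h1 : Tendsto (fun t => t - s) (𝓝[>] s) (𝓝[>] 0) := by
    refine tendsto_nhdsWithin_iff.2 ⟨?_, ?_⟩
    · have : Tendsto (fun t => t - s) (𝓝 s) (𝓝 (s - s)) := (continuous_sub_right s).tendsto s
      rw [sub_self] at this
      exact this.mono_left nhdsWithin_le_nhds
    · filter_upwards [self_mem_nhdsWithin] with t (ht : s < t) using sub_pos.2 ht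
  refine Tendsto.congr' ?_ (((T s).continuous.tendsto _).comp (h.comp h1)).neg
  filter_upwards [self_mem_nhdsWithin] with t (ht : s < t)
  have e := hT.add s (t - s) hs (sub_nonneg.2 ht.le)
  rw [add_sub_cancel] at e
  simp only [Function.comp_apply, slope, vsub_eq_sub, e, Complex.coe_smul]
  rw [← Complex.coe_smul, map_smul, map_sub, ← smul_neg, neg_sub, Complex.coe_smul]
  rfl

theorem IsSemigroupOf.continuousOn_exp_smul (hT : IsSemigroupOf L T) (l : ℝ) (y : H) :
    ContinuousOn (fun s => Real.exp (-(l * s)) • T s y) (Ici 0) :=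
  ContinuousOn.smul (M := ℝ) (by fun_prop) (hT.continuous y)

theorem norm_exp_smul_le (hK : ∀ t, 0 ≤ t → ‖T t‖ ≤ K) (l : ℝ) (y : H) {s : ℝ} (hs : 0 ≤ s) :
    ‖Real.exp (-(l * s)) • T s y‖ ≤ K * ‖y‖ * Real.exp (-l * s) := by
  rw [norm_smul, Real.norm_of_nonneg (Real.exp_pos _).le, mul_comm, neg_mul]
  gcongr
  exact (T s).le_of_opNorm_le (hK s hs) y

theorem IsSemigroupOf.integrableOn_exp_smul (hT : IsSemigroupOf L T)
    (hK : ∀ t, 0 ≤ t → ‖T t‖ ≤ K) {l : ℝ} (hl : 0 < l) (y : H) :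
    IntegrableOn (fun s => Real.exp (-(l * s)) • T s y) (Ioi 0) :=
  integrableOn_of_norm_le_exp ((hT.continuousOn_exp_smul l y).mono Ioi_subset_Ici_self) hl
    fun _ hs => norm_exp_smul_le hK l y hs.le

/-- The integrand is the right derivative of `-e^(-ls) T s x`, which decays at infinity because the
semigroup is bounded. -/
theorem IsSemigroupOf.integral_exp_smul (hT : IsSemigroupOf L T)
    (hK : ∀ t, 0 ≤ t → ‖T t‖ ≤ K) {l : ℝ} (hl : 0 < l) (x : L.domain) :
    ∫ s in Ioi (0 : ℝ), Real.exp (-(l * s)) • T s (L x + (l : ℂ) • (x : H)) = x := by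
  have hint := hT.integrableOn_exp_smul hK hl (L x + (l : ℂ) • (x : H))
  have hft : ∀ b : ℝ, 0 ≤ b → ∫ s in (0 : ℝ)..b,
      Real.exp (-(l * s)) • T s (L x + (l : ℂ) • (x : H)) = x - Real.exp (-(l * b)) • T b x := by
    intro b hb
    have hI : IntervalIntegrable (fun s => Real.exp (-(l * s)) • T s (L x + (l : ℂ) • (x : H)))
        volume 0 b :=
      (intervalIntegrable_iff_integrableOn_Ioc_of_le hb).2 (hint.mono_set Ioc_subset_Ioi_self)
    have h := intervalIntegral.integral_eq_sub_of_hasDeriv_right (a := 0) (b := b)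
      (f := fun s => -(Real.exp (-(l * s)) • T s x))
      (f' := fun s => Real.exp (-(l * s)) • T s (L x + (l : ℂ) • (x : H))) ?_ ?_ hI
    · rw [h]
      simp only [hT.zero, mul_zero, neg_zero, Real.exp_zero, one_smul]
      rw [one_apply_eq_self]
      abel
    · refine ((hT.continuousOn_exp_smul l x).neg).mono ?_
      rw [uIcc_of_le hb]
      exact Icc_subset_Ici_self
    · intro s hs
      rw [min_eq_left hb, max_eq_right hb] at hs
      have h1 : HasDerivAt (fun s => Real.exp (-(l * s))) (Real.exp (-(l * s)) * (-(l * 1))) s :=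
        (((hasDerivAt_id s).const_mul l).neg).exp
      have h2 := (h1.hasDerivWithinAt.smul (hT.hasDerivWithinAt x hs.1.le)).neg
      refine h2.congr_deriv ?_
      rw [map_add, map_smul, Complex.coe_smul]
      simp only [smul_neg, smul_add, smul_smul, mul_one, neg_add, neg_neg, mul_neg, neg_smul]
  have h1 := intervalIntegral_tendsto_integral_Ioi 0 hint tendsto_id
  have h2 : Tendsto (fun b : ℝ => (x : H) - Real.exp (-(l * b)) • T b x) atTop (𝓝 (x - 0)) := by
    refine tendsto_const_nhds.sub ?_
    have h3 : Tendsto (fun b : ℝ => K * ‖(x : H)‖ * Real.exp (-l * b)) atTop (𝓝 0) := by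
      have : Tendsto (fun b : ℝ => Real.exp (-l * b)) atTop (𝓝 0) :=
        Real.tendsto_exp_atBot.comp (tendsto_id.const_mul_atTop_of_neg (neg_lt_zero.2 hl))
      simpa using this.const_mul (K * ‖(x : H)‖)
    refine squeeze_zero_norm' ?_ h3
    filter_upwards [eventually_ge_atTop 0] with b hb using norm_exp_smul_le hK l x hb
  rw [sub_zero] at h2
  refine tendsto_nhds_unique h1 (h2.congr' ?_)
  filter_upwards [eventually_ge_atTop 0] with b hb using (hft b hb).symm

theorem IsOfType.resolventOp_eq_integral (hL : IsOfType L w) (hw : w < Real.pi / 2)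
    (hT : IsSemigroupOf L T) (hK : ∀ t, 0 ≤ t → ‖T t‖ ≤ K) {l : ℝ} (hl : 0 < l) (y : H) :
    resolventOp L (-(l : ℂ)) y = ∫ s in Ioi (0 : ℝ), Real.exp (-(l * s)) • T s y := by
  obtain ⟨hx, h⟩ := (hL.isResolventAt hw hl).1 y
  have := hT.integral_exp_smul hK hl ⟨_, hx⟩
  rw [neg_smul, sub_neg_eq_add] at h
  rw [h] at this
  exact this.symm

theorem IsOfType.integral_resolventOp_shift (hL : IsOfType L w) (hw : w < Real.pi / 2)
    (hT : IsSemigroupOf L T) (hK : ∀ t, 0 ≤ t → ‖T t‖ ≤ K) {α : ℝ} (h0 : 0 < α) (h1 : α < 1)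
    {ε : ℝ} (hε : 0 < ε) (y : H) :
    ∫ t in Ioi (0 : ℝ), t ^ (α - 1) • resolventOp L (-((t + ε : ℝ) : ℂ)) y =
      Real.Gamma α • ∫ s in Ioi (0 : ℝ), s ^ (-α) • (Real.exp (-(ε * s)) • T s y) := by
  rw [← integral_rpow_integral_exp h0 h1
    ((hT.continuousOn_exp_smul ε y).mono Ioi_subset_Ici_self) hε
    (fun s hs => norm_exp_smul_le hK ε y hs.le)]
  refine setIntegral_congr_fun measurableSet_Ioi fun t (ht : 0 < t) => ?_
  rw [hL.resolventOp_eq_integral hw hT hK (by positivity)]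
  congr 2
  funext s
  rw [smul_smul, ← Real.exp_add]
  ring_nf

/-- The kernel `s^(a-1) - (s-1)_+^(a-1)`. -/
noncomputable def diffKernel (α s : ℝ) : ℝ :=
  s ^ (α - 1) - (Ioi (1 : ℝ)).indicator (fun s => (s - 1) ^ (α - 1)) s

/-- Balakrishnan's formula for `L + ε`. -/
noncomputable def balakrishnanShift (L : H →ₗ.[ℂ] H) (α ε : ℝ) (x : L.domain) : H :=
  (Real.sin (Real.pi * α) / Real.pi) •
    ∫ t in Ioi (0 : ℝ), t ^ (α - 1) • resolventOp L (-((t + ε : ℝ) : ℂ)) (L x + (ε : ℂ) • (x : H))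

/-- This is `(L + ε)^(-α) (L + ε)^α x = x`. Both powers are integrals of `e^(-εs) T s`, their
composition is the double integral of `integral_rpow_integral_rpow_add`, and the inner Laplace
integral inverts `L + ε`. The shift supplies the decay at infinity that the integral for `L` itself
may lack. -/
theorem IsOfType.integral_semigroup_balakrishnanShift (hL : IsOfType L w) (hw : w < Real.pi / 2)
    (hT : IsSemigroupOf L T) (hK : ∀ t, 0 ≤ t → ‖T t‖ ≤ K) {α : ℝ} (h0 : 0 < α) (h1 : α < 1)
    {ε : ℝ} (hε : 0 < ε) (x : L.domain) :
    ∫ r in Ioi (0 : ℝ), r ^ (α - 1) • (Real.exp (-(ε * r)) • T r (balakrishnanShift L α ε x)) =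
      Real.Gamma α • (x : H) := by
  set y : H := L x + (ε : ℂ) • (x : H) with hy
  have hcont := (hT.continuousOn_exp_smul ε y).mono Ioi_subset_Ici_self
  have hb : ∀ s, 0 < s → ‖Real.exp (-(ε * s)) • T s y‖ ≤ K * ‖y‖ * Real.exp (-ε * s) :=
    fun s hs => norm_exp_smul_le hK ε y hs.le
  have hsin : Real.sin (Real.pi * α) ≠ 0 := by
    refine (Real.sin_pos_of_pos_of_lt_pi (by positivity) ?_).ne'
    exact mul_lt_of_lt_one_right Real.pi_pos h1
  have e : ∀ r ∈ Ioi (0 : ℝ),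
      r ^ (α - 1) • (Real.exp (-(ε * r)) • T r (balakrishnanShift L α ε x)) =
      (Real.sin (Real.pi * α) / Real.pi * Real.Gamma α) • (r ^ (α - 1) •
        ∫ s in Ioi (0 : ℝ), s ^ (-α) • (Real.exp (-(ε * (r + s))) • T (r + s) y)) := by
    intro r (hr : 0 < r)
    have hi := integrableOn_rpow_smul_of_norm_le_exp (show -1 < -α by linarith) hcont hε hb
    have e2 : Real.exp (-(ε * r)) • T r (∫ s in Ioi (0 : ℝ), s ^ (-α) •
        (Real.exp (-(ε * s)) • T s y)) =
        ∫ s in Ioi (0 : ℝ), s ^ (-α) • (Real.exp (-(ε * (r + s))) • T (r + s) y) := by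
      rw [← ContinuousLinearMap.integral_comp_comm _ hi, ← integral_smul]
      refine setIntegral_congr_fun measurableSet_Ioi fun s (hs : 0 < s) => ?_
      rw [hT.add r s hr.le hs.le, mul_add, neg_add, Real.exp_add, mul_apply_eq_comp]
      rw [← Complex.coe_smul (s ^ (-α)), map_smul, ← Complex.coe_smul (Real.exp (-(ε * s))),
        map_smul]
      simp only [Complex.coe_smul, smul_smul]
      congr 1
      ring
    rw [← e2, balakrishnanShift, hL.integral_resolventOp_shift hw hT hK h0 h1 hε]
    simp only [← Complex.coe_smul, map_smul, smul_smul]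
    congr 1
    push_cast
    ring
  rw [setIntegral_congr_fun measurableSet_Ioi e, integral_smul,
    integral_rpow_integral_rpow_add h0 h1 hcont (integrableOn_of_norm_le_exp hcont hε hb),
    hT.integral_exp_smul hK hε x, smul_smul]
  congr 1
  field_simp

end Laplace


/-! ### Integrability of the difference kernel. -/

section DiffKernel

theorem measurable_diffKernel (α : ℝ) : Measurable (diffKernel α) :=
  (measurable_id.pow_const _).sub
    (((measurable_id.sub_const 1).pow_const _).indicator measurableSet_Ioi)

theorem diffKernel_of_le_one {α s : ℝ} (hs : s ≤ 1) : diffKernel α s = s ^ (α - 1) := by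
  rw [diffKernel, indicator_of_notMem (by simpa using hs), sub_zero]

theorem diffKernel_of_one_lt {α s : ℝ} (hs : 1 < s) :
    diffKernel α s = s ^ (α - 1) - (s - 1) ^ (α - 1) := by
  rw [diffKernel, indicator_of_mem (by exact hs)]

/-- Subtracting the translate gains a power of `s` at infinity, and `α - 2 < -1`. -/
theorem abs_diffKernel_le {α s : ℝ} (hα : 0 ≤ α) (h1 : α < 1) (hs : 2 < s) :
    |diffKernel α s| ≤ 2 * s ^ (α - 2) := by
  have h0 : 0 < s := by linarith
  have hs1 : 0 < s - 1 := by linarith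
  rw [diffKernel_of_one_lt (by linarith), abs_sub_comm, abs_of_nonneg (sub_nonneg.2
    (Real.rpow_le_rpow_of_nonpos hs1 (by linarith) (by linarith)))]
  have e : s ^ (α - 2) = s ^ α / s ^ 2 := by
    rw [Real.rpow_sub h0, Real.rpow_two]
  rw [Real.rpow_sub_one h0.ne', Real.rpow_sub_one hs1.ne', e]
  have h2 : (s - 1) ^ α ≤ s ^ α := Real.rpow_le_rpow hs1.le (by linarith) hα
  calc (s - 1) ^ α / (s - 1) - s ^ α / s ≤ s ^ α / (s - 1) - s ^ α / s := by gcongr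
    _ = s ^ α * (1 / (s * (s - 1))) := by field_simp; ring
    _ ≤ s ^ α * (2 / s ^ 2) := by
        gcongr ?_ * ?_
        rw [div_le_div_iff₀ (by positivity) (by positivity)]
        nlinarith
    _ = _ := by ring

/-- Near `0` the integrand is `s^(α-1-γ)`, integrable since `γ < α`; the singularity `(s-1)^(α-1)`
at 1 is integrable; at infinity `abs_diffKernel_le` applies. -/
theorem integrableOn_abs_diffKernel_mul {α γ : ℝ} (h0 : 0 < α) (h1 : α < 1) (hγ : γ < α) :
    IntegrableOn (fun s => |diffKernel α s| * (min 1 s) ^ (-γ)) (Ioi 0) := by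
  have hm : Measurable fun s : ℝ => |diffKernel α s| * (min 1 s) ^ (-γ) :=
    (measurable_diffKernel α).abs.mul ((measurable_const.min measurable_id).pow_const _)
  rw [← Ioc_union_Ioi_eq_Ioi zero_le_one]
  refine IntegrableOn.union ?_ ?_
  · have h := (intervalIntegral.intervalIntegrable_rpow' (a := 0) (b := 1)
      (show -1 < α - 1 - γ by linarith)).1
    refine h.congr ?_
    filter_upwards [ae_restrict_mem measurableSet_Ioc] with s hs
    have hs0 : 0 < s := hs.1
    rw [diffKernel_of_le_one hs.2, min_eq_right hs.2, abs_of_nonneg (by positivity),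
      ← Real.rpow_add hs0, sub_eq_add_neg _ γ]
  · have e : EqOn (fun s => |diffKernel α s|) (fun s => |diffKernel α s| * (min 1 s) ^ (-γ))
        (Ioi 1) := fun s (hs : 1 < s) => by
      simp only
      rw [min_eq_left hs.le, Real.one_rpow, mul_one]
    refine IntegrableOn.congr_fun ?_ e measurableSet_Ioi
    rw [← Ioc_union_Ioi_eq_Ioi one_le_two]
    refine IntegrableOn.union ?_ ?_
    · have ha := (intervalIntegral.intervalIntegrable_rpow' (a := 1) (b := 2)
        (show -1 < α - 1 by linarith)).1
      have hb := ((intervalIntegral.intervalIntegrable_rpow' (a := 0) (b := 1)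
        (show -1 < α - 1 by linarith)).comp_sub_right 1).1
      rw [zero_add, one_add_one_eq_two] at hb
      refine (ha.sub hb).abs.congr ?_
      filter_upwards [ae_restrict_mem measurableSet_Ioc] with s hs
      rw [diffKernel_of_one_lt hs.1]
      rfl
    · refine Integrable.mono' ((integrableOn_Ioi_rpow_of_lt (show α - 2 < -1 by linarith)
        two_pos).const_mul 2) (measurable_diffKernel α).abs.aestronglyMeasurable ?_
      filter_upwards [ae_restrict_mem measurableSet_Ioi] with s hs
      rw [Real.norm_eq_abs, abs_abs]
      exact abs_diffKernel_le h0.le h1 hs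

theorem integrableOn_diffKernel {α : ℝ} (h0 : 0 < α) (h1 : α < 1) :
    IntegrableOn (diffKernel α) (Ioi 0) := by
  have h := integrableOn_abs_diffKernel_mul h0 h1 h0
  simp only [neg_zero, Real.rpow_zero, mul_one] at h
  exact (integrable_norm_iff (measurable_diffKernel α).aestronglyMeasurable).1 h

end DiffKernel

/-! ### The representation of `u - e^{-L} u`. -/

section Representation

variable {H : Type*} [NormedAddCommGroup H] [NormedSpace ℂ H] [CompleteSpace H]
  {L : H →ₗ.[ℂ] H} {T : ℝ → H →L[ℂ] H} {w K : ℝ}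

theorem IsOfType.sub_eq_integral_diffKernel_shift (hL : IsOfType L w) (hw : w < Real.pi / 2)
    (hT : IsSemigroupOf L T) (hK : ∀ t, 0 ≤ t → ‖T t‖ ≤ K) {α : ℝ} (h0 : 0 < α) (h1 : α < 1)
    {ε : ℝ} (hε : 0 < ε) (x : L.domain) :
    Real.Gamma α • ((x : H) - Real.exp (-(ε * 1)) • T 1 x) = ∫ s in Ioi (0 : ℝ),
      diffKernel α s • (Real.exp (-(ε * s)) • T s (balakrishnanShift L α ε x)) := by
  set A := balakrishnanShift L α ε x with hA
  have hcont := (hT.continuousOn_exp_smul ε A).mono Ioi_subset_Ici_self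
  have hb : ∀ s, 0 < s → ‖Real.exp (-(ε * s)) • T s A‖ ≤ K * ‖A‖ * Real.exp (-ε * s) :=
    fun s hs => norm_exp_smul_le hK ε A hs.le
  have hi := integrableOn_rpow_smul_of_norm_le_exp (show -1 < α - 1 by linarith) hcont hε hb
  have hx := hL.integral_semigroup_balakrishnanShift hw hT hK h0 h1 hε x
  rw [← hA] at hx
  -- Applying `e^(-ε) T 1` to the reproducing formula and substituting `s = r + 1` gives the same
  -- integral with the translated kernel; `g` is its integrand.
  let g : ℝ → H := fun s => (s - 1) ^ (α - 1) • (Real.exp (-(ε * s)) • T s A)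
  have hg : ∀ r ∈ Ioi (0 : ℝ), g (r + 1) = Real.exp (-(ε * 1)) •
      T 1 (r ^ (α - 1) • (Real.exp (-(ε * r)) • T r A)) := by
    intro r (hr : 0 < r)
    simp only [g, add_sub_cancel_right]
    rw [add_comm r 1, hT.add 1 r zero_le_one hr.le, mul_add, neg_add, Real.exp_add,
      mul_apply_eq_comp, ← Complex.coe_smul (r ^ (α - 1)), ← Complex.coe_smul (r ^ (α - 1)),
      map_smul, ← Complex.coe_smul (Real.exp (-(ε * r))), map_smul]
    simp only [Complex.coe_smul, smul_smul]
    congr 1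
    ring
  have hmp := measurePreserving_add_right (volume : Measure ℝ) 1
  have hpre : (fun x : ℝ => x + 1) ⁻¹' Ioi 1 = Ioi 0 := by simp
  have hgi : IntegrableOn g (Ioi 1) := by
    rw [← hmp.integrableOn_comp_preimage (measurableEmbedding_addRight 1), hpre]
    refine IntegrableOn.congr_fun ?_ (fun r hr => (hg r hr).symm) measurableSet_Ioi
    exact ((T 1).integrable_comp hi).smul (Real.exp (-(ε * 1)))
  have hgint : ∫ s in Ioi 1, g s = Real.exp (-(ε * 1)) • T 1 (Real.Gamma α • (x : H)) := by
    rw [← hmp.setIntegral_preimage_emb (measurableEmbedding_addRight 1), hpre,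
      setIntegral_congr_fun measurableSet_Ioi hg, integral_smul,
      ContinuousLinearMap.integral_comp_comm _ hi, hx]
  have e : ∀ s, diffKernel α s • (Real.exp (-(ε * s)) • T s A) =
      s ^ (α - 1) • (Real.exp (-(ε * s)) • T s A) - (Ioi (1 : ℝ)).indicator g s := by
    intro s
    rw [diffKernel, sub_smul]
    congr 1
    by_cases hs : s ∈ Ioi (1 : ℝ)
    · simp only [indicator_of_mem hs, g]
    · simp only [indicator_of_notMem hs, zero_smul]
  simp only [e]
  have hgi' : IntegrableOn ((Ioi (1 : ℝ)).indicator g) (Ioi 0) :=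
    ((integrable_indicator_iff measurableSet_Ioi).2 hgi).integrableOn
  rw [integral_sub hi hgi', setIntegral_indicator measurableSet_Ioi,
    inter_eq_right.2 (Ioi_subset_Ioi zero_le_one), hgint, hx, smul_sub]
  congr 1
  simp only [← Complex.coe_smul, map_smul]
  rw [smul_comm]

/-- Dominated convergence. Near `0` the identity `(t + ε + L)⁻¹ (L + ε) x = x - t (t + ε + L)⁻¹ x`
gives a bound free of `ε`; for `t > 1` the resolvent estimate does. -/
theorem IsOfType.tendsto_balakrishnanShift (hL : IsOfType L w) (hw : w < Real.pi / 2)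
    {α : ℝ} (h0 : 0 < α) (h1 : α < 1) (x : L.domain) :
    Tendsto (fun ε => balakrishnanShift L α ε x) (𝓝[>] 0) (𝓝 (balakrishnan L α x)) := by
  obtain ⟨c, hc0, hc⟩ := hL.exists_norm_resolventOp_le hw
  have eB : balakrishnan L α x = (Real.sin (Real.pi * α) / Real.pi) •
      ∫ t in Ioi (0 : ℝ), t ^ (α - 1) • resolventOp L (-(t : ℂ)) (L x) := by
    simp only [balakrishnan, Complex.coe_smul]
    rw [← Complex.coe_smul (Real.sin (Real.pi * α) / Real.pi)]
    push_cast
    rfl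
  rw [eB]
  refine Tendsto.const_smul ?_ _
  let bound : ℝ → ℝ := fun t => (Ioc (0 : ℝ) 1).indicator
    (fun t => t ^ (α - 1) * ((1 + c) * ‖(x : H)‖)) t +
    (Ioi (1 : ℝ)).indicator (fun t => t ^ (α - 2) * (c * (‖L x‖ + ‖(x : H)‖))) t
  have hbound : IntegrableOn bound (Ioi 0) := by
    refine Integrable.add ?_ ?_
    · have h : IntegrableOn (fun t : ℝ => t ^ (α - 1)) (Ioc 0 1) :=
        (intervalIntegrable_iff_integrableOn_Ioc_of_le zero_le_one).1
          (intervalIntegral.intervalIntegrable_rpow' (by linarith))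
      have h2 : IntegrableOn (fun t : ℝ => t ^ (α - 1) * ((1 + c) * ‖(x : H)‖)) (Ioc 0 1) :=
        Integrable.mul_const h _
      exact (h2.integrable_indicator measurableSet_Ioc).integrableOn
    · have h : IntegrableOn (fun t : ℝ => t ^ (α - 2)) (Ioi 1) :=
        integrableOn_Ioi_rpow_of_lt (by linarith) one_pos
      have h2 : IntegrableOn (fun t : ℝ => t ^ (α - 2) * (c * (‖L x‖ + ‖(x : H)‖))) (Ioi 1) :=
        Integrable.mul_const h _
      exact (h2.integrable_indicator measurableSet_Ioi).integrableOn
  have hnear : ∀ᶠ ε : ℝ in 𝓝[>] 0, ε ∈ Ioc (0 : ℝ) 1 := Ioc_mem_nhdsGT one_pos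
  refine tendsto_integral_filter_of_dominated_convergence bound ?_ ?_ hbound ?_
  · filter_upwards [hnear] with ε hε
    refine ContinuousOn.aestronglyMeasurable (ContinuousOn.smul (M := ℝ) (fun t ht =>
      (Real.continuousAt_rpow_const _ _ (Or.inl (ne_of_gt ht))).continuousWithinAt) ?_)
      measurableSet_Ioi
    refine (hL.continuousOn_resolventOp hw (L x + (ε : ℂ) • (x : H))).comp
      (f := fun t => t + ε) (by fun_prop) fun t ht => ?_
    exact add_pos ht hε.1
  · filter_upwards [hnear] with ε hε
    have hε0 : 0 < ε := hε.1
    filter_upwards [ae_restrict_mem measurableSet_Ioi] with t (ht : 0 < t)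
    have hte : 0 < t + ε := by linarith
    rw [norm_smul, Real.norm_of_nonneg (by positivity)]
    have hR : ‖resolventOp L (-((t + ε : ℝ) : ℂ))‖ ≤ c / t :=
      (hc _ hte).trans (by gcongr; linarith)
    rcases le_or_gt t 1 with h | h
    · simp only [bound, indicator_of_mem (show t ∈ Ioc (0 : ℝ) 1 from ⟨ht, h⟩),
        indicator_of_notMem (show t ∉ Ioi (1 : ℝ) from h.not_gt), add_zero]
      gcongr
      have e : resolventOp L (-((t + ε : ℝ) : ℂ)) (L x + (ε : ℂ) • (x : H)) =
          (x : H) - (t : ℂ) • resolventOp L (-((t + ε : ℝ) : ℂ)) x := by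
        rw [map_add, hL.resolventOp_apply_map hw hte, map_smul]
        push_cast
        rw [add_smul]
        abel
      rw [e, add_mul, one_mul]
      refine (norm_sub_le _ _).trans (add_le_add_right ?_ _)
      rw [norm_smul, Complex.norm_real, Real.norm_of_nonneg ht.le]
      calc t * ‖resolventOp L (-((t + ε : ℝ) : ℂ)) x‖ ≤ t * (c / t * ‖(x : H)‖) := by
            gcongr
            exact ContinuousLinearMap.le_of_opNorm_le _ hR _
        _ = c * ‖(x : H)‖ := by field_simp
    · simp only [bound, indicator_of_notMem (show t ∉ Ioc (0 : ℝ) 1 from fun h' => h'.2.not_gt h),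
        indicator_of_mem (show t ∈ Ioi (1 : ℝ) from h), zero_add]
      have e : t ^ (α - 2) = t ^ (α - 1) / t := by
        rw [show α - 2 = (α - 1) - 1 by ring, Real.rpow_sub_one ht.ne']
      calc t ^ (α - 1) * ‖resolventOp L (-((t + ε : ℝ) : ℂ)) (L x + (ε : ℂ) • (x : H))‖
          ≤ t ^ (α - 1) * (c / t * (‖L x‖ + ‖(x : H)‖)) := by
            gcongr
            refine (ContinuousLinearMap.le_of_opNorm_le _ hR _).trans ?_
            gcongr
            refine (norm_add_le _ _).trans ?_
            gcongr
            rw [norm_smul, Complex.norm_real, Real.norm_of_nonneg hε0.le]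
            exact mul_le_of_le_one_left (norm_nonneg _) hε.2
        _ = _ := by rw [e]; ring
  · filter_upwards [ae_restrict_mem measurableSet_Ioi] with t (ht : 0 < t)
    refine Tendsto.const_smul ?_ _
    have hsh : Tendsto (fun ε : ℝ => t + ε) (𝓝[>] 0) (𝓝 t) := by
      have : Tendsto (fun ε : ℝ => t + ε) (𝓝 0) (𝓝 (t + 0)) := (continuous_const_add t).tendsto 0
      rw [add_zero] at this
      exact this.mono_left nhdsWithin_le_nhds
    have ha : Tendsto (fun ε : ℝ => resolventOp L (-((t + ε : ℝ) : ℂ)) (L x)) (𝓝[>] 0)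
        (𝓝 (resolventOp L (-(t : ℂ)) (L x))) :=
      ((hL.continuousOn_resolventOp hw (L x)).continuousAt (Ioi_mem_nhds ht)).tendsto.comp hsh
    have hb : Tendsto (fun ε : ℝ => resolventOp L (-((t + ε : ℝ) : ℂ)) x) (𝓝[>] 0)
        (𝓝 (resolventOp L (-(t : ℂ)) x)) :=
      ((hL.continuousOn_resolventOp hw x).continuousAt (Ioi_mem_nhds ht)).tendsto.comp hsh
    have hε : Tendsto (fun ε : ℝ => (ε : ℂ)) (𝓝[>] 0) (𝓝 0) := by
      have := Complex.continuous_ofReal.tendsto 0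
      rw [Complex.ofReal_zero] at this
      exact this.mono_left nhdsWithin_le_nhds
    have := ha.add (hε.smul hb)
    rw [zero_smul, add_zero] at this
    simpa only [map_add, map_smul] using this

/-- The kernel is integrable by itself, so the damping `e^(-εs)` is no longer needed for
convergence. Serves both for `ε → 0` and, with `ε = 0`, for limits along the graph. -/
theorem IsSemigroupOf.tendsto_integral_diffKernel (hT : IsSemigroupOf L T)
    (hK : ∀ t, 0 ≤ t → ‖T t‖ ≤ K) {α : ℝ} (h0 : 0 < α) (h1 : α < 1) {ι : Type*} {l : Filter ι}
    [l.IsCountablyGenerated] {ε : ι → ℝ} (hε : Tendsto ε l (𝓝 0)) (hε0 : ∀ᶠ i in l, 0 ≤ ε i)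
    {V : ι → H} {v : H} (hV : Tendsto V l (𝓝 v)) :
    Tendsto (fun i => ∫ s in Ioi (0 : ℝ), diffKernel α s • (Real.exp (-(ε i * s)) • T s (V i))) l
      (𝓝 (∫ s in Ioi (0 : ℝ), diffKernel α s • T s v)) := by
  refine tendsto_integral_filter_of_dominated_convergence
    (fun s => ‖diffKernel α s‖ * (K * (‖v‖ + 1))) ?_ ?_
    ((integrableOn_diffKernel h0 h1).norm.mul_const _) ?_
  · refine Eventually.of_forall fun i => AEStronglyMeasurable.smul (𝕜 := ℝ)
      (measurable_diffKernel α).aestronglyMeasurable ?_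
    exact ((hT.continuousOn_exp_smul (ε i) (V i)).mono Ioi_subset_Ici_self).aestronglyMeasurable
      measurableSet_Ioi
  · filter_upwards [hε0, hV.norm.eventually (gt_mem_nhds (lt_add_one ‖v‖))] with i hi hVi
    filter_upwards [ae_restrict_mem measurableSet_Ioi] with s (hs : 0 < s)
    have hK0 : 0 ≤ K := (norm_nonneg _).trans (hK 0 le_rfl)
    rw [norm_smul]
    gcongr
    refine (norm_exp_smul_le hK _ _ hs.le).trans ?_
    refine (mul_le_of_le_one_right (by positivity) ?_).trans (by gcongr)
    rw [Real.exp_le_one_iff, neg_mul]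
    exact neg_nonpos.2 (mul_nonneg hi hs.le)
  · filter_upwards with s
    refine Tendsto.const_smul ?_ _
    have h1 : Tendsto (fun i => Real.exp (-(ε i * s))) l (𝓝 1) := by
      have := (Real.continuous_exp.tendsto _).comp ((hε.mul_const s).neg)
      simpa [Function.comp_def] using this
    have := h1.smul (((T s).continuous.tendsto v).comp hV)
    rwa [one_smul] at this

/-- `u - e^{-L} u` is an average of the `e^{-sL} L^α u`. -/
theorem IsOfType.sub_eq_integral_diffKernel (hL : IsOfType L w) (hw : w < Real.pi / 2)
    (hT : IsSemigroupOf L T) (hK : ∀ t, 0 ≤ t → ‖T t‖ ≤ K) {α : ℝ} (h0 : 0 < α) (h1 : α < 1)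
    {u v : H} (huv : IsFracPow L α u v) :
    Real.Gamma α • (u - T 1 u) = ∫ s in Ioi (0 : ℝ), diffKernel α s • T s v := by
  have hdom : ∀ x : L.domain, Real.Gamma α • ((x : H) - T 1 x) =
      ∫ s in Ioi (0 : ℝ), diffKernel α s • T s (balakrishnan L α x) := by
    intro x
    -- On the domain of `L` the shift is removed by letting `ε → 0`.
    have hid : Tendsto (fun ε : ℝ => ε) (𝓝[>] 0) (𝓝 0) := tendsto_id.mono_left nhdsWithin_le_nhds
    have ha := hT.tendsto_integral_diffKernel hK h0 h1 hid
      (by filter_upwards [self_mem_nhdsWithin] with ε hε using le_of_lt hε)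
      (hL.tendsto_balakrishnanShift hw h0 h1 x)
    have hb : Tendsto (fun ε : ℝ => Real.Gamma α • ((x : H) - Real.exp (-(ε * 1)) • T 1 x))
        (𝓝[>] 0) (𝓝 (Real.Gamma α • ((x : H) - T 1 x))) := by
      refine (tendsto_const_nhds.sub ?_).const_smul _
      have h2 : Tendsto (fun ε : ℝ => Real.exp (-(ε * 1))) (𝓝[>] 0) (𝓝 1) := by
        have := (Real.continuous_exp.tendsto _).comp ((hid.mul_const 1).neg)
        simpa [Function.comp_def] using this
      have := h2.smul_const (T 1 (x : H))
      rwa [one_smul] at this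
    refine tendsto_nhds_unique hb (ha.congr' ?_)
    filter_upwards [self_mem_nhdsWithin] with ε hε
    exact (hL.sub_eq_integral_diffKernel_shift hw hT hK h0 h1 hε x).symm
  obtain ⟨x, hx, hv⟩ := huv
  -- A general pair in the graph of `L^α` is a limit of pairs over the domain of `L`, and both sides
  -- are continuous.
  have ha := hT.tendsto_integral_diffKernel hK h0 h1 (tendsto_const_nhds (x := (0 : ℝ)))
    (.of_forall fun _ => le_rfl) hv
  simp only [zero_mul, neg_zero, Real.exp_zero, one_smul, ← hdom] at ha
  refine tendsto_nhds_unique ?_ ha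
  exact (hx.sub (((T 1).continuous.tendsto u).comp hx)).const_smul _

end Representation


/-! ### The embedding of `W^{1,p}_L` into `L^∞`. -/

/-- The integral of a function with values in the multiples `κ s • S` of a closed convex set. -/
theorem exists_integral_eq_smul_of_convex {E : Type*} [NormedAddCommGroup E] [NormedSpace ℝ E]
    [CompleteSpace E] {S : Set E} (hS : Convex ℝ S) (hc : IsClosed S) {κ : ℝ → ℝ}
    (hκm : Measurable κ) (hκ : ∀ s, 0 < κ s) (hκi : IntegrableOn κ (Ioi 0)) {F : ℝ → E}
    (hF : IntegrableOn F (Ioi 0)) (hFS : ∀ s, 0 < s → (κ s)⁻¹ • F s ∈ S) :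
    ∃ g ∈ S, ∫ s in Ioi (0 : ℝ), F s = (∫ s in Ioi (0 : ℝ), κ s) • g := by
  set ρ : Measure ℝ := volume.restrict (Ioi 0) with hρ
  -- With respect to the finite measure of density `κ`, the integral is the total mass times the
  -- average of `κ⁻¹ F`, and an average stays in a closed convex set.
  set ν : Measure ℝ := ρ.withDensity fun s => ENNReal.ofReal (κ s) with hν
  have hfin : IsFiniteMeasure ν := isFiniteMeasure_withDensity_ofReal hκi.2
  have hle : 0 ≤ᵐ[ρ] κ := Eventually.of_forall fun s => (hκ s).le
  have hpos : 0 < ∫ s, κ s ∂ρ := by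
    rw [hρ, setIntegral_pos_iff_support_of_nonneg_ae hle hκi]
    have e : Function.support κ = univ := eq_univ_of_forall fun s => (hκ s).ne'
    rw [e, univ_inter, Real.volume_Ioi]
    exact ENNReal.zero_lt_top
  have huniv : ν univ = ENNReal.ofReal (∫ s, κ s ∂ρ) := by
    rw [hν, withDensity_apply _ MeasurableSet.univ, Measure.restrict_univ,
      ofReal_integral_eq_lintegral_ofReal hκi hle]
  have hne : NeZero ν := ⟨fun h => by
    rw [h] at huniv
    simp only [Measure.coe_zero, Pi.zero_apply] at huniv
    exact hpos.not_ge (ENNReal.ofReal_eq_zero.1 huniv.symm)⟩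
  have hm : Measurable fun s => ENNReal.ofReal (κ s) := hκm.ennreal_ofReal
  have hlt : ∀ᵐ s ∂ρ, ENNReal.ofReal (κ s) < ⊤ := .of_forall fun _ => ENNReal.ofReal_lt_top
  have e : ∀ s, (ENNReal.ofReal (κ s)).toReal • ((κ s)⁻¹ • F s) = F s := fun s => by
    rw [ENNReal.toReal_ofReal (hκ s).le, smul_inv_smul₀ (hκ s).ne']
  have hi : Integrable (fun s => (κ s)⁻¹ • F s) ν := by
    rw [hν, integrable_withDensity_iff_integrable_smul' hm hlt]
    simp only [e]
    exact hF
  have hmem : ∀ᵐ s ∂ν, (κ s)⁻¹ • F s ∈ S := by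
    refine (withDensity_absolutelyContinuous ρ _).ae_le ?_
    filter_upwards [ae_restrict_mem measurableSet_Ioi] with s hs using hFS s hs
  refine ⟨_, hS.average_mem hc hmem hi, ?_⟩
  rw [average_eq, measureReal_def, huniv, ENNReal.toReal_ofReal hpos.le, smul_inv_smul₀ hpos.ne',
    hν, integral_withDensity_eq_integral_toReal_smul hm hlt]
  simp only [e]

/-- Meant for `S` a ball of `L^∞` inside `H = L²`: a bound `min(1,s)^(-γ)` on `T s v` in the sup
norm is carried through an integral that exists in `L²` only. -/
theorem IsOfType.exists_sub_eq_smul {H : Type*} [NormedAddCommGroup H] [NormedSpace ℂ H]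
    [CompleteSpace H] {L : H →ₗ.[ℂ] H} {T : ℝ → H →L[ℂ] H} {w K : ℝ} (hL : IsOfType L w)
    (hw : w < Real.pi / 2) (hT : IsSemigroupOf L T) (hK : ∀ t, 0 ≤ t → ‖T t‖ ≤ K) {α γ : ℝ}
    (h0 : 0 < α) (h1 : α < 1) (hγ : γ < α) :
    ∃ Q : ℝ, 0 ≤ Q ∧ ∀ (S : Set H), IsClosed S → (∀ x ∈ S, ∀ y ∈ S, ∀ a b : ℝ, 0 ≤ a → 0 ≤ b →
      a + b = 1 → (a : ℂ) • x + (b : ℂ) • y ∈ S) → ∀ u v : H, IsFracPow L α u v →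
      (∀ s r : ℝ, 0 < s → |r| ≤ (min 1 s) ^ γ → (r : ℂ) • T s v ∈ S) →
      ∃ g ∈ S, u - T 1 u = (Q : ℂ) • g := by
  -- The first term is the size of the integrand; the exponential makes `κ` strictly positive
  -- without a study of the zeros of `diffKernel`, and `|s|` extends this to the whole line.
  let κ : ℝ → ℝ := fun s => |diffKernel α s| * (min 1 |s|) ^ (-γ) + Real.exp (-|s|)
  have hκ : ∀ s, 0 < κ s := fun s => by positivity
  have hκm : Measurable κ := (((measurable_diffKernel α).abs).mul
    ((measurable_const.min measurable_id.abs).pow_const _)).add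
    (Real.measurable_exp.comp measurable_id.abs.neg)
  have hκi : IntegrableOn κ (Ioi 0) := by
    have he : IntegrableOn (fun s : ℝ => Real.exp (-s)) (Ioi 0) := by
      simpa using exp_neg_integrableOn_Ioi 0 one_pos
    refine IntegrableOn.congr_fun ((integrableOn_abs_diffKernel_mul h0 h1 hγ).add he)
      (fun s (hs : 0 < s) => ?_) measurableSet_Ioi
    simp only [κ, abs_of_pos hs, Pi.add_apply]
  have hG := Real.Gamma_pos_of_pos h0
  refine ⟨(Real.Gamma α)⁻¹ * ∫ s in Ioi (0 : ℝ), κ s, mul_nonneg (inv_nonneg.2 hG.le)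
    (integral_nonneg fun s => (hκ s).le), fun S hc hS u v huv hv => ?_⟩
  have hK0 : 0 ≤ K := (norm_nonneg _).trans (hK 0 le_rfl)
  have hF : IntegrableOn (fun s => diffKernel α s • T s v) (Ioi 0) := by
    refine Integrable.mono' ((integrableOn_diffKernel h0 h1).norm.mul_const (K * ‖v‖)) ?_ ?_
    · exact AEStronglyMeasurable.smul (𝕜 := ℝ) (measurable_diffKernel α).aestronglyMeasurable
        (((hT.continuous v).mono Ioi_subset_Ici_self).aestronglyMeasurable measurableSet_Ioi)
    · filter_upwards [ae_restrict_mem measurableSet_Ioi] with s (hs : 0 < s)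
      rw [norm_smul]
      gcongr
      exact (T s).le_of_opNorm_le (hK s hs.le) v
  obtain ⟨g, hg, he⟩ := exists_integral_eq_smul_of_convex (S := S) (fun x hx y hy a b ha hb hab => by
    simpa only [Complex.coe_smul] using hS x hx y hy a b ha hb hab) hc hκm hκ hκi hF
    (fun s hs => by
      rw [smul_smul, ← Complex.coe_smul]
      refine hv s _ hs ?_
      have hs1 : 0 < min 1 s := lt_min one_pos hs
      rw [abs_mul, abs_inv, abs_of_pos (hκ s), inv_mul_le_iff₀ (hκ s)]
      simp only [κ, abs_of_pos hs]
      rw [add_mul, mul_assoc, ← Real.rpow_add hs1, neg_add_cancel, Real.rpow_zero, mul_one]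
      exact le_add_of_nonneg_right (by positivity))
  refine ⟨g, hg, ?_⟩
  rw [← hL.sub_eq_integral_diffKernel hw hT hK h0 h1 huv] at he
  rw [Complex.coe_smul, mul_smul, ← he, inv_smul_smul₀ hG.ne']

section SupBound

/-- A subsequence converges almost everywhere, and the sup norm is lower semicontinuous under such
convergence. -/
theorem eLpNorm_top_le_of_tendsto {α : Type*} [MeasurableSpace α] {μ : Measure α} {p : ℝ≥0∞}
    (hp : p ≠ 0) {F : ℕ → α → ℂ} {f : α → ℂ} (hF : ∀ k, AEStronglyMeasurable (F k) μ)
    (hf : AEStronglyMeasurable f μ)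
    (hlim : Tendsto (fun k => eLpNorm (fun z => F k z - f z) p μ) atTop (𝓝 0)) {R : ℕ → ℝ≥0∞}
    {R' : ℝ≥0∞} (hFR : ∀ k, eLpNorm (F k) ⊤ μ ≤ R k) (hR : Tendsto R atTop (𝓝 R')) :
    eLpNorm f ⊤ μ ≤ R' := by
  obtain ⟨ns, hns, hae⟩ := (tendstoInMeasure_of_tendsto_eLpNorm hp hF hf hlim).exists_seq_tendsto_ae
  refine (Lp.eLpNorm_lim_le_liminf_eLpNorm (fun k => hF (ns k)) f hae).trans ?_
  rw [← (hR.comp hns.tendsto_atTop).liminf_eq]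
  exact liminf_le_liminf (.of_forall fun k => hFR (ns k))

variable {M : Type*} [MetricSpace M] [SecondCountableTopology M] [MeasurableSpace M] [BorelSpace M]
  {μ : Measure M} [IsLocallyFiniteMeasure μ] [μ.IsOpenPosMeasure]

theorem isClosed_eLpNorm_top_le (R : ℝ≥0∞) : IsClosed {h : Lp ℂ 2 μ | eLpNorm h ⊤ μ ≤ R} := by
  refine IsSeqClosed.isClosed fun F f hF hlim => ?_
  exact eLpNorm_top_le_of_tendsto two_ne_zero (fun k => Lp.aestronglyMeasurable (F k))
    (Lp.aestronglyMeasurable f) ((Lp.tendsto_Lp_iff_tendsto_eLpNorm' F f).1 hlim) hF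
    tendsto_const_nhds

theorem eLpNorm_top_add_smul_le {R : ℝ≥0∞} {x y : Lp ℂ 2 μ} (hx : eLpNorm x ⊤ μ ≤ R)
    (hy : eLpNorm y ⊤ μ ≤ R) {a b : ℝ} (ha : 0 ≤ a) (hb : 0 ≤ b) :
    eLpNorm ((a : ℂ) • x + (b : ℂ) • y : Lp ℂ 2 μ) ⊤ μ ≤ ENNReal.ofReal (a + b) * R := by
  have e : ((a : ℂ) • x + (b : ℂ) • y : Lp ℂ 2 μ) =ᵐ[μ] (a : ℂ) • ⇑x + (b : ℂ) • ⇑y :=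
    (Lp.coeFn_add _ _).trans ((Lp.coeFn_smul _ _).add (Lp.coeFn_smul _ _))
  have h : ∀ c : ℝ, 0 ≤ c → ‖(c : ℂ)‖ₑ = ENNReal.ofReal c := fun c hc => by
    rw [← ofReal_norm, Complex.norm_real, Real.norm_of_nonneg hc]
  rw [eLpNorm_congr_ae e, ENNReal.ofReal_add ha hb, add_mul]
  refine (eLpNorm_add_le ((Lp.aestronglyMeasurable x).const_smul _)
    ((Lp.aestronglyMeasurable y).const_smul _) le_top).trans ?_
  rw [eLpNorm_const_smul, eLpNorm_const_smul, h a ha, h b hb]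
  gcongr

/-- The Sobolev embedding into `L^∞`, on the `L^2`-domain of `L^{1/m}`. -/
theorem OffDiagonalDecay.exists_eLpNorm_top_le {L : Lp ℂ 2 μ →ₗ.[ℂ] Lp ℂ 2 μ} {w m : ℝ}
    (hL : IsOfType L w) (hw : w < Real.pi / 2) (hm : 1 < m) (hD : Doubling μ) {s p : ℝ≥0∞}
    (hs2 : s < 2) (hp1 : 1 ≤ p) (hsp : s < p) (hp : p ≠ ⊤) (hdecay : OffDiagonalDecay L m s)
    {d : ℝ} (hd : 0 ≤ d) (hV : VolumeLowerBound μ d) (hdp : ENNReal.ofReal d < p) :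
    ∃ C : ℝ≥0, ∀ u v : Lp ℂ 2 μ, IsFracPow L (1 / m) u v →
      eLpNorm u ⊤ μ ≤ C * (eLpNorm u p μ + eLpNorm v p μ) := by
  obtain ⟨T, hT, ⟨K, -, hK⟩, B, hB0, hB⟩ :=
    hdecay.exists_semigroup_bounds hm hD hs2.le hp1 hsp.le hp hV
  have hpp : 0 < p.toReal := ENNReal.toReal_pos (zero_lt_one.trans_le hp1).ne' hp
  have hdp' : d < p.toReal := (ENNReal.ofReal_lt_iff_lt_toReal hd hp).1 hdp
  -- The singularity exponent of the `L^p`–`L^∞` bound; `γ < 1/m` is precisely `d < p`.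
  set γ := d / (m * p.toReal) with hγ
  have hγα : γ < 1 / m := by
    rw [hγ, div_lt_div_iff₀ (by positivity) (by positivity), one_mul, mul_comm]
    gcongr
  obtain ⟨h0, h1⟩ := one_div_mem_Ioo hm
  obtain ⟨Q, hQ, hrep⟩ := hL.exists_sub_eq_smul hw hT hK h0 h1 hγα
  refine ⟨(B + Q * B).toNNReal, fun u v huv => ?_⟩
  set R := ENNReal.ofReal B * eLpNorm v p μ with hR
  -- The ball of radius `B ‖v‖_p` in `L^∞` contains every `r • T t v` with `|r| ≤ min(1,t)^γ`, since
  -- the two powers of `min(1,t)` cancel.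
  obtain ⟨g, hg, he⟩ := hrep {h : Lp ℂ 2 μ | eLpNorm h ⊤ μ ≤ R} (isClosed_eLpNorm_top_le R)
    (fun x hx y hy a b ha hb hab => by
      have := eLpNorm_top_add_smul_le hx hy ha hb
      rwa [hab, ENNReal.ofReal_one, one_mul] at this) u v huv (fun t r ht hr => by
      have ht1 : 0 < min 1 t := lt_min one_pos ht
      refine (eLpNorm_congr_ae (Lp.coeFn_smul _ _)).trans_le ?_
      rw [eLpNorm_const_smul]
      calc ‖(r : ℂ)‖ₑ * eLpNorm (T t v) ⊤ μ
          ≤ ENNReal.ofReal ((min 1 t) ^ γ) *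
            (ENNReal.ofReal (B * (min 1 t) ^ (-γ)) * eLpNorm v p μ) := by
            gcongr
            · rw [← ofReal_norm, Complex.norm_real, Real.norm_eq_abs]
              exact ENNReal.ofReal_le_ofReal hr
            · exact hB t ht v
        _ = R := by
            rw [← mul_assoc, ← ENNReal.ofReal_mul (by positivity), mul_left_comm,
              ← Real.rpow_add ht1, add_neg_cancel, Real.rpow_zero, mul_one])
  have hg' : eLpNorm g ⊤ μ ≤ R := hg
  have h1u : eLpNorm (T 1 u) ⊤ μ ≤ ENNReal.ofReal B * eLpNorm u p μ := by
    simpa using hB 1 one_pos u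
  have eu : u = T 1 u + (Q : ℂ) • g := by rw [← he]; abel
  have eae : u =ᵐ[μ] ⇑(T 1 u) + (Q : ℂ) • ⇑g := by
    nth_rewrite 1 [eu]
    exact (Lp.coeFn_add _ _).trans ((EventuallyEq.refl _ _).add (Lp.coeFn_smul _ _))
  rw [eLpNorm_congr_ae eae]
  refine (eLpNorm_add_le (Lp.aestronglyMeasurable _)
    ((Lp.aestronglyMeasurable g).const_smul _) le_top).trans ?_
  rw [eLpNorm_const_smul, ← ofReal_norm, Complex.norm_real, Real.norm_of_nonneg hQ]
  change _ ≤ ENNReal.ofReal (B + Q * B) * _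
  rw [mul_add]
  refine add_le_add ?_ ?_
  · exact h1u.trans (by gcongr; exact le_add_of_nonneg_right (by positivity))
  · refine (mul_le_mul_right hg' _).trans ?_
    rw [hR, ← mul_assoc, ← ENNReal.ofReal_mul hQ]
    gcongr
    exact le_add_of_nonneg_left hB0

/-- The Sobolev embedding `W^{1,p}_L ⊆ L^∞` for `p > d`. -/
theorem exists_eLpNorm_top_le_normW {L : Lp ℂ 2 μ →ₗ.[ℂ] Lp ℂ 2 μ} {w m : ℝ} (hL : IsOfType L w)
    (hw : w < Real.pi / 2) (hm : 1 < m) (hD : Doubling μ) {s p : ℝ≥0∞} (hs2 : s < 2)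
    (hp1 : 1 ≤ p) (hsp : s < p) (hp : p ≠ ⊤) (hdecay : OffDiagonalDecay L m s) {d : ℝ} (hd : 0 ≤ d)
    (hV : VolumeLowerBound μ d) (hdp : ENNReal.ofReal d < p) :
    ∃ K : ℝ≥0, ∀ f : M → ℂ, MemW L m p f → MemLp f ⊤ μ ∧ eLpNorm f ⊤ μ ≤ K * normW L m p f := by
  obtain ⟨C, hC⟩ := hdecay.exists_eLpNorm_top_le hL hw hm hD hs2 hp1 hsp hp hd hV hdp
  have hroot : ∀ f h : M → ℂ, IsRootLp L m p f h →
      eLpNorm f ⊤ μ ≤ C * (eLpNorm f p μ + eLpNorm h p μ) := by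
    rintro f h ⟨hf, hh, u, v, huv, hu, hv⟩
    -- The estimate on the `L²` graph passes to its closure in `L^p`, because the approximants have
    -- sup norms bounded by convergent quantities.
    refine eLpNorm_top_le_of_tendsto (zero_lt_one.trans_le hp1).ne' (fun k => (huv k).2.1.1) hf.1 hu
      (R := fun k => C * ((eLpNorm f p μ + eLpNorm (fun z => u k z - f z) p μ) +
        (eLpNorm h p μ + eLpNorm (fun z => v k z - h z) p μ))) (fun k => ?_) ?_
    · refine (hC _ _ (huv k).1).trans ?_
      gcongr
      · exact eLpNorm_le_add_of_le hp1 (huv k).2.1.1 hf.1 le_rfl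
      · exact eLpNorm_le_add_of_le hp1 (huv k).2.2.1 hh.1 le_rfl
    · refine ENNReal.Tendsto.const_mul ?_ (Or.inr ENNReal.coe_ne_top)
      simpa using (tendsto_const_nhds.add hu).add (tendsto_const_nhds.add hv)
  have hbound : ∀ f : M → ℂ, MemW L m p f →
      eLpNorm f ⊤ μ ≤ ((C * 2 : ℝ≥0) : ℝ≥0∞) * normW L m p f := by
    intro f hf
    -- Letting the slack `ε` tend to zero replaces a chosen value of `L^{1/m} f` by the infimum in
    -- `normW`.
    refine ge_of_tendsto (f := fun ε : ℝ≥0∞ => C * (normW L m p f + (normW L m p f + ε)))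
      (x := 𝓝[>] 0) ?_ ?_
    · have h : Tendsto (fun ε : ℝ≥0∞ => C * (normW L m p f + (normW L m p f + ε))) (𝓝 0)
          (𝓝 (C * (normW L m p f + (normW L m p f + 0)))) :=
        ENNReal.Tendsto.const_mul (tendsto_const_nhds.add (tendsto_const_nhds.add tendsto_id))
          (Or.inr ENNReal.coe_ne_top)
      rw [add_zero, ← two_mul, ← mul_assoc] at h
      push_cast
      exact h.mono_left nhdsWithin_le_nhds
    · filter_upwards [self_mem_nhdsWithin] with ε (hε : 0 < ε)
      obtain ⟨h, hh, hle⟩ := hf.exists_isRootLp_le hε.ne'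
      refine (hroot f h hh).trans ?_
      gcongr
      exact eLpNorm_le_normW f
  exact ⟨C * 2, fun f hf => ⟨⟨hf.memLp.1, (hbound f hf).trans_lt
    (ENNReal.mul_lt_top ENNReal.coe_lt_top hf.normW_lt_top)⟩, hbound f hf⟩⟩

end SupBound

end LSobolev

/-! ### The three assertions. -/

theorem theorem1p5 {n : ℕ} {M : Type*} [MetricSpace M] [CompleteSpace M]
    [SecondCountableTopology M] [MeasurableSpace M] [BorelSpace M]
    [ChartedSpace (EuclideanSpace ℝ (Fin n)) M] [IsManifold (𝓡 n) ∞ M]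
    [RiemannianBundle (fun x : M => TangentSpace (𝓡 n) x)]
    [IsContMDiffRiemannianBundle (𝓡 n) ∞ (EuclideanSpace ℝ (Fin n))
      (fun x : M => TangentSpace (𝓡 n) x)]
    [IsRiemannianManifold (𝓡 n) M]
    (hD : Doubling (riemannianVolume n M))
    (w m : ℝ) (hw : 0 ≤ w) (hw' : w < Real.pi / 2) (hm : 1 < m)
    (L : Lp ℂ 2 (riemannianVolume n M) →ₗ.[ℂ] Lp ℂ 2 (riemannianVolume n M))
    (hL : IsOfType L w)
    (sminus splus qminus qplus : ℝ≥0∞)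
    (hs : 0 < sminus) (hs2 : sminus < 2) (h2s : 2 < splus) (hq : 1 ≤ qminus)
    (hRiesz : ∀ p, sminus < p → p < splus → RieszBounded n L m p)
    (hReverse : ∀ p, qminus < p → p < qplus → ReverseRiesz n L m p) :
    -- the Leibniz rule
    (∀ r p₁ q₁ p₂ q₂ : ℝ≥0∞, qminus < r → r < qplus →
      sminus < p₁ → p₁ < splus → r ≤ p₁ → r < q₁ →
      sminus < q₂ → q₂ < splus → r ≤ q₂ → r < p₂ →
      r⁻¹ = p₁⁻¹ + q₁⁻¹ → r⁻¹ = p₂⁻¹ + q₂⁻¹ →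
      ∃ C : ℝ≥0, ∀ f g : M → ℂ,
        MemW L m p₁ f → MemLp f p₂ (riemannianVolume n M) →
        MemW L m q₂ g → MemLp g q₁ (riemannianVolume n M) →
        MemW L m r (fun x => f x * g x) ∧
        normW L m r (fun x => f x * g x) ≤
          C * (normW L m p₁ f * eLpNorm g q₁ (riemannianVolume n M) +
            eLpNorm f p₂ (riemannianVolume n M) * normW L m q₂ g)) ∧
    -- the algebra property of `W^{1,p}_L ∩ L^∞`
    (∀ p : ℝ≥0∞, max qminus sminus < p → p < min qplus splus →
      ∃ C : ℝ≥0, ∀ f g : M → ℂ,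
        MemW L m p f → MemLp f ∞ (riemannianVolume n M) →
        MemW L m p g → MemLp g ∞ (riemannianVolume n M) →
        MemW L m p (fun x => f x * g x) ∧
        MemLp (fun x => f x * g x) ∞ (riemannianVolume n M) ∧
        normW L m p (fun x => f x * g x) ≤
          C * (normW L m p f * eLpNorm g ∞ (riemannianVolume n M) +
            eLpNorm f ∞ (riemannianVolume n M) * normW L m p g)) ∧
    -- the algebra property of `W^{1,p}_L`
    (OffDiagonalDecay L m sminus →
      ∀ d : ℝ, 0 ≤ d → VolumeLowerBound (riemannianVolume n M) d →
      ∀ p : ℝ≥0∞, max qminus sminus < p → p < min qplus splus → ENNReal.ofReal d < p →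
      ∃ C : ℝ≥0, ∀ f g : M → ℂ, MemW L m p f → MemW L m p g →
        MemW L m p (fun x => f x * g x) ∧
        normW L m p (fun x => f x * g x) ≤ C * (normW L m p f * normW L m p g)) := by
  have := riemannianVolume_isLocallyFinite (n := n) (M := M)
  have := riemannianVolume_isOpenPos (n := n) (M := M)
  have hproper : ProperSpace M := hD.properSpace
  have part2 : ∀ p : ℝ≥0∞, max qminus sminus < p → p < min qplus splus →
      ∃ C : ℝ≥0, ∀ f g : M → ℂ,
        MemW L m p f → MemLp f ∞ (riemannianVolume n M) →
        MemW L m p g → MemLp g ∞ (riemannianVolume n M) →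
        MemW L m p (fun x => f x * g x) ∧
        MemLp (fun x => f x * g x) ∞ (riemannianVolume n M) ∧
        normW L m p (fun x => f x * g x) ≤
          C * (normW L m p f * eLpNorm g ∞ (riemannianVolume n M) +
            eLpNorm f ∞ (riemannianVolume n M) * normW L m p g) := by
    intro p h1 h2
    obtain ⟨hq1, hs1⟩ := max_lt_iff.1 h1
    obtain ⟨hq2, hs3⟩ := lt_min_iff.1 h2
    -- The exponents are `r = p₁ = q₂ = p` and `q₁ = p₂ = ∞`; finiteness of `p` comes from `p <
    -- qplus`.
    obtain ⟨C, hC⟩ := exists_leibniz hL hw' hm (hq.trans hq1.le) hq2.ne_top le_rfl le_rfl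
      (q₁ := ⊤) (p₂ := ⊤) (by simp) (by simp) (hRiesz p hs1 hs3) (hRiesz p hs1 hs3)
      (hReverse p hq1 hq2)
    refine ⟨C, fun f g hf hf' hg hg' => ?_⟩
    obtain ⟨h3, h4⟩ := hC f g hf hf' hg hg'
    exact ⟨h3, memLp_mul_of_holder hf' hg', h4⟩
  refine ⟨fun r p₁ q₁ p₂ q₂ hr1 hr2 hp1 hp2 hrp _ hq1 hq2 hrq _ e1 e2 =>
    exists_leibniz hL hw' hm (hq.trans hr1.le) hr2.ne_top hrp hrq e1 e2 (hRiesz p₁ hp1 hp2)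
      (hRiesz q₂ hq1 hq2) (hReverse r hr1 hr2), part2, ?_⟩
  intro hdecay d hd hV p h1 h2 hdp
  obtain ⟨hq1, hs1⟩ := max_lt_iff.1 h1
  obtain ⟨hq2, hs3⟩ := lt_min_iff.1 h2
  obtain ⟨C, hC⟩ := part2 p h1 h2
  -- The embedding puts both factors in `L^∞` and bounds each sup norm by a `W^{1,p}_L` norm; each
  -- of the two terms costs one `K`.
  obtain ⟨K, hK⟩ := exists_eLpNorm_top_le_normW hL hw' hm hD hs2 (hq.trans hq1.le) hs1
    hq2.ne_top hdecay hd hV hdp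
  refine ⟨C * (K + K), fun f g hf hg => ?_⟩
  obtain ⟨h3, -, h4⟩ := hC f g hf (hK f hf).1 hg (hK g hg).1
  refine ⟨h3, h4.trans ?_⟩
  calc _ ≤ (C : ℝ≥0∞) * (normW L m p f * (K * normW L m p g) +
        K * normW L m p f * normW L m p g) := by
        gcongr
        · exact (hK g hg).2
        · exact (hK f hf).2
    _ = _ := by push_cast; ring
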